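/- Let $n\ge 0$, $N\ge 1$, and let $\pi\colon (M,\omega)\to B$ be a Lagrangian fibration: $(M,\omega)$ is a $2n$-dimensional symplectic manifold (Hausdorff, second countable), $B$ is a connected $n$-dimensional manifold (Hausdorff, second countable), and $\pi$ is a smooth fibre bundle with compact path-connected fibres on which $\omega$ vanishes. Let $T^n=\mathbb R^n/\mathbb Z^n$. The fibration induces an integral affine structure on $B$ by local action-angle coordinates (local fibre-preserving identifications of $(M,\omega)$ with $(V\times T^n,\sum_i dx_i\wedge dy_i)$, $V\subseteq\mathbb R^n$ open). Assume that $B$ is complete, that is, the developing map of this structure is a bijection from the universal covering of $B$ onto $\mathbb R^n$. Let $(L,\nabla)\to(M,\omega)$ be a prequantum line bundle (a Hermitian line bundle with a Hermitian connection whose curvature is $-2\pi\sqrt{-1}\,\omega$). Let $J$ be an $\omega$-compatible almost complex structure that is integrable and invariant along the fibres of $\pi$, the latter meaning that in action-angle coordinates $J$ depends only on $x$. Then there is an identification of the pullback of $(L,\nabla)\to(M,\omega)\to B$ to the universal covering of $B$ with the standard model $$(\mathbb R^n\times T^n\times\mathbb C,\; d-2\pi\sqrt{-1}\,x\cdot dy)\to(\mathbb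 R^n\times T^n,\;\textstyle\sum_i dx_i\wedge dy_i)\to\mathbb R^n .$$ For every such identification the following holds. Let $q\colon\mathbb R^n\to B$ be the resulting universal covering and $\Gamma$ its group of deck transformations. Each $\gamma\in\Gamma$ acts by $\rho_\gamma$ on $\mathbb R^n$, by $\tilde\rho_\gamma$ on $\mathbb R^n\times T^n$ and by $\tilde{\tilde\rho}_\gamma$ on $\mathbb R^n\times T^n\times\mathbb C$ (and on the $N$-th tensor power of this line bundle), so that the quotients are $B$, $M$ and $L$ (respectively $L^{\otimes N}$). There is a map $Z=X+\sqrt{-1}\,Y$ from $\mathbb R^n$ to the Siegel upper half space such that $J$, pulled back to $\mathbb R^n\times T^n$, is at $(x,y)$ the linear map $$(u,v)\mapsto\bigl(XY^{-1}u-(Y+XY^{-1}X)v,\;Y^{-1}u-Y^{-1}Xv\bigr),\qquad Z=Z(x).$$ Put $\Omega=(Y+XY^{-1}X)^{-1}ZY^{-1}$. For $m\in\mathbb Z^n$ let $$G_m^i(x)=\int_{m_i/N}^{x_i}\bigl(\Omega(\xi)\,(m-N\xi)\bigr)_i\,\Big|_{\xi=(x_1,\dots,x_{i-1},t,x_{i+1},\dots,x_n)}\,dt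 ,$$ $$s_m(x,y)=\exp\Bigl(2\pi\sqrt{-1}\,\Bigl\{-\sum_{i=1}^nG_m^i\bigl(\tfrac{m_1}N,\dots,\tfrac{m_{i-1}}N,x_i,\dots,x_n\bigr)+m\cdot y\Bigr\}\Bigr),$$ and let $$\vartheta_{m/N}=\sum_{\gamma\in\Gamma}\tilde{\tilde\rho}_\gamma\circ s_m\circ\tilde\rho_{\gamma^{-1}} .$$ Here $s_m$ is regarded as a section of the $N$-th power of the standard line bundle, and the $\gamma$-term of the series has the form $a_{N\rho_\gamma(m/N)}(x)\,e^{2\pi\sqrt{-1}\,N\rho_\gamma(m/N)\cdot y}$. Let $F\subset\mathbb R^n$ be a fundamental domain of $\Gamma$, that is, a set containing exactly one point of each $\Gamma$-orbit. Assume that for every $m\in\mathbb Z^n$ with $m/N\in F$ the series $\vartheta_{m/N}$ converges absolutely and uniformly on compact sets. Then: 1. The map $m/N\mapsto q(m/N)$ is a bijection from $F\cap\frac1N\mathbb Z^n$ onto the set $B_{BS}$ of Bohr–Sommerfeld points, i.e. of the points $b\in B$ for which $(L,\nabla)^{\otimes N}|_{\pi^{-1}(b)}$ has a nonzero covariant constant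 section. 2. Each $\vartheta_{m/N}$, $m/N\in F\cap\frac1N\mathbb Z^n$, descends to a holomorphic section of $L^{\otimes N}$ over $(M,N\omega,J)$. These sections form a basis of the holomorphic sections of $L^{\otimes N}$ in the following sense: every holomorphic section $s$ has a unique expansion $s=\sum_m c_m\vartheta_{m/N}$, $c_m\in\mathbb C$, that converges unconditionally and uniformly on compact subsets of $M$. 3. If $M$ is compact, then $B_{BS}$ is finite, the sections $\vartheta_{m/N}$ form a basis of the complex vector space of holomorphic sections of $L^{\otimes N}$, and they are pairwise orthogonal for the inner product $$(s,s')=\int_M\langle s,s'\rangle_{L^{\otimes N}}\,(-1)^{n(n-1)/2}\frac{(N\omega)^n}{n!},$$ where $M$ is oriented so that $(-1)^{n(n-1)/2}(N\omega)^n/n!$ is a positive volume form. -/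

import Mathlib

open Set Filter Topology MeasureTheory
open scoped Manifold ContDiff TensorProduct Matrix

noncomputable section

namespace LagFib

/-! ## Symplectic manifolds and almost complex structures -/

/-- The tangent space of a real manifold modelled on `ℝ^d`. -/
abbrev Tan (d : ℕ) {M : Type*} [TopologicalSpace M] [ChartedSpace (EuclideanSpace ℝ (Fin d)) M]
    (p : M) : Type :=
  TangentSpace (𝓡 d) p

/-- `X` is a smooth vector field on the set `U` (used for open `U`). -/
def SmoothField {d : ℕ} {M : Type*} [TopologicalSpace M]
    [ChartedSpace (EuclideanSpace ℝ (Fin d)) M] [IsManifold (𝓡 d) ∞ M]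
    (U : Set M) (X : ∀ p : M, Tan d p) : Prop :=
  ContMDiffOn (𝓡 d) (𝓡 d).tangent ∞ (fun p => (⟨p, X p⟩ : TangentBundle (𝓡 d) M)) U

/-- A symplectic form: a smooth, alternating, nondegenerate, closed 2-form. Smoothness and
closedness are expressed by evaluation on smooth local vector fields
(closedness is Cartan's formula for `dω (X, Y, Z)`). -/
structure IsSymplectic {d : ℕ} {M : Type*} [TopologicalSpace M]
    [ChartedSpace (EuclideanSpace ℝ (Fin d)) M] [IsManifold (𝓡 d) ∞ M]
    (ωM : ∀ p : M, Tan d p →L[ℝ] Tan d p →L[ℝ] ℝ) : Prop where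
  alternating : ∀ (p : M) (v : Tan d p), ωM p v v = 0
  nondegenerate : ∀ (p : M) (v : Tan d p), (∀ w, ωM p v w = 0) → v = 0
  smooth : ∀ (U : Set M) (X Y : ∀ p : M, Tan d p), IsOpen U → SmoothField U X → SmoothField U Y →
    ContMDiffOn (𝓡 d) 𝓘(ℝ, ℝ) ∞ (fun p => ωM p (X p) (Y p)) U
  closed : ∀ (U : Set M) (X Y Z : ∀ p : M, Tan d p), IsOpen U →
    SmoothField U X → SmoothField U Y → SmoothField U Z → ∀ p ∈ U,
      mvfderiv (𝓡 d) (fun q => ωM q (Y q) (Z q)) p (X p)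
      + mvfderiv (𝓡 d) (fun q => ωM q (Z q) (X q)) p (Y p)
      + mvfderiv (𝓡 d) (fun q => ωM q (X q) (Y q)) p (Z p)
      - ωM p (VectorField.mlieBracket (𝓡 d) X Y p) (Z p)
      - ωM p (VectorField.mlieBracket (𝓡 d) Y Z p) (X p)
      - ωM p (VectorField.mlieBracket (𝓡 d) Z X p) (Y p) = 0

/-- A smooth almost complex structure compatible with `ω`. -/
structure IsCompatible {d : ℕ} {M : Type*} [TopologicalSpace M]
    [ChartedSpace (EuclideanSpace ℝ (Fin d)) M] [IsManifold (𝓡 d) ∞ M]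
    (ωM : ∀ p : M, Tan d p →L[ℝ] Tan d p →L[ℝ] ℝ)
    (J : ∀ p : M, Tan d p →L[ℝ] Tan d p) : Prop where
  smooth : ∀ (U : Set M) (X : ∀ p : M, Tan d p), IsOpen U → SmoothField U X →
    SmoothField U (fun p => J p (X p))
  sq : ∀ (p : M) (v : Tan d p), J p (J p v) = -v
  invariant : ∀ (p : M) (v w : Tan d p), ωM p (J p v) (J p w) = ωM p v w
  positive : ∀ (p : M) (v : Tan d p), v ≠ 0 → 0 < ωM p v (J p v)

/-- Integrability of an almost complex structure: its Nijenhuis tensor vanishes. -/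
def IsIntegrable {d : ℕ} {M : Type*} [TopologicalSpace M]
    [ChartedSpace (EuclideanSpace ℝ (Fin d)) M] [IsManifold (𝓡 d) ∞ M]
    (J : ∀ p : M, Tan d p →L[ℝ] Tan d p) : Prop :=
  ∀ (U : Set M) (X Y : ∀ p : M, Tan d p), IsOpen U → SmoothField U X → SmoothField U Y →
    ∀ p ∈ U,
      VectorField.mlieBracket (𝓡 d) (fun q => J q (X q)) (fun q => J q (Y q)) p
      - J p (VectorField.mlieBracket (𝓡 d) (fun q => J q (X q)) Y p)
      - J p (VectorField.mlieBracket (𝓡 d) X (fun q => J q (Y q)) p)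
      - VectorField.mlieBracket (𝓡 d) X Y p = 0

/-- The Liouville measure of a symplectic form `ω` on a `2k`-dimensional manifold, i.e. the measure
given by the volume form `± ω ^ k / k!`. In a chart it is `√(det (ω (∂ᵢ, ∂ⱼ)))` times Lebesgue
measure (the square root of the determinant is the absolute value of the Pfaffian); these chart
measures agree on overlaps, so their supremum is the measure they define together. -/
def liouville {d : ℕ} {M : Type*} [TopologicalSpace M]
    [ChartedSpace (EuclideanSpace ℝ (Fin d)) M] [MeasurableSpace M]
    (ωM : ∀ p : M, Tan d p →L[ℝ] Tan d p →L[ℝ] ℝ) : Measure M :=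
  ⨆ p : M,
    let c := chartAt (EuclideanSpace ℝ (Fin d)) p
    let e : ∀ u : EuclideanSpace ℝ (Fin d), Fin d → Tan d (c.symm u) := fun u i =>
      mfderiv (𝓡 d) (𝓡 d) c.symm u (EuclideanSpace.single i (1 : ℝ))
    Measure.map c.symm ((volume.restrict c.target).withDensity fun u =>
      ENNReal.ofReal (Real.sqrt |(Matrix.of fun i j => ωM (c.symm u) (e u i) (e u j)).det|))

/-! ## Lagrangian fibrations and complete bases -/

/-- `π : (M, ω) → B` is a Lagrangian fibration with typical fibre `S`: a smooth fibre bundle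
whose fibres are Lagrangian (they have half the dimension of `M`, and `ω` vanishes on them). -/
structure IsLagrangianFibration {n : ℕ} {M B : Type*} (S : Type*)
    [TopologicalSpace M] [ChartedSpace (EuclideanSpace ℝ (Fin (2 * n))) M]
    [TopologicalSpace B] [ChartedSpace (EuclideanSpace ℝ (Fin n)) B]
    [TopologicalSpace S] [ChartedSpace (EuclideanSpace ℝ (Fin n)) S]
    (ωM : ∀ p : M, Tan (2 * n) p →L[ℝ] Tan (2 * n) p →L[ℝ] ℝ) (π : M → B) : Prop where
  smooth : ContMDiff (𝓡 (2 * n)) (𝓡 n) ∞ π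
  locally_trivial : ∀ b : B, ∃ e : Bundle.Trivialization S π, b ∈ e.baseSet ∧
    ContMDiffOn (𝓡 (2 * n)) ((𝓡 n).prod (𝓡 n)) ∞ e e.source ∧
    ContMDiffOn ((𝓡 n).prod (𝓡 n)) (𝓡 (2 * n)) ∞ e.toOpenPartialHomeomorph.symm e.target
  lagrangian : ∀ (p : M) (v w : Tan (2 * n) p),
    mfderiv (𝓡 (2 * n)) (𝓡 n) π p v = 0 → mfderiv (𝓡 (2 * n)) (𝓡 n) π p w = 0 → ωM p v w = 0

/-- Coordinates `x` on `ℝⁿ`. -/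
abbrev Rn (n : ℕ) : Type := Fin n → ℝ

/-- The derivative of `Q : ℝⁿ × ℝⁿ → M`. -/
def dQ {n : ℕ} {M : Type*} [TopologicalSpace M]
    [ChartedSpace (EuclideanSpace ℝ (Fin (2 * n))) M] (Q : Rn n × Rn n → M)
    (z u : Rn n × Rn n) : Tan (2 * n) (Q z) :=
  mfderiv 𝓘(ℝ, Rn n × Rn n) (𝓡 (2 * n)) Q z u

/-- Action-angle coordinates over an open `V ⊆ ℝⁿ`. The map `(x, [y]) ↦ (x, Q (x, y))` is a
fibre-preserving isomorphism from `(V × Tⁿ, ∑ᵢ dxᵢ ∧ dyᵢ)`, `Tⁿ = ℝⁿ / ℤⁿ`, to the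
pullback of `π : (M, ω) → B` along `q : V → B`. -/
structure IsActionAngle {n : ℕ} {M B : Type*}
    [TopologicalSpace M] [ChartedSpace (EuclideanSpace ℝ (Fin (2 * n))) M]
    (ωM : ∀ p : M, Tan (2 * n) p →L[ℝ] Tan (2 * n) p →L[ℝ] ℝ) (π : M → B)
    (V : Set (Rn n)) (q : Rn n → B) (Q : Rn n × Rn n → M) : Prop where
  smooth : ContMDiffOn 𝓘(ℝ, Rn n × Rn n) (𝓡 (2 * n)) ∞ Q (V ×ˢ univ)
  proj : ∀ x ∈ V, ∀ y, π (Q (x, y)) = q x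
  periodic : ∀ x ∈ V, ∀ y y', Q (x, y) = Q (x, y') ↔ ∃ k : Fin n → ℤ, ∀ i, y' i = y i + k i
  surjective : ∀ x ∈ V, ∀ p, π p = q x → ∃ y, Q (x, y) = p
  symplectic : ∀ x ∈ V, ∀ (y : Rn n) (u v : Rn n × Rn n),
    ωM (Q (x, y)) (dQ Q (x, y) u) (dQ Q (x, y) v) = u.1 ⬝ᵥ v.2 - u.2 ⬝ᵥ v.1

/-- The base of a Lagrangian fibration is complete: for the integral affine structure that the
fibration induces on the base (its charts are the local inverses of maps `q` that lift to
action-angle coordinates), the developing map is a bijection from the universal covering of `B`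
to `ℝⁿ`. Equivalently phrased through the inverse of the developing map: there is a
covering `q : ℝⁿ → B` which is integral affine. -/
def IsCompleteBase {n : ℕ} {M B : Type*}
    [TopologicalSpace M] [ChartedSpace (EuclideanSpace ℝ (Fin (2 * n))) M] [TopologicalSpace B]
    (ωM : ∀ p : M, Tan (2 * n) p →L[ℝ] Tan (2 * n) p →L[ℝ] ℝ) (π : M → B) : Prop :=
  ∃ q : Rn n → B, IsCoveringMap q ∧
    ∀ x : Rn n, ∃ V : Set (Rn n), IsOpen V ∧ x ∈ V ∧ ∃ Q, IsActionAngle ωM π V q Q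

/-! ## Almost complex structures that are invariant along the fibres -/

/-- `Z = X + √-1 Y` lies in the Siegel upper half space. -/
def IsSiegel {n : ℕ} (Z : Matrix (Fin n) (Fin n) ℂ) : Prop :=
  Zᵀ = Z ∧ (Z.map Complex.im).PosDef

/-- The complex structure `J_Z` on the symplectic vector space `ℝⁿ × ℝⁿ`, `Z = X + √-1 Y`. -/
def siegelJ {n : ℕ} (Z : Matrix (Fin n) (Fin n) ℂ) (u : Rn n × Rn n) : Rn n × Rn n :=
  let X := Z.map Complex.re
  let Y := Z.map Complex.im
  ((X * Y⁻¹) *ᵥ u.1 - (Y + X * Y⁻¹ * X) *ᵥ u.2, Y⁻¹ *ᵥ u.1 - (Y⁻¹ * X) *ᵥ u.2)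

/-- In the action-angle coordinates `Q` over `V`, `J` is given by a map to the Siegel upper half
space that does not depend on the fibre coordinate, namely by `Z`. -/
def IsSiegelMap {n : ℕ} {M : Type*} [TopologicalSpace M]
    [ChartedSpace (EuclideanSpace ℝ (Fin (2 * n))) M]
    (J : ∀ p : M, Tan (2 * n) p →L[ℝ] Tan (2 * n) p)
    (V : Set (Rn n)) (Q : Rn n × Rn n → M) (Z : Rn n → Matrix (Fin n) (Fin n) ℂ) : Prop :=
  ∀ x ∈ V, IsSiegel (Z x) ∧ ∀ z u : Rn n × Rn n, z.1 = x →
    J (Q z) (dQ Q z u) = dQ Q z (siegelJ (Z x) u)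

/-- `J` is invariant along the fibres of `π`: in action-angle coordinates, the corresponding map to
the Siegel upper half space does not depend on the fibre coordinate. -/
def IsFibreInvariant {n : ℕ} {M B : Type*}
    [TopologicalSpace M] [ChartedSpace (EuclideanSpace ℝ (Fin (2 * n))) M]
    (ωM : ∀ p : M, Tan (2 * n) p →L[ℝ] Tan (2 * n) p →L[ℝ] ℝ) (π : M → B)
    (J : ∀ p : M, Tan (2 * n) p →L[ℝ] Tan (2 * n) p) : Prop :=
  ∀ (V : Set (Rn n)) (q : Rn n → B) (Q : Rn n × Rn n → M), IsOpen V → IsActionAngle ωM π V q Q →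
    ∃ Z, IsSiegelMap J V Q Z

/-- `Ω = (Y + X Y⁻¹ X)⁻¹ Z Y⁻¹` for `Z = X + √-1 Y`. -/
def siegelOmega {n : ℕ} (Z : Matrix (Fin n) (Fin n) ℂ) : Matrix (Fin n) (Fin n) ℂ :=
  let X := Z.map Complex.re
  let Y := Z.map Complex.im
  ((Y + X * Y⁻¹ * X)⁻¹).map Complex.ofReal * Z * (Y⁻¹).map Complex.ofReal

/-! ## Prequantum line bundles, their tensor powers, holomorphic sections -/

/-- `σ` is a smooth section of `L` on the set `U` (used for open `U`). -/
def SmoothSec (d : ℕ) {M : Type*} [TopologicalSpace M]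
    [ChartedSpace (EuclideanSpace ℝ (Fin d)) M]
    {L : M → Type*} [TopologicalSpace (Bundle.TotalSpace ℂ L)]
    [∀ p, NormedAddCommGroup (L p)] [∀ p, InnerProductSpace ℂ (L p)]
    [FiberBundle ℂ L] [VectorBundle ℝ ℂ L] (U : Set M) (σ : ∀ p, L p) : Prop :=
  ContMDiffOn (𝓡 d) ((𝓡 d).prod 𝓘(ℝ, ℂ)) ∞ (fun p => Bundle.TotalSpace.mk' ℂ p (σ p)) U

/-- `(L, ∇)` is a prequantum line bundle on `(M, ω)`. Here `L` is a smooth real vector bundle with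
fibre `ℂ` whose fibres are complex inner product spaces; the complex structure and the metric are
smooth (so `L` is a smooth Hermitian line bundle), `∇` is a smooth complex linear connection compatible with
the Hermitian metric, and its curvature is `-2π√-1 ω`. -/
structure IsPrequantum {d : ℕ} {M : Type*} [TopologicalSpace M]
    [ChartedSpace (EuclideanSpace ℝ (Fin d)) M] [IsManifold (𝓡 d) ∞ M]
    {L : M → Type*} [TopologicalSpace (Bundle.TotalSpace ℂ L)]
    [∀ p, NormedAddCommGroup (L p)] [∀ p, InnerProductSpace ℂ (L p)]
    [FiberBundle ℂ L] [VectorBundle ℝ ℂ L]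
    (ωM : ∀ p : M, Tan d p →L[ℝ] Tan d p →L[ℝ] ℝ) (D : CovariantDerivative (𝓡 d) ℂ L) : Prop where
  smooth_complex : ∀ (U : Set M) (σ : ∀ p, L p), IsOpen U → SmoothSec d U σ →
    SmoothSec d U (fun p => Complex.I • σ p)
  smooth_metric : ∀ (U : Set M) (σ τ : ∀ p, L p), IsOpen U → SmoothSec d U σ → SmoothSec d U τ →
    ContMDiffOn (𝓡 d) 𝓘(ℝ, ℂ) ∞ (fun p => inner ℂ (σ p) (τ p)) U
  smooth_conn : CovariantDerivative.ContMDiffCovariantDerivative D ∞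
  complex_linear : ∀ (U : Set M) (σ : ∀ p, L p), IsOpen U → SmoothSec d U σ →
    ∀ p ∈ U, ∀ v : Tan d p, D (fun q => Complex.I • σ q) p v = Complex.I • D σ p v
  hermitian : ∀ (U : Set M) (σ τ : ∀ p, L p), IsOpen U → SmoothSec d U σ → SmoothSec d U τ →
    ∀ p ∈ U, ∀ v : Tan d p,
      mvfderiv (𝓡 d) (fun q => inner ℂ (σ q) (τ q)) p v
        = inner ℂ (D σ p v) (τ p) + inner ℂ (σ p) (D τ p v)
  curvature : ∀ (U : Set M) (X Y : ∀ p : M, Tan d p) (σ : ∀ p, L p), IsOpen U →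
    SmoothField U X → SmoothField U Y → SmoothSec d U σ → ∀ p ∈ U,
      D (fun q => D σ q (Y q)) p (X p) - D (fun q => D σ q (X q)) p (Y p)
        - D σ p (VectorField.mlieBracket (𝓡 d) X Y p)
        = (-(2 * Real.pi * Complex.I) * (ωM p (X p) (Y p) : ℂ)) • σ p

/-- The fibre of `L^{⊗N}` at `p`. -/
abbrev Pow {M : Type*} (L : M → Type*) [∀ p, NormedAddCommGroup (L p)]
    [∀ p, InnerProductSpace ℂ (L p)] (N : ℕ) (p : M) : Type _ :=
  ⨂[ℂ]^N (L p)

/-- `e^{⊗N}`. -/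
def pow {M : Type*} {L : M → Type*} [∀ p, NormedAddCommGroup (L p)]
    [∀ p, InnerProductSpace ℂ (L p)] (N : ℕ) {p : M} (e : L p) : Pow L N p :=
  PiTensorProduct.tprod ℂ (fun _ : Fin N => e)

/-- The section `s` of `L^{⊗N}` is smooth near `p`, and `A v = ∇_v s` at `p` for the connection
induced by `D` on `L^{⊗N}`: with `s = f • e^{⊗N}` near `p` for a smooth local frame `e` of `L`,
`∇_v s = df(v) e^{⊗N} + f ∑ᵢ e ⊗ ⋯ ⊗ ∇_v e ⊗ ⋯ ⊗ e`. -/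
def HasCovDeriv {d : ℕ} {M : Type*} [TopologicalSpace M]
    [ChartedSpace (EuclideanSpace ℝ (Fin d)) M]
    {L : M → Type*} [TopologicalSpace (Bundle.TotalSpace ℂ L)]
    [∀ p, NormedAddCommGroup (L p)] [∀ p, InnerProductSpace ℂ (L p)]
    [FiberBundle ℂ L] [VectorBundle ℝ ℂ L]
    (D : CovariantDerivative (𝓡 d) ℂ L) (N : ℕ) (s : ∀ p, Pow L N p) (p : M)
    (A : Tan d p → Pow L N p) : Prop :=
  ∃ (U : Set M) (e : ∀ q, L q) (f : M → ℂ), IsOpen U ∧ p ∈ U ∧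
    SmoothSec d U e ∧ (∀ q ∈ U, e q ≠ 0) ∧ ContMDiffOn (𝓡 d) 𝓘(ℝ, ℂ) ∞ f U ∧
    (∀ q ∈ U, s q = f q • pow N (e q)) ∧
    ∀ v : Tan d p, A v = (mvfderiv (𝓡 d) f p v : ℂ) • pow N (e p) +
      f p • ∑ i : Fin N,
        PiTensorProduct.tprod ℂ (Function.update (fun _ : Fin N => e p) i (D e p v))

/-- `s` is a holomorphic section of `(L, ∇)^{⊗N}` with respect to `J`: it is smooth and its
covariant derivative is of type `(1, 0)`, that is, `∇_{Jv} s = √-1 ∇_v s`. -/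
def IsHolomorphicSection {d : ℕ} {M : Type*} [TopologicalSpace M]
    [ChartedSpace (EuclideanSpace ℝ (Fin d)) M]
    {L : M → Type*} [TopologicalSpace (Bundle.TotalSpace ℂ L)]
    [∀ p, NormedAddCommGroup (L p)] [∀ p, InnerProductSpace ℂ (L p)]
    [FiberBundle ℂ L] [VectorBundle ℝ ℂ L]
    (J : ∀ p : M, Tan d p →L[ℝ] Tan d p)
    (D : CovariantDerivative (𝓡 d) ℂ L) (N : ℕ) (s : ∀ p, Pow L N p) : Prop :=
  ∀ p : M, ∃ A : Tan d p → Pow L N p, HasCovDeriv D N s p A ∧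
    ∀ v, A (J p v) = Complex.I • A v

/-- The Bohr–Sommerfeld points of `π` for `(L, ∇)^{⊗N}`: the points `b` such that the
restriction of `(L, ∇)^{⊗N}` to `π⁻¹(b)` has a nontrivial covariant constant section `s`. (Only the
values of `s` on the fibre matter; locally, `s` is the restriction of a smooth
section `σ` whose covariant derivative vanishes along the fibre.) -/
def bohrSommerfeld {n : ℕ} {M B : Type*} [TopologicalSpace M]
    [ChartedSpace (EuclideanSpace ℝ (Fin (2 * n))) M]
    [TopologicalSpace B] [ChartedSpace (EuclideanSpace ℝ (Fin n)) B]
    {L : M → Type*} [TopologicalSpace (Bundle.TotalSpace ℂ L)]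
    [∀ p, NormedAddCommGroup (L p)] [∀ p, InnerProductSpace ℂ (L p)]
    [FiberBundle ℂ L] [VectorBundle ℝ ℂ L]
    (π : M → B) (D : CovariantDerivative (𝓡 (2 * n)) ℂ L) (N : ℕ) : Set B :=
  {b | ∃ s : ∀ p, Pow L N p, (∃ p, π p = b ∧ s p ≠ 0) ∧
    ∀ p, π p = b → ∃ (U : Set M) (σ : ∀ p, Pow L N p), IsOpen U ∧ p ∈ U ∧
      ∀ q ∈ U, (π q = b → σ q = s q) ∧
        ∃ A, HasCovDeriv D N σ q A ∧
          (π q = b → ∀ v, mfderiv (𝓡 (2 * n)) (𝓡 n) π q v = 0 → A v = 0)}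

/-- The linear form on `L^{⊗N}` at `p` that maps `v₁ ⊗ ⋯ ⊗ v_N` to `∏ᵢ ⟨w, vᵢ⟩`
(linear in `vᵢ`). -/
def contract {M : Type*} {L : M → Type*} [∀ p, NormedAddCommGroup (L p)]
    [∀ p, InnerProductSpace ℂ (L p)] (N : ℕ) {p : M} (w : L p) : Pow L N p →ₗ[ℂ] ℂ :=
  PiTensorProduct.lift ((MultilinearMap.mkPiAlgebra ℂ (Fin N) ℂ).compLinearMap
    (fun _ => (innerSL ℂ w).toLinearMap))

/-- A unit vector of `L p`. -/
def unitVec {M : Type*} (L : M → Type*) [∀ p, NormedAddCommGroup (L p)] (p : M) : L p :=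
  Classical.epsilon fun w : L p => ‖w‖ = 1

/-- The Hermitian metric of `L^{⊗N}` induced by that of the line bundle `L`, so that
`⟨v₁ ⊗ ⋯ ⊗ v_N, w₁ ⊗ ⋯ ⊗ w_N⟩ = ∏ᵢ ⟨vᵢ, wᵢ⟩`. It does not depend on the chosen unit vector, since the
fibre is a complex line. -/
def hermPow {M : Type*} {L : M → Type*} [∀ p, NormedAddCommGroup (L p)]
    [∀ p, InnerProductSpace ℂ (L p)] (N : ℕ) {p : M} (s t : Pow L N p) : ℂ :=
  starRingEnd ℂ (contract N (unitVec L p) s) * contract N (unitVec L p) t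

/-! ## Developed Lagrangian fibrations -/

/-- An identification of the pullback of `(L, ∇) → (M, ω) → B` to the universal covering of `B` with
the standard model `(ℝⁿ × Tⁿ × ℂ, d - 2π√-1 x·dy) → (ℝⁿ × Tⁿ, ∑ᵢ dxᵢ ∧ dyᵢ) → ℝⁿ`. It consists of
the covering `q : ℝⁿ → B`, the induced map `Q : ℝⁿ × ℝⁿ → M` (periodic in the second variable), and the
section `τ` of `Q^* L` (periodic as well) that corresponds to the constant
section `1` of the standard model, so that `∇ τ = -2π√-1 (x·dy) τ`. -/
structure Development {n : ℕ} {M B : Type*}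
    [TopologicalSpace M] [ChartedSpace (EuclideanSpace ℝ (Fin (2 * n))) M] [TopologicalSpace B]
    {L : M → Type*} [TopologicalSpace (Bundle.TotalSpace ℂ L)]
    [∀ p, NormedAddCommGroup (L p)] [∀ p, InnerProductSpace ℂ (L p)]
    [FiberBundle ℂ L] [VectorBundle ℝ ℂ L]
    (ωM : ∀ p : M, Tan (2 * n) p →L[ℝ] Tan (2 * n) p →L[ℝ] ℝ) (π : M → B)
    (D : CovariantDerivative (𝓡 (2 * n)) ℂ L) where
  /-- the covering of the base -/
  q : Rn n → B
  /-- the covering of the total space -/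
  Q : Rn n × Rn n → M
  /-- the frame of the pulled back line bundle -/
  τ : Rn n × Rn n → Bundle.TotalSpace ℂ L
  covering : IsCoveringMap q
  actionAngle : IsActionAngle ωM π univ q Q
  τ_proj : ∀ z, (τ z).proj = Q z
  τ_ne_zero : ∀ z, (τ z).snd ≠ 0
  τ_periodic : ∀ (x y : Rn n) (k : Fin n → ℤ), τ (x, fun i => y i + k i) = τ (x, y)
  τ_conn : ∀ z₀ : Rn n × Rn n, ∃ (U : Set M) (e : ∀ p, L p) (W : Set (Rn n × Rn n)),
    IsOpen U ∧ SmoothSec (2 * n) U e ∧ IsOpen W ∧ z₀ ∈ W ∧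
    ∀ z ∈ W, Q z ∈ U ∧ τ z = ⟨Q z, e (Q z)⟩ ∧
      ∀ u : Rn n × Rn n, D e (Q z) (dQ Q z u) =
        (-(2 * Real.pi * Complex.I) * ((z.1 ⬝ᵥ u.2 : ℝ) : ℂ)) • e (Q z)

/-- The group `Γ` of deck transformations of the universal covering `q : ℝⁿ → B`, acting on
`ℝⁿ`. -/
abbrev Deck {n : ℕ} {B : Type*} (q : Rn n → B) : Type :=
  {γ : Rn n ≃ₜ Rn n // ∀ x, q (γ x) = q x}

/-- The fundamental domain `F` meets each `Γ`-orbit in `ℝⁿ` (i.e. each fibre of `q`) in exactly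
one point. -/
def IsFundDomain {n : ℕ} {B : Type*} (q : Rn n → B) (F : Set (Rn n)) : Prop :=
  ∀ b : B, ∃! x, x ∈ F ∧ q x = b

/-- The point `m / N`. -/
def latticePt {n : ℕ} (N : ℕ) (m : Fin n → ℤ) : Rn n := fun i => (m i : ℝ) / N

/-- `G_m^i (m₁/N, …, m_{i-1}/N, xᵢ, …, xₙ)`, where `G_m^i (x)` is the integral from `mᵢ/N` to `xᵢ`,
with respect to the `i`-th variable, of the `i`-th component of `Ω (m - N x)`. -/
def gInt {n : ℕ} (N : ℕ) (Z : Rn n → Matrix (Fin n) (Fin n) ℂ) (m : Fin n → ℤ) (i : Fin n)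
    (x : Rn n) : ℂ :=
  ∫ t in (latticePt N m i)..(x i),
    let z : Rn n := fun j => if j < i then latticePt N m j else if j = i then t else x j
    (siegelOmega (Z z) *ᵥ (fun j => ((m j - N * z j : ℝ) : ℂ))) i

/-- `s_m (x, y) = a_m (x) exp (2π√-1 m·y)` with
`a_m (x) = exp (-2π√-1 ∑ᵢ G_m^i (m₁/N, …, m_{i-1}/N, xᵢ, …, xₙ))`, a function on `ℝⁿ × Tⁿ`. -/
def sBase {n : ℕ} (N : ℕ) (Z : Rn n → Matrix (Fin n) (Fin n) ℂ) (m : Fin n → ℤ)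
    (z : Rn n × Rn n) : ℂ :=
  Complex.exp (2 * Real.pi * Complex.I *
    (-(∑ i, gInt N Z m i z.1) + ∑ i, (m i : ℂ) * (z.2 i : ℂ)))

/-- The number `c` with `t' = c • t`, for vectors `t ≠ 0` and `t'` of the same fibre. -/
def lineRatio {M : Type*} {L : M → Type*} [∀ p, NormedAddCommGroup (L p)]
    [∀ p, InnerProductSpace ℂ (L p)] (t t' : Bundle.TotalSpace ℂ L) : ℂ :=
  Classical.epsilon fun c : ℂ => t' = ⟨t.proj, c • t.snd⟩

/-- The lift `(x, y) ↦ (γ x, y')` of `γ` to `ℝⁿ × Tⁿ`, i.e. `Q (γ x, y') = Q (x, y)`. (The point `y'`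
is determined up to `ℤⁿ`.) -/
def deckLift {n : ℕ} {M B : Type*} {q : Rn n → B} (Q : Rn n × Rn n → M) (γ : Deck q)
    (z : Rn n × Rn n) : Rn n × Rn n :=
  (γ.1 z.1, Classical.epsilon fun y' : Rn n => Q (γ.1 z.1, y') = Q z)

/-- The inverse of a deck transformation. -/
def deckInv {n : ℕ} {B : Type*} {q : Rn n → B} (γ : Deck q) : Deck q :=
  ⟨γ.1.symm, fun x => by rw [← γ.2 (γ.1.symm x), γ.1.apply_symm_apply]⟩

/-- The `γ`-term of the series `ϑ_{m/N} (x, y)`. It is the value at `z = (x, y)` of the transform of the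
section `s_m` of the `N`-th power of the standard line bundle under the action of `γ`
on that bundle: with `z' = γ⁻¹ z`, the vector `s_m (z') τ(z')^{⊗N}` equals this
number times `τ(z)^{⊗N}`. Thus it is `a_{N γ(m/N)} (x) exp (2π√-1 N γ(m/N)·y)`. -/
def thetaTerm {n : ℕ} {M B : Type*}
    [TopologicalSpace M] [ChartedSpace (EuclideanSpace ℝ (Fin (2 * n))) M] [TopologicalSpace B]
    {L : M → Type*} [TopologicalSpace (Bundle.TotalSpace ℂ L)]
    [∀ p, NormedAddCommGroup (L p)] [∀ p, InnerProductSpace ℂ (L p)]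
    [FiberBundle ℂ L] [VectorBundle ℝ ℂ L]
    {ωM : ∀ p : M, Tan (2 * n) p →L[ℝ] Tan (2 * n) p →L[ℝ] ℝ} {π : M → B}
    {D : CovariantDerivative (𝓡 (2 * n)) ℂ L} (Δ : Development ωM π D)
    (N : ℕ) (Z : Rn n → Matrix (Fin n) (Fin n) ℂ) (m : Fin n → ℤ) (γ : Deck Δ.q)
    (z : Rn n × Rn n) : ℂ :=
  sBase N Z m (deckLift Δ.Q (deckInv γ) z)
    * lineRatio (Δ.τ z) (Δ.τ (deckLift Δ.Q (deckInv γ) z)) ^ N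

/-- The series `ϑ_{m/N} = ∑_γ a_{N γ(m/N)} (x) exp (2π√-1 N γ(m/N)·y)` converges absolutely and
uniformly on compact sets. -/
def ThetaConverges {n : ℕ} {M B : Type*}
    [TopologicalSpace M] [ChartedSpace (EuclideanSpace ℝ (Fin (2 * n))) M] [TopologicalSpace B]
    {L : M → Type*} [TopologicalSpace (Bundle.TotalSpace ℂ L)]
    [∀ p, NormedAddCommGroup (L p)] [∀ p, InnerProductSpace ℂ (L p)]
    [FiberBundle ℂ L] [VectorBundle ℝ ℂ L]
    {ωM : ∀ p : M, Tan (2 * n) p →L[ℝ] Tan (2 * n) p →L[ℝ] ℝ} {π : M → B}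
    {D : CovariantDerivative (𝓡 (2 * n)) ℂ L} (Δ : Development ωM π D)
    (N : ℕ) (Z : Rn n → Matrix (Fin n) (Fin n) ℂ) (m : Fin n → ℤ) : Prop :=
  ∀ K : Set (Rn n × Rn n), IsCompact K →
    SummableUniformlyOn (fun (γ : Deck Δ.q) z => ‖thetaTerm Δ N Z m γ z‖) K

/-- The section `ϑ` of `L^{⊗N}` over `M` is the one induced by the sum of the series `ϑ_{m/N}`:
`ϑ (Q z) = ϑ_{m/N} (z) τ(z)^{⊗N}`. -/
def IsThetaSection {n : ℕ} {M B : Type*}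
    [TopologicalSpace M] [ChartedSpace (EuclideanSpace ℝ (Fin (2 * n))) M] [TopologicalSpace B]
    {L : M → Type*} [TopologicalSpace (Bundle.TotalSpace ℂ L)]
    [∀ p, NormedAddCommGroup (L p)] [∀ p, InnerProductSpace ℂ (L p)]
    [FiberBundle ℂ L] [VectorBundle ℝ ℂ L]
    {ωM : ∀ p : M, Tan (2 * n) p →L[ℝ] Tan (2 * n) p →L[ℝ] ℝ} {π : M → B}
    {D : CovariantDerivative (𝓡 (2 * n)) ℂ L} (Δ : Development ωM π D)
    (N : ℕ) (Z : Rn n → Matrix (Fin n) (Fin n) ℂ) (m : Fin n → ℤ)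
    (ϑ : ∀ p, Pow L N p) : Prop :=
  ∀ z : Rn n × Rn n, ∃ e : L (Δ.Q z), Δ.τ z = ⟨Δ.Q z, e⟩ ∧
    ϑ (Δ.Q z) = (∑' γ : Deck Δ.q, thetaTerm Δ N Z m γ z) • pow N e

/-- `∑ᵢ cᵢ ϑᵢ = s`, the series converging (unconditionally) uniformly on compact subsets
of `M` for the Hermitian metric of `L^{⊗N}`. -/
def HasExpansion {M : Type*} [TopologicalSpace M] {L : M → Type*}
    [∀ p, NormedAddCommGroup (L p)] [∀ p, InnerProductSpace ℂ (L p)] {N : ℕ}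
    {ι : Type*} (ϑ : ι → ∀ p, Pow L N p) (c : ι → ℂ) (s : ∀ p, Pow L N p) : Prop :=
  ∀ K : Set M, IsCompact K → ∀ ε > 0, ∃ T₀ : Finset ι, ∀ T : Finset ι, T₀ ⊆ T → ∀ p ∈ K,
    ‖hermPow N (s p - ∑ i ∈ T, c i • ϑ i p) (s p - ∑ i ∈ T, c i • ϑ i p)‖ < ε

end LagFib

end

noncomputable section

set_option linter.unusedSectionVars false

namespace LagFib

/-! ### Linear algebra of the Siegel upper half space -/

section Siegel

variable {n : ℕ}

/-! Put B = Y + X Y⁻¹ X and R = Re Ω. Then Im Ω = B⁻¹, both R and B are symmetric, and J is obtained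
from (u, w) ↦ (-B w, B⁻¹ u) by the shear w = v - R u. Since J depends on x only, the Nijenhuis
tensor on constant vertical fields reduces to the bracket of the fields J∂_y. Its vanishing makes
the rows of R and of B⁻¹ closed one-forms (`IsSiegelMap.fderiv_R_symm`,
`IsSiegelMap.fderiv_C_symm`), so Ω dx has a primitive.

Existence of a development. Shifting the angles by a primitive of R is symplectic and makes R
vanish. A transition between two such normal coordinates that covers the identity of the base is
symplectic and J-linear, which leaves only the identity as its derivative (`IsLift.fderiv_eq_id`).
Transitions are therefore locally constant translations of the torus, and on the simply connected
space ℝⁿ such a cocycle is a coboundary (`exists_locallyConstant_coboundary`), so the coordinates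
glue. The same lemma with values in ℂˣ glues local frames with ∇τ = -2πi (x·dy) τ, which exist by
the curvature condition. The holonomies of the glued frame around the circles of the torus are
constants exp(2πi aᵢ) with a real. Multiplying by exp(-2πi a·y) and translating x by a removes them
(`exists_development`).

Sections as functions. Given a development, a section of L^{⊗N} is F τ^N with F equivariant under
identification of points by Q. Choose ψ with dψ = Ω dx and φ with dφ = x·Ω dx, and let e_m = exp(2πi
(m·(y - ψ) + Nφ)) (`eBase`). The sum of the G_m^i telescopes to differences of m·ψ - Nφ, so s_m is a
constant multiple of e_m (`IsPotential.sBase_eq`). The Cauchy–Riemann equations express horizontal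
derivatives by vertical ones. Hence a function of type (1,0) with the single frequency m in y is a
multiple of e_m. The γ-term of a theta series is of type (1,0), and its frequency is a continuous
integral function of x, hence constant, with the value Nγ(m/N), read off at x = γ(m/N). So it is a
nonzero multiple of e_k with k = Nγ(m/N) (`exists_thetaTerm_eq`).

Expansion. The Fourier coefficients in y of a function F of type (1,0) are κ_m e_m(x, 0) with
constants κ_m. Local uniform boundedness of the terms already forces exponential decay, because Im ψ
is a local diffeomorphism: a bound at nearby points, taken in the direction of the signs of m, gains
a factor exp(-ε|m|) (`Tame.decay`). This gives convergence, termwise differentiation and F = Σ κ_m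
e_m. Each k in ℤⁿ is Nγ(m/N) for exactly one γ and one m with m/N in the fundamental domain
(`bijective_index`), and equivariance of F makes κ proportional on each orbit to the coefficients of
the theta series (`IsThetaIndex.exists_coef`). Summing over orbits expands F in theta functions. The
expansion is unique since different theta functions have disjoint Fourier supports.

Bohr–Sommerfeld points. A flat section along the fibre over x has frequency Nx in y, so it is
periodic exactly when Nx is integral.

Compact case. Every orbit of lattice points meets a bounded set, which gives finiteness. The norm of
τ is constant, and the Liouville measure in action-angle coordinates is a constant multiple of
Lebesgue measure. Integrating over the tori first, disjointness of the Fourier supports gives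
orthogonality. -/

/-- The matrix `Y + X Y⁻¹ X`. -/
def siegelB (Z : Matrix (Fin n) (Fin n) ℂ) : Matrix (Fin n) (Fin n) ℝ :=
  Z.map Complex.im + Z.map Complex.re * (Z.map Complex.im)⁻¹ * Z.map Complex.re

/-- The real part of `Ω`. -/
def siegelR (Z : Matrix (Fin n) (Fin n) ℂ) : Matrix (Fin n) (Fin n) ℝ :=
  (siegelB Z)⁻¹ * (Z.map Complex.re * (Z.map Complex.im)⁻¹)

variable {Z : Matrix (Fin n) (Fin n) ℂ}

lemma IsSiegel.re_transpose (hZ : IsSiegel Z) : (Z.map Complex.re)ᵀ = Z.map Complex.re := by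
  rw [← Matrix.transpose_map, hZ.1]

lemma IsSiegel.im_transpose (hZ : IsSiegel Z) : (Z.map Complex.im)ᵀ = Z.map Complex.im := by
  rw [← Matrix.transpose_map, hZ.1]

lemma IsSiegel.isUnit_det_im (hZ : IsSiegel Z) : IsUnit (Z.map Complex.im).det :=
  (Matrix.isUnit_iff_isUnit_det _).1 hZ.2.isUnit

lemma IsSiegel.posDef_B (hZ : IsSiegel Z) : (siegelB Z).PosDef := by
  refine hZ.2.add_posSemidef ?_
  have := hZ.2.inv.posSemidef.conjTranspose_mul_mul_same (Z.map Complex.re)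
  rwa [Matrix.conjTranspose_eq_transpose_of_trivial, hZ.re_transpose] at this

lemma IsSiegel.isUnit_det_B (hZ : IsSiegel Z) : IsUnit (siegelB Z).det :=
  (Matrix.isUnit_iff_isUnit_det _).1 hZ.posDef_B.isUnit

lemma IsSiegel.transpose_B (hZ : IsSiegel Z) : (siegelB Z)ᵀ = siegelB Z := by
  simpa using hZ.posDef_B.isHermitian.eq

/-- The symmetry rests on X Y⁻¹ B = B Y⁻¹ X: both sides are X + X Y⁻¹ X Y⁻¹ X. -/
lemma IsSiegel.transpose_R (hZ : IsSiegel Z) : (siegelR Z)ᵀ = siegelR Z := by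
  have hu := hZ.isUnit_det_B
  have hY := hZ.isUnit_det_im
  rw [siegelR, Matrix.transpose_mul, Matrix.transpose_nonsing_inv, hZ.transpose_B,
    Matrix.transpose_mul, Matrix.transpose_nonsing_inv, hZ.re_transpose, hZ.im_transpose]
  set X := Z.map Complex.re
  set Y := Z.map Complex.im
  have key : (X * Y⁻¹) * siegelB Z = siegelB Z * (Y⁻¹ * X) := by
    simp only [siegelB, Matrix.mul_add, Matrix.add_mul, Matrix.mul_assoc]
    congr 1
    · rw [Matrix.nonsing_inv_mul _ hY, ← Matrix.mul_assoc Y,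
        Matrix.mul_nonsing_inv _ hY]; simp
  calc Y⁻¹ * X * (siegelB Z)⁻¹
      = (siegelB Z)⁻¹ * (siegelB Z * (Y⁻¹ * X)) * (siegelB Z)⁻¹ := by
        rw [← Matrix.mul_assoc, Matrix.nonsing_inv_mul _ hu, Matrix.one_mul]
    _ = (siegelB Z)⁻¹ * (X * Y⁻¹) := by
        rw [← key, Matrix.mul_assoc, Matrix.mul_assoc _ (siegelB Z), Matrix.mul_nonsing_inv _ hu,
          Matrix.mul_one]

lemma IsSiegel.B_mul_R (hZ : IsSiegel Z) :
    siegelB Z * siegelR Z = Z.map Complex.re * (Z.map Complex.im)⁻¹ := by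
  rw [siegelR, ← Matrix.mul_assoc, Matrix.mul_nonsing_inv _ hZ.isUnit_det_B, Matrix.one_mul]

lemma IsSiegel.R_mul_B (hZ : IsSiegel Z) :
    siegelR Z * siegelB Z = (Z.map Complex.im)⁻¹ * Z.map Complex.re := by
  rw [← Matrix.transpose_transpose (siegelR Z * siegelB Z), Matrix.transpose_mul, hZ.transpose_R,
    hZ.transpose_B, hZ.B_mul_R, Matrix.transpose_mul, Matrix.transpose_nonsing_inv,
    hZ.im_transpose, hZ.re_transpose]

/-- This follows from B Y⁻¹ = 1 + (X Y⁻¹)² and X Y⁻¹ = B R. It eliminates X and Y from the formula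
for J in favour of B and R. -/
lemma IsSiegel.inv_im (hZ : IsSiegel Z) :
    (Z.map Complex.im)⁻¹ = (siegelB Z)⁻¹ + siegelR Z * siegelB Z * siegelR Z := by
  have hu := hZ.isUnit_det_B
  have hY := hZ.isUnit_det_im
  have h : siegelB Z * (Z.map Complex.im)⁻¹
      = 1 + (Z.map Complex.re * (Z.map Complex.im)⁻¹) *
        (Z.map Complex.re * (Z.map Complex.im)⁻¹) := by
    rw [siegelB, Matrix.add_mul, Matrix.mul_nonsing_inv _ hY]
    simp only [Matrix.mul_assoc]
  calc (Z.map Complex.im)⁻¹ = (siegelB Z)⁻¹ * (siegelB Z * (Z.map Complex.im)⁻¹) := by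
        rw [← Matrix.mul_assoc, Matrix.nonsing_inv_mul _ hu, Matrix.one_mul]
    _ = _ := by
        rw [h, Matrix.mul_add, Matrix.mul_one, ← Matrix.mul_assoc, ← siegelR, Matrix.mul_assoc,
          hZ.B_mul_R]

/-- In the sheared coordinate w = v - R u the structure is (u, w) ↦ (-B w, B⁻¹ u); the formula
undoes the shear. -/
lemma IsSiegel.siegelJ_eq (hZ : IsSiegel Z) (u : Rn n × Rn n) :
    siegelJ Z u = (siegelB Z *ᵥ (siegelR Z *ᵥ u.1 - u.2),
      (siegelB Z)⁻¹ *ᵥ u.1 + siegelR Z *ᵥ (siegelB Z *ᵥ (siegelR Z *ᵥ u.1 - u.2))) := by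
  have hB : Z.map Complex.im + Z.map Complex.re * (Z.map Complex.im)⁻¹ * Z.map Complex.re
    = siegelB Z := rfl
  simp only [siegelJ]
  rw [hB, ← hZ.B_mul_R, ← hZ.R_mul_B, hZ.inv_im]
  simp only [Matrix.add_mulVec, Matrix.mulVec_sub, Matrix.mulVec_mulVec, Matrix.mul_assoc]
  ext i <;> simp <;> ring

lemma IsSiegel.siegelJ_snd (hZ : IsSiegel Z) (v : Rn n) :
    siegelJ Z (0, v) = (-(siegelB Z *ᵥ v), -(siegelR Z *ᵥ (siegelB Z *ᵥ v))) := by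
  rw [hZ.siegelJ_eq]
  simp [Matrix.mulVec_neg]

/-- Multiplying Z = X + iY by Y⁻¹ gives X Y⁻¹ + i, and B⁻¹ X Y⁻¹ is R. -/
lemma IsSiegel.omega_eq (hZ : IsSiegel Z) :
    siegelOmega Z = (siegelR Z).map Complex.ofReal
      + Complex.I • ((siegelB Z)⁻¹).map Complex.ofReal := by
  have hY := hZ.isUnit_det_im
  have hZ' : Z = (Z.map Complex.re).map Complex.ofReal
      + Complex.I • (Z.map Complex.im).map Complex.ofReal := by
    ext i j
    simp [mul_comm Complex.I]
  have hm : ∀ P Q : Matrix (Fin n) (Fin n) ℝ,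
      (P * Q).map Complex.ofReal = P.map Complex.ofReal * Q.map Complex.ofReal := fun P Q =>
    Matrix.map_mul (f := Complex.ofRealHom)
  have h1 : Z * ((Z.map Complex.im)⁻¹).map Complex.ofReal
      = (Z.map Complex.re * (Z.map Complex.im)⁻¹).map Complex.ofReal + Complex.I • 1 := by
    conv_lhs => enter [1]; rw [hZ']
    have : ((Z.map Complex.im).map Complex.ofReal) * ((Z.map Complex.im)⁻¹).map Complex.ofReal
        = 1 := by
      rw [← hm, Matrix.mul_nonsing_inv _ hY]
      ext i j
      simp [Matrix.one_apply]
      split_ifs <;> simp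
    rw [hm, Matrix.add_mul, Matrix.smul_mul, this]
  change ((siegelB Z)⁻¹).map Complex.ofReal * Z * _ = _
  rw [Matrix.mul_assoc, h1, Matrix.mul_add, ← hm, siegelR, Matrix.mul_smul, Matrix.mul_one]

/-- A real linear form `l` is of type `(1, 0)` for `J_Z` iff it satisfies
`l(u, 0) = - l(0, Re Ω u) - √-1 l(0, Im Ω u)`. -/
lemma IsSiegel.forall_siegelJ_iff (hZ : IsSiegel Z) (l : Rn n × Rn n →+ ℂ) :
    (∀ u, l (siegelJ Z u) = Complex.I * l u) ↔
    ∀ u : Rn n, l (u, 0) = -l (0, siegelR Z *ᵥ u) - Complex.I * l (0, (siegelB Z)⁻¹ *ᵥ u) := by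
  have hu := hZ.isUnit_det_B
  have split : ∀ a b : Rn n, l (a, b) = l (a, 0) + l (0, b) := fun a b => by
    rw [← map_add]; simp
  have hneg : ∀ a b : Rn n, l (-a, -b) = -l (a, b) := fun a b => by rw [← map_neg]; rfl
  constructor
  · intro h u
    -- The vector (0, B⁻¹ u) is chosen because J sends it to -(u, R u).
    have := h (0, (siegelB Z)⁻¹ *ᵥ u)
    rw [hZ.siegelJ_snd, Matrix.mulVec_mulVec, Matrix.mul_nonsing_inv _ hu, Matrix.one_mulVec, hneg,
      split] at this
    linear_combination -this
  · rintro h ⟨u, v⟩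
    have h0 : ∀ w : Rn n, l (siegelB Z *ᵥ w, siegelR Z *ᵥ (siegelB Z *ᵥ w))
        = - Complex.I * l (0, w) := by
      intro w
      rw [split, h, Matrix.mulVec_mulVec _ (siegelB Z)⁻¹, Matrix.nonsing_inv_mul _ hu,
        Matrix.one_mulVec]
      ring
    rw [hZ.siegelJ_eq, add_comm ((siegelB Z)⁻¹ *ᵥ _)]
    dsimp only
    have e : ((siegelB Z *ᵥ (siegelR Z *ᵥ u - v),
        siegelR Z *ᵥ (siegelB Z *ᵥ (siegelR Z *ᵥ u - v)) + (siegelB Z)⁻¹ *ᵥ u) : Rn n × Rn n)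
        = (siegelB Z *ᵥ (siegelR Z *ᵥ u - v), siegelR Z *ᵥ (siegelB Z *ᵥ (siegelR Z *ᵥ u - v)))
          + (0, (siegelB Z)⁻¹ *ᵥ u) := by simp
    have e2 : ((0, siegelR Z *ᵥ u - v) : Rn n × Rn n) = (0, siegelR Z *ᵥ u) - (0, v) := by simp
    rw [e, map_add, h0, split u v, h u, e2, map_sub]
    linear_combination (l (0, (siegelB Z)⁻¹ *ᵥ u)) * Complex.I_mul_I

end Siegel

/-! ### Action-angle coordinates are local diffeomorphisms -/

/-- `R` is a smooth inverse of `Q` on the open set `W`. -/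
structure IsLocalInverse {n : ℕ} {M : Type*} [TopologicalSpace M]
    [ChartedSpace (EuclideanSpace ℝ (Fin (2 * n))) M] (Q : Rn n × Rn n → M)
    (W : Set (Rn n × Rn n)) (R : M → Rn n × Rn n) : Prop where
  isOpen : IsOpen W
  isOpen_image : IsOpen (Q '' W)
  left_inv : ∀ z ∈ W, R (Q z) = z
  smooth : ContMDiffOn 𝓘(ℝ, Rn n × Rn n) (𝓡 (2 * n)) ∞ Q W
  smooth_inv : ContMDiffOn (𝓡 (2 * n)) 𝓘(ℝ, Rn n × Rn n) ∞ R (Q '' W)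

section LocalInverse

variable {n : ℕ} {M : Type*} [TopologicalSpace M]
  [ChartedSpace (EuclideanSpace ℝ (Fin (2 * n))) M] {Q : Rn n × Rn n → M}
  {W : Set (Rn n × Rn n)} {R : M → Rn n × Rn n}

lemma IsLocalInverse.mono (h : IsLocalInverse Q W R) {O : Set (Rn n × Rn n)} (hO : IsOpen O) :
    IsLocalInverse Q (W ∩ O) R := by
  refine ⟨h.isOpen.inter hO, ?_, fun z hz => h.left_inv z hz.1, h.smooth.mono inter_subset_left,
    h.smooth_inv.mono (image_mono inter_subset_left)⟩
  have : Q '' (W ∩ O) = Q '' W ∩ R ⁻¹' O := by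
    ext p
    constructor
    · rintro ⟨z, hz, rfl⟩
      exact ⟨⟨z, hz.1, rfl⟩, by simpa [h.left_inv z hz.1] using hz.2⟩
    · rintro ⟨⟨z, hz, rfl⟩, hz'⟩
      exact ⟨z, ⟨hz, by simpa [h.left_inv z hz] using hz'⟩, rfl⟩
  rw [this]
  exact h.smooth_inv.continuousOn.isOpen_inter_preimage h.isOpen_image hO

lemma IsLocalInverse.right_inv (h : IsLocalInverse Q W R) {p : M} (hp : p ∈ Q '' W) :
    Q (R p) = p := by
  obtain ⟨z, hz, rfl⟩ := hp
  rw [h.left_inv z hz]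

lemma IsLocalInverse.mapsTo (h : IsLocalInverse Q W R) {p : M} (hp : p ∈ Q '' W) : R p ∈ W := by
  obtain ⟨z, hz, rfl⟩ := hp
  rwa [h.left_inv z hz]

lemma IsLocalInverse.contMDiffAt (h : IsLocalInverse Q W R) {z : Rn n × Rn n} (hz : z ∈ W) :
    ContMDiffAt 𝓘(ℝ, Rn n × Rn n) (𝓡 (2 * n)) ∞ Q z :=
  h.smooth.contMDiffAt (h.isOpen.mem_nhds hz)

lemma IsLocalInverse.contMDiffAt_inv (h : IsLocalInverse Q W R) {z : Rn n × Rn n} (hz : z ∈ W) :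
    ContMDiffAt (𝓡 (2 * n)) 𝓘(ℝ, Rn n × Rn n) ∞ R (Q z) :=
  h.smooth_inv.contMDiffAt (h.isOpen_image.mem_nhds ⟨z, hz, rfl⟩)

lemma IsLocalInverse.mdifferentiableAt (h : IsLocalInverse Q W R) {z : Rn n × Rn n} (hz : z ∈ W) :
    MDifferentiableAt 𝓘(ℝ, Rn n × Rn n) (𝓡 (2 * n)) Q z :=
  (h.contMDiffAt hz).mdifferentiableAt (by simp)

lemma IsLocalInverse.mdifferentiableAt_inv (h : IsLocalInverse Q W R) {z : Rn n × Rn n}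
    (hz : z ∈ W) : MDifferentiableAt (𝓡 (2 * n)) 𝓘(ℝ, Rn n × Rn n) R (Q z) :=
  (h.contMDiffAt_inv hz).mdifferentiableAt (by simp)

lemma IsLocalInverse.mfderiv_inv_dQ (h : IsLocalInverse Q W R) {z : Rn n × Rn n} (hz : z ∈ W)
    (u : Rn n × Rn n) :
    mfderiv (𝓡 (2 * n)) 𝓘(ℝ, Rn n × Rn n) R (Q z) (dQ Q z u) = u := by
  have h1 := mfderiv_comp z (h.mdifferentiableAt_inv hz) (h.mdifferentiableAt hz)
  have h2 : R ∘ Q =ᶠ[𝓝 z] id := by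
    filter_upwards [h.isOpen.mem_nhds hz] with w hw using h.left_inv w hw
  rw [h2.mfderiv_eq] at h1
  have := congrArg (fun A => A u) h1
  rw [mfderiv_id] at this
  exact this.symm

lemma IsLocalInverse.dQ_mfderiv_inv (h : IsLocalInverse Q W R) {z : Rn n × Rn n} (hz : z ∈ W)
    (v : Tan (2 * n) (Q z)) :
    dQ Q z (mfderiv (𝓡 (2 * n)) 𝓘(ℝ, Rn n × Rn n) R (Q z) v) = v := by
  have h0 := h.mdifferentiableAt hz
  rw [← h.left_inv z hz] at h0
  have h1 := mfderiv_comp (Q z) (g := Q) h0 (h.mdifferentiableAt_inv hz)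
  have h2 : Q ∘ R =ᶠ[𝓝 (Q z)] id := by
    filter_upwards [h.isOpen_image.mem_nhds ⟨z, hz, rfl⟩] with w hw using h.right_inv hw
  rw [h2.mfderiv_eq] at h1
  have := congrArg (fun A => A v) h1
  rw [mfderiv_id, h.left_inv z hz] at this
  exact this.symm

lemma IsLocalInverse.isInvertible_mfderiv_inv (h : IsLocalInverse Q W R) {z : Rn n × Rn n}
    (hz : z ∈ W) : (mfderiv (𝓡 (2 * n)) 𝓘(ℝ, Rn n × Rn n) R (Q z)).IsInvertible :=
  ContinuousLinearMap.IsInvertible.of_inverse (g := mfderiv 𝓘(ℝ, Rn n × Rn n) (𝓡 (2 * n)) Q z)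
    (by ext1 u; exact h.mfderiv_inv_dQ hz u) (by ext1 u; exact h.dQ_mfderiv_inv hz u)

lemma IsLocalInverse.inverse_mfderiv_inv (h : IsLocalInverse Q W R) {z : Rn n × Rn n}
    (hz : z ∈ W) (u : Rn n × Rn n) :
    (mfderiv (𝓡 (2 * n)) 𝓘(ℝ, Rn n × Rn n) R (Q z)).inverse u = dQ Q z u := by
  exact (h.isInvertible_mfderiv_inv hz).inverse_apply_eq.2 (h.mfderiv_inv_dQ hz u).symm

lemma IsLocalInverse.isInvertible_mfderiv (h : IsLocalInverse Q W R) {z : Rn n × Rn n}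
    (hz : z ∈ W) : (mfderiv 𝓘(ℝ, Rn n × Rn n) (𝓡 (2 * n)) Q z).IsInvertible :=
  ContinuousLinearMap.IsInvertible.of_inverse (g := mfderiv (𝓡 (2 * n)) 𝓘(ℝ, Rn n × Rn n) R (Q z))
    (by ext1 u; exact h.dQ_mfderiv_inv hz u) (by ext1 u; exact h.mfderiv_inv_dQ hz u)

lemma IsLocalInverse.inverse_mfderiv (h : IsLocalInverse Q W R) {z : Rn n × Rn n}
    (hz : z ∈ W) (u : Rn n × Rn n) :
    (mfderiv 𝓘(ℝ, Rn n × Rn n) (𝓡 (2 * n)) Q z).inverse (dQ Q z u) = u :=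
  (h.isInvertible_mfderiv hz).inverse_apply_self u

end LocalInverse

/-! ### The inverse function theorem for action-angle coordinates -/

section ActionAngle

variable {n : ℕ} {M B : Type*} [TopologicalSpace M]
  [ChartedSpace (EuclideanSpace ℝ (Fin (2 * n))) M]
  {ωM : ∀ p : M, Tan (2 * n) p →L[ℝ] Tan (2 * n) p →L[ℝ] ℝ} {π : M → B}
  {V : Set (Rn n)} {q : Rn n → B} {Q : Rn n × Rn n → M}

lemma eq_zero_of_forall_symplectic {u : Rn n × Rn n}
    (h : ∀ v : Rn n × Rn n, u.1 ⬝ᵥ v.2 - u.2 ⬝ᵥ v.1 = 0) : u = 0 := by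
  have h1 : u.1 = 0 := by
    apply dotProduct_self_eq_zero.1
    simpa using h (0, u.1)
  have h2 : u.2 = 0 := by
    apply dotProduct_self_eq_zero.1
    simpa using h (u.2, 0)
  exact Prod.ext h1 h2

/-- A vector killed by dQ pairs to zero with everything under the standard symplectic form, which is
nondegenerate. -/
lemma IsActionAngle.dQ_injective (hQ : IsActionAngle ωM π V q Q) {z : Rn n × Rn n} (hz : z.1 ∈ V) :
    Function.Injective (mfderiv 𝓘(ℝ, Rn n × Rn n) (𝓡 (2 * n)) Q z) := by
  rw [injective_iff_map_eq_zero]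
  intro u hu
  refine eq_zero_of_forall_symplectic (u := u) fun v => ?_
  rw [← hQ.symplectic z.1 hz z.2 u v]
  have : dQ Q (z.1, z.2) u = 0 := hu
  rw [this]
  simp

lemma IsActionAngle.isInvertible_dQ (hQ : IsActionAngle ωM π V q Q) {z : Rn n × Rn n}
    (hz : z.1 ∈ V) : (mfderiv 𝓘(ℝ, Rn n × Rn n) (𝓡 (2 * n)) Q z).IsInvertible := by
  let A : (Rn n × Rn n) →ₗ[ℝ] EuclideanSpace ℝ (Fin (2 * n)) :=
    (mfderiv 𝓘(ℝ, Rn n × Rn n) (𝓡 (2 * n)) Q z).toLinearMap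
  have hA : Function.Injective A := hQ.dQ_injective hz
  have hd : Module.finrank ℝ (Rn n × Rn n)
      = Module.finrank ℝ (EuclideanSpace ℝ (Fin (2 * n))) := by
    simp [Module.finrank_prod]
    ring
  exact ⟨(LinearEquiv.ofInjectiveOfFinrankEq A hA hd).toContinuousLinearEquiv, by ext1 u; rfl⟩

variable [IsManifold (𝓡 (2 * n)) ∞ M]

/-- This is the inverse function theorem in the chart at Q z₀. Since Q is periodic in the angles,
only a local inverse can exist. -/
lemma IsActionAngle.exists_localInverse (hQ : IsActionAngle ωM π V q Q) (hV : IsOpen V)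
    {z₀ : Rn n × Rn n} (hz₀ : z₀.1 ∈ V) :
    ∃ (W : Set (Rn n × Rn n)) (R : M → Rn n × Rn n), z₀ ∈ W ∧ W ⊆ V ×ˢ univ ∧
      IsLocalInverse Q W R := by
  have hVo : IsOpen (V ×ˢ (univ : Set (Rn n))) := hV.prod isOpen_univ
  set c := chartAt (EuclideanSpace ℝ (Fin (2 * n))) (Q z₀) with hc
  have hQc : ContinuousOn Q (V ×ˢ univ) := hQ.smooth.continuousOn
  set O : Set (Rn n × Rn n) := (V ×ˢ univ) ∩ Q ⁻¹' c.source with hOdef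
  have hO : IsOpen O := hQc.isOpen_inter_preimage hVo c.open_source
  have hz₀O : z₀ ∈ O := ⟨⟨hz₀, trivial⟩, mem_chart_source _ _⟩
  let G : Rn n × Rn n → EuclideanSpace ℝ (Fin (2 * n)) := fun z => c (Q z)
  have hQat : ∀ z ∈ O, ContMDiffAt 𝓘(ℝ, Rn n × Rn n) (𝓡 (2 * n)) ∞ Q z := fun z hz =>
    hQ.smooth.contMDiffAt (hVo.mem_nhds hz.1)
  have hcat : ∀ p ∈ c.source, ContMDiffAt (𝓡 (2 * n)) 𝓘(ℝ, EuclideanSpace ℝ (Fin (2 * n))) ∞ c p :=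
    fun p hp => (contMDiffOn_chart (I := 𝓡 (2 * n)) (n := ∞)
      (H := EuclideanSpace ℝ (Fin (2 * n))) (x := Q z₀)).contMDiffAt (c.open_source.mem_nhds hp)
  have hGm : ∀ z ∈ O, ContMDiffAt 𝓘(ℝ, Rn n × Rn n) 𝓘(ℝ, EuclideanSpace ℝ (Fin (2 * n))) ∞ G z :=
    fun z hz => (hcat (Q z) hz.2).comp z (hQat z hz)
  have hG : ∀ z ∈ O, ContDiffAt ℝ ∞ G z := fun z hz => (hGm z hz).contDiffAt
  have hinv : ∀ z ∈ O, ∃ e : (Rn n × Rn n) ≃L[ℝ] EuclideanSpace ℝ (Fin (2 * n)),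
      HasFDerivAt G (e : (Rn n × Rn n) →L[ℝ] EuclideanSpace ℝ (Fin (2 * n))) z := by
    intro z hz
    have h1 := mfderiv_comp z ((hcat (Q z) hz.2).mdifferentiableAt (by simp))
      ((hQat z hz).mdifferentiableAt (by simp))
    have h2 : (mfderiv (𝓡 (2 * n)) 𝓘(ℝ, EuclideanSpace ℝ (Fin (2 * n))) c (Q z)).IsInvertible :=
      isInvertible_mfderiv_extChartAt (I := 𝓡 (2 * n)) (x := Q z₀) (y := Q z)
        (by simpa using hz.2)
    have h3 := hQ.isInvertible_dQ hz.1.1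
    obtain ⟨e, he⟩ := h2.comp h3
    let e' : (Rn n × Rn n) ≃L[ℝ] EuclideanSpace ℝ (Fin (2 * n)) := e
    refine ⟨e', ?_⟩
    have h4 := ((hG z hz).differentiableAt (by simp)).hasFDerivAt
    have h5 : fderiv ℝ G z = (e' : (Rn n × Rn n) →L[ℝ] EuclideanSpace ℝ (Fin (2 * n))) := by
      rw [← mfderiv_eq_fderiv]
      exact h1.trans he.symm
    rwa [h5] at h4
  obtain ⟨e₀, he₀⟩ := hinv z₀ hz₀O
  let Φ := (hG z₀ hz₀O).toOpenPartialHomeomorph G he₀ (by simp)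
  have hΦ : ∀ z, Φ z = G z := fun z => rfl
  have hzΦ : z₀ ∈ Φ.source := (hG z₀ hz₀O).mem_toOpenPartialHomeomorph_source he₀ (by simp)
  let W := Φ.source ∩ O
  have hW : IsOpen W := Φ.open_source.inter hO
  have himg : Q '' W = c.source ∩ c ⁻¹' (Φ '' W) := by
    ext p
    constructor
    · rintro ⟨z, hz, rfl⟩
      exact ⟨hz.2.2, z, hz, rfl⟩
    · rintro ⟨hp, z, hz, hzp⟩
      exact ⟨z, hz, c.injOn hz.2.2 hp hzp⟩
  have hΦW : IsOpen (Φ '' W) := Φ.isOpen_image_of_subset_source hW inter_subset_left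
  refine ⟨W, fun p => Φ.symm (c p), ⟨hzΦ, hz₀O⟩, fun z hz => hz.2.1, hW, ?_, ?_, ?_, ?_⟩
  · rw [himg]
    exact c.continuousOn.isOpen_inter_preimage c.open_source hΦW
  · intro z hz
    exact Φ.left_inv hz.1
  · exact fun z hz => (hQat z hz.2).contMDiffWithinAt
  · rintro _ ⟨z, hz, rfl⟩
    -- The derivative is invertible on all of O, so the inverse is smooth at every point of Q '' W
    -- and not only at Q z₀.
    obtain ⟨e, he⟩ := hinv z hz.2
    have hmem : G z ∈ Φ.target := Φ.map_source hz.1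
    have hs : Φ.symm (G z) = z := Φ.left_inv hz.1
    have : ContDiffAt ℝ ∞ Φ.symm (G z) :=
      Φ.contDiffAt_symm hmem (f₀' := e) (by rw [hs]; exact he) (by rw [hs]; exact hG z hz.2)
    exact (this.contMDiffAt.comp (Q z) (hcat (Q z) hz.2.2)).contMDiffWithinAt

end ActionAngle

/-! ### Comparison of action-angle coordinates -/

/-- Near `z`, the smooth map `Φ` intertwines `Q` and `Q'` and covers `α`. -/
structure IsLift {n : ℕ} {M : Type*} [TopologicalSpace M] (Q Q' : Rn n × Rn n → M)
    (α : Rn n → Rn n) (Φ : Rn n × Rn n → Rn n × Rn n) (z : Rn n × Rn n) : Prop where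
  smooth : ContDiffAt ℝ ∞ Φ z
  eq : ∀ᶠ w in 𝓝 z, Q' (Φ w) = Q w
  fst : ∀ᶠ w in 𝓝 z, (Φ w).1 = α w.1

section Congr

variable {d : ℕ} {M : Type*} [TopologicalSpace M] [ChartedSpace (EuclideanSpace ℝ (Fin d)) M]

lemma form_congr (ωM : ∀ p : M, Tan d p →L[ℝ] Tan d p →L[ℝ] ℝ) {p p' : M} (hp : p = p')
    {v w v' w' : EuclideanSpace ℝ (Fin d)} (hv : v = v') (hw : w = w') :
    ωM p v w = ωM p' v' w' := by
  subst hp hv hw; rfl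

lemma endo_congr (J : ∀ p : M, Tan d p →L[ℝ] Tan d p) {p p' : M} (hp : p = p')
    {v v' : EuclideanSpace ℝ (Fin d)} (hv : v = v') :
    (J p v : EuclideanSpace ℝ (Fin d)) = J p' v' := by
  subst hp hv; rfl

end Congr

section Lift

variable {n : ℕ} {M B : Type*} [TopologicalSpace M]
  [ChartedSpace (EuclideanSpace ℝ (Fin (2 * n))) M]
  {ωM : ∀ p : M, Tan (2 * n) p →L[ℝ] Tan (2 * n) p →L[ℝ] ℝ} {π : M → B}
  {V V' : Set (Rn n)} {q : Rn n → B} {Q Q' : Rn n × Rn n → M} {α : Rn n → Rn n}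
  {Φ : Rn n × Rn n → Rn n × Rn n} {z : Rn n × Rn n}

/-- The lift is R ∘ Q for a local inverse R of Q'. Its base component and α z.1 have the same image
under q and both stay in O, where q is injective, so they agree. -/
lemma IsActionAngle.exists_lift [IsManifold (𝓡 (2 * n)) ∞ M] (hQ : IsActionAngle ωM π V q Q)
    (hV : IsOpen V) (hQ' : IsActionAngle ωM π V' q Q') (hV' : IsOpen V')
    {z₀ z₀' : Rn n × Rn n} (h₀ : z₀.1 ∈ V) (h₀' : z₀'.1 ∈ V') (he : Q z₀ = Q' z₀')
    {O : Set (Rn n)} (hO : O ∈ 𝓝 z₀'.1) (hqO : InjOn q O) (hα : ContinuousAt α z₀.1)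
    (hα₀ : α z₀.1 = z₀'.1) (hαq : ∀ x, q (α x) = q x) :
    ∃ Φ, Φ z₀ = z₀' ∧ ∀ᶠ z in 𝓝 z₀, IsLift Q Q' α Φ z := by
  obtain ⟨W, R, hW₀, hWV, hR⟩ := hQ'.exists_localInverse hV' h₀'
  have hVo : IsOpen (V ×ˢ (univ : Set (Rn n))) := hV.prod isOpen_univ
  have hU : IsOpen ((V ×ˢ (univ : Set (Rn n))) ∩ Q ⁻¹' (Q' '' W)) :=
    hQ.smooth.continuousOn.isOpen_inter_preimage hVo hR.isOpen_image
  have hzU : z₀ ∈ (V ×ˢ (univ : Set (Rn n))) ∩ Q ⁻¹' (Q' '' W) :=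
    ⟨⟨h₀, trivial⟩, z₀', hW₀, he.symm⟩
  have hΦ₀ : R (Q z₀) = z₀' := by rw [he, hR.left_inv _ hW₀]
  have hsm : ∀ z ∈ (V ×ˢ (univ : Set (Rn n))) ∩ Q ⁻¹' (Q' '' W),
      ContDiffAt ℝ ∞ (fun z => R (Q z)) z := by
    intro z hz
    have h1 := hQ.smooth.contMDiffAt (hVo.mem_nhds hz.1)
    have h2 := hR.smooth_inv.contMDiffAt (hR.isOpen_image.mem_nhds hz.2)
    exact (h2.comp z h1).contDiffAt
  refine ⟨fun z => R (Q z), hΦ₀, ?_⟩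
  have hfst : ∀ᶠ z in 𝓝 z₀, (R (Q z)).1 = α z.1 := by
    have hc : ContinuousAt (fun z => (R (Q z)).1) z₀ := continuousAt_fst.comp
      (hsm z₀ hzU).continuousAt
    have hc2 : ContinuousAt (fun z : Rn n × Rn n => α z.1) z₀ :=
      ContinuousAt.comp (f := Prod.fst) hα continuousAt_fst
    filter_upwards [hU.mem_nhds hzU, hc.preimage_mem_nhds (t := O) (by rw [hΦ₀]; exact hO),
      hc2.preimage_mem_nhds (t := O) (by rw [hα₀]; exact hO)] with z hz h1 h2
    refine hqO h1 h2 ?_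
    have hRW := hR.mapsTo hz.2
    rw [hαq, ← hQ.proj z.1 hz.1.1 z.2, ← hQ'.proj _ (hWV hRW).1 (R (Q z)).2]
    exact congrArg π (hR.right_inv hz.2)
  filter_upwards [hU.mem_nhds hzU, hfst.eventually_nhds] with z hz hz'
  refine ⟨hsm z hz, ?_, hz'⟩
  filter_upwards [hU.mem_nhds hz] with w hw
  exact hR.right_inv hw.2

lemma IsLift.dQ_fderiv (h : IsLift Q Q' α Φ z) (hV' : IsOpen V')
    (hQ' : IsActionAngle ωM π V' q Q') (hz' : (Φ z).1 ∈ V') (u : Rn n × Rn n) :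
    (dQ Q' (Φ z) (fderiv ℝ Φ z u) : EuclideanSpace ℝ (Fin (2 * n))) = dQ Q z u := by
  have h1 : MDifferentiableAt 𝓘(ℝ, Rn n × Rn n) (𝓡 (2 * n)) Q' (Φ z) :=
    (hQ'.smooth.contMDiffAt ((hV'.prod isOpen_univ).mem_nhds ⟨hz', trivial⟩)).mdifferentiableAt
      (by simp)
  have h2 : MDifferentiableAt 𝓘(ℝ, Rn n × Rn n) 𝓘(ℝ, Rn n × Rn n) Φ z :=
    (h.smooth.differentiableAt (by simp)).mdifferentiableAt
  have h3 := mfderiv_comp z h1 h2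
  have h4 : Q' ∘ Φ =ᶠ[𝓝 z] Q := h.eq
  rw [h4.mfderiv_eq, mfderiv_eq_fderiv] at h3
  exact (congrArg (fun A : (Rn n × Rn n) →L[ℝ] EuclideanSpace ℝ (Fin (2 * n)) => A u) h3).symm

lemma IsLift.symplectic (h : IsLift Q Q' α Φ z) (hQ : IsActionAngle ωM π V q Q)
    (hV' : IsOpen V') (hQ' : IsActionAngle ωM π V' q Q') (hz : z.1 ∈ V) (hz' : (Φ z).1 ∈ V')
    (u v : Rn n × Rn n) :
    (fderiv ℝ Φ z u).1 ⬝ᵥ (fderiv ℝ Φ z v).2 - (fderiv ℝ Φ z u).2 ⬝ᵥ (fderiv ℝ Φ z v).1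
      = u.1 ⬝ᵥ v.2 - u.2 ⬝ᵥ v.1 := by
  have h1 := hQ.symplectic z.1 hz z.2 u v
  have h2 := hQ'.symplectic _ hz' (Φ z).2 (fderiv ℝ Φ z u) (fderiv ℝ Φ z v)
  exact h2.symm.trans ((form_congr ωM h.eq.self_of_nhds (h.dQ_fderiv hV' hQ' hz' u)
    (h.dQ_fderiv hV' hQ' hz' v)).trans h1)

lemma IsLift.contDiffAt_base (h : IsLift Q Q' α Φ z) : ContDiffAt ℝ ∞ α z.1 := by
  have h1 : ContDiffAt ℝ ∞ (fun x : Rn n => (x, z.2)) z.1 := by fun_prop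
  have h2 : ContDiffAt ℝ ∞ (fun x : Rn n => (Φ (x, z.2)).1) z.1 :=
    contDiffAt_fst.comp z.1 (ContDiffAt.comp (f := fun x : Rn n => (x, z.2)) z.1 h.smooth h1)
  refine h2.congr_of_eventuallyEq ?_
  have h3 : Tendsto (fun x : Rn n => (x, z.2)) (𝓝 z.1) (𝓝 z) := h1.continuousAt
  filter_upwards [h3.eventually h.fst] with x hx using hx.symm

lemma IsLift.fderiv_fst (h : IsLift Q Q' α Φ z) (u : Rn n × Rn n) :
    (fderiv ℝ Φ z u).1 = fderiv ℝ α z.1 u.1 := by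
  have h1 : HasFDerivAt (fun w => (Φ w).1) ((ContinuousLinearMap.fst ℝ _ _).comp (fderiv ℝ Φ z)) z :=
    (h.smooth.differentiableAt (by simp)).hasFDerivAt.fst
  have h2 : HasFDerivAt (fun w : Rn n × Rn n => α w.1)
      ((fderiv ℝ α z.1).comp (ContinuousLinearMap.fst ℝ _ _)) z :=
    (h.contDiffAt_base.differentiableAt (by simp)).hasFDerivAt.comp z hasFDerivAt_fst
  have h3 : (fun w => (Φ w).1) =ᶠ[𝓝 z] fun w => α w.1 := h.fst
  have := h1.unique (h2.congr_of_eventuallyEq h3)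
  exact congrArg (fun A => A u) this

/-- A symplectic map that covers α acts on vertical vectors by the inverse transpose of dα. The
other term of the symplectic form drops out because dΦ(0, v) has no base component. -/
lemma IsLift.fderiv_vertical (h : IsLift Q Q' α Φ z) (hQ : IsActionAngle ωM π V q Q)
    (hV' : IsOpen V') (hQ' : IsActionAngle ωM π V' q Q') (hz : z.1 ∈ V) (hz' : (Φ z).1 ∈ V')
    (u v : Rn n) :
    fderiv ℝ α z.1 u ⬝ᵥ (fderiv ℝ Φ z (0, v)).2 = u ⬝ᵥ v := by
  have := h.symplectic hQ hV' hQ' hz hz' (u, 0) (0, v)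
  rw [h.fderiv_fst, h.fderiv_fst] at this
  simpa using this

/-- Both matrices describe the same J on M, so the derivative of a coordinate change is complex
linear. -/
lemma IsSiegelMap.unique_J {J : ∀ p : M, Tan (2 * n) p →L[ℝ] Tan (2 * n) p}
    {Z Z' : Rn n → Matrix (Fin n) (Fin n) ℂ} (h : IsLift Q Q' α Φ z)
    (hV' : IsOpen V') (hQ' : IsActionAngle ωM π V' q Q') (hz : z.1 ∈ V) (hz' : (Φ z).1 ∈ V')
    (hZ : IsSiegelMap J V Q Z) (hZ' : IsSiegelMap J V' Q' Z') (u : Rn n × Rn n) :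
    siegelJ (Z' (Φ z).1) (fderiv ℝ Φ z u) = fderiv ℝ Φ z (siegelJ (Z z.1) u) := by
  apply hQ'.dQ_injective hz'
  have h1 := (hZ' _ hz').2 (Φ z) (fderiv ℝ Φ z u) rfl
  have h2 := (hZ _ hz).2 z u rfl
  have h3 := endo_congr J h.eq.self_of_nhds (h.dQ_fderiv hV' hQ' hz' u)
  have h4 := h.dQ_fderiv hV' hQ' hz' (siegelJ (Z z.1) u)
  exact h1.symm.trans (h3.trans (h2.trans h4.symm))

end Lift

/-! ### Smoothness and closedness of `Ω` -/

/-- The continuous linear map given by a square matrix. -/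
def matL {n : ℕ} (A : Matrix (Fin n) (Fin n) ℝ) : Rn n →L[ℝ] Rn n :=
  LinearMap.toContinuousLinearMap A.mulVecLin

@[simp] lemma matL_apply {n : ℕ} (A : Matrix (Fin n) (Fin n) ℝ) (v : Rn n) :
    matL A v = A *ᵥ v := rfl

/-- The vector field on `M` that corresponds to `P` under `R`. -/
def pushField {n : ℕ} {M : Type*} [TopologicalSpace M]
    [ChartedSpace (EuclideanSpace ℝ (Fin (2 * n))) M] (R : M → Rn n × Rn n)
    (P : Rn n × Rn n → Rn n × Rn n) (p : M) : Tan (2 * n) p :=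
  VectorField.mpullback (𝓡 (2 * n)) 𝓘(ℝ, Rn n × Rn n) R P p

/-! ### Vector fields and their brackets in coordinates -/

section Fields

variable {n : ℕ} {M : Type*} [TopologicalSpace M]
  [ChartedSpace (EuclideanSpace ℝ (Fin (2 * n))) M] [IsManifold (𝓡 (2 * n)) ∞ M]
  {Q : Rn n × Rn n → M} {W : Set (Rn n × Rn n)} {R : M → Rn n × Rn n}

lemma pushField_apply (h : IsLocalInverse Q W R) (P : Rn n × Rn n → Rn n × Rn n)
    {z : Rn n × Rn n} (hz : z ∈ W) : pushField R P (Q z) = dQ Q z (P z) := by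
  rw [← h.inverse_mfderiv_inv hz]
  change (mfderiv (𝓡 (2 * n)) 𝓘(ℝ, Rn n × Rn n) R (Q z)).inverse (P (R (Q z))) = _
  rw [h.left_inv z hz]

lemma smoothField_pushField (h : IsLocalInverse Q W R) {P : Rn n × Rn n → Rn n × Rn n}
    (hP : ContDiffOn ℝ ∞ P W) : SmoothField (Q '' W) (pushField R P) := by
  rintro _ ⟨z, hz, rfl⟩
  have h1 : ContMDiffWithinAt 𝓘(ℝ, Rn n × Rn n) 𝓘(ℝ, Rn n × Rn n).tangent ∞
      (fun x => (⟨x, P x⟩ : TangentBundle 𝓘(ℝ, Rn n × Rn n) (Rn n × Rn n))) W (R (Q z)) := by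
    rw [h.left_inv z hz]
    exact contMDiffWithinAt_vectorSpace_iff_contDiffWithinAt.2 (hP z hz)
  have h2 := h1.mpullback_vectorField_preimage (h.contMDiffAt_inv hz)
    (h.isInvertible_mfderiv_inv hz) (by simp)
  exact h2.mono fun p hp => h.mapsTo hp

lemma contDiffOn_mpullback (h : IsLocalInverse Q W R) {X : ∀ p : M, Tan (2 * n) p}
    (hX : SmoothField (Q '' W) X) :
    ContDiffOn ℝ ∞ (VectorField.mpullback 𝓘(ℝ, Rn n × Rn n) (𝓡 (2 * n)) Q X :
      Rn n × Rn n → Rn n × Rn n) W := by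
  intro z hz
  have h2 := (hX (Q z) ⟨z, hz, rfl⟩).mpullback_vectorField_preimage (h.contMDiffAt hz)
    (h.isInvertible_mfderiv hz) (by simp)
  exact contMDiffWithinAt_vectorSpace_iff_contDiffWithinAt.1
    (h2.mono fun w hw => ⟨w, hw, rfl⟩)

lemma mpullback_eq (h : IsLocalInverse Q W R) {X : ∀ p : M, Tan (2 * n) p} {z : Rn n × Rn n}
    (hz : z ∈ W) {u : Rn n × Rn n} (hu : X (Q z) = dQ Q z u) :
    VectorField.mpullback 𝓘(ℝ, Rn n × Rn n) (𝓡 (2 * n)) Q X z = u := by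
  change (mfderiv 𝓘(ℝ, Rn n × Rn n) (𝓡 (2 * n)) Q z).inverse (X (Q z)) = u
  rw [hu, h.inverse_mfderiv hz]

/-- The bracket of two vector fields, computed in the coordinates `Q`. -/
lemma mlieBracket_eq_dQ (h : IsLocalInverse Q W R) {X Y : ∀ p : M, Tan (2 * n) p}
    (hX : SmoothField (Q '' W) X) (hY : SmoothField (Q '' W) Y)
    {P P' : Rn n × Rn n → Rn n × Rn n} (hP : ∀ z ∈ W, X (Q z) = dQ Q z (P z))
    (hP' : ∀ z ∈ W, Y (Q z) = dQ Q z (P' z)) {z : Rn n × Rn n} (hz : z ∈ W) :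
    VectorField.mlieBracket (𝓡 (2 * n)) X Y (Q z)
      = dQ Q z (fderiv ℝ P' z (P z) - fderiv ℝ P z (P' z)) := by
  have hU := h.isOpen_image.mem_nhds ⟨z, hz, rfl⟩
  have : IsManifold (𝓡 (2 * n)) (minSmoothness ℝ 2) M := by
    simp only [minSmoothness_of_isRCLikeNormedField]
    exact IsManifold.of_le (n := ∞) (by exact ENat.LEInfty.out)
  have hb := VectorField.mpullback_mlieBracket (𝕜 := ℝ) (I := 𝓘(ℝ, Rn n × Rn n))
    (I' := 𝓡 (2 * n)) (f := Q) (x₀ := z) (n := ∞) (V := X) (W := Y)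
    ((hX.contMDiffAt hU).mdifferentiableAt (by simp))
    ((hY.contMDiffAt hU).mdifferentiableAt (by simp)) (h.contMDiffAt hz)
    (by simp only [minSmoothness_of_isRCLikeNormedField]; exact ENat.LEInfty.out)
  have e1 : VectorField.mpullback 𝓘(ℝ, Rn n × Rn n) (𝓡 (2 * n)) Q X =ᶠ[𝓝 z] P := by
    filter_upwards [h.isOpen.mem_nhds hz] with w hw using mpullback_eq h hw (hP w hw)
  have e2 : VectorField.mpullback 𝓘(ℝ, Rn n × Rn n) (𝓡 (2 * n)) Q Y =ᶠ[𝓝 z] P' := by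
    filter_upwards [h.isOpen.mem_nhds hz] with w hw using mpullback_eq h hw (hP' w hw)
  have e0 : ∀ A A' : (∀ x : Rn n × Rn n, TangentSpace 𝓘(ℝ, Rn n × Rn n) x),
      VectorField.mlieBracket 𝓘(ℝ, Rn n × Rn n) A A' = VectorField.lieBracket ℝ A A' := by
    intro A A'
    rw [← VectorField.mlieBracketWithin_univ, VectorField.mlieBracketWithin_eq_lieBracketWithin]
    exact VectorField.lieBracketWithin_univ
  rw [e0] at hb
  have e3 := e1.lieBracket_vectorField_eq (𝕜 := ℝ) e2
  have e4 := hb.trans e3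
  have e5 : dQ Q z (VectorField.lieBracket ℝ P P' z) = _ :=
    congrArg (fun u => dQ Q z u) e4.symm
  have e6 : VectorField.lieBracket ℝ P P' z = fderiv ℝ P' z (P z) - fderiv ℝ P z (P' z) := rfl
  rw [e6] at e5
  rw [e5]
  exact ((h.isInvertible_mfderiv hz).self_apply_inverse _).symm

end Fields

/-! ### Closedness of Ω from integrability of J -/

section Omega

variable {n : ℕ} {M B : Type*} [TopologicalSpace M]
  [ChartedSpace (EuclideanSpace ℝ (Fin (2 * n))) M] [IsManifold (𝓡 (2 * n)) ∞ M]
  {ωM : ∀ p : M, Tan (2 * n) p →L[ℝ] Tan (2 * n) p →L[ℝ] ℝ} {π : M → B}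
  {V : Set (Rn n)} {q : Rn n → B} {Q : Rn n × Rn n → M}
  {J : ∀ p : M, Tan (2 * n) p →L[ℝ] Tan (2 * n) p} {Z : Rn n → Matrix (Fin n) (Fin n) ℂ}

/-- Smoothness of J on M is known only through its action on smooth fields, so the constant vertical
field is pushed to M, J is applied, and the result is pulled back. -/
lemma IsSiegelMap.contDiffOn_J (hV : IsOpen V) (hQ : IsActionAngle ωM π V q Q)
    (hJ : IsCompatible ωM J) (hZ : IsSiegelMap J V Q Z) (v : Rn n) :
    ContDiffOn ℝ ∞ (fun x => siegelJ (Z x) (0, v)) V := by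
  intro x hx
  obtain ⟨W, R, hW₀, hWV, hR⟩ := hQ.exists_localInverse hV (z₀ := (x, 0)) hx
  have h1 := smoothField_pushField hR (P := fun _ => (0, v)) contDiffOn_const
  have h2 := contDiffOn_mpullback hR (hJ.smooth _ _ hR.isOpen_image h1)
  have h3 : ContDiffOn ℝ ∞ (fun z : Rn n × Rn n => siegelJ (Z z.1) (0, v)) W := by
    refine h2.congr fun z hz => ?_
    refine (mpullback_eq hR hz ?_).symm
    rw [pushField_apply hR _ hz]
    exact (hZ _ (hWV hz).1).2 z (0, v) rfl
  have h4 : ContDiffAt ℝ ∞ (fun x : Rn n => (x, (0 : Rn n))) x := by fun_prop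
  exact ((h3.contDiffAt (hR.isOpen.mem_nhds hW₀)).comp x h4).contDiffWithinAt

lemma IsSiegelMap.contDiffOn_B (hV : IsOpen V) (hQ : IsActionAngle ωM π V q Q)
    (hJ : IsCompatible ωM J) (hZ : IsSiegelMap J V Q Z) :
    ContDiffOn ℝ ∞ (fun x => matL (siegelB (Z x))) V := by
  rw [contDiffOn_clm_apply]
  intro v
  have h := (hZ.contDiffOn_J hV hQ hJ v).fst.neg
  refine h.congr fun x hx => ?_
  rw [(hZ x hx).1.siegelJ_snd]
  simp

lemma IsSiegel.matL_inv {Z : Matrix (Fin n) (Fin n) ℂ} (hZ : IsSiegel Z) :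
    ∃ e : Rn n ≃L[ℝ] Rn n, (e : Rn n →L[ℝ] Rn n) = matL (siegelB Z) ∧
      (e.symm : Rn n →L[ℝ] Rn n) = matL (siegelB Z)⁻¹ := by
  have h1 : ∀ v, (siegelB Z)⁻¹ *ᵥ (siegelB Z *ᵥ v) = v := fun v => by
    rw [Matrix.mulVec_mulVec, Matrix.nonsing_inv_mul _ hZ.isUnit_det_B, Matrix.one_mulVec]
  have h2 : ∀ v, siegelB Z *ᵥ ((siegelB Z)⁻¹ *ᵥ v) = v := fun v => by
    rw [Matrix.mulVec_mulVec, Matrix.mul_nonsing_inv _ hZ.isUnit_det_B, Matrix.one_mulVec]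
  exact ⟨ContinuousLinearEquiv.equivOfInverse (matL (siegelB Z)) (matL (siegelB Z)⁻¹) h1 h2,
    rfl, rfl⟩

lemma IsSiegelMap.contDiffOn_C (hV : IsOpen V) (hQ : IsActionAngle ωM π V q Q)
    (hJ : IsCompatible ωM J) (hZ : IsSiegelMap J V Q Z) :
    ContDiffOn ℝ ∞ (fun x => matL (siegelB (Z x))⁻¹) V := by
  have h : ContDiffOn ℝ ∞ (fun x => (matL (siegelB (Z x))).inverse) V := by
    intro x hx
    obtain ⟨e, he, -⟩ := (hZ x hx).1.matL_inv
    have h1 := contDiffAt_map_inverse (𝕜 := ℝ) (n := ∞) e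
    rw [he] at h1
    exact h1.comp_contDiffWithinAt x (hZ.contDiffOn_B hV hQ hJ x hx)
  refine h.congr fun x hx => ?_
  obtain ⟨e, he, he'⟩ := (hZ x hx).1.matL_inv
  rw [← he, ← he', ContinuousLinearMap.inverse_equiv]

/-- The angle component of -J(0, v) is R B v, and R is recovered as (R B) B⁻¹. -/
lemma IsSiegelMap.contDiffOn_R (hV : IsOpen V) (hQ : IsActionAngle ωM π V q Q)
    (hJ : IsCompatible ωM J) (hZ : IsSiegelMap J V Q Z) :
    ContDiffOn ℝ ∞ (fun x => matL (siegelR (Z x))) V := by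
  have h1 : ContDiffOn ℝ ∞ (fun x => matL (siegelR (Z x) * siegelB (Z x))) V := by
    rw [contDiffOn_clm_apply]
    intro v
    refine (hZ.contDiffOn_J hV hQ hJ v).snd.neg.congr fun x hx => ?_
    rw [(hZ x hx).1.siegelJ_snd]
    simp
  refine (h1.clm_comp (hZ.contDiffOn_C hV hQ hJ)).congr fun x hx => ?_
  ext1 v
  simp [Matrix.mul_assoc, Matrix.mul_nonsing_inv _ (hZ x hx).1.isUnit_det_B]

/-- Integrability of `J` says that the vector fields `J ∂_y` commute. -/
lemma IsSiegelMap.bracket_J (hV : IsOpen V) (hQ : IsActionAngle ωM π V q Q)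
    (hJ : IsCompatible ωM J) (hint : IsIntegrable J) (hZ : IsSiegelMap J V Q Z)
    {x : Rn n} (hx : x ∈ V) (v w : Rn n) :
    fderiv ℝ (fun x => siegelJ (Z x) (0, w)) x (siegelJ (Z x) (0, v)).1
      = fderiv ℝ (fun x => siegelJ (Z x) (0, v)) x (siegelJ (Z x) (0, w)).1 := by
  obtain ⟨W, R, hW₀, hWV, hR⟩ := hQ.exists_localInverse hV (z₀ := (x, 0)) hx
  have hX : ∀ v : Rn n, SmoothField (Q '' W) (pushField R fun _ => (0, v)) := fun v =>
    smoothField_pushField hR contDiffOn_const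
  have hJX : ∀ v : Rn n, SmoothField (Q '' W) (fun p => J p (pushField R (fun _ => (0, v)) p)) :=
    fun v => hJ.smooth _ _ hR.isOpen_image (hX v)
  have eX : ∀ v : Rn n, ∀ z ∈ W, pushField R (fun _ => (0, v)) (Q z) = dQ Q z (0, v) :=
    fun v z hz => pushField_apply hR _ hz
  have eJX : ∀ v : Rn n, ∀ z ∈ W, J (Q z) (pushField R (fun _ => (0, v)) (Q z))
      = dQ Q z (siegelJ (Z z.1) (0, v)) := fun v z hz => by
    rw [eX v z hz]
    exact (hZ _ (hWV hz).1).2 z (0, v) rfl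
  have hN := hint (Q '' W) _ _ hR.isOpen_image (hX v) (hX w) (Q (x, 0)) ⟨_, hW₀, rfl⟩
  have hd : ∀ v : Rn n, HasFDerivAt (fun z : Rn n × Rn n => siegelJ (Z z.1) (0, v))
      ((fderiv ℝ (fun x => siegelJ (Z x) (0, v)) x).comp (ContinuousLinearMap.fst ℝ _ _))
      ((x, 0) : Rn n × Rn n) := fun v =>
    HasFDerivAt.comp (x, 0) (f := Prod.fst) (g := fun x => siegelJ (Z x) (0, v))
      (((hZ.contDiffOn_J hV hQ hJ v).contDiffAt (hV.mem_nhds hx)).differentiableAt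
        (by simp)).hasFDerivAt hasFDerivAt_fst
  -- Of the four brackets in the Nijenhuis tensor only [J∂_v, J∂_w] survives. The fields ∂_v, ∂_w
  -- are constant, and J∂_v, J∂_w depend on x only, so their derivatives along vertical vectors
  -- vanish.
  rw [mlieBracket_eq_dQ hR (hJX v) (hJX w) (eJX v) (eJX w) hW₀,
    mlieBracket_eq_dQ hR (hJX v) (hX w) (eJX v) (eX w) hW₀,
    mlieBracket_eq_dQ hR (hX v) (hJX w) (eX v) (eJX w) hW₀,
    mlieBracket_eq_dQ hR (hX v) (hX w) (eX v) (eX w) hW₀] at hN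
  have hc : ∀ c : Rn n × Rn n, fderiv ℝ (fun _ : Rn n × Rn n => c) (x, 0) = 0 := fun c =>
    fderiv_const_apply c
  have h0 : dQ Q (x, 0) (0 : Rn n × Rn n) = 0 := map_zero _
  have hJ0 : J (Q (x, 0)) (dQ Q (x, 0) (0 : Rn n × Rn n)) = 0 := by rw [h0, map_zero]
  rw [(hd v).fderiv, (hd w).fderiv, hc, hc] at hN
  have e1 : ∀ a b : Rn n × Rn n, (0 : (Rn n × Rn n) →L[ℝ] Rn n × Rn n) a - (0 :
      (Rn n × Rn n) →L[ℝ] Rn n × Rn n) b = 0 := fun a b => by simp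
  have e2 : ∀ (A : Rn n →L[ℝ] Rn n × Rn n) (a : Rn n × Rn n) (b : Rn n),
      (0 : (Rn n × Rn n) →L[ℝ] Rn n × Rn n) a -
        (A.comp (ContinuousLinearMap.fst ℝ (Rn n) (Rn n))) (0, b) = 0 := fun A a b => by simp
  have e3 : ∀ (A : Rn n →L[ℝ] Rn n × Rn n) (a : Rn n × Rn n) (b : Rn n),
      (A.comp (ContinuousLinearMap.fst ℝ (Rn n) (Rn n))) (0, b) -
        (0 : (Rn n × Rn n) →L[ℝ] Rn n × Rn n) a = 0 := fun A a b => by simp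
  rw [e1, e2, e3, hJ0, h0, sub_zero, sub_zero, sub_zero, ← h0] at hN
  have := hQ.dQ_injective (z := (x, 0)) hx hN
  exact sub_eq_zero.1 this

/-- These are the two components of the bracket identity for J(0, v) = -(B v, R B v). The second
component contains R applied to the first, and subtracting that leaves the derivative of R. -/
lemma IsSiegelMap.fderiv_B_symm (hV : IsOpen V) (hQ : IsActionAngle ωM π V q Q)
    (hJ : IsCompatible ωM J) (hint : IsIntegrable J) (hZ : IsSiegelMap J V Q Z)
    {x : Rn n} (hx : x ∈ V) (v w : Rn n) :
    fderiv ℝ (fun x => matL (siegelB (Z x))) x (siegelB (Z x) *ᵥ v) w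
      = fderiv ℝ (fun x => matL (siegelB (Z x))) x (siegelB (Z x) *ᵥ w) v ∧
    fderiv ℝ (fun x => matL (siegelR (Z x))) x (siegelB (Z x) *ᵥ v) (siegelB (Z x) *ᵥ w)
      = fderiv ℝ (fun x => matL (siegelR (Z x))) x (siegelB (Z x) *ᵥ w) (siegelB (Z x) *ᵥ v) := by
  have hB := ((hZ.contDiffOn_B hV hQ hJ).contDiffAt (hV.mem_nhds hx)).differentiableAt (by simp)
  have hR := ((hZ.contDiffOn_R hV hQ hJ).contDiffAt (hV.mem_nhds hx)).differentiableAt (by simp)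
  have hBv : ∀ v : Rn n, HasFDerivAt (fun x => matL (siegelB (Z x)) v)
      ((fderiv ℝ (fun x => matL (siegelB (Z x))) x).flip v) x := fun v => by
    simpa using hB.hasFDerivAt.clm_apply (hasFDerivAt_const v x)
  have hd : ∀ v : Rn n, HasFDerivAt (fun x => siegelJ (Z x) (0, v))
      (-(((fderiv ℝ (fun x => matL (siegelB (Z x))) x).flip v).prod
        ((matL (siegelR (Z x))).comp ((fderiv ℝ (fun x => matL (siegelB (Z x))) x).flip v)
          + (fderiv ℝ (fun x => matL (siegelR (Z x))) x).flip (siegelB (Z x) *ᵥ v)))) x := by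
    intro v
    have h1 := ((hBv v).prodMk (hR.hasFDerivAt.clm_apply (hBv v))).neg
    refine h1.congr_of_eventuallyEq ?_
    filter_upwards [hV.mem_nhds hx] with y hy
    rw [(hZ y hy).1.siegelJ_snd]
    rfl
  have h := hZ.bracket_J hV hQ hJ hint hx v w
  rw [(hd v).fderiv, (hd w).fderiv, (hZ x hx).1.siegelJ_snd, (hZ x hx).1.siegelJ_snd] at h
  have h1 := congrArg Prod.fst h
  have h2 := congrArg Prod.snd h
  simp only [neg_apply, ContinuousLinearMap.prod_apply,
    ContinuousLinearMap.flip_apply, map_neg, neg_neg, add_apply,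
    ContinuousLinearMap.comp_apply] at h1 h2
  refine ⟨h1, ?_⟩
  rw [h1] at h2
  exact add_left_cancel h2

/-- This symmetry is the hypothesis of the Poincaré lemma. It comes from the preceding lemma because
every vector has the form B v. -/
lemma IsSiegelMap.fderiv_R_symm (hV : IsOpen V) (hQ : IsActionAngle ωM π V q Q)
    (hJ : IsCompatible ωM J) (hint : IsIntegrable J) (hZ : IsSiegelMap J V Q Z)
    {x : Rn n} (hx : x ∈ V) (h k : Rn n) :
    fderiv ℝ (fun x => matL (siegelR (Z x))) x h k
      = fderiv ℝ (fun x => matL (siegelR (Z x))) x k h := by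
  have h2 : ∀ v, siegelB (Z x) *ᵥ ((siegelB (Z x))⁻¹ *ᵥ v) = v := fun v => by
    rw [Matrix.mulVec_mulVec, Matrix.mul_nonsing_inv _ (hZ x hx).1.isUnit_det_B,
      Matrix.one_mulVec]
  simpa [h2] using (hZ.fderiv_B_symm hV hQ hJ hint hx ((siegelB (Z x))⁻¹ *ᵥ h)
    ((siegelB (Z x))⁻¹ *ᵥ k)).2

lemma IsSiegelMap.fderiv_C_symm (hV : IsOpen V) (hQ : IsActionAngle ωM π V q Q)
    (hJ : IsCompatible ωM J) (hint : IsIntegrable J) (hZ : IsSiegelMap J V Q Z)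
    {x : Rn n} (hx : x ∈ V) (h k : Rn n) :
    fderiv ℝ (fun x => matL (siegelB (Z x))⁻¹) x h k
      = fderiv ℝ (fun x => matL (siegelB (Z x))⁻¹) x k h := by
  have h2 : ∀ v, siegelB (Z x) *ᵥ ((siegelB (Z x))⁻¹ *ᵥ v) = v := fun v => by
    rw [Matrix.mulVec_mulVec, Matrix.mul_nonsing_inv _ (hZ x hx).1.isUnit_det_B,
      Matrix.one_mulVec]
  have hB := ((hZ.contDiffOn_B hV hQ hJ).contDiffAt (hV.mem_nhds hx)).differentiableAt (by simp)
  have hC := ((hZ.contDiffOn_C hV hQ hJ).contDiffAt (hV.mem_nhds hx)).differentiableAt (by simp)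
  -- Differentiating B⁻¹ B = 1 transfers the symmetry from B to B⁻¹.
  have key : ∀ h w : Rn n, fderiv ℝ (fun x => matL (siegelB (Z x))⁻¹) x h (siegelB (Z x) *ᵥ w)
      = -((siegelB (Z x))⁻¹ *ᵥ (fderiv ℝ (fun x => matL (siegelB (Z x))) x h w)) := by
    intro h w
    have h1 := hC.hasFDerivAt.clm_comp hB.hasFDerivAt
    have h3 : (fun x => (matL (siegelB (Z x))⁻¹).comp (matL (siegelB (Z x)))) =ᶠ[𝓝 x]
        fun _ => ContinuousLinearMap.id ℝ (Rn n) := by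
      filter_upwards [hV.mem_nhds hx] with y hy
      ext1 v
      simp [Matrix.nonsing_inv_mul _ (hZ y hy).1.isUnit_det_B]
    have h4 := h1.unique ((hasFDerivAt_const _ x).congr_of_eventuallyEq h3)
    have h5 := congrArg (fun A => A h w) h4
    simp at h5
    exact (neg_eq_of_add_eq_zero_right h5).symm
  have := (hZ.fderiv_B_symm hV hQ hJ hint hx ((siegelB (Z x))⁻¹ *ᵥ h)
    ((siegelB (Z x))⁻¹ *ᵥ k)).1
  rw [h2, h2] at this
  have e1 := key h ((siegelB (Z x))⁻¹ *ᵥ k)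
  have e2 := key k ((siegelB (Z x))⁻¹ *ᵥ h)
  rw [h2] at e1 e2
  rw [e1, e2, this]

end Omega

/-! ### Locally constant cocycles on simply connected spaces -/

/-- A locally constant cocycle on a simply connected space is the coboundary of a locally constant
cochain. -/
theorem exists_locallyConstant_coboundary {X G : Type*} [TopologicalSpace X]
    [SimplyConnectedSpace X] [LocallyPathConnectedSpace X] [AddGroup G] (V : X → Set X)
    (hV : ∀ i, IsOpen (V i)) (hmem : ∀ x, x ∈ V x) (c : X → X → X → G)
    (hc : ∀ i j k, ∀ x ∈ V i, x ∈ V j → x ∈ V k → c i j x + c j k x = c i k x)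
    (hloc : ∀ i j, ∀ x ∈ V i, x ∈ V j → ∀ᶠ y in 𝓝 x, c i j y = c i j x) :
    ∃ d : X → X → G, (∀ i, ∀ x ∈ V i, ∀ᶠ y in 𝓝 x, d i y = d i x) ∧
      ∀ i j, ∀ x ∈ V i, x ∈ V j → d i x = c i j x + d j x := by
  let _ : TopologicalSpace G := ⊥
  have : DiscreteTopology G := ⟨rfl⟩
  have hself : ∀ i, ∀ x ∈ V i, c i i x = 0 := fun i x hx => by
    simpa using hc i i i x hx hx hx
  -- The cocycle serves as transition functions, acting on G by left translation. They are
  -- continuous because the cocycle is locally constant and G is discrete.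
  let K : FiberBundleCore X X G :=
    { baseSet := V
      isOpen_baseSet := hV
      indexAt := fun x => x
      mem_baseSet_at := hmem
      coordChange := fun i j x v => c j i x + v
      coordChange_self := fun i x hx v => by rw [hself i x hx, zero_add]
      continuousOn_coordChange := by
        rintro i j ⟨x, v⟩ ⟨⟨hi, hj⟩, -⟩
        refine ContinuousAt.continuousWithinAt ?_
        refine ContinuousAt.congr (f := fun p : X × G => c j i x + p.2) ?_ ?_
        · exact (continuous_of_discreteTopology (f := fun v : G => c j i x + v)).continuousAt.comp
            continuousAt_snd
        · filter_upwards [(continuous_fst.tendsto ((x, v) : X × G)).eventually (hloc j i x hj hi)]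
            with p hp
          rw [hp]
      coordChange_comp := by
        rintro i j k x ⟨⟨hi, hj⟩, hk⟩ v
        rw [← add_assoc, hc k j i x hk hj hi] }
  have hcov : IsCoveringMap (Bundle.TotalSpace.proj : Bundle.TotalSpace G K.Fiber → X) :=
    haveI : DiscreteTopology G := ⟨rfl⟩
    FiberBundle.isCoveringMap
  obtain ⟨x₀⟩ : Nonempty X := inferInstance
  -- The total space is a covering of X, and the identity of the simply connected space X lifts to
  -- it. The lift is a global section, and its coordinates in the local trivializations form the
  -- required cochain.
  obtain ⟨F, ⟨-, hF⟩, -⟩ := hcov.existsUnique_continuousMap_lifts (ContinuousMap.id X) x₀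
    (⟨x₀, (0 : G)⟩ : Bundle.TotalSpace G K.Fiber) rfl
  have hF' : ∀ x, (F x).proj = x := fun x => congrFun hF x
  refine ⟨fun i x => (K.localTriv i (F x)).2, fun i x hx => ?_, fun i j x hi hj => ?_⟩
  · have h1 : ContinuousAt (fun y => (K.localTriv i (F y)).2) x := by
      refine continuousAt_snd.comp (ContinuousAt.comp (f := F) ?_ F.continuous.continuousAt)
      refine (K.localTriv i).continuousOn.continuousAt
        ((K.localTriv i).open_source.mem_nhds ?_)
      rw [(K.localTriv i).mem_source]
      change (F x).proj ∈ V i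
      rwa [hF']
    have h2 : {(K.localTriv i (F x)).2} ∈ 𝓝 (K.localTriv i (F x)).2 :=
      (isOpen_discrete _).mem_nhds rfl
    exact h1 h2
  · simp only [FiberBundleCore.localTriv_apply]
    change c i (F x).proj (F x).proj + _ = c i j x + (c j (F x).proj (F x).proj + _)
    rw [hF' x]
    have h : ∀ v : G, c i x x + v = c i j x + (c j x x + v) := fun v => by
      rw [← add_assoc, hc i j x x hi hj (hmem x)]
    exact h _

/-! ### The torus `ℝⁿ / ℤⁿ` -/

/-- The projection `ℝⁿ → ℝⁿ / ℤⁿ`. -/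
def toTorus {n : ℕ} (y : Rn n) : UnitAddTorus (Fin n) := fun i => (y i : UnitAddCircle)

section Torus

variable {n : ℕ}

lemma toTorus_eq_iff {y y' : Rn n} :
    toTorus y = toTorus y' ↔ ∃ k : Fin n → ℤ, ∀ i, y' i = y i + k i := by
  rw [← Classical.skolem (p := fun i (k : ℤ) => y' i = y i + k), funext_iff]
  refine forall_congr' fun i => ?_
  refine (QuotientAddGroup.eq (s := AddSubgroup.zmultiples (1 : ℝ)) (a := y i)
    (b := y' i)).trans ?_
  rw [AddSubgroup.mem_zmultiples_iff]
  refine exists_congr fun k => ?_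
  rw [zsmul_one]
  constructor <;> intro h <;> linarith

lemma toTorus_add (y y' : Rn n) : toTorus (y + y') = toTorus y + toTorus y' := rfl

lemma toTorus_sub (y y' : Rn n) : toTorus (y - y') = toTorus y - toTorus y' := rfl

lemma toTorus_surjective : Function.Surjective (toTorus : Rn n → UnitAddTorus (Fin n)) := by
  intro t
  choose y hy using fun i => QuotientAddGroup.mk_surjective (t i)
  exact ⟨y, funext hy⟩

end Torus

/-! ### Global action-angle coordinates -/

section Global

variable {n : ℕ} {M B : Type*} [TopologicalSpace M]
  [ChartedSpace (EuclideanSpace ℝ (Fin (2 * n))) M]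
  {ωM : ∀ p : M, Tan (2 * n) p →L[ℝ] Tan (2 * n) p →L[ℝ] ℝ} {π : M → B}
  {V V' : Set (Rn n)} {q : Rn n → B} {Q Q' : Rn n × Rn n → M}
  {J : ∀ p : M, Tan (2 * n) p →L[ℝ] Tan (2 * n) p} {Z Z' : Rn n → Matrix (Fin n) (Fin n) ℂ}

lemma dQ_congr {z : Rn n × Rn n} (h : Q =ᶠ[𝓝 z] Q') (u : Rn n × Rn n) :
    (dQ Q z u : EuclideanSpace ℝ (Fin (2 * n))) = dQ Q' z u :=
  congrArg (fun A : (Rn n × Rn n) →L[ℝ] EuclideanSpace ℝ (Fin (2 * n)) => A u) h.mfderiv_eq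

lemma dQ_comp {S : Rn n × Rn n → Rn n × Rn n} {S' : (Rn n × Rn n) →L[ℝ] Rn n × Rn n}
    {z : Rn n × Rn n} (hQ : MDifferentiableAt 𝓘(ℝ, Rn n × Rn n) (𝓡 (2 * n)) Q (S z))
    (hS : HasFDerivAt S S' z) (u : Rn n × Rn n) :
    (dQ (fun w => Q (S w)) z u : EuclideanSpace ℝ (Fin (2 * n))) = dQ Q (S z) (S' u) := by
  have h := mfderiv_comp z hQ hS.hasMFDerivAt.mdifferentiableAt
  rw [hS.hasMFDerivAt.mfderiv] at h
  exact congrArg (fun A : (Rn n × Rn n) →L[ℝ] EuclideanSpace ℝ (Fin (2 * n)) => A u) h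

lemma IsActionAngle.mdifferentiableAt (hV : IsOpen V) (hQ : IsActionAngle ωM π V q Q)
    {z : Rn n × Rn n} (hz : z.1 ∈ V) :
    MDifferentiableAt 𝓘(ℝ, Rn n × Rn n) (𝓡 (2 * n)) Q z :=
  (hQ.smooth.contMDiffAt ((hV.prod isOpen_univ).mem_nhds ⟨hz, trivial⟩)).mdifferentiableAt
    (by simp)

lemma IsActionAngle.mono (hQ : IsActionAngle ωM π V q Q) (h : V' ⊆ V) :
    IsActionAngle ωM π V' q Q where
  smooth := hQ.smooth.mono (prod_mono h subset_rfl)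
  proj x hx := hQ.proj x (h hx)
  periodic x hx := hQ.periodic x (h hx)
  surjective x hx := hQ.surjective x (h hx)
  symplectic x hx := hQ.symplectic x (h hx)

lemma IsActionAngle.of_local (h : ∀ x ∈ V, ∃ (O : Set (Rn n)) (Q' : Rn n × Rn n → M),
    IsOpen O ∧ x ∈ O ∧ IsActionAngle ωM π O q Q' ∧ ∀ ξ ∈ O, ∀ y, Q (ξ, y) = Q' (ξ, y)) :
    IsActionAngle ωM π V q Q where
  smooth := by
    rintro ⟨x, y⟩ ⟨hx, -⟩
    obtain ⟨O, Q', hO, hxO, hQ', he⟩ := h x hx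
    have hn : O ×ˢ (univ : Set (Rn n)) ∈ 𝓝 (x, y) :=
      (hO.prod isOpen_univ).mem_nhds ⟨hxO, trivial⟩
    refine ((hQ'.smooth.contMDiffAt hn).congr_of_eventuallyEq ?_).contMDiffWithinAt
    filter_upwards [hn] with w hw using he w.1 hw.1 w.2
  proj x hx y := by
    obtain ⟨O, Q', hO, hxO, hQ', he⟩ := h x hx
    rw [he x hxO, hQ'.proj x hxO]
  periodic x hx y y' := by
    obtain ⟨O, Q', hO, hxO, hQ', he⟩ := h x hx
    rw [he x hxO, he x hxO, hQ'.periodic x hxO]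
  surjective x hx p hp := by
    obtain ⟨O, Q', hO, hxO, hQ', he⟩ := h x hx
    simpa only [he x hxO] using hQ'.surjective x hxO p hp
  symplectic x hx y u v := by
    obtain ⟨O, Q', hO, hxO, hQ', he⟩ := h x hx
    have hn : O ×ˢ (univ : Set (Rn n)) ∈ 𝓝 (x, y) :=
      (hO.prod isOpen_univ).mem_nhds ⟨hxO, trivial⟩
    have hee : Q =ᶠ[𝓝 (x, y)] Q' := by
      filter_upwards [hn] with w hw using he w.1 hw.1 w.2
    exact (form_congr ωM (he x hxO y) (dQ_congr hee u) (dQ_congr hee v)).trans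
      (hQ'.symplectic x hxO y u v)

lemma hasFDerivAt_shift {ψ : Rn n → Rn n} {T : Rn n →L[ℝ] Rn n} {z : Rn n × Rn n}
    (h : HasFDerivAt ψ T z.1) : HasFDerivAt (fun w : Rn n × Rn n => (w.1, w.2 + ψ w.1))
      ((ContinuousLinearMap.fst ℝ _ _).prod
        (ContinuousLinearMap.snd ℝ _ _ + T.comp (ContinuousLinearMap.fst ℝ _ _))) z :=
  hasFDerivAt_fst.prodMk (hasFDerivAt_snd.add (h.comp z hasFDerivAt_fst))

/-- Action-angle coordinates can be shifted along the fibres by a map with symmetric derivative. -/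
lemma IsActionAngle.shift (hV : IsOpen V) (hQ : IsActionAngle ωM π V q Q) {ψ : Rn n → Rn n}
    {T : Rn n → Matrix (Fin n) (Fin n) ℝ} (hψ : ContDiffOn ℝ ∞ ψ V)
    (hT : ∀ x ∈ V, HasFDerivAt ψ (matL (T x)) x) (hs : ∀ x ∈ V, (T x)ᵀ = T x) :
    IsActionAngle ωM π V q (fun z => Q (z.1, z.2 + ψ z.1)) where
  smooth := by
    refine hQ.smooth.comp (t := V ×ˢ univ) ?_ fun z hz => ⟨hz.1, trivial⟩
    refine ContDiffOn.contMDiffOn ?_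
    exact contDiff_fst.contDiffOn.prodMk (contDiff_snd.contDiffOn.add
      (hψ.comp contDiff_fst.contDiffOn fun z hz => hz.1))
  proj x hx y := hQ.proj x hx _
  periodic x hx y y' := by
    refine (hQ.periodic x hx _ _).trans (exists_congr fun k => forall_congr' fun i => ?_)
    simp only [Pi.add_apply]
    constructor <;> intro h <;> linarith
  surjective x hx p hp := by
    obtain ⟨y, hy⟩ := hQ.surjective x hx p hp
    exact ⟨y - ψ x, by simpa using hy⟩
  symplectic x hx y u v := by
    have h1 := hasFDerivAt_shift (z := (x, y)) (hT x hx)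
    have h2 := hQ.mdifferentiableAt hV (z := (x, y + ψ x)) hx
    refine (form_congr ωM rfl (dQ_comp h2 h1 u) (dQ_comp h2 h1 v)).trans
      ((hQ.symplectic x hx _ _ _).trans ?_)
    -- The two extra terms of the symplectic form cancel by symmetry of T.
    have h3 : u.1 ⬝ᵥ (T x *ᵥ v.1) = (T x *ᵥ u.1) ⬝ᵥ v.1 := by
      rw [Matrix.dotProduct_mulVec, ← Matrix.mulVec_transpose, hs x hx]
    simp only [ContinuousLinearMap.prod_apply, ContinuousLinearMap.coe_fst', add_apply,
      ContinuousLinearMap.coe_snd', ContinuousLinearMap.comp_apply, matL_apply, dotProduct_add,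
      add_dotProduct, h3]
    ring

/-- A shear of the angles by T x leaves the base component B of J unchanged and adds T to R. -/
lemma IsSiegel.siegelR_eq_add {Z Z' T : Matrix (Fin n) (Fin n) _} (hZ : IsSiegel Z)
    (hZ' : IsSiegel Z') (h : ∀ v : Rn n, siegelJ Z (0, v)
      = ((siegelJ Z' (0, v)).1, (siegelJ Z' (0, v)).2 + T *ᵥ (siegelJ Z' (0, v)).1)) :
    siegelR Z = siegelR Z' + T := by
  refine Matrix.ext_of_mulVec_single fun i => ?_
  have h2 : siegelB Z *ᵥ ((siegelB Z)⁻¹ *ᵥ Pi.single i 1) = Pi.single i 1 := by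
    rw [Matrix.mulVec_mulVec, Matrix.mul_nonsing_inv _ hZ.isUnit_det_B, Matrix.one_mulVec]
  have h1 := h ((siegelB Z)⁻¹ *ᵥ Pi.single i 1)
  rw [hZ.siegelJ_snd, hZ'.siegelJ_snd, h2, Prod.mk.injEq] at h1
  obtain ⟨h3, h4⟩ := h1
  rw [neg_inj] at h3
  dsimp only at h4
  rw [← h3, Matrix.mulVec_neg, ← neg_add, neg_inj] at h4
  rw [h4, Matrix.add_mulVec]

/-- On a ball R has a primitive ψ, and because R is symmetric the shift of the angles by ψ is
symplectic. The shift subtracts R from itself, leaving a purely imaginary Ω. -/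
lemma IsActionAngle.exists_normal [IsManifold (𝓡 (2 * n)) ∞ M] (hJ : IsCompatible ωM J)
    (hJinv : IsFibreInvariant ωM π J) (hint : IsIntegrable J) (hV : IsOpen V)
    (hQ : IsActionAngle ωM π V q Q) {x : Rn n} (hx : x ∈ V) :
    ∃ (O : Set (Rn n)) (Q' : Rn n × Rn n → M) (Z : Rn n → Matrix (Fin n) (Fin n) ℂ),
      IsOpen O ∧ x ∈ O ∧ IsActionAngle ωM π O q Q' ∧ IsSiegelMap J O Q' Z ∧
      ∀ ξ ∈ O, siegelR (Z ξ) = 0 := by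
  obtain ⟨r, hr, hrV⟩ := Metric.isOpen_iff.1 hV x hx
  have hQr := hQ.mono hrV
  have ho : IsOpen (Metric.ball x r) := Metric.isOpen_ball
  obtain ⟨Z, hZ⟩ := hJinv _ _ _ ho hQr
  have hRs := hZ.contDiffOn_R ho hQr hJ
  obtain ⟨ψ, hψ⟩ := (convex_ball x r).exists_forall_hasFDerivAt_of_fderiv_symmetric ho
    (hRs.differentiableOn (by simp)) fun a ha h k => hZ.fderiv_R_symm ho hQr hJ hint ha h k
  have hψs : ContDiffOn ℝ ∞ ψ (Metric.ball x r) := by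
    rw [contDiffOn_infty_iff_fderiv_of_isOpen ho]
    refine ⟨fun a ha => (hψ a ha).differentiableAt.differentiableWithinAt, ?_⟩
    exact hRs.congr fun a ha => (hψ a ha).fderiv
  have hQ' := hQr.shift ho hψs hψ fun a ha => (hZ a ha).1.transpose_R
  obtain ⟨Z', hZ'⟩ := hJinv _ _ _ ho hQ'
  refine ⟨_, _, Z', ho, Metric.mem_ball_self hr, hQ', hZ', fun ξ hξ => ?_⟩
  have h := (hZ ξ hξ).1.siegelR_eq_add (T := siegelR (Z ξ)) (hZ' ξ hξ).1 ?_
  · simpa using h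
  intro v
  have h1 := hasFDerivAt_shift (z := (ξ, (0 : Rn n))) (hψ ξ hξ)
  have h2 := hQr.mdifferentiableAt ho (z := (ξ, 0 + ψ ξ)) hξ
  have e1 := (hZ ξ hξ).2 (ξ, 0 + ψ ξ) (0, v) rfl
  have e2 := (hZ' ξ hξ).2 (ξ, 0) (0, v) rfl
  have e3 := dQ_comp h2 h1 (0, v)
  have e4 := dQ_comp h2 h1 (siegelJ (Z' ξ) (0, v))
  have e5 := (endo_congr J rfl e3).symm.trans (e2.trans e4)
  have e6 : ((ContinuousLinearMap.fst ℝ (Rn n) (Rn n)).prod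
        (ContinuousLinearMap.snd ℝ _ _ + (matL (siegelR (Z ξ))).comp
          (ContinuousLinearMap.fst ℝ _ _))) (0, v) = (0, v) := by simp
  rw [e6] at e5
  have e7 := hQr.dQ_injective (z := (ξ, 0 + ψ ξ)) hξ (e1.symm.trans e5)
  exact e7

lemma exists_nhds_injOn [TopologicalSpace B] (hq : IsCoveringMap q) (x : Rn n) :
    ∃ O ∈ 𝓝 x, InjOn q O := by
  obtain ⟨e, he, rfl⟩ := hq.isLocalHomeomorph x
  exact ⟨e.source, e.open_source.mem_nhds he, e.injOn⟩

/-- The symplectic condition fixes vertical vectors, since the base map is the identity. When R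
vanishes on both sides, horizontal vectors are the J-images of vertical ones, and complex linearity
fixes them too. -/
lemma IsLift.fderiv_eq_id {Φ : Rn n × Rn n → Rn n × Rn n} {z : Rn n × Rn n}
    (h : IsLift Q Q' id Φ z) (hQ : IsActionAngle ωM π V q Q)
    (hV' : IsOpen V') (hQ' : IsActionAngle ωM π V' q Q') (hz : z.1 ∈ V) (hz' : z.1 ∈ V')
    (hZ : IsSiegelMap J V Q Z) (hZ' : IsSiegelMap J V' Q' Z') (h0 : siegelR (Z z.1) = 0)
    (h0' : siegelR (Z' z.1) = 0) : fderiv ℝ Φ z = ContinuousLinearMap.id ℝ _ := by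
  have hΦ : (Φ z).1 = z.1 := h.fst.self_of_nhds
  have hfst : ∀ u, (fderiv ℝ Φ z u).1 = u.1 := fun u => by
    rw [h.fderiv_fst, fderiv_id, ContinuousLinearMap.id_apply]
  have hvert : ∀ v : Rn n, fderiv ℝ Φ z (0, v) = (0, v) := by
    intro v
    refine Prod.ext (hfst _) (dotProduct_eq _ _ fun u => ?_)
    have := h.fderiv_vertical hQ hV' hQ' hz (hΦ ▸ hz') u v
    rw [fderiv_id, ContinuousLinearMap.id_apply] at this
    rw [dotProduct_comm, this, dotProduct_comm]
  have hhor : ∀ w : Rn n, fderiv ℝ Φ z (w, 0) = (w, 0) := by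
    intro w
    have hB : siegelB (Z z.1) *ᵥ ((siegelB (Z z.1))⁻¹ *ᵥ w) = w := by
      rw [Matrix.mulVec_mulVec, Matrix.mul_nonsing_inv _ (hZ _ hz).1.isUnit_det_B,
        Matrix.one_mulVec]
    have := hZ.unique_J h hV' hQ' hz (hΦ ▸ hz') hZ' (0, -((siegelB (Z z.1))⁻¹ *ᵥ w))
    rw [hΦ, hvert, (hZ _ hz).1.siegelJ_snd, (hZ' _ hz').1.siegelJ_snd, h0, h0'] at this
    simp only [Matrix.mulVec_neg, hB, neg_neg, Matrix.zero_mulVec, neg_zero] at this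
    refine Prod.ext (hfst _) ?_
    rw [← this]
  refine ContinuousLinearMap.ext fun u => ?_
  have : u = (u.1, 0) + (0, u.2) := by simp
  rw [this, map_add, hhor, hvert]
  rfl

/-- The lift of the identity has derivative id, so it differs from the identity by a constant near
the point. -/
lemma eventually_eq_shift [TopologicalSpace B] [IsManifold (𝓡 (2 * n)) ∞ M]
    (hq : IsCoveringMap q) (hV : IsOpen V)
    (hQ : IsActionAngle ωM π V q Q) (hV' : IsOpen V') (hQ' : IsActionAngle ωM π V' q Q')
    (hZ : IsSiegelMap J V Q Z) (hZ' : IsSiegelMap J V' Q' Z') (h0 : ∀ x ∈ V, siegelR (Z x) = 0)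
    (h0' : ∀ x ∈ V', siegelR (Z' x) = 0) {x y c : Rn n} (hx : x ∈ V) (hx' : x ∈ V')
    (he : Q' (x, y + c) = Q (x, y)) :
    ∀ᶠ w : Rn n × Rn n in 𝓝 (x, y), Q' (w.1, w.2 + c) = Q w := by
  obtain ⟨O, hO, hqO⟩ := exists_nhds_injOn hq x
  obtain ⟨Φ, hΦ₀, hΦ⟩ := hQ.exists_lift hV hQ' hV' (z₀ := (x, y)) (z₀' := (x, y + c)) hx hx'
    he.symm hO hqO (α := id) continuousAt_id rfl fun _ => rfl
  have hn : ∀ᶠ w : Rn n × Rn n in 𝓝 (x, y), IsLift Q Q' id Φ w ∧ w.1 ∈ V ∩ V' :=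
    hΦ.and (continuousAt_fst.preimage_mem_nhds ((hV.inter hV').mem_nhds ⟨hx, hx'⟩))
  obtain ⟨r, hr, hb⟩ := Metric.eventually_nhds_iff_ball.1 hn
  have hd : ∀ w ∈ Metric.ball (x, y) r, HasFDerivAt (fun w => Φ w - w)
      (0 : (Rn n × Rn n) →L[ℝ] Rn n × Rn n) w := by
    intro w hw
    obtain ⟨h1, h2, h3⟩ := hb w hw
    have h4 := (h1.smooth.differentiableAt (by simp)).hasFDerivAt
    rw [h1.fderiv_eq_id hQ hV' hQ' h2 h3 hZ hZ' (h0 _ h2) (h0' _ h3)] at h4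
    have h5 := h4.sub (hasFDerivAt_id w)
    rw [sub_self] at h5
    exact h5
  filter_upwards [Metric.ball_mem_nhds (x, y) hr] with w hw
  have h5 := Metric.isOpen_ball.is_const_of_fderiv_eq_zero (convex_ball (x, y) r).isPreconnected
    (fun w hw => (hd w hw).differentiableAt.differentiableWithinAt)
    (fun w hw => (hd w hw).fderiv) hw (Metric.mem_ball_self hr)
  have h6 : Φ w = (w.1, w.2 + c) := by
    rw [hΦ₀, sub_eq_iff_eq_add] at h5
    rw [h5]
    ext i <;> simp [add_comm]
  rw [← h6]
  exact (hb w hw).1.eq.self_of_nhds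

lemma IsActionAngle.toTorus_eq_iff (hQ : IsActionAngle ωM π V q Q) {x : Rn n} (hx : x ∈ V)
    {y y' : Rn n} : Q (x, y) = Q (x, y') ↔ toTorus y = toTorus y' := by
  rw [hQ.periodic x hx, LagFib.toTorus_eq_iff]

/-- The difference of two action-angle coordinates. -/
def angleShift (Q Q' : Rn n × Rn n → M) (w : Rn n × Rn n) : Rn n :=
  Classical.epsilon fun c => Q' (w.1, w.2 + c) = Q w

lemma angleShift_spec (hQ : IsActionAngle ωM π V q Q) (hQ' : IsActionAngle ωM π V' q Q')
    {w : Rn n × Rn n} (hx : w.1 ∈ V) (hx' : w.1 ∈ V') :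
    Q' (w.1, w.2 + angleShift Q Q' w) = Q w := by
  obtain ⟨y, hy⟩ := hQ'.surjective _ hx' (Q w) (hQ.proj w.1 hx w.2)
  exact Classical.epsilon_spec (p := fun c => Q' (w.1, w.2 + c) = Q w) ⟨y - w.2, by simpa using hy⟩

lemma toTorus_angleShift (hQ : IsActionAngle ωM π V q Q) (hQ' : IsActionAngle ωM π V' q Q')
    {w : Rn n × Rn n} (hx : w.1 ∈ V) (hx' : w.1 ∈ V') {c : Rn n} :
    Q' (w.1, w.2 + c) = Q w ↔ toTorus (angleShift Q Q' w) = toTorus c := by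
  rw [← angleShift_spec hQ hQ' hx hx', hQ'.toTorus_eq_iff hx', toTorus_add, toTorus_add,
    add_right_inj, eq_comm]

/-- Over every point there are normal coordinates, and any two of them differ by a translation of
the torus that is locally constant in the base. These translations form a cocycle on the simply
connected ℝⁿ, and correcting the local coordinates by a cochain that bounds it makes them agree. -/
theorem exists_global_actionAngle [TopologicalSpace B] [IsManifold (𝓡 (2 * n)) ∞ M]
    (hq : IsCoveringMap q) (hJ : IsCompatible ωM J)
    (hJinv : IsFibreInvariant ωM π J) (hint : IsIntegrable J)
    (hloc : ∀ x : Rn n, ∃ V : Set (Rn n), IsOpen V ∧ x ∈ V ∧ ∃ Q, IsActionAngle ωM π V q Q) :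
    ∃ Q, IsActionAngle ωM π univ q Q := by
  have hnorm : ∀ x : Rn n, ∃ (O : Set (Rn n)) (Q' : Rn n × Rn n → M)
      (Z : Rn n → Matrix (Fin n) (Fin n) ℂ), IsOpen O ∧ x ∈ O ∧ IsActionAngle ωM π O q Q' ∧
      IsSiegelMap J O Q' Z ∧ ∀ ξ ∈ O, siegelR (Z ξ) = 0 := by
    intro x
    obtain ⟨V, hV, hx, Q, hQ⟩ := hloc x
    exact hQ.exists_normal hJ hJinv hint hV hx
  choose V Q Z hV hmem hQ hZ h0 using hnorm
  have hconst : ∀ i j ξ, ξ ∈ V i → ξ ∈ V j → ∀ y,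
      ∀ᶠ w : Rn n × Rn n in 𝓝 (ξ, y), toTorus (angleShift (Q i) (Q j) w)
        = toTorus (angleShift (Q i) (Q j) (ξ, y)) := by
    intro i j ξ hi hj y
    have h1 := eventually_eq_shift hq (hV i) (hQ i) (hV j) (hQ j) (hZ i) (hZ j) (h0 i) (h0 j)
      hi hj (angleShift_spec (hQ i) (hQ j) (w := (ξ, y)) hi hj)
    filter_upwards [h1, (continuousAt_fst (p := (ξ, y))).preimage_mem_nhds
      (((hV i).inter (hV j)).mem_nhds ⟨hi, hj⟩)] with w hw hw'
    exact (toTorus_angleShift (hQ i) (hQ j) hw'.1 hw'.2).1 hw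
  have hindep : ∀ i j ξ, ξ ∈ V i → ξ ∈ V j → ∀ y, toTorus (angleShift (Q i) (Q j) (ξ, y))
      = toTorus (angleShift (Q i) (Q j) (ξ, 0)) := by
    intro i j ξ hi hj y
    -- Local constancy also along the connected fibre direction shows that the translation depends
    -- on the base point alone.
    have : IsLocallyConstant fun y => toTorus (angleShift (Q i) (Q j) (ξ, y)) := by
      rw [IsLocallyConstant.iff_eventually_eq]
      intro y
      have h1 : Tendsto (fun y : Rn n => (ξ, y)) (𝓝 y) (𝓝 (ξ, y)) := by
        exact (Continuous.prodMk_right ξ).tendsto y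
      exact h1.eventually (hconst i j ξ hi hj y)
    exact this.apply_eq_of_preconnectedSpace y 0
  have hkey : ∀ i j ξ, ξ ∈ V i → ξ ∈ V j → ∀ c : Rn n,
      toTorus (angleShift (Q i) (Q j) (ξ, 0)) = toTorus c → ∀ y, Q j (ξ, y + c) = Q i (ξ, y) := by
    intro i j ξ hi hj c hc y
    rw [toTorus_angleShift (hQ i) (hQ j) (w := (ξ, y)) hi hj, hindep i j ξ hi hj y, hc]
  obtain ⟨d, hd, hdc⟩ := exists_locallyConstant_coboundary V hV hmem
    (fun i j ξ => toTorus (angleShift (Q i) (Q j) (ξ, 0)))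
    (by
      intro i j k ξ hi hj hk
      obtain ⟨a, ha⟩ := toTorus_surjective (toTorus (angleShift (Q i) (Q j) (ξ, 0)))
      obtain ⟨b, hb⟩ := toTorus_surjective (toTorus (angleShift (Q j) (Q k) (ξ, 0)))
      have h1 := hkey i j ξ hi hj a ha.symm 0
      have h2 := hkey j k ξ hj hk b hb.symm (0 + a)
      rw [h1, add_assoc] at h2
      rw [(toTorus_angleShift (hQ i) (hQ k) (w := (ξ, 0)) hi hk).1 h2, toTorus_add, ha, hb])
    (by
      intro i j ξ hi hj
      have h1 : Tendsto (fun x : Rn n => (x, (0 : Rn n))) (𝓝 ξ) (𝓝 (ξ, 0)) := by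
        exact (Continuous.prodMk_left (0 : Rn n)).tendsto ξ
      exact h1.eventually (hconst i j ξ hi hj 0))
  -- The representatives need not depend continuously on the torus point, because they are applied
  -- only to the locally constant cochain d.
  choose rep hrep using toTorus_surjective (n := n)
  have hglue : ∀ i j ξ, ξ ∈ V i → ξ ∈ V j → ∀ y,
      Q i (ξ, y - rep (d i ξ)) = Q j (ξ, y - rep (d j ξ)) := by
    intro i j ξ hi hj y
    rw [← hkey i j ξ hi hj (rep (d i ξ) - rep (d j ξ))
      (by rw [toTorus_sub, hrep, hrep, hdc i j ξ hi hj, add_sub_cancel_right])]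
    congr 2
    abel
  -- Each base point uses the coordinates chosen at that point; by `hglue`, near x they coincide
  -- with a constant shift of the single chart chosen at x.
  refine ⟨fun z => Q z.1 (z.1, z.2 - rep (d z.1 z.1)), IsActionAngle.of_local fun x _ => ?_⟩
  obtain ⟨O, hO, hOo, hxO⟩ := eventually_nhds_iff.1 (hd x x (hmem x))
  refine ⟨O ∩ V x, fun z => Q x (z.1, z.2 + -rep (d x x)), hOo.inter (hV x), ⟨hxO, hmem x⟩, ?_, ?_⟩
  · refine ((hQ x).mono inter_subset_right).shift (T := 0) (hOo.inter (hV x)) contDiffOn_const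
      (fun ξ _ => ?_) fun ξ _ => Matrix.transpose_zero
    have : matL ((0 : Rn n → Matrix (Fin n) (Fin n) ℝ) ξ) = 0 := by ext1 v; simp
    rw [this]
    exact hasFDerivAt_const _ _
  · intro ξ hξ y
    change Q ξ (ξ, y - rep (d ξ ξ)) = _
    rw [hglue ξ x ξ (hmem ξ) hξ.2, hO ξ hξ.1, sub_eq_add_neg]

end Global

/-! ### Frames of a prequantum line bundle -/

section Coef

variable {M : Type*} {L : M → Type*} [∀ p, NormedAddCommGroup (L p)]
  [∀ p, InnerProductSpace ℂ (L p)] {p : M}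

/-- The coefficient of `v` with respect to `e`. -/
def coef (e v : L p) : ℂ := inner ℂ e v / inner ℂ e e

lemma coef_smul {e : L p} (he : e ≠ 0) (c : ℂ) : coef e (c • e) = c := by
  rw [coef, inner_smul_right, mul_div_cancel_right₀ _ (inner_self_ne_zero.2 he)]

end Coef

section Mvfderiv

variable {d : ℕ} {M : Type*} [TopologicalSpace M] [ChartedSpace (EuclideanSpace ℝ (Fin d)) M]
  {p : M} {f : M → ℂ}

lemma mvfderiv_clm_comp {E F : Type*} [NormedAddCommGroup E] [NormedSpace ℝ E]
    [NormedAddCommGroup F] [NormedSpace ℝ F] (A : E →L[ℝ] F) {f : M → E}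
    (hf : MDifferentiableAt (𝓡 d) 𝓘(ℝ, E) f p) (v : Tan d p) :
    mvfderiv (𝓡 d) (fun q => A (f q)) p v = A (mvfderiv (𝓡 d) f p v) := by
  have h := (A.hasMFDerivAt.comp p hf.hasMFDerivAt).mfderiv
  exact congrArg (fun T : EuclideanSpace ℝ (Fin d) →L[ℝ] F => T v) h

end Mvfderiv

/-! ### Calculus of sections of a Hermitian line bundle -/

section LineBundle

variable {d : ℕ} {M : Type*} [TopologicalSpace M]
  [ChartedSpace (EuclideanSpace ℝ (Fin d)) M] [IsManifold (𝓡 d) ∞ M]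
  {L : M → Type*} [TopologicalSpace (Bundle.TotalSpace ℂ L)]
  [∀ p, NormedAddCommGroup (L p)] [∀ p, InnerProductSpace ℂ (L p)]
  [FiberBundle ℂ L] [VectorBundle ℝ ℂ L]
  {ωM : ∀ p : M, Tan d p →L[ℝ] Tan d p →L[ℝ] ℝ} {D : CovariantDerivative (𝓡 d) ℂ L}
  {U : Set M} {e σ τ : ∀ p, L p} {f : M → ℂ} {p : M}

omit [IsManifold (𝓡 d) ∞ M] in
lemma finrank_fiber (p : M) : Module.finrank ℂ (L p) = 1 := by
  have h1 := (Bundle.Trivialization.continuousLinearEquivAt ℝ (trivializationAt ℂ L p) p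
    (mem_baseSet_trivializationAt ℂ L p)).toLinearEquiv.finrank_eq
  rw [Complex.finrank_real_complex, finrank_real_of_complex] at h1
  omega

lemma exists_smul_eq {v : L p} (hv : v ≠ 0) (w : L p) : ∃ c : ℂ, w = c • v := by
  obtain ⟨c, hc⟩ := exists_smul_eq_of_finrank_eq_one (finrank_fiber p) hv w
  exact ⟨c, hc.symm⟩

lemma coef_smul_self {v : L p} (hv : v ≠ 0) (w : L p) : coef v w • v = w := by
  obtain ⟨c, rfl⟩ := exists_smul_eq hv w
  rw [coef_smul hv]

lemma SmoothSec.mdifferentiableAt (hU : IsOpen U) (h : SmoothSec d U σ) (hp : p ∈ U) :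
    MDifferentiableAt (𝓡 d) ((𝓡 d).prod 𝓘(ℝ, ℂ)) (fun q => Bundle.TotalSpace.mk' ℂ q (σ q)) p :=
  (h.contMDiffAt (hU.mem_nhds hp)).mdifferentiableAt (by simp)

lemma covDeriv_congr (hU : IsOpen U) (hσ : SmoothSec d U σ) (hτ : SmoothSec d U τ)
    (h : ∀ q ∈ U, σ q = τ q) (hp : p ∈ U) : D σ p = D τ p :=
  D.isCovariantDerivativeOnUniv.congr_of_eventuallyEq (hσ.mdifferentiableAt hU hp)
    (hτ.mdifferentiableAt hU hp) univ_mem (by filter_upwards [hU.mem_nhds hp] using h)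

lemma SmoothSec.congr (hσ : SmoothSec d U σ) (h : ∀ q ∈ U, τ q = σ q) : SmoothSec d U τ :=
  ContMDiffOn.congr hσ fun q hq => by rw [h q hq]

lemma IsPrequantum.contMDiffOn_coef (hD : IsPrequantum ωM D) (hU : IsOpen U)
    (he : SmoothSec d U e) (hne : ∀ q ∈ U, e q ≠ 0) (hσ : SmoothSec d U σ) :
    ContMDiffOn (𝓡 d) 𝓘(ℝ, ℂ) ∞ (fun q => coef (e q) (σ q)) U := by
  have h1 := hD.smooth_metric U e σ hU he hσ
  have h2 := hD.smooth_metric U e e hU he he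
  have h3 : ContMDiffOn (𝓡 d) 𝓘(ℝ, ℂ) ∞ (fun q => (inner ℂ (e q) (e q))⁻¹) U := fun q hq =>
    (contDiffAt_inv ℝ (inner_self_ne_zero.2 (hne q hq))).contMDiffAt.comp_contMDiffWithinAt q
      (h2 q hq)
  exact ((contDiff_mul (𝕜 := ℝ) (𝔸 := ℂ)).contMDiff.comp_contMDiffOn (h1.prodMk_space h3)).congr
    fun q _ => div_eq_mul_inv _ _

variable [ContMDiffVectorBundle ∞ ℂ L (𝓡 d)]

lemma smul_re_im (c : ℂ) (v : L p) : c • v = c.re • v + c.im • (Complex.I • v) := by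
  rw [← Complex.coe_smul c.re, ← Complex.coe_smul c.im, smul_smul, ← add_smul,
    Complex.re_add_im]

lemma IsPrequantum.smoothSec_smul (hD : IsPrequantum ωM D) (hU : IsOpen U)
    (hf : ContMDiffOn (𝓡 d) 𝓘(ℝ, ℂ) ∞ f U) (he : SmoothSec d U e) :
    SmoothSec d U (fun q => f q • e q) := by
  have hre : ContMDiffOn (𝓡 d) 𝓘(ℝ, ℝ) ∞ (fun q => (f q).re) U :=
    Complex.reCLM.contMDiff.comp_contMDiffOn hf
  have him : ContMDiffOn (𝓡 d) 𝓘(ℝ, ℝ) ∞ (fun q => (f q).im) U :=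
    Complex.imCLM.contMDiff.comp_contMDiffOn hf
  have h1 := (hre.smul_section he).add_section
    (him.smul_section (hD.smooth_complex U e hU he))
  exact SmoothSec.congr h1 fun q _ => smul_re_im (f q) (e q)

/-- The complex Leibniz rule. -/
lemma IsPrequantum.covDeriv_smul (hD : IsPrequantum ωM D) (hU : IsOpen U)
    (hf : ContMDiffOn (𝓡 d) 𝓘(ℝ, ℂ) ∞ f U) (he : SmoothSec d U e) (hp : p ∈ U) (v : Tan d p) :
    D (fun q => f q • e q) p v = (mvfderiv (𝓡 d) f p v : ℂ) • e p + f p • D e p v := by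
  have hfp : MDifferentiableAt (𝓡 d) 𝓘(ℝ, ℂ) f p :=
    (hf.contMDiffAt (hU.mem_nhds hp)).mdifferentiableAt (by simp)
  have hre : ContMDiffOn (𝓡 d) 𝓘(ℝ, ℝ) ∞ (fun q => (f q).re) U :=
    Complex.reCLM.contMDiff.comp_contMDiffOn hf
  have him : ContMDiffOn (𝓡 d) 𝓘(ℝ, ℝ) ∞ (fun q => (f q).im) U :=
    Complex.imCLM.contMDiff.comp_contMDiffOn hf
  have hIe := hD.smooth_complex U e hU he
  have hrep := (hre.contMDiffAt (hU.mem_nhds hp)).mdifferentiableAt (n := ∞) (by simp)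
  have himp := (him.contMDiffAt (hU.mem_nhds hp)).mdifferentiableAt (n := ∞) (by simp)
  have e1 : (fun q => f q • e q) = (fun q => (f q).re) • e
      + (fun q => (f q).im) • fun q => Complex.I • e q :=
    funext fun q => smul_re_im (f q) (e q)
  have h1 : SmoothSec d U ((fun q => (f q).re) • e) := hre.smul_section he
  have h2 : SmoothSec d U ((fun q => (f q).im) • fun q => Complex.I • e q) := him.smul_section hIe
  rw [e1, D.isCovariantDerivativeOnUniv.add (h1.mdifferentiableAt hU hp)
      (h2.mdifferentiableAt hU hp),
    D.isCovariantDerivativeOnUniv.leibniz (he.mdifferentiableAt hU hp) hrep,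
    D.isCovariantDerivativeOnUniv.leibniz (hIe.mdifferentiableAt hU hp) himp]
  have e2 := mvfderiv_clm_comp Complex.reCLM hfp v
  have e3 := mvfderiv_clm_comp Complex.imCLM hfp v
  simp only [add_apply, ContinuousLinearMap.smulRight_apply,
    smul_apply]
  rw [hD.complex_linear U e hU he p hp v, smul_re_im (mvfderiv (𝓡 d) f p v), smul_re_im (f p)]
  simp only [Complex.reCLM_apply, Complex.imCLM_apply] at e2 e3
  rw [e2, e3]
  abel

variable [T2Space M]

/-- Smoothness of the connection is applied to sections on the whole of M, so the local section is
first multiplied by a bump function that equals 1 near the point. Locality of the covariant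
derivative removes the bump again. -/
lemma smoothSec_covDeriv (hD : IsPrequantum ωM D) (hU : IsOpen U) (he : SmoothSec d U e)
    {X : ∀ p : M, Tan d p} (hX : SmoothField U X) : SmoothSec d U (fun q => D e q (X q)) := by
  intro p hp
  obtain ⟨ρ, -, hρ⟩ := (SmoothBumpFunction.nhds_basis_tsupport (I := 𝓡 d) p).mem_iff.1
    (hU.mem_nhds hp)
  have hs := ContMDiffOn.smul_section_of_tsupport (n := ∞) (ρ.contMDiff.contMDiffOn) hU hρ he
  have h1 := (hD.smooth_conn.contMDiff.contMDiff (σ := (ρ : M → ℝ) • e) hs.contMDiffOn) p trivial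
  have h2 := ((h1.contMDiffAt univ_mem).clm_bundle_apply (hX.contMDiffAt (hU.mem_nhds hp)))
  refine (h2.congr_of_eventuallyEq ?_).contMDiffWithinAt
  filter_upwards [ρ.eventuallyEq_one.eventually_nhds, hU.mem_nhds hp] with q hq hqU
  have h3 : D ((ρ : M → ℝ) • e) q = D e q :=
    D.isCovariantDerivativeOnUniv.congr_of_eventuallyEq
      (hs.contMDiffAt.mdifferentiableAt (by simp)) (he.mdifferentiableAt hU hqU) univ_mem
      (hq.mono fun r hr => by
        change ρ r • e r = e r
        rw [hr, Pi.one_apply, one_smul])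
  rw [h3]

lemma exists_local_frame (L : M → Type*) [TopologicalSpace (Bundle.TotalSpace ℂ L)]
    [∀ p, NormedAddCommGroup (L p)] [∀ p, InnerProductSpace ℂ (L p)]
    [FiberBundle ℂ L] [VectorBundle ℝ ℂ L] [ContMDiffVectorBundle ∞ ℂ L (𝓡 d)] (p : M) :
    ∃ (U : Set M) (e : ∀ q, L q), IsOpen U ∧ p ∈ U ∧ SmoothSec d U e ∧ ∀ q ∈ U, e q ≠ 0 := by
  let t := trivializationAt ℂ L p
  have hsymm : ∀ q ∈ t.baseSet, (t ⟨q, t.symm q 1⟩).2 = (1 : ℂ) := fun q hq => by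
    rw [t.apply_mk_symm hq]
  refine ⟨t.baseSet, fun q => t.symm q 1, t.open_baseSet, mem_baseSet_trivializationAt ℂ L p,
    ?_, fun q hq h0 => ?_⟩
  · refine (t.contMDiffOn_section_baseSet_iff (n := ∞) (IB := 𝓡 d) (𝕜 := ℝ)).2 ?_
    exact (contMDiffOn_const (c := (1 : ℂ))).congr hsymm
  · have h1 := hsymm q hq
    dsimp only at h0
    rw [h0] at h1
    have h2 : (t.continuousLinearEquivAt ℝ q hq) (0 : L q) = (1 : ℂ) := h1
    rw [map_zero] at h2
    exact zero_ne_one h2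

end LineBundle

/-! ### Flat frames along action-angle coordinates -/

/-- `-2π√-1 b(x)·dy`, evaluated at `(x, y)` on `u`. -/
def connForm {n : ℕ} (b : Rn n → Rn n) (z u : Rn n × Rn n) : ℂ :=
  -(2 * Real.pi * Complex.I) * ((b z.1 ⬝ᵥ u.2 : ℝ) : ℂ)

/-- `τ` is a nowhere vanishing section of `Q^* L` with `∇ τ = -2π√-1 (b(x)·dy) τ`. -/
structure IsFrame {n : ℕ} {M : Type*} [TopologicalSpace M]
    [ChartedSpace (EuclideanSpace ℝ (Fin (2 * n))) M]
    {L : M → Type*} [TopologicalSpace (Bundle.TotalSpace ℂ L)]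
    [∀ p, NormedAddCommGroup (L p)] [∀ p, InnerProductSpace ℂ (L p)]
    [FiberBundle ℂ L] [VectorBundle ℝ ℂ L] (D : CovariantDerivative (𝓡 (2 * n)) ℂ L)
    (b : Rn n → Rn n) (Q : Rn n × Rn n → M) (τ : Rn n × Rn n → Bundle.TotalSpace ℂ L) :
    Prop where
  proj : ∀ z, (τ z).proj = Q z
  ne_zero : ∀ z, (τ z).snd ≠ 0
  conn : ∀ z₀ : Rn n × Rn n, ∃ (U : Set M) (e : ∀ p, L p) (W : Set (Rn n × Rn n)),
    IsOpen U ∧ SmoothSec (2 * n) U e ∧ IsOpen W ∧ z₀ ∈ W ∧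
    ∀ z ∈ W, Q z ∈ U ∧ τ z = ⟨Q z, e (Q z)⟩ ∧
      ∀ u : Rn n × Rn n, D e (Q z) (dQ Q z u) = connForm b z u • e (Q z)

lemma eventually_eq_of_hasFDerivAt_zero {E F : Type*} [NormedAddCommGroup E] [NormedSpace ℝ E]
    [NormedAddCommGroup F] [NormedSpace ℝ F] {f : E → F} {z : E}
    (h : ∀ᶠ w in 𝓝 z, HasFDerivAt f (0 : E →L[ℝ] F) w) : ∀ᶠ w in 𝓝 z, f w = f z := by
  obtain ⟨r, hr, hb⟩ := Metric.eventually_nhds_iff_ball.1 h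
  filter_upwards [Metric.ball_mem_nhds z hr] with w hw
  exact Metric.isOpen_ball.is_const_of_fderiv_eq_zero (convex_ball z r).isPreconnected
    (fun w hw => (hb w hw).differentiableAt.differentiableWithinAt)
    (fun w hw => (hb w hw).fderiv) hw (Metric.mem_ball_self hr)

/-! ### Frames with connection form -2πi x·dy -/

section FlatFrame

variable {n : ℕ} {M B : Type*} [TopologicalSpace M]
  [ChartedSpace (EuclideanSpace ℝ (Fin (2 * n))) M]
  {L : M → Type*} [TopologicalSpace (Bundle.TotalSpace ℂ L)]
  [∀ p, NormedAddCommGroup (L p)] [∀ p, InnerProductSpace ℂ (L p)]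
  [FiberBundle ℂ L] [VectorBundle ℝ ℂ L]
  {ωM : ∀ p : M, Tan (2 * n) p →L[ℝ] Tan (2 * n) p →L[ℝ] ℝ} {π : M → B}
  {D : CovariantDerivative (𝓡 (2 * n)) ℂ L}
  {q : Rn n → B} {Q : Rn n × Rn n → M} {U : Set M} {e e' : ∀ p, L p} {z : Rn n × Rn n}

lemma fderiv_comp_coord {E : Type*} [NormedAddCommGroup E] [NormedSpace ℝ E] {f : M → E}
    (hQ : MDifferentiableAt 𝓘(ℝ, Rn n × Rn n) (𝓡 (2 * n)) Q z)
    (hf : MDifferentiableAt (𝓡 (2 * n)) 𝓘(ℝ, E) f (Q z)) (u : Rn n × Rn n) :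
    fderiv ℝ (fun w => f (Q w)) z u = mvfderiv (𝓡 (2 * n)) f (Q z) (dQ Q z u) := by
  rw [← mfderiv_eq_fderiv]
  exact mfderiv_comp_apply z hf hQ u

lemma IsActionAngle.contMDiff (hQ : IsActionAngle ωM π univ q Q) :
    ContMDiff 𝓘(ℝ, Rn n × Rn n) (𝓡 (2 * n)) ∞ Q := by
  have := hQ.smooth
  rwa [univ_prod_univ, contMDiffOn_univ] at this

lemma IsActionAngle.exists_localInverse_ball [IsManifold (𝓡 (2 * n)) ∞ M]
    (hQ : IsActionAngle ωM π univ q Q) {z : Rn n × Rn n}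
    {O : Set (Rn n × Rn n)} (hO : O ∈ 𝓝 z) :
    ∃ r > 0, ∃ R, Metric.ball z r ⊆ O ∧ IsLocalInverse Q (Metric.ball z r) R := by
  obtain ⟨W, R, hW, -, hR⟩ := hQ.exists_localInverse isOpen_univ (z₀ := z) trivial
  obtain ⟨r, hr, hb⟩ := Metric.mem_nhds_iff.1 (inter_mem (hR.isOpen.mem_nhds hW) hO)
  refine ⟨r, hr, R, fun w hw => (hb hw).2, ?_⟩
  have h := hR.mono (O := Metric.ball z r) Metric.isOpen_ball
  rwa [inter_eq_right.2 fun w hw => (hb hw).1] at h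

/-- The logarithmic derivative of the ratio of two frames is the difference of their connection
forms, by the Leibniz rule. -/
lemma IsPrequantum.hasFDerivAt_coef [IsManifold (𝓡 (2 * n)) ∞ M]
    [ContMDiffVectorBundle ∞ ℂ L (𝓡 (2 * n))] (hD : IsPrequantum ωM D) (hU : IsOpen U)
    (he : SmoothSec (2 * n) U e) (hne : ∀ p ∈ U, e p ≠ 0) (he' : SmoothSec (2 * n) U e')
    (hQ : MDifferentiableAt 𝓘(ℝ, Rn n × Rn n) (𝓡 (2 * n)) Q z) (hz : Q z ∈ U)
    {θ θ' : Rn n × Rn n → ℂ} (hθ : ∀ u, D e (Q z) (dQ Q z u) = θ u • e (Q z))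
    (hθ' : ∀ u, D e' (Q z) (dQ Q z u) = θ' u • e' (Q z)) :
    DifferentiableAt ℝ (fun w => coef (e (Q w)) (e' (Q w))) z ∧
      ∀ u, fderiv ℝ (fun w => coef (e (Q w)) (e' (Q w))) z u
        = (θ' u - θ u) * coef (e (Q z)) (e' (Q z)) := by
  have hc := hD.contMDiffOn_coef hU he hne he'
  have hcz : MDifferentiableAt (𝓡 (2 * n)) 𝓘(ℝ, ℂ) (fun q => coef (e q) (e' q)) (Q z) :=
    (hc.contMDiffAt (hU.mem_nhds hz)).mdifferentiableAt (by simp)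
  refine ⟨(hcz.comp z hQ).differentiableAt, fun u => ?_⟩
  rw [fderiv_comp_coord (f := fun q => coef (e q) (e' q)) hQ hcz]
  have h1 := hD.covDeriv_smul hU hc he hz (dQ Q z u)
  have h2 : D (fun q => coef (e q) (e' q) • e q) (Q z) = D e' (Q z) :=
    covDeriv_congr hU (hD.smoothSec_smul hU hc he) he'
      (fun q hq => coef_smul_self (hne q hq) _) hz
  rw [h2, hθ, hθ'] at h1
  have h3 := coef_smul_self (hne _ hz) (e' (Q z))
  rw [← sub_eq_zero, ← h3, smul_smul, smul_smul, ← add_smul, ← sub_smul, smul_eq_zero,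
    or_iff_left (hne _ hz), coef_smul (hne _ hz)] at h1
  linear_combination -h1

/-- `-2π√-1 x·dy` as a smooth 1-form. -/
def connFormL (n : ℕ) : (Rn n × Rn n) →L[ℝ] (Rn n × Rn n) →L[ℝ] ℂ :=
  LinearMap.toContinuousLinearMap ((LinearMap.toContinuousLinearMap (𝕜 := ℝ) (E := Rn n × Rn n)
    (F' := ℂ)).toLinearMap ∘ₗ LinearMap.mk₂ ℝ (fun z u => connForm id z u)
      (fun z z' u => by simp [connForm]; ring) (fun c z u => by simp [connForm]; ring)
      (fun z u u' => by simp [connForm]; ring) (fun c z u => by simp [connForm]; ring))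

@[simp] lemma connFormL_apply (z u : Rn n × Rn n) : connFormL n z u = connForm id z u := rfl

variable [IsManifold (𝓡 (2 * n)) ∞ M] [T2Space M] [ContMDiffVectorBundle ∞ ℂ L (𝓡 (2 * n))]

/-- The connection form of any local frame has the same exterior derivative as -2πi x·dy, by the
curvature condition. On a ball the difference is dh, and multiplication by exp(-h) corrects the
frame. -/
lemma exists_flat_frame (hD : IsPrequantum ωM D) (hQ : IsActionAngle ωM π univ q Q)
    (z₀ : Rn n × Rn n) :
    ∃ (W : Set (Rn n × Rn n)) (e : ∀ p, L p), IsOpen W ∧ z₀ ∈ W ∧ IsOpen (Q '' W) ∧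
      SmoothSec (2 * n) (Q '' W) e ∧ (∀ p ∈ Q '' W, e p ≠ 0) ∧
      ∀ z ∈ W, ∀ u, D e (Q z) (dQ Q z u) = connForm id z u • e (Q z) := by
  obtain ⟨U, e, hU, hz₀U, heU, hneU⟩ := exists_local_frame (d := 2 * n) L (Q z₀)
  obtain ⟨r, hr, R, hbU, hR⟩ := hQ.exists_localInverse_ball
    (hQ.contMDiff.continuous.continuousAt.preimage_mem_nhds (hU.mem_nhds hz₀U))
  set W := Metric.ball z₀ r with hW
  have hWo : IsOpen W := Metric.isOpen_ball
  have hWU : Q '' W ⊆ U := image_subset_iff.2 hbU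
  have hQW := hR.isOpen_image
  have he : SmoothSec (2 * n) (Q '' W) e := ContMDiffOn.mono heU hWU
  have hne : ∀ p ∈ Q '' W, e p ≠ 0 := fun p hp => hneU p (hWU hp)
  have hX : ∀ u : Rn n × Rn n, SmoothField (Q '' W) (pushField R fun _ => u) := fun u =>
    smoothField_pushField hR contDiffOn_const
  have hDX : ∀ u : Rn n × Rn n, SmoothSec (2 * n) (Q '' W)
      (fun p => D e p (pushField R (fun _ => u) p)) := fun u =>
    smoothSec_covDeriv hD hQW he (hX u)
  have hF : ∀ u : Rn n × Rn n, ContMDiffOn (𝓡 (2 * n)) 𝓘(ℝ, ℂ) ∞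
      (fun p => coef (e p) (D e p (pushField R (fun _ => u) p))) (Q '' W) := fun u =>
    hD.contMDiffOn_coef hQW he hne (hDX u)
  let a : Rn n × Rn n → (Rn n × Rn n) →L[ℝ] ℂ := fun z => LinearMap.toContinuousLinearMap
    { toFun := fun u => coef (e (Q z)) (D e (Q z) (dQ Q z u))
      map_add' := fun u v => by
        have h : D e (Q z) (dQ Q z (u + v)) = D e (Q z) (dQ Q z u) + D e (Q z) (dQ Q z v) := by
          rw [← map_add]
          exact congrArg _ (map_add (mfderiv 𝓘(ℝ, Rn n × Rn n) (𝓡 (2 * n)) Q z) u v)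
        rw [h, coef, coef, coef, inner_add_right, add_div]
      map_smul' := fun c u => by
        have h : D e (Q z) (dQ Q z (c • u)) = (c : ℂ) • D e (Q z) (dQ Q z u) := by
          rw [Complex.coe_smul, ← map_smul]
          exact congrArg _ (map_smul (mfderiv 𝓘(ℝ, Rn n × Rn n) (𝓡 (2 * n)) Q z) c u)
        rw [h, coef, coef, inner_smul_right, mul_div_assoc]
        rfl }
  have ha : ∀ z u, a z u = coef (e (Q z)) (D e (Q z) (dQ Q z u)) := fun z u => rfl
  have haF : ∀ z ∈ W, ∀ u, a z u
      = coef (e (Q z)) (D e (Q z) (pushField R (fun _ => u) (Q z))) := fun z hz u => by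
    rw [ha, pushField_apply hR _ hz]
  have haD : ∀ z ∈ W, ∀ u, D e (Q z) (dQ Q z u) = a z u • e (Q z) := fun z hz u =>
    (coef_smul_self (hne _ ⟨z, hz, rfl⟩) _).symm
  have has : ContDiffOn ℝ ∞ a W := by
    rw [contDiffOn_clm_apply]
    intro u
    refine ContDiffOn.congr ?_ fun z hz => haF z hz u
    exact ((hF u).comp hQ.contMDiff.contMDiffOn fun z hz => ⟨z, hz, rfl⟩).contDiffOn
  have had : ∀ z ∈ W, DifferentiableAt ℝ a z := fun z hz =>
    (has.contDiffAt (hWo.mem_nhds hz)).differentiableAt (by simp)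
  have hQz : ∀ z, MDifferentiableAt 𝓘(ℝ, Rn n × Rn n) (𝓡 (2 * n)) Q z := fun z =>
    hQ.contMDiff.mdifferentiable (by simp) z
  -- The second covariant derivative of e is ∂_u a(v) + a(v) a(u) times e; the symmetric product
  -- cancels in the curvature.
  have key : ∀ z ∈ W, ∀ u v, D (fun p => D e p (pushField R (fun _ => v) p)) (Q z) (dQ Q z u)
      = (fderiv ℝ a z u v + a z v * a z u) • e (Q z) := by
    intro z hz u v
    have hzW : Q z ∈ Q '' W := ⟨z, hz, rfl⟩
    have h1 := hD.covDeriv_smul hQW (hF v) he hzW (dQ Q z u)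
    have h2 := covDeriv_congr (D := D) hQW (hD.smoothSec_smul hQW (hF v) he) (hDX v)
      (fun p hp => coef_smul_self (hne p hp) _) hzW
    rw [h2, ← fderiv_comp_coord (hQz z)
      (((hF v).contMDiffAt (hQW.mem_nhds hzW)).mdifferentiableAt (by simp)), haD z hz,
      ← haF z hz, smul_smul, ← add_smul] at h1
    rw [h1]
    have h3 : (fun w => coef (e (Q w)) (D e (Q w) (pushField R (fun _ => v) (Q w)))) =ᶠ[𝓝 z]
        fun w => a w v := by
      filter_upwards [hWo.mem_nhds hz] with w hw using (haF w hw v).symm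
    have h4 := (had z hz).hasFDerivAt.clm_apply (hasFDerivAt_const v z)
    rw [h3.fderiv_eq, h4.fderiv]
    simp
  have hcurv : ∀ z ∈ W, ∀ u v, fderiv ℝ a z u v - fderiv ℝ a z v u
      = -(2 * Real.pi * Complex.I) * ((u.1 ⬝ᵥ v.2 - u.2 ⬝ᵥ v.1 : ℝ) : ℂ) := by
    intro z hz u v
    have hzW : Q z ∈ Q '' W := ⟨z, hz, rfl⟩
    have h1 := hD.curvature (Q '' W) _ _ e hQW (hX u) (hX v) he (Q z) hzW
    have h2 := mlieBracket_eq_dQ hR (hX u) (hX v) (P := fun _ => u) (P' := fun _ => v)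
      (fun w hw => pushField_apply hR _ hw) (fun w hw => pushField_apply hR _ hw) hz
    have h3 : dQ Q z (fderiv ℝ (fun _ => v) z u - fderiv ℝ (fun _ => u) z v) = 0 := by
      have h0 : fderiv ℝ (fun _ : Rn n × Rn n => v) z u - fderiv ℝ (fun _ : Rn n × Rn n => u) z v
          = 0 := by simp
      rw [h0]
      exact map_zero (mfderiv 𝓘(ℝ, Rn n × Rn n) (𝓡 (2 * n)) Q z)
    rw [h2, h3, map_zero, sub_zero, pushField_apply hR _ hz, pushField_apply hR _ hz,
      key z hz, key z hz] at h1
    have h4 := hQ.symplectic z.1 trivial z.2 u v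
    rw [← sub_smul] at h1
    have h5 := smul_left_injective ℂ (hne _ hzW) h1
    rw [h4] at h5
    linear_combination h5
  have hconn : ∀ z ∈ W, HasFDerivAt (fun w => a w - connFormL n w)
      (fderiv ℝ a z - connFormL n) z := fun z hz =>
    (had z hz).hasFDerivAt.sub (connFormL n).hasFDerivAt
  -- Poincaré lemma for the closed form a + 2πi x·dy on the ball.
  obtain ⟨h, hh⟩ := (convex_ball z₀ r).exists_forall_hasFDerivAt_of_fderiv_symmetric hWo
    (fun z hz => (hconn z hz).differentiableAt.differentiableWithinAt) (fun z hz u v => by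
      rw [(hconn z hz).fderiv]
      have h1 := hcurv z hz u v
      simp only [sub_apply, connFormL_apply, connForm, id]
      rw [dotProduct_comm v.1 u.2]
      push_cast at h1
      linear_combination h1)
  have hhs : ContDiffOn ℝ ∞ h W := by
    rw [contDiffOn_infty_iff_fderiv_of_isOpen hWo]
    refine ⟨fun z hz => (hh z hz).differentiableAt.differentiableWithinAt, ?_⟩
    exact (has.sub (connFormL n).contDiff.contDiffOn).congr fun z hz => (hh z hz).fderiv
  have hgs : ContDiffOn ℝ ∞ (fun z => Complex.exp (-h z)) W := hhs.neg.cexp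
  have hfs : ContMDiffOn (𝓡 (2 * n)) 𝓘(ℝ, ℂ) ∞ (fun p => Complex.exp (-h (R p))) (Q '' W) :=
    hgs.contMDiffOn.comp hR.smooth_inv fun p hp => hR.mapsTo hp
  refine ⟨W, fun p => Complex.exp (-h (R p)) • e p, hWo, Metric.mem_ball_self hr, hQW,
    hD.smoothSec_smul hQW hfs he, fun p hp => smul_ne_zero (Complex.exp_ne_zero _) (hne p hp),
    fun z hz u => ?_⟩
  have hzW : Q z ∈ Q '' W := ⟨z, hz, rfl⟩
  have h1 := hD.covDeriv_smul hQW hfs he hzW (dQ Q z u)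
  rw [h1, ← fderiv_comp_coord (hQz z)
    ((hfs.contMDiffAt (hQW.mem_nhds hzW)).mdifferentiableAt (by simp)), haD z hz]
  have h2 : (fun w => Complex.exp (-h (R (Q w)))) =ᶠ[𝓝 z] fun w => Complex.exp (-h w) := by
    filter_upwards [hWo.mem_nhds hz] with w hw
    rw [hR.left_inv w hw]
  have h3 : HasFDerivAt (fun w => Complex.exp (-h w)) _ z := (hh z hz).neg.cexp
  rw [h2.fderiv_eq, h3.fderiv, hR.left_inv z hz, smul_smul, smul_smul, ← add_smul]
  congr 1
  simp only [smul_apply, neg_apply, sub_apply, connFormL_apply, smul_eq_mul, Pi.neg_apply,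
    hR.left_inv z hz]
  ring

/-- `c` as a unit, in additive notation. -/
def unitOf (c : ℂ) : Additive ℂˣ :=
  Additive.ofMul (if h : c = 0 then 1 else Units.mk0 c h)

lemma coe_unitOf {c : ℂ} (hc : c ≠ 0) : ((unitOf c).toMul : ℂ) = c := by
  simp [unitOf, hc]

/-- Ratios of frames with the same connection form have zero derivative. They form a locally
constant cocycle in ℂˣ on ℝⁿ × ℝⁿ, written additively in order to apply the coboundary theorem, and
dividing by a bounding cochain glues the frames. -/
theorem exists_isFrame (hD : IsPrequantum ωM D) (hQ : IsActionAngle ωM π univ q Q) :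
    ∃ τ, IsFrame D id Q τ := by
  choose W e hWo hmem hQW he hne hconn using exists_flat_frame (L := L) hD hQ
  have hQz : ∀ z, MDifferentiableAt 𝓘(ℝ, Rn n × Rn n) (𝓡 (2 * n)) Q z := fun z =>
    hQ.contMDiff.mdifferentiable (by simp) z
  have hmemQ : ∀ i, ∀ z ∈ W i, Q z ∈ Q '' W i := fun i z hz => ⟨z, hz, rfl⟩
  have hcne : ∀ i j, ∀ z ∈ W i, z ∈ W j → coef (e j (Q z)) (e i (Q z)) ≠ 0 := by
    intro i j z hi hj h0
    have h1 := coef_smul_self (hne j _ (hmemQ j z hj)) (e i (Q z))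
    rw [h0, zero_smul] at h1
    exact hne i _ (hmemQ i z hi) h1.symm
  obtain ⟨d, hd, hdc⟩ := exists_locallyConstant_coboundary W hWo hmem
    (fun i j z => unitOf (coef (e j (Q z)) (e i (Q z))))
    (by
      intro i j k z hi hj hk
      apply Additive.toMul.injective
      apply Units.ext
      rw [toMul_add, Units.val_mul, coe_unitOf (hcne i j z hi hj), coe_unitOf (hcne j k z hj hk),
        coe_unitOf (hcne i k z hi hk)]
      conv_rhs => rw [← coef_smul_self (hne j _ (hmemQ j z hj)) (e i (Q z))]
      conv_rhs => rw [← coef_smul_self (hne k _ (hmemQ k z hk)) (e j (Q z)), smul_smul]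
      rw [coef_smul (hne k _ (hmemQ k z hk)), coef_smul_self (hne k _ (hmemQ k z hk))])
    (by
      intro i j z hi hj
      have h1 := eventually_eq_of_hasFDerivAt_zero
        (f := fun w => coef (e j (Q w)) (e i (Q w))) (z := z) (by
          filter_upwards [(hWo i).mem_nhds hi, (hWo j).mem_nhds hj] with w hwi hwj
          have hU := (hQW i).inter (hQW j)
          obtain ⟨h1, h2⟩ := hD.hasFDerivAt_coef hU
            (ContMDiffOn.mono (he j) inter_subset_right) (fun p hp => hne j p hp.2)
            (ContMDiffOn.mono (he i) inter_subset_left) (hQz w) ⟨hmemQ i w hwi, hmemQ j w hwj⟩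
            (hconn j w hwj) (hconn i w hwi)
          have h3 : fderiv ℝ (fun w => coef (e j (Q w)) (e i (Q w))) w = 0 :=
            ContinuousLinearMap.ext fun u => by
              rw [h2, sub_self, zero_mul, zero_apply]
          rw [← h3]
          exact h1.hasFDerivAt)
      filter_upwards [h1] with w hw
      rw [hw])
  let δ : Rn n × Rn n → Rn n × Rn n → ℂ := fun i z => ((d i z).toMul : ℂ)
  have hδ : ∀ i z, δ i z ≠ 0 := fun i z => Units.ne_zero _
  have hδc : ∀ i j, ∀ z ∈ W i, z ∈ W j → δ i z = coef (e j (Q z)) (e i (Q z)) * δ j z := by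
    intro i j z hi hj
    have h1 := congrArg (fun g : Additive ℂˣ => (g.toMul : ℂ)) (hdc i j z hi hj)
    simpa only [toMul_add, Units.val_mul, coe_unitOf (hcne i j z hi hj)] using h1
  refine ⟨fun z => ⟨Q z, (δ z z)⁻¹ • e z (Q z)⟩, fun z => rfl, fun z =>
    (smul_ne_zero_iff_right (inv_ne_zero (hδ z z))).2 (hne z _ (hmemQ z z (hmem z))), fun z₀ => ?_⟩
  obtain ⟨O, hO, hOo, hzO⟩ := eventually_nhds_iff.1 (hd z₀ z₀ (hmem z₀))
  refine ⟨Q '' W z₀, fun p => (δ z₀ z₀)⁻¹ • e z₀ p, W z₀ ∩ O, hQW z₀,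
    hD.smoothSec_smul (hQW z₀) contMDiffOn_const (he z₀), (hWo z₀).inter hOo, ⟨hmem z₀, hzO⟩,
    fun z hz => ⟨hmemQ z₀ z hz.1, ?_, fun u => ?_⟩⟩
  · have h1 : δ z₀ z = δ z₀ z₀ := by simp only [δ, hO z hz.2]
    have h2 := coef_smul_self (hne z₀ _ (hmemQ z₀ z hz.1)) (e z (Q z))
    have h3 := hcne z z₀ z (hmem z) hz.1
    have h4 : (δ z z)⁻¹ • e z (Q z) = (δ z₀ z₀)⁻¹ • e z₀ (Q z) := by
      rw [hδc z z₀ z (hmem z) hz.1, ← h1]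
      conv_lhs => enter [2]; rw [← h2]
      rw [smul_smul, mul_inv_rev, mul_assoc, inv_mul_cancel₀ h3, mul_one]
    rw [h4]
  · rw [hD.covDeriv_smul (hQW z₀) contMDiffOn_const (he z₀) (hmemQ z₀ z hz.1), hconn z₀ z hz.1,
      mvfderiv_const]
    simp [smul_smul, mul_comm]

end FlatFrame

/-! ### Existence of a development -/

section LineRatio

variable {M : Type*} {L : M → Type*} [∀ p, NormedAddCommGroup (L p)]
  [∀ p, InnerProductSpace ℂ (L p)]

/-- Scalar multiplication on the total space of a line bundle. -/
def smulT (c : ℂ) (t : Bundle.TotalSpace ℂ L) : Bundle.TotalSpace ℂ L := ⟨t.proj, c • t.snd⟩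

lemma smulT_smulT (c c' : ℂ) (t : Bundle.TotalSpace ℂ L) :
    smulT c (smulT c' t) = smulT (c * c') t := by
  rw [smulT, smulT, smulT, smul_smul]

lemma lineRatio_eq {t t' : Bundle.TotalSpace ℂ L} {c : ℂ} (ht : t.snd ≠ 0)
    (h : t' = smulT c t) : lineRatio t t' = c := by
  have h1 := Classical.epsilon_spec (p := fun c : ℂ => t' = ⟨t.proj, c • t.snd⟩) ⟨c, h⟩
  have h2 : (⟨t.proj, c • t.snd⟩ : Bundle.TotalSpace ℂ L)
      = ⟨t.proj, lineRatio t t' • t.snd⟩ := h.symm.trans h1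
  have h3 := eq_of_heq (Bundle.TotalSpace.mk.inj h2).2
  exact (smul_left_injective ℂ ht h3).symm

variable [TopologicalSpace M] [TopologicalSpace (Bundle.TotalSpace ℂ L)]
  [FiberBundle ℂ L] [VectorBundle ℝ ℂ L]

lemma lineRatio_mk {p : M} {v : L p} (hv : v ≠ 0) (w : L p) :
    lineRatio (⟨p, v⟩ : Bundle.TotalSpace ℂ L) ⟨p, w⟩ = coef v w :=
  lineRatio_eq hv (by rw [smulT, coef_smul_self hv])

lemma smulT_lineRatio {t t' : Bundle.TotalSpace ℂ L} (ht : t.snd ≠ 0) (h : t.proj = t'.proj) :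
    smulT (lineRatio t t') t = t' := by
  obtain ⟨p, v⟩ := t
  obtain ⟨p', w⟩ := t'
  obtain rfl : p = p' := h
  rw [lineRatio_mk ht, smulT, coef_smul_self ht]

lemma lineRatio_ne_zero {t t' : Bundle.TotalSpace ℂ L} (ht : t.snd ≠ 0) (ht' : t'.snd ≠ 0)
    (h : t.proj = t'.proj) : lineRatio t t' ≠ 0 := by
  intro h0
  obtain ⟨p, v⟩ := t
  obtain ⟨p', w⟩ := t'
  obtain rfl : p = p' := h
  rw [lineRatio_mk ht] at h0
  have := coef_smul_self ht w
  rw [h0, zero_smul] at this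
  exact ht' this.symm

end LineRatio

/-! ### Removal of the holonomy along the tori -/

section Develop

variable {n : ℕ} {M B : Type*} [TopologicalSpace M]
  [ChartedSpace (EuclideanSpace ℝ (Fin (2 * n))) M]
  {L : M → Type*} [TopologicalSpace (Bundle.TotalSpace ℂ L)]
  [∀ p, NormedAddCommGroup (L p)] [∀ p, InnerProductSpace ℂ (L p)]
  [FiberBundle ℂ L] [VectorBundle ℝ ℂ L]
  {ωM : ∀ p : M, Tan (2 * n) p →L[ℝ] Tan (2 * n) p →L[ℝ] ℝ} {π : M → B}
  {D : CovariantDerivative (𝓡 (2 * n)) ℂ L}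
  {q : Rn n → B} {Q : Rn n × Rn n → M} {b : Rn n → Rn n} {z : Rn n × Rn n}
  {τ : Rn n × Rn n → Bundle.TotalSpace ℂ L}
  [IsManifold (𝓡 (2 * n)) ∞ M] [ContMDiffVectorBundle ∞ ℂ L (𝓡 (2 * n))]

omit [IsManifold (𝓡 (2 * n)) ∞ M] [ContMDiffVectorBundle ∞ ℂ L (𝓡 (2 * n))] in
lemma snd_ne_zero_of_eq {t : Bundle.TotalSpace ℂ L} (ht : t.snd ≠ 0) {p : M} {v : L p}
    (h : t = ⟨p, v⟩) : v ≠ 0 := by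
  subst h; exact ht

lemma IsPrequantum.isOpen_ne_zero (hD : IsPrequantum ωM D) {U : Set M} {e : ∀ p, L p}
    (hU : IsOpen U) (he : SmoothSec (2 * n) U e) : IsOpen (U ∩ {p | e p ≠ 0}) := by
  have h := (hD.smooth_metric U e e hU he he).continuousOn.isOpen_inter_preimage hU
    (isOpen_compl_singleton (x := (0 : ℂ)))
  convert h using 2
  ext p
  simp

/-- The ratio of a frame and its transform under a lift of a map of the base. -/
lemma IsFrame.hasFDerivAt_lineRatio (hD : IsPrequantum ωM D) (hQ : IsActionAngle ωM π univ q Q)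
    (hτ : IsFrame D b Q τ) {α : Rn n → Rn n} {Φ : Rn n × Rn n → Rn n × Rn n}
    (h : IsLift Q Q α Φ z) :
    DifferentiableAt ℝ (fun w => lineRatio (τ w) (τ (Φ w))) z ∧
      ∀ u, fderiv ℝ (fun w => lineRatio (τ w) (τ (Φ w))) z u
        = (connForm b (Φ z) (fderiv ℝ Φ z u) - connForm b z u)
          * lineRatio (τ z) (τ (Φ z)) := by
  obtain ⟨U, e, W, hU, he, hW, hz, hc⟩ := hτ.conn z
  obtain ⟨U', e', W', hU', he', hW', hz', hc'⟩ := hτ.conn (Φ z)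
  have hne : ∀ w ∈ W, e (Q w) ≠ 0 := fun w hw =>
    snd_ne_zero_of_eq (hτ.ne_zero w) (hc w hw).2.1
  have hUo : IsOpen ((U ∩ {p | e p ≠ 0}) ∩ U') := (hD.isOpen_ne_zero hU he).inter hU'
  have hQz : MDifferentiableAt 𝓘(ℝ, Rn n × Rn n) (𝓡 (2 * n)) Q z :=
    hQ.contMDiff.mdifferentiable (by simp) z
  have heq := h.eq.self_of_nhds
  have hzU : Q z ∈ (U ∩ {p | e p ≠ 0}) ∩ U' :=
    ⟨⟨(hc z hz).1, hne z hz⟩, heq ▸ (hc' _ hz').1⟩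
  have key : ∀ u, D e' (Q z) (dQ Q z u)
      = connForm b (Φ z) (fderiv ℝ Φ z u) • e' (Q z) := by
    intro u
    have h1 := (hc' _ hz').2.2 (fderiv ℝ Φ z u)
    have h2 := h.dQ_fderiv isOpen_univ hQ trivial u
    have h3 : ∀ {p p' : M} (hp : p = p') {v v' : EuclideanSpace ℝ (Fin (2 * n))} (hv : v = v')
        (c : ℂ), (D e' p : EuclideanSpace ℝ (Fin (2 * n)) →L[ℝ] L p) v = c • e' p →
        (D e' p' : EuclideanSpace ℝ (Fin (2 * n)) →L[ℝ] L p') v' = c • e' p' := by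
      rintro p p' rfl v v' rfl c h
      exact h
    exact h3 heq h2 _ h1
  obtain ⟨h1, h2⟩ := hD.hasFDerivAt_coef hUo
    (ContMDiffOn.mono he (inter_subset_left.trans inter_subset_left)) (fun p hp => hp.1.2)
    (ContMDiffOn.mono he' inter_subset_right) hQz hzU (hc z hz).2.2 key
  have h3 : (fun w => lineRatio (τ w) (τ (Φ w))) =ᶠ[𝓝 z]
      fun w => coef (e (Q w)) (e' (Q w)) := by
    filter_upwards [hW.mem_nhds hz, h.smooth.continuousAt.preimage_mem_nhds (hW'.mem_nhds hz'),
      h.eq] with w hw hw' hww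
    rw [(hc w hw).2.1, (hc' _ hw').2.1, hww, lineRatio_mk (hne w hw)]
  refine ⟨h1.congr_of_eventuallyEq h3, fun u => ?_⟩
  have h4 : lineRatio (τ z) (τ (Φ z)) = coef (e (Q z)) (e' (Q z)) := h3.self_of_nhds
  rw [h3.fderiv_eq, h2, h4]

/-- The connection form is purely imaginary and the connection is metric, so the norm of τ is
locally constant on a connected space. -/
lemma IsFrame.norm_eq (hD : IsPrequantum ωM D) (hQ : IsActionAngle ωM π univ q Q)
    (hτ : IsFrame D b Q τ) (z z' : Rn n × Rn n) : ‖(τ z).snd‖ = ‖(τ z').snd‖ := by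
  have hl : IsLocallyConstant fun z => ‖(τ z).snd‖ := by
    rw [IsLocallyConstant.iff_eventually_eq]
    intro z
    obtain ⟨U, e, W, hU, he, hW, hz, hc⟩ := hτ.conn z
    have h0 : ∀ w ∈ W, ‖(τ w).snd‖ = ‖e (Q w)‖ := fun w hw =>
      congrArg (fun t : Bundle.TotalSpace ℂ L => ‖t.snd‖) (hc w hw).2.1
    have h1 := eventually_eq_of_hasFDerivAt_zero (z := z)
      (f := fun w => (inner ℂ (e (Q w)) (e (Q w)) : ℂ)) (by
        filter_upwards [hW.mem_nhds hz] with w hw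
        have hQw : MDifferentiableAt 𝓘(ℝ, Rn n × Rn n) (𝓡 (2 * n)) Q w :=
          hQ.contMDiff.mdifferentiable (by simp) w
        have hi : MDifferentiableAt (𝓡 (2 * n)) 𝓘(ℝ, ℂ)
            (fun p => (inner ℂ (e p) (e p) : ℂ)) (Q w) :=
          ((hD.smooth_metric U e e hU he he).contMDiffAt
            (hU.mem_nhds (hc w hw).1)).mdifferentiableAt (by simp)
        have h3 : fderiv ℝ (fun w => (inner ℂ (e (Q w)) (e (Q w)) : ℂ)) w = 0 := by
          refine ContinuousLinearMap.ext fun u => ?_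
          rw [fderiv_comp_coord (f := fun p => (inner ℂ (e p) (e p) : ℂ)) hQw hi,
            hD.hermitian U e e hU he he _ (hc w hw).1, (hc w hw).2.2 u, inner_smul_left,
            inner_smul_right, ← add_mul]
          have : (starRingEnd ℂ) (connForm b w u) + connForm b w u = 0 := by
            simp only [connForm, map_mul, map_neg, Complex.conj_ofReal, Complex.conj_I, map_ofNat]
            ring
          rw [this, zero_mul, zero_apply]
        rw [← h3]
        exact (hi.comp w hQw).differentiableAt.hasFDerivAt)
    filter_upwards [h1, hW.mem_nhds hz] with w hw hwW
    rw [h0 w hwW, h0 z hz]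
    rw [inner_self_eq_norm_sq_to_K, inner_self_eq_norm_sq_to_K] at hw
    have hw2 : ‖e (Q w)‖ ^ 2 = ‖e (Q z)‖ ^ 2 := by exact_mod_cast hw
    exact (sq_eq_sq₀ (norm_nonneg _) (norm_nonneg _)).1 hw2
  exact hl.apply_eq_of_preconnectedSpace z z'

/-- The factor exp(-2πi a·y) contributes -2πi a·dy to the connection form. -/
lemma IsFrame.twist (hD : IsPrequantum ωM D) (hQ : IsActionAngle ωM π univ q Q)
    (hτ : IsFrame D id Q τ) (a : Rn n) :
    IsFrame D (fun x => x + a) Q (fun z => smulT (connForm (fun _ => a) z (0, z.2)).exp (τ z)) where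
  proj z := hτ.proj z
  ne_zero z := smul_ne_zero (Complex.exp_ne_zero _) (hτ.ne_zero z)
  conn z₀ := by
    obtain ⟨U, e, W, hU, he, hW, hz, hc⟩ := hτ.conn z₀
    obtain ⟨r, hr, R, hbU, hR⟩ := hQ.exists_localInverse_ball (z := z₀)
      (inter_mem (hW.mem_nhds hz) (hQ.contMDiff.continuous.continuousAt.preimage_mem_nhds
        (hU.mem_nhds (hc z₀ hz).1)))
    set W' := Metric.ball z₀ r
    have hWU : Q '' W' ⊆ U := image_subset_iff.2 fun w hw => (hbU hw).2
    have he' : SmoothSec (2 * n) (Q '' W') e := ContMDiffOn.mono he hWU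
    let A : (Rn n × Rn n) →L[ℝ] ℂ := LinearMap.toContinuousLinearMap
      { toFun := fun w => connForm (fun _ => a) z₀ (0, w.2)
        map_add' := fun u v => by simp [connForm]; ring
        map_smul' := fun c u => by simp [connForm]; ring }
    have hA : ∀ w w' : Rn n × Rn n, A w = connForm (fun _ => a) w' w := fun w w' => rfl
    have hgs : ContDiff ℝ ∞ (fun z => Complex.exp (A z)) := A.contDiff.cexp
    have hfs : ContMDiffOn (𝓡 (2 * n)) 𝓘(ℝ, ℂ) ∞ (fun p => Complex.exp (A (R p))) (Q '' W') :=
      hgs.contMDiff.comp_contMDiffOn hR.smooth_inv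
    refine ⟨Q '' W', fun p => Complex.exp (A (R p)) • e p, W', hR.isOpen_image,
      hD.smoothSec_smul hR.isOpen_image hfs he', hR.isOpen, Metric.mem_ball_self hr,
      fun z hz => ⟨⟨z, hz, rfl⟩, ?_, fun u => ?_⟩⟩
    · rw [(hc z (hbU hz).1).2.1, smulT]
      dsimp only
      rw [hR.left_inv z hz]
      rfl
    · have hzW : Q z ∈ Q '' W' := ⟨z, hz, rfl⟩
      have h1 := hD.covDeriv_smul hR.isOpen_image hfs he' hzW (dQ Q z u)
      rw [h1, ← fderiv_comp_coord (hQ.contMDiff.mdifferentiable (by simp) z)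
        ((hfs.contMDiffAt (hR.isOpen_image.mem_nhds hzW)).mdifferentiableAt (by simp)),
        (hc z (hbU hz).1).2.2]
      have h2 : (fun w => Complex.exp (A (R (Q w)))) =ᶠ[𝓝 z] fun w => Complex.exp (A w) := by
        filter_upwards [hR.isOpen.mem_nhds hz] with w hw
        rw [hR.left_inv w hw]
      have h3 : HasFDerivAt (fun w => Complex.exp (A w)) _ z := A.hasFDerivAt.cexp
      rw [h2.fderiv_eq, h3.fderiv, smul_smul, smul_smul, ← add_smul]
      congr 1
      simp only [smul_apply, smul_eq_mul, hR.left_inv z hz, hA u z, connForm, id, add_dotProduct]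
      push_cast
      ring

omit [IsManifold (𝓡 (2 * n)) ∞ M] [ContMDiffVectorBundle ∞ ℂ L (𝓡 (2 * n))] in
lemma dQ_translate (hQ : IsActionAngle ωM π univ q Q) (a : Rn n) (z u : Rn n × Rn n) :
    (dQ (fun w : Rn n × Rn n => Q (w.1 - a, w.2)) z u : EuclideanSpace ℝ (Fin (2 * n)))
      = dQ Q (z.1 - a, z.2) u := by
  have h1 : HasFDerivAt (fun w : Rn n × Rn n => (w.1 - a, w.2))
      ((ContinuousLinearMap.fst ℝ (Rn n) (Rn n)).prod (ContinuousLinearMap.snd ℝ _ _)) z :=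
    (hasFDerivAt_fst.sub_const a).prodMk hasFDerivAt_snd
  exact dQ_comp (S := fun w : Rn n × Rn n => (w.1 - a, w.2))
    (hQ.contMDiff.mdifferentiable (by simp) _) h1 u

omit [IsManifold (𝓡 (2 * n)) ∞ M] [ContMDiffVectorBundle ∞ ℂ L (𝓡 (2 * n))] in
lemma IsActionAngle.translate (hQ : IsActionAngle ωM π univ q Q) (a : Rn n) :
    IsActionAngle ωM π univ (fun x => q (x - a)) (fun z => Q (z.1 - a, z.2)) where
  smooth := by
    refine (hQ.contMDiff.comp ?_).contMDiffOn
    have : ContDiff ℝ ∞ (fun w : Rn n × Rn n => (w.1 - a, w.2)) := by fun_prop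
    exact this.contMDiff
  proj x _ y := hQ.proj _ trivial y
  periodic x _ := hQ.periodic (x - a) trivial
  surjective x _ := hQ.surjective _ trivial
  symplectic x _ y u v := (form_congr ωM rfl (dQ_translate hQ a (x, y) u)
    (dQ_translate hQ a (x, y) v)).trans (hQ.symplectic (x - a) trivial y u v)

omit [IsManifold (𝓡 (2 * n)) ∞ M] [ContMDiffVectorBundle ∞ ℂ L (𝓡 (2 * n))] in
lemma IsFrame.translate (hQ : IsActionAngle ωM π univ q Q) {a : Rn n}
    (hτ : IsFrame D (fun x => x + a) Q τ) :
    IsFrame D id (fun z => Q (z.1 - a, z.2)) (fun z => τ (z.1 - a, z.2)) where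
  proj z := hτ.proj _
  ne_zero z := hτ.ne_zero _
  conn z₀ := by
    obtain ⟨U, e, W, hU, he, hW, hz, hc⟩ := hτ.conn (z₀.1 - a, z₀.2)
    have hS : Continuous (fun w : Rn n × Rn n => (w.1 - a, w.2)) := by fun_prop
    refine ⟨U, e, (fun w : Rn n × Rn n => (w.1 - a, w.2)) ⁻¹' W, hU, he, hW.preimage hS, hz,
      fun z hz => ⟨(hc _ hz).1, (hc _ hz).2.1, fun u => ?_⟩⟩
    have h1 := (hc _ hz).2.2 u
    have h2 : connForm (fun x => x + a) (z.1 - a, z.2) u = connForm id z u := by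
      simp [connForm]
    rw [h2] at h1
    refine Eq.trans ?_ h1
    exact congrArg (D e (Q (z.1 - a, z.2))) (dQ_translate hQ a z u)

omit [ContMDiffVectorBundle ∞ ℂ L (𝓡 (2 * n))] [IsManifold (𝓡 (2 * n)) ∞ M] in
lemma IsActionAngle.isLift_shift (hQ : IsActionAngle ωM π univ q Q) (k : Fin n → ℤ)
    (z : Rn n × Rn n) :
    IsLift Q Q id (fun w => (w.1, w.2 + fun i => (k i : ℝ))) z where
  smooth := by fun_prop
  eq := Eventually.of_forall fun w => ((hQ.periodic w.1 trivial w.2 _).2 ⟨k, fun _ => rfl⟩).symm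
  fst := Eventually.of_forall fun _ => rfl

/-- The glued frame is periodic in y only up to constants. These have modulus one, so they are
exp(2πi a·k) for a real vector a. A twist by exp(-2πi a·y) makes the frame periodic and turns x·dy
into (x + a)·dy, and replacing x by x - a restores the standard form. -/
theorem exists_development [TopologicalSpace B] [T2Space M] (hD : IsPrequantum ωM D)
    (hq : IsCoveringMap q) (hQ : IsActionAngle ωM π univ q Q) :
    Nonempty (Development ωM π D) := by
  obtain ⟨τ, hτ⟩ := exists_isFrame hD hQ
  -- An integral shift of y covers the identity and preserves the connection form, so the ratio of
  -- the frame and its shift is constant. The constancy of ‖τ‖ makes it unimodular.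
  have hgen : ∀ k : Fin n → ℤ, ∃ c : ℂ, ‖c‖ = 1 ∧
      ∀ z : Rn n × Rn n, τ (z.1, z.2 + fun i => (k i : ℝ)) = smulT c (τ z) := by
    intro k
    set Φ : Rn n × Rn n → Rn n × Rn n := fun w => (w.1, w.2 + fun i => (k i : ℝ)) with hΦ
    have hΦd : ∀ z, fderiv ℝ Φ z = ContinuousLinearMap.id ℝ (Rn n × Rn n) := fun z => by
      have : HasFDerivAt Φ
          ((ContinuousLinearMap.fst ℝ (Rn n) (Rn n)).prod (ContinuousLinearMap.snd ℝ _ _)) z :=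
        hasFDerivAt_fst.prodMk (hasFDerivAt_snd.add_const _)
      exact this.fderiv
    have hproj : ∀ z, (τ z).proj = (τ (Φ z)).proj := fun z => by
      rw [hτ.proj, hτ.proj]
      exact ((hQ.isLift_shift k z).eq.self_of_nhds).symm
    have hspec := fun z => smulT_lineRatio (hτ.ne_zero z) (hproj z)
    have hconst : ∀ z z', lineRatio (τ z) (τ (Φ z)) = lineRatio (τ z') (τ (Φ z')) := by
      refine fun z z' => is_const_of_fderiv_eq_zero (𝕜 := ℝ)
        (f := fun z => lineRatio (τ z) (τ (Φ z)))
        (fun z => (hτ.hasFDerivAt_lineRatio hD hQ (hQ.isLift_shift k z)).1) (fun z => ?_) z z'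
      refine ContinuousLinearMap.ext fun u => ?_
      rw [(hτ.hasFDerivAt_lineRatio hD hQ (hQ.isLift_shift k z)).2]
      have h1 := hΦd z
      rw [hΦ] at h1
      rw [h1]
      simp [connForm]
    refine ⟨lineRatio (τ 0) (τ (Φ 0)), ?_, fun z => ?_⟩
    · have h1 := hτ.norm_eq hD hQ (Φ 0) 0
      rw [← hspec 0, smulT, norm_smul] at h1
      exact mul_right_cancel₀ (norm_ne_zero_iff.2 (hτ.ne_zero 0)) (h1.trans (one_mul _).symm)
    · rw [hconst 0 z, hspec z]
  have ha : ∀ i : Fin n, ∃ a : ℝ, ∀ z : Rn n × Rn n,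
      τ (z.1, z.2 + fun j => (((Pi.single i 1 : Fin n → ℤ) j : ℤ) : ℝ))
        = smulT (Complex.exp (2 * Real.pi * Complex.I * a)) (τ z) := by
    intro i
    obtain ⟨c, hc, h⟩ := hgen (Pi.single i 1)
    obtain ⟨θ, rfl⟩ := (Complex.norm_eq_one_iff c).1 hc
    refine ⟨θ / (2 * Real.pi), fun z => ?_⟩
    rw [h]
    congr 2
    have : (Real.pi : ℂ) ≠ 0 := Complex.ofReal_ne_zero.2 Real.pi_ne_zero
    push_cast
    field_simp
  choose a ha using ha
  set τ₁ : Rn n × Rn n → Bundle.TotalSpace ℂ L :=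
    fun z => smulT (connForm (fun _ => a) z (0, z.2)).exp (τ z) with hτ₁
  have hper : ∀ (k : Fin n → ℤ) (z : Rn n × Rn n),
      τ₁ (z.1, z.2 + fun i => (k i : ℝ)) = τ₁ z := by
    -- The periods of the twisted frame form a group, so the unit vectors suffice.
    let P : AddSubgroup (Fin n → ℤ) :=
      { carrier := {k | ∀ z : Rn n × Rn n, τ₁ (z.1, z.2 + fun i => (k i : ℝ)) = τ₁ z}
        zero_mem' := fun z => by
          have : (fun i : Fin n => (((0 : Fin n → ℤ) i : ℤ) : ℝ)) = 0 := by ext; simp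
          rw [this, add_zero]
        add_mem' := fun {k l} hk hl z => by
          rw [← hk z, ← hl (z.1, z.2 + fun i => (k i : ℝ))]
          congr 2
          ext i
          simp [add_assoc]
        neg_mem' := fun {k} hk z => by
          rw [← hk (z.1, z.2 + fun i => (((-k) i : ℤ) : ℝ))]
          congr 1
          ext i <;> simp }
    intro k
    have hk : k ∈ P := by
      rw [← Finset.univ_sum_single k]
      refine P.sum_mem fun i _ => ?_
      have h1 : Pi.single i (k i) = k i • (Pi.single i 1 : Fin n → ℤ) := by
        rw [← Pi.single_smul]; simp
      rw [h1]
      refine P.zsmul_mem (fun z => ?_) _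
      simp only [hτ₁]
      rw [ha, smulT_smulT]
      congr 1
      rw [← Complex.exp_add]
      congr 1
      have h2 : a ⬝ᵥ (fun j => (((Pi.single i 1 : Fin n → ℤ) j : ℤ) : ℝ)) = a i := by
        have : (fun j => (((Pi.single i 1 : Fin n → ℤ) j : ℤ) : ℝ)) = Pi.single i (1 : ℝ) := by
          ext j
          by_cases h : j = i
          · subst h; simp
          · simp [h]
        rw [this]
        simp
      simp only [connForm, dotProduct_add, h2]
      push_cast
      ring
    exact hk
  have hτa := (hτ.twist hD hQ a).translate hQ
  exact ⟨{ q := _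
           Q := _
           τ := _
           covering := IsCoveringMap.comp_homeomorph hq (Homeomorph.subRight a)
           actionAngle := hQ.translate a
           τ_proj := hτa.proj
           τ_ne_zero := hτa.ne_zero
           τ_periodic := fun x y k => hper k (x - a, y)
           τ_conn := hτa.conn }⟩

end Develop

/-! ### Potentials of `Ω` and holomorphic functions on `ℝⁿ × ℝⁿ` -/

section Potential

variable {n N : ℕ}

/-- The pairing of a real and a complex vector. -/
def cdot (u : Rn n) (w : Fin n → ℂ) : ℂ := ∑ i, (u i : ℂ) * w i

lemma cdot_add (u : Rn n) (w w' : Fin n → ℂ) : cdot u (w + w') = cdot u w + cdot u w' := by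
  simp [cdot, mul_add, Finset.sum_add_distrib]

lemma cdot_sub (u : Rn n) (w w' : Fin n → ℂ) : cdot u (w - w') = cdot u w - cdot u w' := by
  simp [cdot, mul_sub, Finset.sum_sub_distrib]

lemma cdot_smul (u : Rn n) (c : ℂ) (w : Fin n → ℂ) : cdot u (c • w) = c * cdot u w := by
  simp [cdot, Finset.mul_sum, mul_left_comm]

lemma add_cdot (u u' : Rn n) (w : Fin n → ℂ) : cdot (u + u') w = cdot u w + cdot u' w := by
  simp [cdot, add_mul, Finset.sum_add_distrib]

/-- The inclusion of `ℝⁿ` into `ℂⁿ`. -/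
def cvec (n : ℕ) : Rn n →L[ℝ] (Fin n → ℂ) :=
  ContinuousLinearMap.pi fun i => Complex.ofRealCLM.comp (ContinuousLinearMap.proj i)

@[simp] lemma cvec_apply (u : Rn n) (i : Fin n) : cvec n u i = (u i : ℂ) := rfl

lemma cdot_cvec (u v : Rn n) : cdot u (cvec n v) = ((u ⬝ᵥ v : ℝ) : ℂ) := by
  simp [cdot, dotProduct]

/-- The pairing of real and complex vectors as a bilinear map. -/
def cdotL (n : ℕ) : (Fin n → ℂ) →L[ℝ] Rn n →L[ℝ] ℂ :=
  LinearMap.toContinuousLinearMap ((LinearMap.toContinuousLinearMap (𝕜 := ℝ) (E := Rn n)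
    (F' := ℂ)).toLinearMap ∘ₗ LinearMap.mk₂ ℝ (fun w u => cdot u w)
      (fun w w' u => cdot_add u w w')
      (fun c w u => by simp [cdot, Finset.mul_sum, mul_left_comm])
      (fun w u u' => add_cdot u u' w)
      (fun c w u => by simp [cdot, Finset.mul_sum, mul_assoc]))

@[simp] lemma cdotL_apply (w : Fin n → ℂ) (u : Rn n) : cdotL n w u = cdot u w := rfl

/-- `Ω` as a map from `ℝⁿ` to `ℂⁿ`. -/
def omegaL (Z : Matrix (Fin n) (Fin n) ℂ) : Rn n →L[ℝ] (Fin n → ℂ) :=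
  (cvec n).comp (matL (siegelR Z)) + Complex.I • (cvec n).comp (matL (siegelB Z)⁻¹)

lemma omegaL_apply (Z : Matrix (Fin n) (Fin n) ℂ) (u : Rn n) :
    omegaL Z u = cvec n (siegelR Z *ᵥ u) + Complex.I • cvec n ((siegelB Z)⁻¹ *ᵥ u) := rfl

lemma cdot_omegaL (Z : Matrix (Fin n) (Fin n) ℂ) (u v : Rn n) :
    cdot u (omegaL Z v) = ((u ⬝ᵥ (siegelR Z *ᵥ v) : ℝ) : ℂ)
      + Complex.I * ((u ⬝ᵥ ((siegelB Z)⁻¹ *ᵥ v) : ℝ) : ℂ) := by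
  rw [omegaL_apply, cdot_add, cdot_smul, cdot_cvec, cdot_cvec]

lemma IsSiegel.omegaL_eq {Z : Matrix (Fin n) (Fin n) ℂ} (hZ : IsSiegel Z) (u : Rn n) :
    omegaL Z u = siegelOmega Z *ᵥ cvec n u := by
  have h : ∀ A : Matrix (Fin n) (Fin n) ℝ, A.map Complex.ofReal *ᵥ cvec n u = cvec n (A *ᵥ u) := by
    intro A
    ext i
    simp [Matrix.mulVec, dotProduct]
  rw [hZ.omega_eq, Matrix.add_mulVec, Matrix.smul_mulVec, h, h, omegaL_apply]

lemma dotProduct_mulVec_symm {A : Matrix (Fin n) (Fin n) ℝ} (hA : Aᵀ = A) (u v : Rn n) :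
    u ⬝ᵥ (A *ᵥ v) = v ⬝ᵥ (A *ᵥ u) := by
  rw [Matrix.dotProduct_mulVec, ← Matrix.mulVec_transpose, hA, dotProduct_comm]

lemma IsSiegel.cdot_omegaL_symm {Z : Matrix (Fin n) (Fin n) ℂ} (hZ : IsSiegel Z) (u v : Rn n) :
    cdot u (omegaL Z v) = cdot v (omegaL Z u) := by
  have hB : ((siegelB Z)⁻¹)ᵀ = (siegelB Z)⁻¹ := by
    rw [Matrix.transpose_nonsing_inv, hZ.transpose_B]
  rw [cdot_omegaL, cdot_omegaL, dotProduct_mulVec_symm hZ.transpose_R,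
    dotProduct_mulVec_symm hB]

/-- `ψ` is a primitive of `Ω dx` and `φ` is a primitive of `x · Ω dx`. -/
structure IsPotential (Z : Rn n → Matrix (Fin n) (Fin n) ℂ) (ψ : Rn n → Fin n → ℂ)
    (φ : Rn n → ℂ) : Prop where
  siegel : ∀ x, IsSiegel (Z x)
  smooth : ContDiff ℝ ∞ ψ
  smooth' : ContDiff ℝ ∞ φ
  hasFDerivAt : ∀ x, HasFDerivAt ψ (omegaL (Z x)) x
  fderiv' : ∀ x u, fderiv ℝ φ x u = cdot x (omegaL (Z x) u)

lemma contDiff_of_hasFDerivAt {E F : Type*} [NormedAddCommGroup E] [NormedSpace ℝ E]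
    [NormedAddCommGroup F] [NormedSpace ℝ F] {f : E → F} {f' : E → E →L[ℝ] F}
    (h : ∀ x, HasFDerivAt f (f' x) x) (h' : ContDiff ℝ ∞ f') : ContDiff ℝ ∞ f := by
  rw [contDiff_infty_iff_fderiv]
  refine ⟨fun x => (h x).differentiableAt, ?_⟩
  rwa [funext fun x => (h x).fderiv]

/-- Closedness of R and of B⁻¹ gives ψ. Symmetry of Ω makes ψ·dx closed, say ψ·dx = dθ. Then φ = ψ·x
- θ has differential x·Ω dx, because the terms ψ·dx cancel. -/
lemma IsSiegelMap.exists_potential {M B : Type*} [TopologicalSpace M]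
    [ChartedSpace (EuclideanSpace ℝ (Fin (2 * n))) M] [IsManifold (𝓡 (2 * n)) ∞ M]
    {ωM : ∀ p : M, Tan (2 * n) p →L[ℝ] Tan (2 * n) p →L[ℝ] ℝ} {π : M → B}
    {q : Rn n → B} {Q : Rn n × Rn n → M}
    {J : ∀ p : M, Tan (2 * n) p →L[ℝ] Tan (2 * n) p} {Z : Rn n → Matrix (Fin n) (Fin n) ℂ}
    (hQ : IsActionAngle ωM π univ q Q) (hJ : IsCompatible ωM J) (hint : IsIntegrable J)
    (hZ : IsSiegelMap J univ Q Z) : ∃ ψ φ, IsPotential Z ψ φ := by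
  have hR := contDiffOn_univ.1 (hZ.contDiffOn_R isOpen_univ hQ hJ)
  have hC := contDiffOn_univ.1 (hZ.contDiffOn_C isOpen_univ hQ hJ)
  obtain ⟨ψr, hψr⟩ := convex_univ.exists_forall_hasFDerivAt_of_fderiv_symmetric isOpen_univ
    (hR.differentiable (by simp)).differentiableOn
    fun a _ h k => hZ.fderiv_R_symm isOpen_univ hQ hJ hint trivial h k
  obtain ⟨ψi, hψi⟩ := convex_univ.exists_forall_hasFDerivAt_of_fderiv_symmetric isOpen_univ
    (hC.differentiable (by simp)).differentiableOn
    fun a _ h k => hZ.fderiv_C_symm isOpen_univ hQ hJ hint trivial h k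
  set ψ : Rn n → Fin n → ℂ := fun x => cvec n (ψr x) + Complex.I • cvec n (ψi x) with hψdef
  have hψ : ∀ x, HasFDerivAt ψ (omegaL (Z x)) x := fun x =>
    ((cvec n).hasFDerivAt.comp x (hψr x trivial)).add
      (((cvec n).hasFDerivAt.comp x (hψi x trivial)).const_smul Complex.I)
  have hψs : ContDiff ℝ ∞ ψ :=
    ((cvec n).contDiff.comp (contDiff_of_hasFDerivAt (fun x => hψr x trivial) hR)).add
      (((cvec n).contDiff.comp
        (contDiff_of_hasFDerivAt (fun x => hψi x trivial) hC)).const_smul Complex.I)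
  have hθd : ∀ x, HasFDerivAt (fun x => cdotL n (ψ x)) ((cdotL n).comp (omegaL (Z x))) x :=
    fun x => (cdotL n).hasFDerivAt.comp x (hψ x)
  have hθd' : DifferentiableOn ℝ (fun x => cdotL n (ψ x)) univ := fun x _ =>
    (hθd x).differentiableAt.differentiableWithinAt
  obtain ⟨θ, hθ⟩ := convex_univ.exists_forall_hasFDerivAt_of_fderiv_symmetric isOpen_univ hθd'
    (fun x _ h k => by
      rw [(hθd x).fderiv]
      exact (hZ x trivial).1.cdot_omegaL_symm k h)
  have hφ : ∀ x, HasFDerivAt (fun x => cdotL n (ψ x) x - θ x)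
      (((cdotL n (ψ x)).comp (ContinuousLinearMap.id ℝ (Rn n))
        + ((cdotL n).comp (omegaL (Z x))).flip x) - cdotL n (ψ x)) x := fun x =>
    ((hθd x).clm_apply (hasFDerivAt_id x)).sub (hθ x trivial)
  refine ⟨ψ, fun x => cdotL n (ψ x) x - θ x, fun x => (hZ x trivial).1, hψs, ?_, hψ,
    fun x u => ?_⟩
  · have h1 : ContDiff ℝ ∞ fun x => cdotL n (ψ x) := (cdotL n).contDiff.comp hψs
    exact (h1.clm_apply contDiff_id).sub
      (contDiff_of_hasFDerivAt (fun x => hθ x trivial) h1)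
  · rw [(hφ x).fderiv]
    simp

/-- The covariant derivative of `F τ^N` along `u`, as a multiple of `τ^N`. -/
def nab (N : ℕ) (F : Rn n × Rn n → ℂ) (z u : Rn n × Rn n) : ℂ :=
  fderiv ℝ F z u + N * connForm id z u * F z

/-- `F τ^N` has a covariant derivative of type `(1, 0)` at `z`. -/
def IsHolAt (N : ℕ) (Z : Rn n → Matrix (Fin n) (Fin n) ℂ) (F : Rn n × Rn n → ℂ)
    (z : Rn n × Rn n) : Prop :=
  ∀ u, nab N F z (siegelJ (Z z.1) u) = Complex.I * nab N F z u

/-- `nab` as an additive map. -/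
def nabHom (N : ℕ) (F : Rn n × Rn n → ℂ) (z : Rn n × Rn n) : Rn n × Rn n →+ ℂ where
  toFun := nab N F z
  map_zero' := by simp [nab, connForm]
  map_add' u v := by simp [nab, connForm]; ring

/-- These are the Cauchy–Riemann equations in a form where vertical derivatives determine horizontal
ones. The zeroth order term comes from the connection. -/
lemma isHolAt_iff {Z : Rn n → Matrix (Fin n) (Fin n) ℂ} {F : Rn n × Rn n → ℂ} {z : Rn n × Rn n}
    (hZ : IsSiegel (Z z.1)) : IsHolAt N Z F z ↔ ∀ u : Rn n,
      fderiv ℝ F z (u, 0) = -fderiv ℝ F z (0, siegelR (Z z.1) *ᵥ u)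
        - Complex.I * fderiv ℝ F z (0, (siegelB (Z z.1))⁻¹ *ᵥ u)
        + 2 * Real.pi * Complex.I * N * cdot z.1 (omegaL (Z z.1) u) * F z := by
  refine (hZ.forall_siegelJ_iff (nabHom N F z)).trans (forall_congr' fun u => ?_)
  change nab N F z _ = -nab N F z _ - Complex.I * nab N F z _ ↔ _
  simp only [nab, connForm, id, cdot_omegaL, dotProduct_zero, Complex.ofReal_zero]
  constructor
  · intro h
    linear_combination h
  · intro h
    linear_combination h

/-- The function `exp (2π√-1 (m·(y - ψ(x)) + N φ(x)))`. -/
def eBase (N : ℕ) (ψ : Rn n → Fin n → ℂ) (φ : Rn n → ℂ) (m : Fin n → ℤ) (z : Rn n × Rn n) : ℂ :=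
  Complex.exp (2 * Real.pi * Complex.I
    * (cdot (fun i => (m i : ℝ)) (cvec n z.2 - ψ z.1) + N * φ z.1))

lemma eBase_ne_zero (ψ : Rn n → Fin n → ℂ) (φ : Rn n → ℂ) (m : Fin n → ℤ) (z : Rn n × Rn n) :
    eBase N ψ φ m z ≠ 0 := Complex.exp_ne_zero _

variable {Z : Rn n → Matrix (Fin n) (Fin n) ℂ} {ψ : Rn n → Fin n → ℂ} {φ : Rn n → ℂ}

lemma hasFDerivAt_cdot_left (a : Rn n) {E : Type*} [NormedAddCommGroup E] [NormedSpace ℝ E]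
    {f : E → Fin n → ℂ} {f' : E →L[ℝ] (Fin n → ℂ)} {x : E} (hf : HasFDerivAt f f' x) :
    HasFDerivAt (fun x => cdot a (f x)) (((cdotL n).flip a).comp f') x :=
  ((cdotL n).flip a).hasFDerivAt.comp x hf

lemma IsPotential.hasFDerivAt_exponent (h : IsPotential Z ψ φ) (a : Rn n) (c : ℂ)
    (z : Rn n × Rn n) :
    HasFDerivAt (fun z : Rn n × Rn n => cdot a (cvec n z.2 - ψ z.1) + c * φ z.1)
      (((cdotL n).flip a).comp ((cvec n).comp (ContinuousLinearMap.snd ℝ _ _)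
        - (omegaL (Z z.1)).comp (ContinuousLinearMap.fst ℝ _ _))
        + c • (fderiv ℝ φ z.1).comp (ContinuousLinearMap.fst ℝ _ _)) z := by
  have h1 : HasFDerivAt (fun z : Rn n × Rn n => φ z.1) _ z :=
    ((h.smooth'.differentiable (by simp)) z.1).hasFDerivAt.comp z hasFDerivAt_fst
  have h2 : HasFDerivAt (fun z : Rn n × Rn n => ψ z.1) _ z :=
    (h.hasFDerivAt z.1).comp z hasFDerivAt_fst
  have h3 : HasFDerivAt (fun z : Rn n × Rn n => cvec n z.2) _ z :=
    (cvec n).hasFDerivAt.comp z hasFDerivAt_snd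
  exact (hasFDerivAt_cdot_left a (h3.sub h2)).add (h1.const_mul c)

/-- A function of type `(1, 0)` whose vertical derivative is `2π√-1 m` is a multiple of
`eBase N ψ φ m`. -/
lemma IsPotential.exists_eq_mul_eBase (h : IsPotential Z ψ φ) {t : Rn n × Rn n → ℂ}
    {m : Fin n → ℤ} (ht : Differentiable ℝ t) (hol : ∀ z, IsHolAt N Z t z)
    (hv : ∀ z (v : Rn n), fderiv ℝ t z (0, v)
      = 2 * Real.pi * Complex.I * (((fun i => (m i : ℝ)) ⬝ᵥ v : ℝ) : ℂ) * t z) :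
    ∃ c : ℂ, ∀ z, t z = c * eBase N ψ φ m z := by
  set a : Rn n := fun i => (m i : ℝ) with ha
  set w : Rn n × Rn n → ℂ := fun z => -(2 * Real.pi * Complex.I)
    * (cdot a (cvec n z.2 - ψ z.1) + N * φ z.1) with hw
  have hwd : ∀ z, HasFDerivAt w _ z := fun z =>
    (h.hasFDerivAt_exponent a N z).const_mul (-(2 * Real.pi * Complex.I))
  -- The quotient of t by the exponential has zero derivative: vertically by `hv`, horizontally by
  -- the Cauchy–Riemann equations.
  have hconst : ∀ z z', t z * Complex.exp (w z) = t z' * Complex.exp (w z') := by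
    refine fun z z' => is_const_of_fderiv_eq_zero (𝕜 := ℝ) (f := fun z => t z * Complex.exp (w z))
      (fun z => (ht z).mul (hwd z).cexp.differentiableAt) (fun z => ?_) z z'
    have h1 := (ht z).hasFDerivAt.mul (hwd z).cexp
    have h1' : HasFDerivAt (fun z => t z * Complex.exp (w z)) _ z := h1
    refine ContinuousLinearMap.ext fun u => ?_
    rw [h1'.fderiv]
    have h2 : u = (u.1, 0) + (0, u.2) := by simp
    have h3 : fderiv ℝ t z u = 2 * Real.pi * Complex.I * (cdot a (cvec n u.2 - omegaL (Z z.1) u.1)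
        + N * cdot z.1 (omegaL (Z z.1) u.1)) * t z := by
      conv_lhs => rw [h2]
      rw [map_add, (isHolAt_iff (h.siegel z.1)).1 (hol z) u.1, hv, hv, hv, cdot_sub,
        cdot_omegaL (Z z.1) a, cdot_cvec]
      ring
    simp only [add_apply, smul_apply, ContinuousLinearMap.comp_apply, sub_apply,
      ContinuousLinearMap.flip_apply, cdotL_apply, ContinuousLinearMap.coe_fst',
      ContinuousLinearMap.coe_snd', smul_eq_mul, h.fderiv', h3, zero_apply]
    ring
  refine ⟨t 0 * Complex.exp (w 0), fun z => ?_⟩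
  have h4 : w z + 2 * Real.pi * Complex.I
      * (cdot (fun i => (m i : ℝ)) (cvec n z.2 - ψ z.1) + N * φ z.1) = 0 := by
    simp only [hw, ha]
    ring
  rw [hconst 0 z, mul_assoc, eBase, ← Complex.exp_add, h4, Complex.exp_zero, mul_one]

/-- The function `m·ψ - N φ`. -/
def potH (N : ℕ) (ψ : Rn n → Fin n → ℂ) (φ : Rn n → ℂ) (m : Fin n → ℤ) (x : Rn n) : ℂ :=
  cdot (fun i => (m i : ℝ)) (ψ x) - N * φ x

lemma IsPotential.contDiff_potH (h : IsPotential Z ψ φ) (m : Fin n → ℤ) :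
    ContDiff ℝ ∞ (potH N ψ φ m) :=
  (((cdotL n).flip _).contDiff.comp h.smooth).sub (contDiff_const.mul h.smooth')

/-- By symmetry of Ω the gradient of m·ψ - Nφ is Ω(m - Nx), so the integrand of G_m^i is a partial
derivative of one function. -/
lemma IsPotential.fderiv_potH (h : IsPotential Z ψ φ) (m : Fin n → ℤ) (x : Rn n) (i : Fin n) :
    fderiv ℝ (potH N ψ φ m) x (Pi.single i 1)
      = (siegelOmega (Z x) *ᵥ (fun j => ((m j - N * x j : ℝ) : ℂ))) i := by
  have h1 := hasFDerivAt_cdot_left (fun i => (m i : ℝ)) (h.hasFDerivAt x)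
  have h2 := ((h.smooth'.differentiable (by simp)) x).hasFDerivAt.const_mul (N : ℂ)
  have h3 : HasFDerivAt (potH N ψ φ m) _ x := h1.sub h2
  have h4 : (fun j => ((m j - N * x j : ℝ) : ℂ))
      = cvec n ((fun j => (m j : ℝ)) - (N : ℝ) • x) := by ext j; simp
  have h5 : ∀ w : Fin n → ℂ, w i = cdot (Pi.single i 1) w := fun w => by
    rw [cdot, Finset.sum_eq_single i (fun j _ hj => by simp [hj]) (by simp)]
    simp
  rw [h3.fderiv, h4, ← (h.siegel x).omegaL_eq,
    h5 (omegaL (Z x) _), map_sub, map_smul]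
  simp only [sub_apply, ContinuousLinearMap.comp_apply, ContinuousLinearMap.flip_apply,
    cdotL_apply, smul_apply, h.fderiv', cdot_sub, smul_eq_mul]
  rw [(h.siegel x).cdot_omegaL_symm _ (Pi.single i 1),
    (h.siegel x).cdot_omegaL_symm x (Pi.single i 1)]
  congr 1
  simp [cdot, Finset.mul_sum, mul_left_comm]

/-- The integrals run along an edge path from m/N to x that changes one coordinate at a time, and
the sum telescopes. -/
lemma IsPotential.sum_gInt (h : IsPotential Z ψ φ) (m : Fin n → ℤ) (x : Rn n) :
    ∑ i, gInt N Z m i x = potH N ψ φ m x - potH N ψ φ m (latticePt N m) := by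
  -- The vertices of the path: the first k coordinates are those of m/N, the others those of x, so P
  -- 0 = x and P n = m/N.
  let P : ℕ → Rn n := fun k j => if (j : ℕ) < k then latticePt N m j else x j
  have hg : ∀ i : Fin n, gInt N Z m i x = potH N ψ φ m (P i) - potH N ψ φ m (P (i + 1)) := by
    intro i
    have hc : ∀ t : ℝ, (fun j => if j < i then latticePt N m j else if j = i then t else x j)
        = Function.update (P i) i t := by
      intro t
      ext j
      by_cases hj : j = i
      · subst hj; simp
      · simp [P, hj]
    have hd : ∀ t : ℝ, HasDerivAt (fun t => potH N ψ φ m (Function.update (P i) i t))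
        (fderiv ℝ (potH N ψ φ m) (Function.update (P i) i t) (Pi.single i 1)) t := fun t =>
      (((h.contDiff_potH m).differentiable (by simp)) _).hasFDerivAt.comp_hasDerivAt t
        (hasDerivAt_update (P i) i t)
    have hcont : Continuous fun t : ℝ =>
        fderiv ℝ (potH N ψ φ m) (Function.update (P i) i t) (Pi.single i 1) :=
      (((h.contDiff_potH m).continuous_fderiv (by simp)).comp
        (continuous_const.update i continuous_id)).clm_apply continuous_const
    have h1 := intervalIntegral.integral_eq_sub_of_hasDerivAt (a := latticePt N m i) (b := x i)
      (fun t _ => hd t) (hcont.intervalIntegrable _ _)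
    have e1 : Function.update (P i) i (x i) = P i := by
      rw [Function.update_eq_self_iff]; simp [P]
    have e2 : Function.update (P i) i (latticePt N m i) = P (i + 1) := by
      ext j
      by_cases hj : j = i
      · subst hj; simp [P]
      · have : (j : ℕ) < i + 1 ↔ (j : ℕ) < i := by
          have : (j : ℕ) ≠ i := fun h => hj (Fin.ext h)
          omega
        simp [P, hj, this]
    rw [e1, e2] at h1
    rw [← h1, gInt]
    refine intervalIntegral.integral_congr fun t _ => ?_
    rw [h.fderiv_potH]
    simp only [← hc t]
  have h0 : P 0 = x := by ext j; simp [P]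
  have hn : P n = latticePt N m := by ext j; simp [P]
  rw [Finset.sum_congr rfl fun i _ => hg i,
    Fin.sum_univ_eq_sum_range (fun k => potH N ψ φ m (P k) - potH N ψ φ m (P (k + 1))) n,
    Finset.sum_range_sub', h0, hn]

lemma IsPotential.sBase_eq (h : IsPotential Z ψ φ) (m : Fin n → ℤ) (z : Rn n × Rn n) :
    sBase N Z m z = Complex.exp (2 * Real.pi * Complex.I * potH N ψ φ m (latticePt N m))
      * eBase N ψ φ m z := by
  rw [sBase, h.sum_gInt, eBase, ← Complex.exp_add]
  congr 1
  have : ∑ i, (m i : ℂ) * (z.2 i : ℂ) = cdot (fun i => (m i : ℝ)) (cvec n z.2) := by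
    simp [cdot]
  rw [this, cdot_sub, potH, potH]
  ring

end Potential

/-! ### Deck transformations and the terms of the theta series -/

section EBase

variable {n N : ℕ} {Z : Rn n → Matrix (Fin n) (Fin n) ℂ} {ψ : Rn n → Fin n → ℂ} {φ : Rn n → ℂ}

lemma IsPotential.hasFDerivAt_eBase (h : IsPotential Z ψ φ) (m : Fin n → ℤ) (z : Rn n × Rn n) :
    DifferentiableAt ℝ (eBase N ψ φ m) z ∧ ∀ u, fderiv ℝ (eBase N ψ φ m) z u
      = 2 * Real.pi * Complex.I * (cdot (fun i => (m i : ℝ)) (cvec n u.2 - omegaL (Z z.1) u.1)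
        + N * cdot z.1 (omegaL (Z z.1) u.1)) * eBase N ψ φ m z := by
  have h1 : HasFDerivAt (eBase N ψ φ m) _ z :=
    ((h.hasFDerivAt_exponent (fun i => (m i : ℝ)) N z).const_mul (2 * Real.pi * Complex.I)).cexp
  refine ⟨h1.differentiableAt, fun u => ?_⟩
  rw [h1.fderiv]
  simp only [add_apply, smul_apply, ContinuousLinearMap.comp_apply, sub_apply,
    ContinuousLinearMap.flip_apply, cdotL_apply, ContinuousLinearMap.coe_fst',
    ContinuousLinearMap.coe_snd', smul_eq_mul, h.fderiv', eBase]
  ring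

lemma IsPotential.contDiff_eBase (h : IsPotential Z ψ φ) (m : Fin n → ℤ) :
    ContDiff ℝ ∞ (eBase N ψ φ m) := by
  have h1 : ContDiff ℝ ∞ fun z : Rn n × Rn n =>
      (cdotL n).flip (fun i => (m i : ℝ)) (cvec n z.2 - ψ z.1) :=
    ((cdotL n).flip (fun i => (m i : ℝ))).contDiff.comp
      (((cvec n).contDiff.comp contDiff_snd).sub (h.smooth.comp contDiff_fst))
  exact (contDiff_const.mul (h1.add (contDiff_const.mul (h.smooth'.comp contDiff_fst)))).cexp

lemma IsPotential.nab_eBase (h : IsPotential Z ψ φ) (m : Fin n → ℤ) (z u : Rn n × Rn n) :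
    nab N (eBase N ψ φ m) z u = 2 * Real.pi * Complex.I
      * (cdot ((fun i => (m i : ℝ)) - (N : ℝ) • z.1) (cvec n u.2 - omegaL (Z z.1) u.1))
      * eBase N ψ φ m z := by
  rw [nab, (h.hasFDerivAt_eBase m z).2, connForm]
  have h1 : cdot ((fun i => (m i : ℝ)) - (N : ℝ) • z.1) (cvec n u.2 - omegaL (Z z.1) u.1)
      = cdot (fun i => (m i : ℝ)) (cvec n u.2 - omegaL (Z z.1) u.1)
        - N * cdot z.1 (cvec n u.2 - omegaL (Z z.1) u.1) := by
    simp [cdot, sub_mul, Finset.mul_sum, mul_assoc]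
  rw [h1, cdot_sub z.1, cdot_cvec, id]
  ring

lemma IsPotential.isHolAt_eBase (h : IsPotential Z ψ φ) (m : Fin n → ℤ) (z : Rn n × Rn n) :
    IsHolAt N Z (eBase N ψ φ m) z := by
  rw [isHolAt_iff (h.siegel z.1)]
  intro u
  rw [(h.hasFDerivAt_eBase m z).2, (h.hasFDerivAt_eBase m z).2, (h.hasFDerivAt_eBase m z).2]
  have h0 : ∀ a : Rn n, cdot a 0 = 0 := fun a => by simp [cdot]
  have hneg : ∀ (a : Rn n) w, cdot a (-w) = -cdot a w := fun a w => by simp [cdot]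
  simp only [map_zero, sub_zero, zero_sub, h0, hneg, cdot_cvec, cdot_omegaL]
  ring

lemma eBase_add_int (ψ : Rn n → Fin n → ℂ) (φ : Rn n → ℂ) (m k : Fin n → ℤ) (x y : Rn n) :
    eBase N ψ φ m (x, y + fun i => (k i : ℝ)) = eBase N ψ φ m (x, y) := by
  rw [eBase, eBase]
  have h1 : cdot (fun i => (m i : ℝ)) (cvec n (y + fun i => (k i : ℝ)) - ψ x)
      = cdot (fun i => (m i : ℝ)) (cvec n y - ψ x) + ((∑ i, m i * k i : ℤ) : ℂ) := by
    simp [cdot, mul_sub, mul_add, Finset.sum_add_distrib]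
    ring
  dsimp only
  rw [h1]
  refine Complex.exp_eq_exp_iff_exists_int.2 ⟨∑ i, m i * k i, ?_⟩
  ring

end EBase

/-! ### Deck transformations of the covering -/

section Cover

variable {n : ℕ} {B : Type*} [TopologicalSpace B] {q : Rn n → B}

lemma Deck.eq_of_apply_eq (hq : IsCoveringMap q) {γ δ : Deck q} {x : Rn n}
    (h : γ.1 x = δ.1 x) : γ = δ := by
  refine Subtype.ext (Homeomorph.ext fun y => congrFun (hq.eq_of_comp_eq γ.1.continuous
    δ.1.continuous (funext fun y => ?_) x h) y)
  simp only [Function.comp_apply, γ.2, δ.2]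

/-- As ℝⁿ is simply connected, q lifts through itself in both directions between x and x'. The two
composites agree with the identity at one point, hence everywhere. -/
lemma exists_deck (hq : IsCoveringMap q) {x x' : Rn n} (h : q x = q x') :
    ∃ γ : Deck q, γ.1 x = x' := by
  have hc : Continuous q := hq.continuous
  obtain ⟨f, ⟨hf, hf'⟩, -⟩ := hq.existsUnique_continuousMap_lifts ⟨q, hc⟩ x x' h.symm
  obtain ⟨g, ⟨hg, hg'⟩, -⟩ := hq.existsUnique_continuousMap_lifts ⟨q, hc⟩ x' x h
  have hfq : ∀ y, q (f y) = q y := congrFun hf'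
  have hgq : ∀ y, q (g y) = q y := congrFun hg'
  have h1 : ∀ y, g (f y) = y := congrFun (hq.eq_of_comp_eq (g₁ := fun y => g (f y))
    (g₂ := fun y => y) (by fun_prop) continuous_id (funext fun y => by simp [hfq, hgq]) x
    (by simp [hf, hg]))
  have h2 : ∀ y, f (g y) = y := congrFun (hq.eq_of_comp_eq (g₁ := fun y => f (g y))
    (g₂ := fun y => y) (by fun_prop) continuous_id (funext fun y => by simp [hfq, hgq]) x'
    (by simp [hf, hg]))
  exact ⟨⟨⟨⟨f, g, h1, h2⟩, f.continuous, g.continuous⟩, hfq⟩, hf⟩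

@[simp] lemma deckInv_apply (γ : Deck q) (x : Rn n) : (deckInv γ).1 (γ.1 x) = x :=
  γ.1.symm_apply_apply x

@[simp] lemma apply_deckInv (γ : Deck q) (x : Rn n) : γ.1 ((deckInv γ).1 x) = x :=
  γ.1.apply_symm_apply x

/-- The composition of deck transformations. -/
def deckMul (γ δ : Deck q) : Deck q := ⟨δ.1.trans γ.1, fun x => by simp [γ.2, δ.2]⟩

@[simp] lemma deckMul_apply (γ δ : Deck q) (x : Rn n) : (deckMul γ δ).1 x = γ.1 (δ.1 x) := rfl

lemma Deck.ext {γ δ : Deck q} (h : ∀ x, γ.1 x = δ.1 x) : γ = δ :=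
  Subtype.ext (Homeomorph.ext h)

/-- Composition with a deck transformation as a permutation. -/
def deckMulEquiv (γ : Deck q) : Deck q ≃ Deck q where
  toFun := deckMul γ
  invFun := deckMul (deckInv γ)
  left_inv δ := Deck.ext fun x => by simp
  right_inv δ := Deck.ext fun x => by simp

end Cover

/-! ### Lifts of deck transformations to ℝⁿ × ℝⁿ -/

section Lift

variable {n : ℕ} {M B : Type*} [TopologicalSpace M]
  [ChartedSpace (EuclideanSpace ℝ (Fin (2 * n))) M]
  {ωM : ∀ p : M, Tan (2 * n) p →L[ℝ] Tan (2 * n) p →L[ℝ] ℝ} {π : M → B}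
  {q : Rn n → B} {Q : Rn n × Rn n → M}

lemma IsActionAngle.apply_deckLift (hQ : IsActionAngle ωM π univ q Q) (γ : Deck q)
    (z : Rn n × Rn n) : Q (deckLift Q γ z) = Q z := by
  obtain ⟨y, hy⟩ := hQ.surjective (γ.1 z.1) trivial (Q z)
    (by rw [γ.2]; exact hQ.proj z.1 trivial z.2)
  exact Classical.epsilon_spec (p := fun y' : Rn n => Q (γ.1 z.1, y') = Q z) ⟨y, hy⟩

lemma IsActionAngle.add_int (hQ : IsActionAngle ωM π univ q Q) (x y : Rn n) (k : Fin n → ℤ) :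
    Q (x, y + fun i => (k i : ℝ)) = Q (x, y) :=
  ((hQ.periodic x trivial y _).2 ⟨k, fun _ => rfl⟩).symm

lemma IsActionAngle.exists_add_int (hQ : IsActionAngle ωM π univ q Q) {z z' : Rn n × Rn n}
    (h : Q z = Q z') (h1 : z.1 = z'.1) :
    ∃ k : Fin n → ℤ, z' = (z.1, z.2 + fun i => (k i : ℝ)) := by
  obtain ⟨x, y⟩ := z
  obtain ⟨x', y'⟩ := z'
  obtain rfl : x = x' := h1
  obtain ⟨k, hk⟩ := (hQ.periodic x trivial y y').1 h
  exact ⟨k, by rw [Prod.mk.injEq]; exact ⟨rfl, funext hk⟩⟩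

/-- The pointwise choice in `deckLift` need not be continuous. Near each point it is replaced by a
smooth lift with the same value there. -/
lemma IsActionAngle.exists_deck_lift [TopologicalSpace B] [IsManifold (𝓡 (2 * n)) ∞ M]
    (hQ : IsActionAngle ωM π univ q Q)
    (hq : IsCoveringMap q) (γ : Deck q) (z : Rn n × Rn n) :
    ∃ Φ, Φ z = deckLift Q γ z ∧ ∀ᶠ w in 𝓝 z, IsLift Q Q γ.1 Φ w := by
  obtain ⟨O, hO, hqO⟩ := exists_nhds_injOn hq (deckLift Q γ z).1
  exact hQ.exists_lift isOpen_univ hQ isOpen_univ trivial trivial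
    (hQ.apply_deckLift γ z).symm hO hqO γ.1.continuous.continuousAt rfl γ.2

lemma IsLift.fderiv_bijective {α : Rn n → Rn n} {Φ : Rn n × Rn n → Rn n × Rn n}
    {z : Rn n × Rn n} (h : IsLift Q Q α Φ z) (hQ : IsActionAngle ωM π univ q Q) :
    Function.Surjective (fderiv ℝ α z.1) := by
  have hinj : Function.Injective (fderiv ℝ α z.1) := by
    rw [injective_iff_map_eq_zero]
    intro u hu
    have h1 := h.fderiv_vertical hQ isOpen_univ hQ trivial trivial u u
    rw [hu, zero_dotProduct] at h1
    exact dotProduct_self_eq_zero.1 h1.symm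
  exact LinearMap.surjective_of_injective (f := (fderiv ℝ α z.1 : Rn n →ₗ[ℝ] Rn n)) hinj

end Lift

/-! ### The terms of the theta series as exponentials -/

section Theta

variable {n : ℕ} {M B : Type*} [TopologicalSpace M]
  [ChartedSpace (EuclideanSpace ℝ (Fin (2 * n))) M] [TopologicalSpace B]
  {L : M → Type*} [TopologicalSpace (Bundle.TotalSpace ℂ L)]
  [∀ p, NormedAddCommGroup (L p)] [∀ p, InnerProductSpace ℂ (L p)]
  [FiberBundle ℂ L] [VectorBundle ℝ ℂ L]
  {ωM : ∀ p : M, Tan (2 * n) p →L[ℝ] Tan (2 * n) p →L[ℝ] ℝ} {π : M → B}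
  {D : CovariantDerivative (𝓡 (2 * n)) ℂ L} (Δ : Development ωM π D) {N : ℕ}
  {J : ∀ p : M, Tan (2 * n) p →L[ℝ] Tan (2 * n) p}
  {Z : Rn n → Matrix (Fin n) (Fin n) ℂ} {ψ : Rn n → Fin n → ℂ} {φ : Rn n → ℂ}
  {m : Fin n → ℤ}

lemma Development.isFrame : IsFrame D id Δ.Q Δ.τ where
  proj := Δ.τ_proj
  ne_zero := Δ.τ_ne_zero
  conn := Δ.τ_conn

lemma Development.proj_eq {z z' : Rn n × Rn n} (h : Δ.Q z = Δ.Q z') :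
    (Δ.τ z).proj = (Δ.τ z').proj := by rw [Δ.τ_proj, Δ.τ_proj, h]

lemma Development.lineRatio_mul {z z' z'' : Rn n × Rn n} (h : Δ.Q z = Δ.Q z')
    (h' : Δ.Q z' = Δ.Q z'') : lineRatio (Δ.τ z) (Δ.τ z'')
      = lineRatio (Δ.τ z) (Δ.τ z') * lineRatio (Δ.τ z') (Δ.τ z'') := by
  refine lineRatio_eq (Δ.τ_ne_zero z) ?_
  rw [mul_comm, ← smulT_smulT, smulT_lineRatio (Δ.τ_ne_zero z) (Δ.proj_eq h),
    smulT_lineRatio (Δ.τ_ne_zero z') (Δ.proj_eq h')]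

lemma sBase_add_int (x y : Rn n) (k : Fin n → ℤ) :
    sBase N Z m (x, y + fun i => (k i : ℝ)) = sBase N Z m (x, y) := by
  rw [sBase, sBase]
  refine Complex.exp_eq_exp_iff_exists_int.2 ⟨∑ i, m i * k i, ?_⟩
  simp only [Pi.add_apply, Complex.ofReal_add, mul_add, Finset.sum_add_distrib]
  push_cast
  ring

/-- Any lift of γ⁻¹ may be used, since s_m and τ are unchanged by integral shifts of y. -/
lemma thetaTerm_eq {γ : Deck Δ.q} {z z' : Rn n × Rn n} (h : Δ.Q z' = Δ.Q z)
    (h1 : z'.1 = (deckInv γ).1 z.1) :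
    thetaTerm Δ N Z m γ z = sBase N Z m z' * lineRatio (Δ.τ z) (Δ.τ z') ^ N := by
  obtain ⟨k, hk⟩ := Δ.actionAngle.exists_add_int (z := z') (z' := deckLift Δ.Q (deckInv γ) z)
    (h.trans (Δ.actionAngle.apply_deckLift _ z).symm) h1
  rw [thetaTerm, hk, sBase_add_int]
  have := Δ.τ_periodic z'.1 z'.2 k
  change Δ.τ (z'.1, z'.2 + fun i => (k i : ℝ)) = _ at this
  rw [this]

/-- Moving to another point over the same point of M permutes the terms by left multiplication with
a deck transformation; this gives the equivariance of the sum. -/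
lemma thetaTerm_of_eq {z z' : Rn n × Rn n} (h : Δ.Q z = Δ.Q z') :
    ∃ δ : Deck Δ.q, ∀ γ, thetaTerm Δ N Z m (deckMulEquiv δ γ) z
      = thetaTerm Δ N Z m γ z' * lineRatio (Δ.τ z) (Δ.τ z') ^ N := by
  obtain ⟨δ, hδ⟩ := exists_deck Δ.covering (x := z'.1) (x' := z.1) (by
    rw [← Δ.actionAngle.proj z.1 trivial z.2, ← Δ.actionAngle.proj z'.1 trivial z'.2]
    exact congrArg π h.symm)
  refine ⟨δ, fun γ => ?_⟩
  set w := deckLift Δ.Q (deckInv γ) z'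
  have hw : Δ.Q w = Δ.Q z' := Δ.actionAngle.apply_deckLift _ z'
  have hw1 : w.1 = (deckInv γ).1 z'.1 := rfl
  have h1 : w.1 = (deckInv (deckMulEquiv δ γ)).1 z.1 := by
    apply (deckMulEquiv δ γ).1.injective
    rw [apply_deckInv]
    change δ.1 (γ.1 w.1) = _
    rw [hw1, apply_deckInv, hδ]
  rw [thetaTerm_eq Δ (hw.trans h.symm) h1, thetaTerm_eq Δ hw hw1,
    Δ.lineRatio_mul h hw.symm, mul_pow]
  ring

variable [IsManifold (𝓡 (2 * n)) ∞ M] [ContMDiffVectorBundle ∞ ℂ L (𝓡 (2 * n))]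

/-- The covariant derivative commutes with transport: differentiating the N-th power of the frame
ratio produces exactly the difference of the two connection forms. -/
lemma IsFrame.nab_transport (hD : IsPrequantum ωM D) (Δ : Development ωM π D)
    {α : Rn n → Rn n} {Φ : Rn n × Rn n → Rn n × Rn n} {z : Rn n × Rn n}
    (h : IsLift Δ.Q Δ.Q α Φ z) {f : Rn n × Rn n → ℂ} (hf : DifferentiableAt ℝ f (Φ z)) :
    DifferentiableAt ℝ (fun w => f (Φ w) * lineRatio (Δ.τ w) (Δ.τ (Φ w)) ^ N) z ∧
    ∀ u, nab N (fun w => f (Φ w) * lineRatio (Δ.τ w) (Δ.τ (Φ w)) ^ N) z u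
      = lineRatio (Δ.τ z) (Δ.τ (Φ z)) ^ N * nab N f (Φ z) (fderiv ℝ Φ z u) := by
  obtain ⟨h1, h2⟩ := Δ.isFrame.hasFDerivAt_lineRatio hD Δ.actionAngle h
  have h3 : HasFDerivAt (fun w => f (Φ w)) _ z :=
    hf.hasFDerivAt.comp z (h.smooth.differentiableAt (by simp)).hasFDerivAt
  have h4 : HasFDerivAt (fun w => f (Φ w) * lineRatio (Δ.τ w) (Δ.τ (Φ w)) ^ N) _ z :=
    h3.mul (h1.hasFDerivAt.pow N)
  refine ⟨h4.differentiableAt, fun u => ?_⟩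
  rw [nab, h4.fderiv, nab]
  have h5 : (N : ℂ) * lineRatio (Δ.τ z) (Δ.τ (Φ z)) ^ (N - 1) * lineRatio (Δ.τ z) (Δ.τ (Φ z))
      = N * lineRatio (Δ.τ z) (Δ.τ (Φ z)) ^ N := by
    rcases Nat.eq_zero_or_pos N with hN | hN
    · simp [hN]
    · rw [mul_assoc, ← pow_succ, Nat.sub_add_cancel hN]
  simp only [add_apply, smul_apply, ContinuousLinearMap.comp_apply, smul_eq_mul, h2, nsmul_eq_mul]
  linear_combination (f (Φ z) * (connForm id (Φ z) (fderiv ℝ Φ z u) - connForm id z u)) * h5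

/-- Locally the γ-term is s_m transported by a smooth lift of γ⁻¹. The lift is complex linear, so
type (1,0) is inherited, and the covariant derivative of e_m gives the vertical derivative. -/
lemma thetaTerm_local (hD : IsPrequantum ωM D) (hZ : IsSiegelMap J univ Δ.Q Z)
    (h : IsPotential Z ψ φ) (γ : Deck Δ.q) (z₀ : Rn n × Rn n) :
    ∃ Φ : Rn n × Rn n → Rn n × Rn n, ContDiffAt ℝ ∞ Φ z₀ ∧
    ∀ᶠ z in 𝓝 z₀, IsLift Δ.Q Δ.Q (deckInv γ).1 Φ z ∧
      DifferentiableAt ℝ (thetaTerm Δ N Z m γ) z ∧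
      IsHolAt N Z (thetaTerm Δ N Z m γ) z ∧
      ∀ v, fderiv ℝ (thetaTerm Δ N Z m γ) z (0, v) = 2 * Real.pi * Complex.I
        * (((((fun i => (m i : ℝ)) - (N : ℝ) • (deckInv γ).1 z.1) ⬝ᵥ (fderiv ℝ Φ z (0, v)).2
          + N * (z.1 ⬝ᵥ v) : ℝ)) : ℂ) * thetaTerm Δ N Z m γ z := by
  obtain ⟨Φ, -, hΦ⟩ := Δ.actionAngle.exists_deck_lift Δ.covering (deckInv γ) z₀
  refine ⟨Φ, hΦ.self_of_nhds.smooth, ?_⟩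
  set f := sBase N Z m with hf
  have hfe : f = fun z => Complex.exp (2 * Real.pi * Complex.I * potH N ψ φ m (latticePt N m))
      * eBase N ψ φ m z := funext fun z => h.sBase_eq m z
  set c := Complex.exp (2 * Real.pi * Complex.I * potH N ψ φ m (latticePt N m))
  have hfd : ∀ z, HasFDerivAt f (c • fderiv ℝ (eBase N ψ φ m) z) z := fun z => by
    rw [hfe]
    exact (h.hasFDerivAt_eBase m z).1.hasFDerivAt.const_mul c
  have hnf : ∀ z u, nab N f z u = c * nab N (eBase N ψ φ m) z u := fun z u => by
    rw [nab, (hfd z).fderiv, nab, hfe]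
    simp only [smul_apply, smul_eq_mul]
    ring
  filter_upwards [hΦ.eventually_nhds] with z hz
  have hlz := hz.self_of_nhds
  have heq : thetaTerm Δ N Z m γ =ᶠ[𝓝 z]
      fun w => f (Φ w) * lineRatio (Δ.τ w) (Δ.τ (Φ w)) ^ N := by
    filter_upwards [hz] with w hw
    exact thetaTerm_eq Δ hw.eq.self_of_nhds hw.fst.self_of_nhds
  obtain ⟨h1, h2⟩ := IsFrame.nab_transport (N := N) hD Δ hlz (hfd (Φ z)).differentiableAt
  have hn : ∀ u, nab N (thetaTerm Δ N Z m γ) z u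
      = lineRatio (Δ.τ z) (Δ.τ (Φ z)) ^ N * nab N f (Φ z) (fderiv ℝ Φ z u) := fun u => by
    rw [← h2, nab, nab, heq.fderiv_eq, heq.self_of_nhds]
  refine ⟨hlz, h1.congr_of_eventuallyEq heq, fun u => ?_, fun v => ?_⟩
  · rw [hn, hn, ← hZ.unique_J hlz isOpen_univ Δ.actionAngle (mem_univ _) (mem_univ _) hZ u, hnf, hnf,
      h.isHolAt_eBase m (Φ z)]
    ring
  · have h3 := hn (0, v)
    rw [nab, hnf, h.nab_eBase, hlz.fderiv_fst, hlz.fst.self_of_nhds] at h3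
    have h4 : thetaTerm Δ N Z m γ z
        = c * eBase N ψ φ m (Φ z) * lineRatio (Δ.τ z) (Δ.τ (Φ z)) ^ N := by
      rw [heq.self_of_nhds, hfe]
    simp only [map_zero, sub_zero, cdot_cvec] at h3
    rw [connForm] at h3
    push_cast
    simp only [id] at h3
    linear_combination h3 - (2 * Real.pi * Complex.I *
      ((((fun i => (m i : ℝ)) - (N : ℝ) • (deckInv γ).1 z.1) ⬝ᵥ (fderiv ℝ Φ z (0, v)).2 : ℝ) : ℂ))
        * h4

lemma thetaTerm_add_int (γ : Deck Δ.q) (x y : Rn n) (k : Fin n → ℤ) :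
    thetaTerm Δ N Z m γ (x, y + fun i => (k i : ℝ)) = thetaTerm Δ N Z m γ (x, y) := by
  have h1 := Δ.τ_periodic x y k
  change Δ.τ (x, y + fun i => (k i : ℝ)) = _ at h1
  have h2 := Δ.actionAngle.add_int x y k
  have h3 : deckLift Δ.Q (deckInv γ) (x, y + fun i => (k i : ℝ))
      = deckLift Δ.Q (deckInv γ) (x, y) := by rw [deckLift, deckLift, h2]
  rw [thetaTerm, thetaTerm, h1, h3]

lemma thetaTerm_ne_zero (γ : Deck Δ.q) (z : Rn n × Rn n) : thetaTerm Δ N Z m γ z ≠ 0 :=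
  mul_ne_zero (Complex.exp_ne_zero _) (pow_ne_zero _ (lineRatio_ne_zero (Δ.τ_ne_zero _)
    (Δ.τ_ne_zero _) (Δ.proj_eq (Δ.actionAngle.apply_deckLift _ z).symm)))

/-- The terms of the theta series are multiples of `eBase`. -/
theorem exists_thetaTerm_eq (hD : IsPrequantum ωM D) (hN : 0 < N)
    (hZ : IsSiegelMap J univ Δ.Q Z)
    (h : IsPotential Z ψ φ) (m : Fin n → ℤ) (γ : Deck Δ.q) :
    ∃ m' : Fin n → ℤ, latticePt N m' = γ.1 (latticePt N m) ∧ ∃ c : ℂ, c ≠ 0 ∧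
      ∀ z, thetaTerm Δ N Z m γ z = c * eBase N ψ φ m' z := by
  set t := thetaTerm Δ N Z m γ
  have hloc := fun z => thetaTerm_local (N := N) (m := m) Δ hD hZ h γ z
  have htd : Differentiable ℝ t := fun z => by
    obtain ⟨Φ, -, hΦ⟩ := hloc z
    exact hΦ.self_of_nhds.2.1
  -- Write m - Nγ⁻¹x as dα(u) with α = γ⁻¹. Pairing it with the vertical part of dΦ(0, v) gives u·v,
  -- so the frequency u + Nx depends neither on y nor on the lift. If γ⁻¹x = m/N, then u = 0 and the
  -- frequency is Nx.
  have hl : ∀ x, ∃ l : Rn n, (∀ y v, fderiv ℝ t (x, y) (0, v)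
      = 2 * Real.pi * Complex.I * ((l ⬝ᵥ v : ℝ) : ℂ) * t (x, y)) ∧
      ((deckInv γ).1 x = latticePt N m → l = (N : ℝ) • x) := by
    intro x
    obtain ⟨Φ, -, hΦ⟩ := hloc (x, 0)
    set a := (fun i => (m i : ℝ)) - (N : ℝ) • (deckInv γ).1 x with ha
    have hmN : (deckInv γ).1 x = latticePt N m → a = 0 := fun h => by
      rw [ha, h]
      ext i
      simp only [Pi.sub_apply, Pi.smul_apply, latticePt, smul_eq_mul, Pi.zero_apply]
      field_simp
      ring
    obtain ⟨u, hu, hu0⟩ : ∃ u, fderiv ℝ (deckInv γ).1 x u = a ∧ (a = 0 → u = 0) := by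
      by_cases h0 : a = 0
      · exact ⟨0, by rw [map_zero, h0], fun _ => rfl⟩
      · obtain ⟨u, hu⟩ := hΦ.self_of_nhds.1.fderiv_bijective Δ.actionAngle a
        exact ⟨u, hu, fun h => absurd h h0⟩
    refine ⟨u + (N : ℝ) • x, fun y v => ?_, fun h => by rw [hu0 (hmN h), zero_add]⟩
    obtain ⟨Φ', -, hΦ'⟩ := hloc (x, y)
    obtain ⟨hli, -, -, hv⟩ := hΦ'.self_of_nhds
    rw [hv v]
    congr 4
    dsimp only
    rw [← ha, ← hu, hli.fderiv_vertical Δ.actionAngle isOpen_univ Δ.actionAngle trivial trivial,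
      add_dotProduct, smul_dotProduct, smul_eq_mul]
  choose l hl hl0 using hl
  have hexp : ∀ x y, t (x, y) = t (x, 0) * Complex.exp (2 * Real.pi * Complex.I
      * ((l x ⬝ᵥ y : ℝ) : ℂ)) := by
    intro x y
    let A : Rn n →L[ℝ] ℂ := LinearMap.toContinuousLinearMap
      { toFun := fun y => -(2 * Real.pi * Complex.I) * ((l x ⬝ᵥ y : ℝ) : ℂ)
        map_add' := fun u v => by simp; ring
        map_smul' := fun c u => by simp; ring }
    have hA : ∀ y, A y = -(2 * Real.pi * Complex.I) * ((l x ⬝ᵥ y : ℝ) : ℂ) := fun y => rfl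
    have hd : ∀ y, HasFDerivAt (fun y => t (x, y) * Complex.exp (A y))
        (0 : Rn n →L[ℝ] ℂ) y := by
      intro y
      have h1 : HasFDerivAt (fun y => t (x, y)) _ y :=
        (htd (x, y)).hasFDerivAt.comp y (hasFDerivAt_prodMk_right x y)
      have h2 : HasFDerivAt (fun y => Complex.exp (A y)) _ y := A.hasFDerivAt.cexp
      have h3 : HasFDerivAt (fun y => t (x, y) * Complex.exp (A y)) _ y := h1.mul h2
      refine h3.congr_fderiv (ContinuousLinearMap.ext fun v => ?_)
      simp only [add_apply, smul_apply, ContinuousLinearMap.comp_apply, smul_eq_mul,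
        ContinuousLinearMap.inr_apply, hl, hA, zero_apply]
      ring
    have h1 := is_const_of_fderiv_eq_zero (𝕜 := ℝ) (fun y => (hd y).differentiableAt)
      (fun y => (hd y).fderiv) y 0
    rw [map_zero, Complex.exp_zero, mul_one] at h1
    rw [← h1, mul_assoc, ← Complex.exp_add, hA]
    simp
  -- Periodicity in y makes the frequency integral.
  have hint : ∀ x i, ∃ k : ℤ, l x i = k := by
    intro x i
    have h1 := hexp x (0 + fun j => ((Pi.single i 1 : Fin n → ℤ) j : ℝ))
    rw [show t (x, 0 + fun j => ((Pi.single i 1 : Fin n → ℤ) j : ℝ)) = t (x, 0) from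
      thetaTerm_add_int Δ γ x 0 _] at h1
    have h2 := mul_left_cancel₀ (thetaTerm_ne_zero Δ γ (x, 0)) ((mul_one _).trans h1)
    obtain ⟨k, hk⟩ := Complex.exp_eq_one_iff.1 h2.symm
    refine ⟨k, ?_⟩
    have h3 : l x ⬝ᵥ (0 + fun j => ((Pi.single i 1 : Fin n → ℤ) j : ℝ)) = l x i := by
      rw [zero_add, dotProduct, Finset.sum_eq_single i (fun j _ hj => by simp [hj]) (by simp)]
      simp
    rw [h3] at hk
    have h4 : ((l x i : ℝ) : ℂ) = k :=
      mul_left_cancel₀ Complex.two_pi_I_ne_zero (hk.trans (mul_comm _ _))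
    exact_mod_cast h4
  choose k hk using hint
  -- Near x the frequency is computed through one fixed lift, so it is continuous; being integral,
  -- it is constant on ℝⁿ.
  have hcont : ∀ i, Continuous fun x => k x i := by
    intro i
    rw [Int.isClosedEmbedding_coe_real.isInducing.continuous_iff, continuous_iff_continuousAt]
    intro x
    obtain ⟨Φ, hΦs, hΦ⟩ := hloc (x, 0)
    have hx : Tendsto (fun ξ : Rn n => (ξ, (0 : Rn n))) (𝓝 x) (𝓝 (x, 0)) :=
      (by fun_prop : Continuous fun ξ : Rn n => (ξ, (0 : Rn n))).tendsto x
    set v : Rn n := Pi.single i 1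
    have h1 : ContinuousAt (fun ξ : Rn n => ((fun i => (m i : ℝ)) - (N : ℝ) • (deckInv γ).1 ξ)
        ⬝ᵥ (fderiv ℝ Φ (ξ, 0) (0, v)).2 + N * (ξ ⬝ᵥ v)) x := by
      have hα : Continuous (deckInv γ).1 := (deckInv γ).1.continuous
      have hdΦ : ContinuousAt (fun ξ : Rn n => fderiv ℝ Φ (ξ, 0)) x :=
        ContinuousAt.comp (f := fun ξ : Rn n => (ξ, (0 : Rn n))) (x := x)
          (hΦs.continuousAt_fderiv (by simp)) hx
      have hdΦ2 : ContinuousAt (fun ξ : Rn n => (fderiv ℝ Φ (ξ, 0) (0, v)).2) x :=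
        continuousAt_snd.comp (hdΦ.clm_apply continuousAt_const)
      simp only [dotProduct]
      refine ContinuousAt.add (tendsto_finsetSum _ fun j _ => ?_)
        (continuous_const.mul (Continuous.dotProduct continuous_id continuous_const)).continuousAt
      refine ContinuousAt.mul ?_ ((continuous_apply j).continuousAt.comp hdΦ2)
      have : Continuous fun ξ : Rn n => ((fun i => (m i : ℝ)) - (N : ℝ) • (deckInv γ).1 ξ) j := by
        fun_prop
      exact this.continuousAt
    refine h1.congr ?_
    filter_upwards [hx.eventually hΦ] with ξ hξ
    have h2 := (hl ξ 0 v).symm.trans (hξ.2.2.2 v)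
    have h3 := mul_left_cancel₀ Complex.two_pi_I_ne_zero
      (mul_right_cancel₀ (thetaTerm_ne_zero Δ γ (ξ, 0)) h2)
    have h4 := Complex.ofReal_injective h3
    change _ = ((k ξ i : ℤ) : ℝ)
    rw [← h4, ← hk]
    simp [v]
  have hconst : ∀ x, k x = k (γ.1 (latticePt N m)) := fun x => funext fun i =>
    PreconnectedSpace.constant (inferInstance : PreconnectedSpace (Rn n)) (hcont i)
  set m' := k (γ.1 (latticePt N m)) with hm'
  have hlx : ∀ x, l x = fun i => (m' i : ℝ) := fun x => funext fun i => by
    rw [hk, hconst]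
  -- The constant frequency is evaluated at x = γ(m/N), where it equals Nx.
  have hlat : latticePt N m' = γ.1 (latticePt N m) := by
    have h1 := (hlx (γ.1 (latticePt N m))).symm.trans (hl0 _ (deckInv_apply γ _))
    ext i
    have h2 : (m' i : ℝ) = N * γ.1 (latticePt N m) i := congrFun h1 i
    rw [latticePt, h2]
    field_simp
  obtain ⟨c, hc⟩ := h.exists_eq_mul_eBase (t := t) (m := m') htd (fun z => by
      obtain ⟨Φ, -, hΦ⟩ := hloc z
      exact hΦ.self_of_nhds.2.2.1) (fun z v => by
      rw [← hlx z.1]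
      exact hl z.1 z.2 v)
  refine ⟨m', hlat, c, fun h0 => ?_, hc⟩
  have h1 := hc 0
  rw [h0, zero_mul] at h1
  exact thetaTerm_ne_zero Δ γ 0 h1

end Theta

/-! ### Fourier series on the torus -/

section Fourier

variable {n : ℕ}

/-- The half-open unit cube with corner `a`. -/
def box (a : Rn n) : Set (Rn n) := {x | ∀ i, x i ∈ Ioc (a i) (a i + 1)}

lemma box_eq_pi (a : Rn n) : box a = univ.pi fun i => Ioc (a i) (a i + 1) := by
  ext; simp [box]

lemma measurableSet_box (a : Rn n) : MeasurableSet (box a) := by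
  rw [box_eq_pi]
  exact MeasurableSet.univ_pi fun _ => measurableSet_Ioc

lemma box_subset_Icc (a : Rn n) : box a ⊆ Icc a (a + 1) :=
  fun _ hx => ⟨fun i => (hx i).1.le, fun i => (hx i).2⟩

lemma volume_box (a : Rn n) : volume (box a) = 1 := by
  rw [box_eq_pi, Real.volume_pi_Ioc]
  simp

lemma integrableOn_box {E : Type*} [NormedAddCommGroup E] {f : Rn n → E} (hf : Continuous f)
    (a : Rn n) : IntegrableOn f (box a) :=
  (hf.continuousOn.integrableOn_compact isCompact_Icc).mono_set (box_subset_Icc a)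

/-- `ℤⁿ`-periodicity. -/
def IsPeriodic {E : Type*} (f : Rn n → E) : Prop :=
  ∀ (y : Rn n) (k : Fin n → ℤ), f (y + fun i => (k i : ℝ)) = f y

lemma IsPeriodic.exists_torus {E : Type*} {f : Rn n → E} (hf : IsPeriodic f) :
    ∃ g : UnitAddTorus (Fin n) → E, ∀ y, g (toTorus y) = f y := by
  choose r hr using toTorus_surjective (n := n)
  refine ⟨fun t => f (r t), fun y => ?_⟩
  obtain ⟨k, hk⟩ := toTorus_eq_iff.1 (hr (toTorus y))
  have h1 : y = r (toTorus y) + fun i => (k i : ℝ) := funext hk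
  conv_rhs => rw [h1, hf]

/-- The function `exp (2π√-1 m·y)`. -/
def mchar (m : Fin n → ℤ) (y : Rn n) : ℂ :=
  Complex.exp (2 * Real.pi * Complex.I * cdot (fun i => (m i : ℝ)) (cvec n y))

lemma mFourier_toTorus (m : Fin n → ℤ) (y : Rn n) :
    UnitAddTorus.mFourier m (toTorus y) = mchar m y := by
  rw [mchar, cdot, Finset.mul_sum, Complex.exp_sum]
  change ∏ i, fourier (m i) (toTorus y i) = _
  refine Finset.prod_congr rfl fun i _ => ?_
  rw [toTorus, fourier_coe_apply]
  congr 1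
  simp
  ring

/-- Both integrals are the zeroth Fourier coefficient of the induced function on the torus. -/
lemma setIntegral_box {E : Type*} [NormedAddCommGroup E] [NormedSpace ℂ E] {f : Rn n → E}
    (hf : IsPeriodic f) (a b : Rn n) : ∫ y in box a, f y = ∫ y in box b, f y := by
  obtain ⟨g, hg⟩ := hf.exists_torus
  have h : ∀ a : Rn n, UnitAddTorus.mFourierCoeff g 0 = ∫ y in box a, f y := by
    intro a
    rw [UnitAddTorus.mFourierCoeff_eq_integral g 0 a]
    refine integral_congr_ae (Eventually.of_forall fun y => ?_)
    change UnitAddTorus.mFourier (-0) (toTorus y) • g (toTorus y) = f y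
    rw [neg_zero, UnitAddTorus.mFourier_zero, ContinuousMap.one_apply, one_smul, hg]
  rw [← h a, h b]

lemma setIntegral_box_add {E : Type*} [NormedAddCommGroup E] [NormedSpace ℂ E] {f : Rn n → E}
    (hf : IsPeriodic f) (a s : Rn n) : ∫ y in box a, f (y + s) = ∫ y in box a, f y := by
  rw [← setIntegral_box hf (a + s) a]
  have h1 : box a = (fun y => y + s) ⁻¹' box (a + s) := by
    ext y
    refine forall_congr' fun i => ?_
    simp only [mem_Ioc, Pi.add_apply]
    constructor <;> rintro ⟨h1, h2⟩ <;> constructor <;> linarith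
  rw [h1]
  exact (measurePreserving_add_right volume s).setIntegral_preimage_emb
    (MeasurableEquiv.addRight s).measurableEmbedding f _

lemma mchar_add (m : Fin n → ℤ) (y y' : Rn n) : mchar m (y + y') = mchar m y * mchar m y' := by
  rw [mchar, mchar, mchar, ← Complex.exp_add, map_add, cdot_add, mul_add]

lemma mchar_add' (m m' : Fin n → ℤ) (y : Rn n) : mchar (m + m') y = mchar m y * mchar m' y := by
  rw [mchar, mchar, mchar, ← Complex.exp_add]
  congr 1
  simp only [cdot, Pi.add_apply, Int.cast_add, Complex.ofReal_add, add_mul,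
    Finset.sum_add_distrib, mul_add]

lemma mchar_zero (y : Rn n) : mchar 0 y = 1 := by simp [mchar, cdot]

lemma mchar_neg_mul (m : Fin n → ℤ) (y : Rn n) : mchar (-m) y * mchar m y = 1 := by
  rw [← mchar_add', neg_add_cancel, mchar_zero]

lemma continuous_mchar (m : Fin n → ℤ) : Continuous (mchar m) :=
  Complex.continuous_exp.comp (continuous_const.mul
    (((cdotL n).flip (fun i => (m i : ℝ))).continuous.comp (cvec n).continuous))

lemma mchar_eq (m : Fin n → ℤ) (y : Rn n) :
    mchar m y = Complex.exp (((2 * Real.pi * ((fun i => (m i : ℝ)) ⬝ᵥ y) : ℝ) : ℂ) * Complex.I) := by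
  rw [mchar, cdot_cvec]
  congr 1
  push_cast
  ring

lemma norm_mchar (m : Fin n → ℤ) (y : Rn n) : ‖mchar m y‖ = 1 := by
  rw [mchar_eq, Complex.norm_exp_ofReal_mul_I]

lemma conj_mchar (m : Fin n → ℤ) (y : Rn n) : (starRingEnd ℂ) (mchar m y) = mchar (-m) y := by
  rw [mchar_eq, mchar_eq, ← Complex.exp_conj]
  congr 1
  have : (fun i => ((-m) i : ℝ)) = -(fun i => (m i : ℝ)) := by ext; simp
  rw [this, neg_dotProduct, map_mul, Complex.conj_ofReal, Complex.conj_I]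
  push_cast
  ring

lemma isPeriodic_mchar (m : Fin n → ℤ) : IsPeriodic (mchar m) := by
  intro y k
  have : mchar m (fun i => (k i : ℝ)) = 1 := by
    rw [mchar, Complex.exp_eq_one_iff]
    refine ⟨∑ i, m i * k i, ?_⟩
    simp [cdot]
    ring
  rw [mchar_add, this, mul_one]

/-- Translation by 1/(2mᵢ) in a coordinate with mᵢ ≠ 0 preserves the integral and changes the sign
of the character. -/
lemma integral_box_mchar {m : Fin n → ℤ} (hm : m ≠ 0) : ∫ y in box (0 : Rn n), mchar m y = 0 := by
  obtain ⟨i, hi⟩ := Function.ne_iff.1 hm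
  have hi' : (m i : ℝ) ≠ 0 := by exact_mod_cast hi
  have h1 := setIntegral_box_add (isPeriodic_mchar m) 0 (Pi.single i (1 / (2 * (m i : ℝ))))
  have h2 : mchar m (Pi.single i (1 / (2 * (m i : ℝ)))) = -1 := by
    rw [mchar_eq, dotProduct_single, ← Complex.exp_pi_mul_I]
    congr 2
    field_simp
  simp only [mchar_add, h2, mul_neg, mul_one, integral_neg] at h1
  exact self_eq_neg.1 h1.symm

lemma integral_box_mchar_mul (m k : Fin n → ℤ) :
    ∫ y in box (0 : Rn n), mchar (-k) y * mchar m y = if m = k then 1 else 0 := by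
  simp only [← mchar_add']
  split_ifs with h
  · subst h
    simp only [neg_add_cancel, mchar_zero]
    simp [measureReal_def, volume_box]
  · refine integral_box_mchar fun h0 => h ?_
    rwa [neg_add_eq_zero, eq_comm] at h0

/-- The Fourier coefficients of a function on `ℝⁿ`. -/
def fcoef (f : Rn n → ℂ) (k : Fin n → ℤ) : ℂ := ∫ y in box (0 : Rn n), mchar (-k) y * f y

lemma norm_fcoef_le {f : Rn n → ℂ} {C : ℝ} (h : ∀ y ∈ Icc (0 : Rn n) 1, ‖f y‖ ≤ C)
    (k : Fin n → ℤ) : ‖fcoef f k‖ ≤ C := by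
  have h1 := norm_setIntegral_le_of_norm_le_const (μ := volume) (s := box (0 : Rn n))
    (f := fun y => mchar (-k) y * f y) (C := C) (by rw [volume_box]; exact ENNReal.one_lt_top)
    (fun y hy => by
      rw [norm_mul, norm_mchar, one_mul]
      have := box_subset_Icc 0 hy
      rw [zero_add] at this
      exact h y this)
  rw [measureReal_def, volume_box, ENNReal.toReal_one, mul_one] at h1
  exact h1

/-- Fourier coefficients of an absolutely convergent trigonometric series. -/
lemma hasSum_fcoef {ι : Type*} [Countable ι] {a : ι → ℂ} {σ : ι → Fin n → ℤ} {f : Rn n → ℂ}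
    (ha : Summable fun i => ‖a i‖) (hf : ∀ y, HasSum (fun i => a i * mchar (σ i) y) (f y))
    (k : Fin n → ℤ) : HasSum (fun i => if σ i = k then a i else 0) (fcoef f k) := by
  have h1 := hasSum_integral_of_summable_integral_norm
    (μ := volume.restrict (box (0 : Rn n)))
    (F := fun i y => mchar (-k) y * (a i * mchar (σ i) y))
    (fun i => integrableOn_box ((continuous_mchar _).mul
      (continuous_const.mul (continuous_mchar _))) 0)
    (by simpa [norm_mchar, measureReal_def, volume_box] using ha)
  have h2 : ∀ i, ∫ y in box (0 : Rn n), mchar (-k) y * (a i * mchar (σ i) y)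
      = if σ i = k then a i else 0 := by
    intro i
    have : ∀ y : Rn n, mchar (-k) y * (a i * mchar (σ i) y)
        = a i * (mchar (-k) y * mchar (σ i) y) := fun y => by ring
    simp only [this]
    rw [integral_const_mul, integral_box_mchar_mul]
    split_ifs <;> simp
  simp only [h2] at h1
  have h3 : fcoef f k
      = ∫ y in box (0 : Rn n), ∑' i, mchar (-k) y * (a i * mchar (σ i) y) :=
    integral_congr_ae (Eventually.of_forall fun y => ((hf y).mul_left _).tsum_eq.symm)
  rwa [h3]

lemma fcoef_eq {ι : Type*} [Countable ι] {a : ι → ℂ} {σ : ι → Fin n → ℤ} {f : Rn n → ℂ}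
    (ha : Summable fun i => ‖a i‖) (hf : ∀ y, HasSum (fun i => a i * mchar (σ i) y) (f y))
    (hσ : Function.Injective σ) (i : ι) : fcoef f (σ i) = a i := by
  classical
  refine (hasSum_fcoef ha hf (σ i)).unique ?_
  convert hasSum_ite_eq i (a i) using 2 with j
  by_cases h : j = i
  · subst h; simp
  · simp [h, hσ.ne h]

lemma fcoef_eq_zero {ι : Type*} [Countable ι] {a : ι → ℂ} {σ : ι → Fin n → ℤ} {f : Rn n → ℂ}
    (ha : Summable fun i => ‖a i‖) (hf : ∀ y, HasSum (fun i => a i * mchar (σ i) y) (f y))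
    {k : Fin n → ℤ} (hk : k ∉ range σ) : fcoef f k = 0 := by
  refine (hasSum_fcoef ha hf k).unique ?_
  have : ∀ i, σ i ≠ k := fun i h => hk ⟨i, h⟩
  simp only [this, if_false]
  exact hasSum_zero

lemma isOpenQuotientMap_toTorus : IsOpenQuotientMap (toTorus (n := n)) :=
  IsOpenQuotientMap.piMap (f := fun (_ : Fin n) (x : ℝ) => (x : UnitAddCircle))
    fun _ => QuotientAddGroup.isOpenQuotientMap_mk

/-- Fourier inversion for a periodic function with summable Fourier coefficients. -/
lemma hasSum_fcoef_mul_mchar {f : Rn n → ℂ} (hf : Continuous f) (hp : IsPeriodic f)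
    (hs : Summable (fcoef f)) (y : Rn n) : HasSum (fun k => fcoef f k * mchar k y) (f y) := by
  obtain ⟨g, hg⟩ := hp.exists_torus
  have hgc : Continuous g := by
    rw [isOpenQuotientMap_toTorus.isQuotientMap.continuous_iff]
    exact hf.congr fun y => (hg y).symm
  have hco : UnitAddTorus.mFourierCoeff g = fcoef f := by
    ext k
    rw [UnitAddTorus.mFourierCoeff_eq_integral g k 0]
    refine integral_congr_ae (Eventually.of_forall fun y => ?_)
    change UnitAddTorus.mFourier (-k) (toTorus y) • g (toTorus y) = _
    rw [mFourier_toTorus, hg, smul_eq_mul]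
  have h1 := UnitAddTorus.hasSum_mFourier_series_apply_of_summable (f := ⟨g, hgc⟩)
    (by rw [ContinuousMap.coe_mk, hco]; exact hs) (toTorus y)
  simpa only [ContinuousMap.coe_mk, hco, mFourier_toTorus, hg, smul_eq_mul] using h1

end Fourier

/-! ### Series of the functions `eBase` -/

section Decay

variable {n : ℕ}

/-- The `ℓ¹`-norm of an integral vector. -/
def ell (m : Fin n → ℤ) : ℝ := ∑ i, |(m i : ℝ)|

lemma ell_nonneg (m : Fin n → ℤ) : 0 ≤ ell m := Finset.sum_nonneg fun _ _ => abs_nonneg _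

lemma summable_exp_neg_abs {ε : ℝ} (hε : 0 < ε) :
    Summable fun k : ℤ => Real.exp (-ε * |(k : ℝ)|) := by
  have h1 : Summable fun k : ℕ => Real.exp (-ε * |((k : ℤ) : ℝ)|) := by
    have := summable_geometric_of_lt_one (Real.exp_pos (-ε)).le ((Real.exp_lt_exp.2 (by linarith : -ε < 0)).trans_eq Real.exp_zero)
    refine this.congr fun k => ?_
    rw [← Real.exp_nat_mul, Int.cast_natCast, abs_of_nonneg (Nat.cast_nonneg k), mul_comm]
  refine Summable.of_nat_of_neg h1 (h1.congr fun k => ?_)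
  rw [Int.cast_neg, abs_neg]

lemma summable_exp_neg_ell {ε : ℝ} (hε : 0 < ε) :
    ∀ n : ℕ, Summable fun m : Fin n → ℤ => Real.exp (-ε * ell m)
  | 0 => Summable.of_finite
  | n + 1 => by
    rw [← (Fin.consEquiv fun _ : Fin (n + 1) => ℤ).summable_iff]
    have h := (summable_exp_neg_abs hε).mul_of_nonneg (summable_exp_neg_ell hε n)
      (fun _ => (Real.exp_pos _).le) fun _ => (Real.exp_pos _).le
    refine h.congr fun p => ?_
    rw [← Real.exp_add, Function.comp_apply]
    congr 1
    simp [ell, Fin.sum_univ_succ, Fin.consEquiv, mul_add]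

lemma abs_dotProduct_le (m : Fin n → ℤ) (w : Rn n) :
    |(fun i => (m i : ℝ)) ⬝ᵥ w| ≤ ell m * ‖w‖ := by
  rw [dotProduct, ell, Finset.sum_mul]
  refine (Finset.abs_sum_le_sum_abs _ _).trans (Finset.sum_le_sum fun i _ => ?_)
  rw [abs_mul]
  exact mul_le_mul_of_nonneg_left (norm_le_pi_norm w i) (abs_nonneg _)

lemma ell_mul_exp_le {ε : ℝ} (hε : 0 < ε) (m : Fin n → ℤ) :
    ell m * Real.exp (-ε * ell m) ≤ 2 / ε * Real.exp (-(ε / 2) * ell m) := by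
  have h1 : ε / 2 * ell m ≤ Real.exp (ε / 2 * ell m) := by
    linarith [Real.add_one_le_exp (ε / 2 * ell m)]
  have h2 : Real.exp (-ε * ell m)
      = Real.exp (-(ε / 2) * ell m) * Real.exp (-(ε / 2) * ell m) := by
    rw [← Real.exp_add]; congr 1; ring
  have h3 : Real.exp (ε / 2 * ell m) * Real.exp (-(ε / 2) * ell m) = 1 := by
    rw [← Real.exp_add]; simp
  have h4 := mul_le_mul_of_nonneg_right h1 (Real.exp_pos (-(ε / 2) * ell m)).le
  rw [h3] at h4
  rw [h2]
  have h5 : ell m * (Real.exp (-(ε / 2) * ell m) * Real.exp (-(ε / 2) * ell m))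
      = 2 / ε * (ε / 2 * ell m * Real.exp (-(ε / 2) * ell m)) * Real.exp (-(ε / 2) * ell m) := by
    field_simp
  rw [h5]
  refine mul_le_mul_of_nonneg_right ?_ (Real.exp_pos _).le
  exact mul_le_of_le_one_right (by positivity) h4

/-- Exponential decay of the terms of the series `∑ exp (2π√-1 m·ζ) κ_m` at points `ζ` with
imaginary part `-w`. -/
def Decays {F : Type*} [NormedAddCommGroup F] (κ : (Fin n → ℤ) → F) (w : Rn n) : Prop :=
  ∃ C, ∃ ε > 0, ∀ m, ‖κ m‖ * Real.exp (2 * Real.pi * ((fun i => (m i : ℝ)) ⬝ᵥ w))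
    ≤ C * Real.exp (-ε * ell m)

/-- A displacement of w by less than ε/(4π) changes the exponent by at most (ε/2)|m|, which costs
half of the decay rate. -/
lemma Decays.nhds {F : Type*} [NormedAddCommGroup F] {κ : (Fin n → ℤ) → F} {w : Rn n}
    (h : Decays κ w) : ∃ C, ∃ ε > 0, ∃ r > 0, ∀ w' ∈ Metric.ball w r, ∀ m,
      ‖κ m‖ * Real.exp (2 * Real.pi * ((fun i => (m i : ℝ)) ⬝ᵥ w')) ≤ C * Real.exp (-ε * ell m) := by
  obtain ⟨C, ε, hε, h⟩ := h
  refine ⟨C, ε / 2, by positivity, ε / (4 * Real.pi), by positivity, fun w' hw' m => ?_⟩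
  rw [mem_ball_iff_norm] at hw'
  have h1 : 2 * Real.pi * ((fun i => (m i : ℝ)) ⬝ᵥ (w' - w)) ≤ ε / 2 * ell m := by
    have h2 := (le_abs_self _).trans (abs_dotProduct_le m (w' - w))
    have h3 : ell m * ‖w' - w‖ ≤ ell m * (ε / (4 * Real.pi)) :=
      mul_le_mul_of_nonneg_left hw'.le (ell_nonneg m)
    have h4 : 2 * Real.pi * (ell m * (ε / (4 * Real.pi))) = ε / 2 * ell m := by
      field_simp; ring
    rw [← h4]
    exact mul_le_mul_of_nonneg_left (h2.trans h3) (by positivity)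
  have h5 : 2 * Real.pi * ((fun i => (m i : ℝ)) ⬝ᵥ w')
      = 2 * Real.pi * ((fun i => (m i : ℝ)) ⬝ᵥ w)
        + 2 * Real.pi * ((fun i => (m i : ℝ)) ⬝ᵥ (w' - w)) := by
    rw [dotProduct_sub]; ring
  have h6 : C * Real.exp (-(ε / 2) * ell m)
      = C * Real.exp (-ε * ell m) * Real.exp (ε / 2 * ell m) := by
    rw [mul_assoc, ← Real.exp_add]; congr 2; ring
  rw [h5, Real.exp_add, ← mul_assoc, h6]
  exact mul_le_mul (h m) (Real.exp_le_exp.2 h1) (Real.exp_pos _).le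
    ((mul_nonneg (norm_nonneg _) (Real.exp_pos _).le).trans (h m))

/-- The pairing with an integral vector. -/
def cdotm (m : Fin n → ℤ) : (Fin n → ℂ) →L[ℂ] ℂ :=
  ∑ i, (m i : ℂ) • ContinuousLinearMap.proj (R := ℂ) (φ := fun _ : Fin n => ℂ) i

lemma cdotm_apply (m : Fin n → ℤ) (ζ : Fin n → ℂ) :
    cdotm m ζ = cdot (fun i => (m i : ℝ)) ζ := by
  simp [cdotm, cdot]

lemma norm_cdotm_le (m : Fin n → ℤ) : ‖cdotm m‖ ≤ ell m := by
  refine ContinuousLinearMap.opNorm_le_bound _ (ell_nonneg m) fun ζ => ?_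
  rw [cdotm_apply, cdot, ell, Finset.sum_mul]
  refine (norm_sum_le _ _).trans (Finset.sum_le_sum fun i _ => ?_)
  rw [norm_mul, Complex.norm_real, Real.norm_eq_abs]
  exact mul_le_mul_of_nonneg_left (norm_le_pi_norm ζ i) (abs_nonneg _)

lemma norm_exp_cdotm (m : Fin n → ℤ) (ζ : Fin n → ℂ) :
    ‖Complex.exp (2 * Real.pi * Complex.I * cdotm m ζ)‖
      = Real.exp (2 * Real.pi * ((fun i => (m i : ℝ)) ⬝ᵥ fun i => -(ζ i).im)) := by
  rw [Complex.norm_exp]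
  congr 1
  have h1 : (cdotm m ζ).im = (fun i => (m i : ℝ)) ⬝ᵥ fun i => (ζ i).im := by
    simp [cdotm_apply, cdot, dotProduct]
  have h2 : (2 * Real.pi * Complex.I * cdotm m ζ).re = -(2 * Real.pi * (cdotm m ζ).im) := by
    simp
  rw [h2, h1]
  simp [dotProduct]

/-- The sum of the series `∑ exp (2π√-1 m·ζ) κ_m`. -/
def fseries {F : Type*} [NormedAddCommGroup F] [NormedSpace ℂ F] (κ : (Fin n → ℤ) → F)
    (ζ : Fin n → ℂ) : F := ∑' m, Complex.exp (2 * Real.pi * Complex.I * cdotm m ζ) • κ m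

/-- The coefficients of the derivative of `fseries κ`. -/
def dcoef {F : Type*} [NormedAddCommGroup F] [NormedSpace ℂ F] (κ : (Fin n → ℤ) → F)
    (m : Fin n → ℤ) : (Fin n → ℂ) →L[ℂ] F := ((2 * Real.pi * Complex.I) • cdotm m).smulRight (κ m)

lemma norm_dcoef_le {F : Type*} [NormedAddCommGroup F] [NormedSpace ℂ F] (κ : (Fin n → ℤ) → F)
    (m : Fin n → ℤ) : ‖dcoef κ m‖ ≤ 2 * Real.pi * ell m * ‖κ m‖ := by
  rw [dcoef, ContinuousLinearMap.norm_smulRight_apply, norm_smul]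
  have : ‖(2 * Real.pi * Complex.I : ℂ)‖ = 2 * Real.pi := by
    simp [abs_of_pos Real.pi_pos]
  rw [this]
  gcongr
  exact norm_cdotm_le m

/-- Differentiation multiplies the terms by at most 2π|m|, which half of the exponential rate
absorbs. -/
lemma Decays.dcoef {F : Type*} [NormedAddCommGroup F] [NormedSpace ℂ F] {κ : (Fin n → ℤ) → F}
    {w : Rn n} (h : Decays κ w) : Decays (dcoef κ) w := by
  obtain ⟨C, ε, hε, h⟩ := h
  refine ⟨2 * Real.pi * C * (2 / ε), ε / 2, by positivity, fun m => ?_⟩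
  have hC : 0 ≤ C := by
    by_contra hC
    have h1 := (mul_nonneg (norm_nonneg (κ 0)) (Real.exp_pos _).le).trans (h 0)
    exact hC (nonneg_of_mul_nonneg_left h1 (Real.exp_pos _))
  set e := Real.exp (2 * Real.pi * ((fun i => (m i : ℝ)) ⬝ᵥ w))
  have h1 : ‖LagFib.dcoef κ m‖ * e ≤ 2 * Real.pi * ell m * (‖κ m‖ * e) := by
    rw [← mul_assoc]
    exact mul_le_mul_of_nonneg_right (norm_dcoef_le κ m) (Real.exp_pos _).le
  have h2 : 2 * Real.pi * ell m * (‖κ m‖ * e)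
      ≤ 2 * Real.pi * ell m * (C * Real.exp (-ε * ell m)) :=
    mul_le_mul_of_nonneg_left (h m) (mul_nonneg (by positivity) (ell_nonneg m))
  have h3 := mul_le_mul_of_nonneg_left (ell_mul_exp_le hε m)
    (mul_nonneg (by positivity : (0 : ℝ) ≤ 2 * Real.pi) hC)
  calc _ ≤ _ := h1.trans h2
    _ = 2 * Real.pi * C * (ell m * Real.exp (-ε * ell m)) := by ring
    _ ≤ _ := h3
    _ = _ := by ring

lemma hasFDerivAt_exp_smul {F : Type*} [NormedAddCommGroup F] [NormedSpace ℂ F]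
    (κ : (Fin n → ℤ) → F) (m : Fin n → ℤ) (ζ : Fin n → ℂ) :
    HasFDerivAt (fun ζ => Complex.exp (2 * Real.pi * Complex.I * cdotm m ζ) • κ m)
      (Complex.exp (2 * Real.pi * Complex.I * cdotm m ζ) • dcoef κ m) ζ := by
  have h1 : HasFDerivAt (fun ζ => Complex.exp (2 * Real.pi * Complex.I * cdotm m ζ)) _ ζ :=
    ((cdotm m).hasFDerivAt.const_mul (2 * Real.pi * Complex.I)).cexp
  refine (h1.smul_const (κ m)).congr_fderiv (ContinuousLinearMap.ext fun v => ?_)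
  simp [dcoef, smul_smul, mul_assoc]

lemma isOpen_im_ball (w : Rn n) (r : ℝ) :
    IsOpen {ζ : Fin n → ℂ | (fun i => -(ζ i).im) ∈ Metric.ball w r} :=
  Metric.isOpen_ball.preimage (continuous_pi fun i =>
    (Complex.continuous_im.comp (continuous_apply i)).neg)

lemma isPreconnected_im_ball (w : Rn n) (r : ℝ) :
    IsPreconnected {ζ : Fin n → ℂ | (fun i => -(ζ i).im) ∈ Metric.ball w r} := by
  have h1 : Convex ℝ {ζ : Fin n → ℂ | (fun i => -(ζ i).im) ∈ Metric.ball w r} := by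
    intro ζ hζ ζ' hζ' a b ha hb hab
    have := convex_ball w r hζ hζ' ha hb hab
    have he : (fun i => -((a • ζ + b • ζ') i).im)
        = (a • fun i => -(ζ i).im) + b • fun i => -(ζ' i).im := by
      ext i
      simp
      ring
    rw [mem_setOf_eq, he]
    exact this
  exact h1.isPreconnected

/-- A series whose terms decay exponentially can be differentiated termwise. -/
lemma Decays.hasFDerivAt {F : Type*} [NormedAddCommGroup F] [NormedSpace ℂ F] [CompleteSpace F]
    {κ : (Fin n → ℤ) → F} {ζ₀ : Fin n → ℂ} (h : Decays κ fun i => -(ζ₀ i).im) :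
    ∀ᶠ ζ in 𝓝 ζ₀, HasFDerivAt (fseries κ) (fseries (LagFib.dcoef κ) ζ) ζ := by
  obtain ⟨C, ε, hε, r, hr, hb⟩ := h.nhds
  obtain ⟨C', ε', hε', r', hr', hb'⟩ := h.dcoef.nhds
  set s := {ζ : Fin n → ℂ | (fun i => -(ζ i).im)
    ∈ Metric.ball (fun i => -(ζ₀ i).im) (min r r')}
  have hs : ζ₀ ∈ s := Metric.mem_ball_self (lt_min hr hr')
  filter_upwards [(isOpen_im_ball _ _).mem_nhds hs] with ζ hζ
  refine hasFDerivAt_tsum_of_isPreconnected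
    (((summable_exp_neg_ell hε' n).mul_left C')) (isOpen_im_ball _ _)
    (isPreconnected_im_ball _ _) (fun m x _ => hasFDerivAt_exp_smul κ m x) (fun m x hx => ?_) hs ?_
    hζ
  · rw [norm_smul, norm_exp_cdotm, mul_comm]
    exact hb' _ (Metric.ball_subset_ball (min_le_right _ _) hx) m
  · refine Summable.of_norm_bounded ((summable_exp_neg_ell hε n).mul_left C) fun m => ?_
    rw [norm_smul, norm_exp_cdotm, mul_comm]
    exact hb _ (Metric.mem_ball_self hr) m

/-- The induction on the order runs over all targets F at once, because the derivative is a series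
of the same kind with values in linear maps. -/
lemma Decays.contDiffAt (k : ℕ) : ∀ {F : Type} [NormedAddCommGroup F] [NormedSpace ℂ F]
    [CompleteSpace F] {κ : (Fin n → ℤ) → F} {ζ₀ : Fin n → ℂ},
    (Decays κ fun i => -(ζ₀ i).im) → ContDiffAt ℂ k (fseries κ) ζ₀ := by
  induction k with
  | zero =>
    intro F _ _ _ κ ζ₀ h
    rw [Nat.cast_zero, contDiffAt_zero]
    exact ⟨_, h.hasFDerivAt, fun ζ hζ => HasFDerivAt.continuousAt hζ |>.continuousWithinAt⟩
  | succ k ih =>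
    intro F _ _ _ κ ζ₀ h
    rw [Nat.cast_succ, contDiffAt_succ_iff_hasFDerivAt]
    exact ⟨_, ⟨_, h.hasFDerivAt, fun ζ hζ => hζ⟩, ih h.dcoef⟩

end Decay

/-! ### Tame series and the Fourier expansion of functions of type (1,0) -/

section Series

variable {n N : ℕ} {Z : Rn n → Matrix (Fin n) (Fin n) ℂ} {ψ : Rn n → Fin n → ℂ} {φ : Rn n → ℂ}
  {κ : (Fin n → ℤ) → ℂ}

/-- The imaginary part of `ψ`. -/
def imv (ψ : Rn n → Fin n → ℂ) (x : Rn n) : Rn n := fun i => (ψ x i).im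

lemma eBase_eq (ψ : Rn n → Fin n → ℂ) (φ : Rn n → ℂ) (m : Fin n → ℤ) (z : Rn n × Rn n) :
    eBase N ψ φ m z = Complex.exp (2 * Real.pi * Complex.I * (N * φ z.1))
      * Complex.exp (2 * Real.pi * Complex.I * cdotm m (cvec n z.2 - ψ z.1)) := by
  rw [eBase, cdotm_apply, ← Complex.exp_add]
  ring_nf

lemma eBase_eq_mchar (ψ : Rn n → Fin n → ℂ) (φ : Rn n → ℂ) (m : Fin n → ℤ) (x y : Rn n) :
    eBase N ψ φ m (x, y) = eBase N ψ φ m (x, 0) * mchar m y := by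
  rw [eBase, eBase, mchar, ← Complex.exp_add]
  simp only [map_zero, cdot_sub]
  have : cdot (fun i => (m i : ℝ)) 0 = 0 := by simp [cdot]
  rw [this]
  ring_nf

lemma norm_eBase (ψ : Rn n → Fin n → ℂ) (φ : Rn n → ℂ) (m : Fin n → ℤ) (z : Rn n × Rn n) :
    ‖eBase N ψ φ m z‖ = ‖Complex.exp (2 * Real.pi * Complex.I * (N * φ z.1))‖
      * Real.exp (2 * Real.pi * ((fun i => (m i : ℝ)) ⬝ᵥ imv ψ z.1)) := by
  rw [eBase_eq, norm_mul, norm_exp_cdotm]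
  congr 4
  ext i
  simp [imv]

lemma IsPotential.hasStrictFDerivAt_imv (h : IsPotential Z ψ φ) (x : Rn n) :
    HasStrictFDerivAt (imv ψ) (matL (siegelB (Z x))⁻¹) x := by
  let A : (Fin n → ℂ) →L[ℝ] Rn n :=
    ContinuousLinearMap.pi fun i => Complex.imCLM.comp (ContinuousLinearMap.proj i)
  have hs : ContDiff ℝ ∞ (imv ψ) := A.contDiff.comp h.smooth
  have h1 : HasFDerivAt (imv ψ) (A.comp (omegaL (Z x))) x :=
    A.hasFDerivAt.comp x (h.hasFDerivAt x)
  have h2 := hs.contDiffAt.hasStrictFDerivAt' h1 (by simp)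
  have h3 : A.comp (omegaL (Z x)) = matL (siegelB (Z x))⁻¹ := by
    ext u i
    simp [A, omegaL_apply, matL]
  rwa [h3] at h2

/-- The derivative of Im ψ is Im Ω = B⁻¹, which is invertible, so Im ψ is open. -/
lemma IsPotential.map_nhds_imv (h : IsPotential Z ψ φ) (x : Rn n) :
    map (imv ψ) (𝓝 x) = 𝓝 (imv ψ x) := by
  refine (h.hasStrictFDerivAt_imv x).map_nhds_eq_of_surj (LinearMap.range_eq_top.2 fun u => ?_)
  refine ⟨siegelB (Z x) *ᵥ u, ?_⟩
  change (siegelB (Z x))⁻¹ *ᵥ (siegelB (Z x) *ᵥ u) = u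
  rw [Matrix.mulVec_mulVec, Matrix.nonsing_inv_mul _ (h.siegel x).isUnit_det_B, Matrix.one_mulVec]

/-- The terms `κ_m eBase_m` are bounded locally uniformly. -/
def Tame (ψ : Rn n → Fin n → ℂ) (κ : (Fin n → ℤ) → ℂ) : Prop :=
  ∀ x, ∃ C, ∀ᶠ ξ in 𝓝 x, ∀ m,
    ‖κ m‖ * Real.exp (2 * Real.pi * ((fun i => (m i : ℝ)) ⬝ᵥ imv ψ ξ)) ≤ C

/-- Bounds near x hold for all values of Im ψ in a ball, since Im ψ is open. Moving the value by w
in the direction of the signs of m multiplies the term by exp(2π m·w), and boundedness there gives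
decay at the original point. -/
lemma Tame.decay (h : IsPotential Z ψ φ) (hκ : Tame ψ κ) (x : Rn n) :
    ∃ C, ∃ ε > 0, ∀ᶠ ξ in 𝓝 x, ∀ m,
      ‖κ m‖ * Real.exp (2 * Real.pi * ((fun i => (m i : ℝ)) ⬝ᵥ imv ψ ξ))
        ≤ C * Real.exp (-ε * ell m) := by
  obtain ⟨C, hC⟩ := hκ x
  have h1 : imv ψ '' {ξ | ∀ m, ‖κ m‖ * Real.exp (2 * Real.pi
      * ((fun i => (m i : ℝ)) ⬝ᵥ imv ψ ξ)) ≤ C} ∈ 𝓝 (imv ψ x) := by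
    rw [← h.map_nhds_imv]
    exact image_mem_map hC
  obtain ⟨r, hr, hb⟩ := Metric.mem_nhds_iff.1 h1
  have h2 : ∀ᶠ ξ in 𝓝 x, imv ψ ξ ∈ Metric.ball (imv ψ x) (r / 2) :=
    (h.hasStrictFDerivAt_imv x).continuousAt.preimage_mem_nhds
      (Metric.ball_mem_nhds _ (by positivity))
  refine ⟨C, 2 * Real.pi * (r / 2), by positivity, ?_⟩
  filter_upwards [h2] with ξ hξ m
  -- With this choice m·w = (r/2)|m| while ‖w‖ ≤ r/2, so the displaced value stays in the ball of
  -- radius r.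
  set w : Rn n := fun i => (r / 2) * SignType.sign (m i : ℝ) with hw
  have hwn : ‖w‖ ≤ r / 2 := by
    refine (pi_norm_le_iff_of_nonneg (by positivity)).2 fun i => ?_
    rw [hw, norm_mul, Real.norm_of_nonneg (by positivity : 0 ≤ r / 2)]
    refine mul_le_of_le_one_right (by positivity) ?_
    rcases lt_trichotomy (m i : ℝ) 0 with h | h | h <;> simp [h]
  have h3 : imv ψ ξ + w ∈ Metric.ball (imv ψ x) r := by
    rw [mem_ball_iff_norm] at hξ ⊢
    calc ‖imv ψ ξ + w - imv ψ x‖ = ‖(imv ψ ξ - imv ψ x) + w‖ := by rw [add_sub_right_comm]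
      _ ≤ ‖imv ψ ξ - imv ψ x‖ + ‖w‖ := norm_add_le _ _
      _ < r := by linarith
  obtain ⟨ξ', h4, h5⟩ := hb h3
  have h6 := h4 m
  have h7 : (fun i => (m i : ℝ)) ⬝ᵥ w = r / 2 * ell m := by
    rw [dotProduct, ell, Finset.mul_sum]
    refine Finset.sum_congr rfl fun i _ => ?_
    rw [hw, mul_left_comm, mul_comm (m i : ℝ), sign_mul_self]
  rw [h5, dotProduct_add, h7, mul_add, Real.exp_add, ← mul_assoc] at h6
  have h8 : Real.exp (2 * Real.pi * (r / 2 * ell m)) * Real.exp (-(2 * Real.pi * (r / 2)) * ell m)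
      = 1 := by
    rw [← Real.exp_add]
    ring_nf
    exact Real.exp_zero
  have h9 := mul_le_mul_of_nonneg_right h6 (Real.exp_pos (-(2 * Real.pi * (r / 2)) * ell m)).le
  rwa [mul_assoc, h8, mul_one] at h9

lemma Tame.exists_bound (h : IsPotential Z ψ φ) (hκ : Tame ψ κ) (z₀ : Rn n × Rn n) :
    ∃ u : (Fin n → ℤ) → ℝ, Summable u ∧
      ∀ᶠ z in 𝓝 z₀, ∀ m, ‖κ m * eBase N ψ φ m z‖ ≤ u m := by
  obtain ⟨C, ε, hε, hC⟩ := hκ.decay h z₀.1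
  set E : Rn n → ℝ := fun x => ‖Complex.exp (2 * Real.pi * Complex.I * (N * φ x))‖
  have hE : Continuous E := by
    have := h.smooth'.continuous
    fun_prop
  have h1 : ∀ᶠ x in 𝓝 z₀.1, E x < E z₀.1 + 1 :=
    hE.continuousAt.eventually_lt continuousAt_const (by linarith)
  refine ⟨fun m => (E z₀.1 + 1) * (C * Real.exp (-ε * ell m)),
    ((summable_exp_neg_ell hε n).mul_left C).mul_left _, ?_⟩
  filter_upwards [continuousAt_fst.eventually (hC.and h1)] with z hz m
  rw [norm_mul, norm_eBase, mul_left_comm]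
  exact mul_le_mul hz.2.le (hz.1 m) (by positivity) (by positivity)

lemma Tame.summable (h : IsPotential Z ψ φ) (hκ : Tame ψ κ) (z : Rn n × Rn n) :
    Summable fun m => ‖κ m * eBase N ψ φ m z‖ := by
  obtain ⟨u, hu, hb⟩ := hκ.exists_bound (N := N) h z
  exact hu.of_nonneg_of_le (fun _ => norm_nonneg _) hb.self_of_nhds

lemma Tame.decays (h : IsPotential Z ψ φ) (hκ : Tame ψ κ) (z : Rn n × Rn n) :
    Decays κ fun i => -((cvec n z.2 - ψ z.1) i).im := by
  obtain ⟨C, ε, hε, hC⟩ := hκ.decay h z.1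
  refine ⟨C, ε, hε, fun m => ?_⟩
  convert hC.self_of_nhds m using 6
  simp [imv]

/-- The sum of a tame series is smooth and of type `(1, 0)`. -/
lemma Tame.contDiff_tsum (h : IsPotential Z ψ φ) (hκ : Tame ψ κ) :
    ContDiff ℝ ∞ (fun z => ∑' m, κ m * eBase N ψ φ m z) ∧
      ∀ z, IsHolAt N Z (fun z => ∑' m, κ m * eBase N ψ φ m z) z := by
  set E : Rn n × Rn n → ℂ := fun z => Complex.exp (2 * Real.pi * Complex.I * (N * φ z.1)) with hE
  set S : Rn n × Rn n → Fin n → ℂ := fun z => cvec n z.2 - ψ z.1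
  -- Up to the factor exp(2πi Nφ(x)), the sum is a holomorphic function of ζ = y - ψ(x).
  have heq : (fun z => ∑' m, κ m * eBase N ψ φ m z) = fun z => E z * fseries κ (S z) := by
    ext z
    rw [fseries, ← tsum_mul_left]
    refine tsum_congr fun m => ?_
    rw [eBase_eq, smul_eq_mul]
    ring
  have hEs : ContDiff ℝ ∞ E :=
    (contDiff_const.mul (contDiff_const.mul (h.smooth'.comp contDiff_fst))).cexp
  have hS : ContDiff ℝ ∞ S :=
    ((cvec n).contDiff.comp contDiff_snd).sub (h.smooth.comp contDiff_fst)
  have hS' : ∀ z, HasFDerivAt S ((cvec n).comp (ContinuousLinearMap.snd ℝ _ _)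
      - (omegaL (Z z.1)).comp (ContinuousLinearMap.fst ℝ _ _)) z := fun z =>
    ((cvec n).hasFDerivAt.comp z hasFDerivAt_snd).sub
      ((h.hasFDerivAt z.1).comp z hasFDerivAt_fst)
  rw [heq]
  refine ⟨contDiff_iff_contDiffAt.2 fun z => hEs.contDiffAt.mul ?_, fun z => ?_⟩
  · rw [contDiffAt_infty]
    intro k
    exact ((Decays.contDiffAt k (hκ.decays h z)).restrict_scalars ℝ).comp z
      (hS.contDiffAt.of_le (by exact_mod_cast le_top))
  · rw [isHolAt_iff (h.siegel z.1)]
    intro u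
    -- Complex linearity of g' splits g'(Ω u) into its R and B⁻¹ parts and yields the Cauchy–Riemann
    -- equations.
    obtain ⟨g', hg'⟩ : ∃ g' : (Fin n → ℂ) →L[ℂ] ℂ, HasFDerivAt (fseries κ) g' (S z) :=
      ⟨_, (hκ.decays h z).hasFDerivAt.self_of_nhds⟩
    have h1 : HasFDerivAt (fun z => fseries κ (S z)) _ z :=
      (hg'.restrictScalars ℝ).comp z (hS' z)
    have h2 : HasFDerivAt E _ z := (((((h.smooth'.differentiable (by simp)) z.1).hasFDerivAt.comp z
      hasFDerivAt_fst).const_mul (N : ℂ)).const_mul (2 * Real.pi * Complex.I)).cexp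
    have h3 : HasFDerivAt (fun z => E z * fseries κ (S z)) _ z := h2.mul h1
    rw [h3.fderiv]
    simp only [add_apply, smul_apply, ContinuousLinearMap.comp_apply, sub_apply,
      ContinuousLinearMap.coe_fst', ContinuousLinearMap.coe_snd', smul_eq_mul, h.fderiv',
      ContinuousLinearMap.coe_restrictScalars', map_zero, sub_zero, zero_sub, map_neg]
    have h4 : g' (omegaL (Z z.1) u) = g' (cvec n (siegelR (Z z.1) *ᵥ u))
        + Complex.I * g' (cvec n ((siegelB (Z z.1))⁻¹ *ᵥ u)) := by
      rw [omegaL_apply, map_add, map_smul, smul_eq_mul]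
    have h5 : cdot z.1 (0 : Fin n → ℂ) = 0 := by simp [cdot]
    rw [h4, h5, hE]
    simp only [Function.comp_apply]
    ring

lemma hasFDerivAt_integral_box {G : Rn n × Rn n → ℂ} (hG : ContDiff ℝ 1 G) (w : Rn n × Rn n) :
    HasFDerivAt (fun w : Rn n × Rn n => ∫ y in box (0 : Rn n), G (w.1, w.2 + y))
      (∫ y in box (0 : Rn n), fderiv ℝ G (w.1, w.2 + y)) w := by
  have hG' := hG.continuous_fderiv one_ne_zero
  have hGc := hG.continuous
  obtain ⟨C, hC⟩ := ((isCompact_closedBall w 1).prod (isCompact_Icc (a := (0 : Rn n)) (b := 1)))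
    |>.exists_bound_of_continuousOn (f := fun p => fderiv ℝ G (p.1.1, p.1.2 + p.2))
      (by fun_prop)
  refine hasFDerivAt_integral_of_dominated_of_fderiv_le (μ := volume.restrict (box (0 : Rn n)))
    (F := fun w y => G (w.1, w.2 + y)) (F' := fun w y => fderiv ℝ G (w.1, w.2 + y))
    (bound := fun _ => C)
    (Metric.closedBall_mem_nhds w one_pos) (Eventually.of_forall fun w => ?_) ?_ ?_ ?_ ?_ ?_
  · exact (by fun_prop : Continuous fun y => G (w.1, w.2 + y)).aestronglyMeasurable
  · exact integrableOn_box (by fun_prop) 0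
  · exact (by fun_prop : Continuous fun y => fderiv ℝ G (w.1, w.2 + y)).aestronglyMeasurable
  · rw [ae_restrict_iff' (measurableSet_box 0)]
    refine Eventually.of_forall fun y hy x hx => hC (x, y) ⟨hx, ?_⟩
    have := box_subset_Icc 0 hy
    rwa [zero_add] at this
  · exact integrableOn_const (by rw [volume_box]; exact ENNReal.one_ne_top)
  · refine Eventually.of_forall fun y x _ => ?_
    have h1 : HasFDerivAt (fun w : Rn n × Rn n => (w.1, w.2 + y))
        ((ContinuousLinearMap.fst ℝ _ _).prod (ContinuousLinearMap.snd ℝ _ _)) x :=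
      hasFDerivAt_fst.prodMk (hasFDerivAt_snd.add_const y)
    exact ((hG.differentiable (by simp)) (x.1, x.2 + y)).hasFDerivAt.comp x h1

/-- The Fourier expansion of a function of type `(1, 0)`. -/
theorem IsPotential.exists_fcoef (h : IsPotential Z ψ φ) {F : Rn n × Rn n → ℂ}
    (hF : ContDiff ℝ ∞ F) (hp : ∀ x, IsPeriodic fun y => F (x, y)) (hol : ∀ z, IsHolAt N Z F z)
    (m : Fin n → ℤ) :
    ∃ κ : ℂ, ∀ x, fcoef (fun y => F (x, y)) m = κ * eBase N ψ φ m (x, 0) := by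
  -- Dividing by e_m, which satisfies the same equations, removes their zeroth order term. The
  -- coefficient in question is then the mean of G over the torus times e_m(x, 0).
  set G : Rn n × Rn n → ℂ := fun z => F z * (eBase N ψ φ m z)⁻¹ with hG
  have hGs : ContDiff ℝ ∞ G := hF.mul ((h.contDiff_eBase m).inv fun z => eBase_ne_zero ψ φ m z)
  have hGp : ∀ x, IsPeriodic fun y => G (x, y) := fun x y k => by
    simp only [hG]
    rw [eBase_add_int]
    congr 1
    exact hp x y k
  have hGd : ∀ z u, fderiv ℝ F z u = G z * fderiv ℝ (eBase N ψ φ m) z u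
      + eBase N ψ φ m z * fderiv ℝ G z u := by
    intro z u
    have h1 : HasFDerivAt (fun z => G z * eBase N ψ φ m z) _ z :=
      ((hGs.differentiable (by simp)) z).hasFDerivAt.mul (h.hasFDerivAt_eBase m z).1.hasFDerivAt
    have h2 : F = fun z => G z * eBase N ψ φ m z := by
      ext z
      rw [hG, mul_assoc, inv_mul_cancel₀ (eBase_ne_zero ψ φ m z), mul_one]
    rw [h2, h1.fderiv]
    simp
  have hGz : ∀ z, F z = G z * eBase N ψ φ m z := fun z => by
    rw [hG, mul_assoc, inv_mul_cancel₀ (eBase_ne_zero ψ φ m z), mul_one]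
  have hGh : ∀ z u, fderiv ℝ G z (u, 0) = -fderiv ℝ G z (0, siegelR (Z z.1) *ᵥ u)
      - Complex.I * fderiv ℝ G z (0, (siegelB (Z z.1))⁻¹ *ᵥ u) := by
    intro z u
    have h1 := (isHolAt_iff (h.siegel z.1)).1 (hol z) u
    have h2 := (isHolAt_iff (h.siegel z.1)).1 (h.isHolAt_eBase (N := N) m z) u
    rw [hGd, hGd, hGd, hGz] at h1
    refine mul_left_cancel₀ (eBase_ne_zero (N := N) ψ φ m z) ?_
    linear_combination h1 - G z * h2
  set K : Rn n × Rn n → ℂ := fun w => ∫ y in box (0 : Rn n), G (w.1, w.2 + y) with hK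
  have hKd := hasFDerivAt_integral_box (hGs.of_le (by simp : (1 : WithTop ℕ∞) ≤ ∞))
  have hGc : ∀ w : Rn n × Rn n, Continuous fun y => fderiv ℝ G (w.1, w.2 + y) := fun w =>
    (hGs.continuous_fderiv (by simp)).comp (by fun_prop)
  have hint : ∀ w : Rn n × Rn n, IntegrableOn (fun y => fderiv ℝ G (w.1, w.2 + y)) (box 0) :=
    fun w => integrableOn_box (hGc w) 0
  have hKi : ∀ w u : Rn n × Rn n, (∫ y in box (0 : Rn n), fderiv ℝ G (w.1, w.2 + y)) u
      = ∫ y in box (0 : Rn n), fderiv ℝ G (w.1, w.2 + y) u := fun w u =>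
    ContinuousLinearMap.integral_apply (hint w) u
  have hK0 : ∀ w, K w = K (w.1, 0) := by
    intro w
    have h1 := setIntegral_box_add (hGp w.1) 0 w.2
    simp only [hK, zero_add]
    rw [← h1]
    simp only [add_comm w.2]
  -- The mean K does not depend on y, so vertical derivatives of G have mean zero. By `hGh` so do
  -- horizontal ones, and K is constant.
  have hKv : ∀ (w : Rn n × Rn n) (v : Rn n), ∫ y in box (0 : Rn n), fderiv ℝ G (w.1, w.2 + y) (0, v) = 0 := by
    intro w v
    have h1 : HasFDerivAt (fun v => K (w.1, v)) _ w.2 :=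
      HasFDerivAt.comp (g := K) (f := fun v => (w.1, v)) w.2 (hKd w)
        (hasFDerivAt_prodMk_right w.1 w.2)
    have h2 : HasFDerivAt (fun v => K (w.1, v)) (0 : Rn n →L[ℝ] ℂ) w.2 := by
      have : (fun v => K (w.1, v)) = fun _ => K (w.1, 0) := funext fun v => hK0 (w.1, v)
      rw [this]
      exact hasFDerivAt_const _ _
    have h3 := congrArg (fun A : Rn n →L[ℝ] ℂ => A v) (h1.unique h2)
    rw [← hKi]
    simpa using h3
  have hconst : ∀ w w', K w = K w' := by
    refine is_const_of_fderiv_eq_zero (𝕜 := ℝ) (fun w => (hKd w).differentiableAt) fun w => ?_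
    rw [(hKd w).fderiv]
    refine ContinuousLinearMap.ext fun u => ?_
    have h1 : u = (u.1, 0) + (0, u.2) := by simp
    have h2 : ∫ y in box (0 : Rn n), fderiv ℝ G (w.1, w.2 + y) (u.1, 0) = 0 := by
      simp only [hGh]
      rw [integral_sub, integral_neg, integral_const_mul, hKv, hKv]
      · simp
      · exact (integrableOn_box ((hGc w).clm_apply continuous_const) 0).neg
      · exact (integrableOn_box ((hGc w).clm_apply continuous_const) 0).const_mul _
    rw [h1, map_add, hKi, hKi, h2, hKv]
    simp
  refine ⟨K 0, fun x => ?_⟩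
  rw [hconst 0 (x, 0)]
  simp only [hK, zero_add, fcoef]
  rw [← integral_mul_const]
  refine integral_congr_ae (Eventually.of_forall fun y => ?_)
  simp only [hG]
  rw [eBase_eq_mchar ψ φ m x y, mul_inv, mul_assoc, mul_right_comm,
    inv_mul_cancel₀ (eBase_ne_zero ψ φ m (x, 0)), one_mul, mul_comm (F (x, y))]
  congr 1
  exact eq_inv_of_mul_eq_one_left (mchar_neg_mul m y)

/-- A Fourier coefficient is bounded by the supremum of F on a compact set, so the constants κ_m are
tame. Tameness implies summability of the Fourier coefficients, and Fourier inversion applies. -/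
theorem IsPotential.exists_expansion (h : IsPotential Z ψ φ) {F : Rn n × Rn n → ℂ}
    (hF : ContDiff ℝ ∞ F) (hp : ∀ x, IsPeriodic fun y => F (x, y)) (hol : ∀ z, IsHolAt N Z F z) :
    ∃ κ, Tame ψ κ ∧ ∀ z, HasSum (fun m => κ m * eBase N ψ φ m z) (F z) := by
  choose κ hκ using h.exists_fcoef hF hp hol
  have ht : Tame ψ κ := by
    intro x
    set E : Rn n → ℂ := fun x => Complex.exp (2 * Real.pi * Complex.I * (N * φ x))
    have hE : Continuous E := by
      have := h.smooth'.continuous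
      fun_prop
    have hFc := hF.continuous
    obtain ⟨C, hC⟩ := ((isCompact_closedBall x 1).prod (isCompact_Icc (a := (0 : Rn n)) (b := 1)))
      |>.exists_bound_of_continuousOn (f := fun p => (E p.1)⁻¹ * F p)
        (((hE.comp continuous_fst).inv₀ fun p => Complex.exp_ne_zero _).mul hFc).continuousOn
    refine ⟨C, ?_⟩
    filter_upwards [Metric.closedBall_mem_nhds x one_pos] with ξ hξ m
    have h1 := norm_fcoef_le (f := fun y => (E ξ)⁻¹ * F (ξ, y)) (C := C)
      (fun y hy => hC (ξ, y) ⟨hξ, hy⟩) m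
    have h2 : fcoef (fun y => (E ξ)⁻¹ * F (ξ, y)) m = (E ξ)⁻¹ * fcoef (fun y => F (ξ, y)) m := by
      rw [fcoef, fcoef, ← integral_const_mul]
      congr 1
      ext y
      ring
    rw [h2, hκ, norm_mul, norm_mul, norm_eBase, norm_inv] at h1
    have h3 : ‖E ξ‖ ≠ 0 := norm_ne_zero_iff.2 (Complex.exp_ne_zero _)
    have h4 : ∀ a b : ℝ, ‖E ξ‖⁻¹ * (a * (‖E ξ‖ * b)) = a * b := fun a b => by field_simp
    rwa [h4] at h1
  refine ⟨κ, ht, fun ⟨x, y⟩ => ?_⟩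
  have h1 : Summable (fcoef fun y => F (x, y)) := by
    have h2 := (ht.summable (N := N) h (x, 0)).of_norm
    exact h2.congr fun m => (hκ m x).symm
  have h2 := hasSum_fcoef_mul_mchar (f := fun y => F (x, y))
    (hF.continuous.comp (by fun_prop)) (hp x) h1 y
  convert h2 using 2 with m
  rw [hκ, eBase_eq_mchar ψ φ m x y, mul_assoc]

end Series

/-! ### Sections of `L^{⊗N}` as functions -/

section PowAlg

variable {M : Type*} {L : M → Type*} [∀ p, NormedAddCommGroup (L p)]
  [∀ p, InnerProductSpace ℂ (L p)] {N : ℕ} {p : M}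

lemma pow_smul (c : ℂ) (e : L p) : pow N (c • e) = c ^ N • pow N e := by
  have h := (PiTensorProduct.tprod ℂ (s := fun _ : Fin N => L p)).map_smul_univ (fun _ => c)
    fun _ => e
  simpa [pow] using h

lemma contract_pow (w e : L p) : contract N w (pow N e) = inner ℂ w e ^ N := by
  rw [contract, pow, PiTensorProduct.lift.tprod]
  simp

lemma tprod_update_smul (e : L p) (i : Fin N) (c : ℂ) :
    PiTensorProduct.tprod ℂ (Function.update (fun _ : Fin N => e) i (c • e)) = c • pow N e := by
  rw [MultilinearMap.map_update_smul, Function.update_eq_self, pow]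

lemma pow_ne_zero' {e : L p} (he : e ≠ 0) : pow N e ≠ 0 := by
  intro h
  have h1 := contract_pow (N := N) e e
  rw [h, map_zero] at h1
  exact pow_ne_zero N (inner_self_ne_zero.2 he) h1.symm

variable [TopologicalSpace M] [TopologicalSpace (Bundle.TotalSpace ℂ L)]
  [FiberBundle ℂ L] [VectorBundle ℝ ℂ L]

lemma exists_eq_smul_pow {e : L p} (he : e ≠ 0) (t : Pow L N p) : ∃ c : ℂ, t = c • pow N e := by
  have h : t ∈ Submodule.span ℂ (range (PiTensorProduct.tprod ℂ (s := fun _ : Fin N => L p))) := by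
    rw [PiTensorProduct.span_tprod_eq_top]
    trivial
  induction h using Submodule.span_induction with
  | mem t ht =>
    obtain ⟨v, rfl⟩ := ht
    choose c hc using fun i => exists_smul_eq he (v i)
    refine ⟨∏ i, c i, ?_⟩
    have h := (PiTensorProduct.tprod ℂ (s := fun _ : Fin N => L p)).map_smul_univ c fun _ => e
    rw [funext hc, h, pow]
  | zero => exact ⟨0, by simp⟩
  | add s t _ _ hs ht =>
    obtain ⟨c, rfl⟩ := hs
    obtain ⟨d, rfl⟩ := ht
    exact ⟨c + d, by rw [add_smul]⟩
  | smul r t _ ht =>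
    obtain ⟨c, rfl⟩ := ht
    exact ⟨r * c, by rw [mul_smul]⟩

lemma norm_unitVec : ‖unitVec L p‖ = 1 := by
  have : Nontrivial (L p) := Module.nontrivial_of_finrank_pos (R := ℂ)
    (by rw [finrank_fiber]; exact one_pos)
  obtain ⟨v, hv⟩ := exists_ne (0 : L p)
  refine Classical.epsilon_spec (p := fun w : L p => ‖w‖ = 1) ⟨(‖v‖⁻¹ : ℂ) • v, ?_⟩
  rw [norm_smul, norm_inv, Complex.norm_real, norm_norm, inv_mul_cancel₀ (norm_ne_zero_iff.2 hv)]

lemma hermPow_smul_pow (e : L p) (a b : ℂ) :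
    hermPow N (a • pow N e) (b • pow N e) = (starRingEnd ℂ) a * b * ((‖e‖ ^ 2) ^ N : ℝ) := by
  have hu : unitVec L p ≠ 0 := norm_ne_zero_iff.1 (by rw [norm_unitVec]; exact one_ne_zero)
  obtain ⟨c, rfl⟩ := exists_smul_eq hu e
  have h1 : inner ℂ (unitVec L p) (c • unitVec L p) = c := by
    rw [inner_smul_right, inner_self_eq_norm_sq_to_K, norm_unitVec]
    simp
  rw [hermPow, (contract N (unitVec L p)).map_smul, (contract N (unitVec L p)).map_smul,
    contract_pow, h1, norm_smul, norm_unitVec, mul_one]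
  simp only [smul_eq_mul, map_mul, map_pow]
  push_cast
  rw [← Complex.conj_mul', mul_pow]
  ring

end PowAlg

/-! ### Sections of L^{⊗N} as equivariant functions -/

section Coefficient

variable {n : ℕ} {M B : Type*} [TopologicalSpace M]
  [ChartedSpace (EuclideanSpace ℝ (Fin (2 * n))) M] [TopologicalSpace B]
  {L : M → Type*} [TopologicalSpace (Bundle.TotalSpace ℂ L)]
  [∀ p, NormedAddCommGroup (L p)] [∀ p, InnerProductSpace ℂ (L p)]
  [FiberBundle ℂ L] [VectorBundle ℝ ℂ L]
  {ωM : ∀ p : M, Tan (2 * n) p →L[ℝ] Tan (2 * n) p →L[ℝ] ℝ} {π : M → B}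
  {D : CovariantDerivative (𝓡 (2 * n)) ℂ L} {Δ : Development ωM π D} {N : ℕ}
  {s t : ∀ p, Pow L N p} {F G : Rn n × Rn n → ℂ} {z z' : Rn n × Rn n}

/-- The section `s` of `L^{⊗N}` equals `F(z) τ(z)^{⊗N}` at `Q z`. -/
def CoefAt (Δ : Development ωM π D) (N : ℕ) (s : ∀ p, Pow L N p) (F : Rn n × Rn n → ℂ)
    (z : Rn n × Rn n) : Prop :=
  ∃ e : L (Δ.Q z), Δ.τ z = ⟨Δ.Q z, e⟩ ∧ s (Δ.Q z) = F z • pow N e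

lemma Development.exists_vec (Δ : Development ωM π D) (z : Rn n × Rn n) :
    ∃ e : L (Δ.Q z), Δ.τ z = ⟨Δ.Q z, e⟩ ∧ e ≠ 0 := by
  have h1 := Δ.τ_proj z
  have h2 := Δ.τ_ne_zero z
  generalize Δ.τ z = t at h1 h2
  obtain ⟨p, v⟩ := t
  dsimp only at h1
  subst h1
  exact ⟨v, rfl, h2⟩

lemma coefAt_iff {e : L (Δ.Q z)} (he : Δ.τ z = ⟨Δ.Q z, e⟩) :
    CoefAt Δ N s F z ↔ s (Δ.Q z) = F z • pow N e := by
  refine ⟨?_, fun h => ⟨e, he, h⟩⟩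
  rintro ⟨e', he', h⟩
  have h1 : (⟨Δ.Q z, e⟩ : Bundle.TotalSpace ℂ L) = ⟨Δ.Q z, e'⟩ := he.symm.trans he'
  rw [h, eq_of_heq (Bundle.TotalSpace.mk.inj h1).2]

lemma exists_coefAt (Δ : Development ωM π D) (s : ∀ p, Pow L N p) :
    ∃ F, ∀ z, CoefAt Δ N s F z := by
  have h : ∀ z, ∃ c : ℂ, ∃ e : L (Δ.Q z), Δ.τ z = ⟨Δ.Q z, e⟩ ∧ s (Δ.Q z) = c • pow N e := by
    intro z
    obtain ⟨e, he, hne⟩ := Δ.exists_vec z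
    obtain ⟨c, hc⟩ := exists_eq_smul_pow hne (s (Δ.Q z))
    exact ⟨c, e, he, hc⟩
  choose F hF using h
  exact ⟨F, hF⟩

lemma CoefAt.eq (h : CoefAt Δ N s F z) (h' : CoefAt Δ N t F z) : s (Δ.Q z) = t (Δ.Q z) := by
  obtain ⟨e, he, hne⟩ := Δ.exists_vec z
  rw [(coefAt_iff he).1 h, (coefAt_iff he).1 h']

lemma CoefAt.sub (h : CoefAt Δ N s F z) (h' : CoefAt Δ N t G z) :
    CoefAt Δ N (fun p => s p - t p) (fun z => F z - G z) z := by
  obtain ⟨e, he, hne⟩ := Δ.exists_vec z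
  rw [coefAt_iff he] at h h' ⊢
  rw [h, h', sub_smul]

lemma CoefAt.sum {ι : Type*} {T : Finset ι} {c : ι → ℂ} {ϑ : ι → ∀ p, Pow L N p}
    {Θ : ι → Rn n × Rn n → ℂ} (h : ∀ i ∈ T, CoefAt Δ N (ϑ i) (Θ i) z) :
    CoefAt Δ N (fun p => ∑ i ∈ T, c i • ϑ i p) (fun z => ∑ i ∈ T, c i * Θ i z) z := by
  obtain ⟨e, he, hne⟩ := Δ.exists_vec z
  rw [coefAt_iff he, Finset.sum_smul]
  refine Finset.sum_congr rfl fun i hi => ?_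
  rw [(coefAt_iff he).1 (h i hi), mul_smul]

lemma CoefAt.hermPow (h : CoefAt Δ N s F z) (h' : CoefAt Δ N t G z) :
    LagFib.hermPow N (s (Δ.Q z)) (t (Δ.Q z))
      = (starRingEnd ℂ) (F z) * G z * ((‖(Δ.τ z).snd‖ ^ 2) ^ N : ℝ) := by
  obtain ⟨e, he, hne⟩ := Δ.exists_vec z
  rw [(coefAt_iff he).1 h, (coefAt_iff he).1 h', hermPow_smul_pow]
  have : ‖(Δ.τ z).snd‖ = ‖e‖ := congrArg (fun t : Bundle.TotalSpace ℂ L => ‖t.snd‖) he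
  rw [this]

/-- The transformation behaviour of the coefficient function of a section. -/
def Equivariant (Δ : Development ωM π D) (N : ℕ) (F : Rn n × Rn n → ℂ) : Prop :=
  ∀ z z', Δ.Q z = Δ.Q z' → F z = F z' * lineRatio (Δ.τ z) (Δ.τ z') ^ N

/-- The vector `c t^{⊗N}` of the fibre of `L^{⊗N}` at `p`. -/
def castPow {p : M} (N : ℕ) (t : Bundle.TotalSpace ℂ L) (h : t.proj = p) (c : ℂ) : Pow L N p :=
  h ▸ (c • pow N t.snd)

lemma castPow_smulT {p : M} {t t' : Bundle.TotalSpace ℂ L} {r : ℂ} (ht : t' = smulT r t)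
    (h : t.proj = p) (h' : t'.proj = p) (c : ℂ) :
    castPow N t' h' c = castPow N t h (c * r ^ N) := by
  subst ht h
  change c • pow N (r • t.snd) = (c * r ^ N) • pow N t.snd
  rw [pow_smul, smul_smul]

lemma castPow_mk {t : Bundle.TotalSpace ℂ L} {p : M} {e : L p} (ht : t = ⟨p, e⟩) (h : t.proj = p)
    (c : ℂ) : castPow N t h c = c • pow N e := by
  subst ht; rfl

/-- Two points over the same p express one vector by frames that differ by the line ratio. The
vector is carried between the equal fibres by `castPow`. -/
lemma CoefAt.equivariant (h : ∀ z, CoefAt Δ N s F z) : Equivariant Δ N F := by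
  intro z z' hz
  have h1 : ∀ z, s (Δ.Q z) = castPow N (Δ.τ z) (Δ.τ_proj z) (F z) := fun z => by
    obtain ⟨e, he, hs⟩ := h z
    rw [hs, castPow_mk he]
  have h2 : ∀ {p : M} (hp : Δ.Q z' = p) (h' : (Δ.τ z').proj = p),
      s p = castPow N (Δ.τ z') h' (F z') := by
    rintro p rfl h'
    exact h1 z'
  have h3 := h2 hz.symm ((Δ.τ_proj z').trans hz.symm)
  rw [castPow_smulT (smulT_lineRatio (Δ.τ_ne_zero z) (Δ.proj_eq hz)).symm (Δ.τ_proj z)] at h3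
  obtain ⟨e, he, hne⟩ := Δ.exists_vec z
  rw [castPow_mk he, (coefAt_iff he).1 (h z)] at h3
  exact smul_left_injective ℂ (pow_ne_zero' hne) h3

/-- At each p an arbitrary preimage in O defines the vector, and compatibility makes the choice
immaterial. Where there is no preimage the value is 0. Small sets O give local sections and sections
over a single fibre without equivariance under Γ. -/
lemma exists_section_on {O : Set (Rn n × Rn n)}
    (hF : ∀ z ∈ O, ∀ z' ∈ O, Δ.Q z = Δ.Q z' → F z = F z' * lineRatio (Δ.τ z) (Δ.τ z') ^ N) :
    ∃ s : ∀ p, Pow L N p, ∀ z ∈ O, CoefAt Δ N s F z := by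
  classical
  refine ⟨fun p => if h : ∃ z, z ∈ O ∧ (Δ.τ z).proj = p then
    castPow N (Δ.τ h.choose) h.choose_spec.2 (F h.choose) else 0, fun z hz => ?_⟩
  have hex : ∃ w, w ∈ O ∧ (Δ.τ w).proj = Δ.Q z := ⟨z, hz, Δ.τ_proj z⟩
  obtain ⟨e, he, hne⟩ := Δ.exists_vec z
  rw [coefAt_iff he, dif_pos hex]
  have hQ : Δ.Q z = Δ.Q hex.choose := by rw [← Δ.τ_proj hex.choose, hex.choose_spec.2]
  rw [castPow_smulT (smulT_lineRatio (Δ.τ_ne_zero z) (Δ.proj_eq hQ)).symm (Δ.τ_proj z),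
    castPow_mk he, ← hF z hz _ hex.choose_spec.1 hQ]

lemma Development.lineRatio_self (Δ : Development ωM π D) (z : Rn n × Rn n) :
    lineRatio (Δ.τ z) (Δ.τ z) = 1 :=
  lineRatio_eq (Δ.τ_ne_zero _) (by rw [smulT, one_smul])

lemma Equivariant.isPeriodic (hF : Equivariant Δ N F) (x : Rn n) :
    IsPeriodic fun y => F (x, y) := by
  intro y k
  have h1 := Δ.τ_periodic x y k
  change Δ.τ (x, y + fun i => (k i : ℝ)) = _ at h1
  have h2 := hF _ _ (Δ.actionAngle.add_int x y k)
  rw [h1, Δ.lineRatio_self, one_pow, mul_one] at h2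
  exact h2

lemma equivariant_theta (Z : Rn n → Matrix (Fin n) (Fin n) ℂ) (m : Fin n → ℤ) :
    Equivariant Δ N fun z => ∑' γ : Deck Δ.q, thetaTerm Δ N Z m γ z := by
  intro z z' h
  obtain ⟨δ, hδ⟩ := thetaTerm_of_eq (N := N) (Z := Z) (m := m) Δ h
  dsimp only
  rw [← (deckMulEquiv δ).tsum_eq, ← tsum_mul_right]
  exact tsum_congr hδ

lemma Development.exists_Q (Δ : Development ωM π D) (hq : Function.Surjective Δ.q) (p : M) :
    ∃ z, Δ.Q z = p := by
  obtain ⟨x, hx⟩ := hq (π p)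
  obtain ⟨y, hy⟩ := Δ.actionAngle.surjective x trivial p hx.symm
  exact ⟨_, hy⟩

end Coefficient

/-! ### Covariant derivatives and holomorphy in terms of coefficient functions -/

section CovDeriv

variable {n : ℕ} {M B : Type*} [TopologicalSpace M]
  [ChartedSpace (EuclideanSpace ℝ (Fin (2 * n))) M] [TopologicalSpace B]
  {L : M → Type*} [TopologicalSpace (Bundle.TotalSpace ℂ L)]
  [∀ p, NormedAddCommGroup (L p)] [∀ p, InnerProductSpace ℂ (L p)]
  [FiberBundle ℂ L] [VectorBundle ℝ ℂ L]
  {ωM : ∀ p : M, Tan (2 * n) p →L[ℝ] Tan (2 * n) p →L[ℝ] ℝ} {π : M → B}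
  {D : CovariantDerivative (𝓡 (2 * n)) ℂ L} {Δ : Development ωM π D} {N : ℕ}
  {s : ∀ p, Pow L N p} {F : Rn n × Rn n → ℂ} {z : Rn n × Rn n}
  [IsManifold (𝓡 (2 * n)) ∞ M] [ContMDiffVectorBundle ∞ ℂ L (𝓡 (2 * n))]

/-- The covariant derivative of a section in terms of its coefficient function. -/
lemma HasCovDeriv.coef (hD : IsPrequantum ωM D) (hs : ∀ᶠ w in 𝓝 z, CoefAt Δ N s F w)
    {A : Tan (2 * n) (Δ.Q z) → Pow L N (Δ.Q z)} (h : HasCovDeriv D N s (Δ.Q z) A)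
    {v : L (Δ.Q z)} (hv : Δ.τ z = ⟨Δ.Q z, v⟩) :
    ContDiffAt ℝ ∞ F z ∧ ∀ u, A (dQ Δ.Q z u) = nab N F z u • pow N v := by
  obtain ⟨U, e, f, hU, hzU, he, hne, hf, hsf, hA⟩ := h
  obtain ⟨U₀, e₀, W, hU₀, he₀, hW, hz, hc⟩ := Δ.τ_conn z
  have hne₀ : ∀ w ∈ W, e₀ (Δ.Q w) ≠ 0 := fun w hw =>
    snd_ne_zero_of_eq (Δ.τ_ne_zero w) (hc w hw).2.1
  have hUo : IsOpen ((U₀ ∩ {p | e₀ p ≠ 0}) ∩ U) := (hD.isOpen_ne_zero hU₀ he₀).inter hU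
  have hzo : Δ.Q z ∈ (U₀ ∩ {p | e₀ p ≠ 0}) ∩ U := ⟨⟨(hc z hz).1, hne₀ z hz⟩, hzU⟩
  have hQc := Δ.actionAngle.contMDiff
  have hQz : MDifferentiableAt 𝓘(ℝ, Rn n × Rn n) (𝓡 (2 * n)) Δ.Q z :=
    hQc.mdifferentiable (by simp) z
  choose θ hθ using fun u => exists_smul_eq (hne _ hzU) (D e (Δ.Q z) (dQ Δ.Q z u))
  have he' : SmoothSec (2 * n) ((U₀ ∩ {p | e₀ p ≠ 0}) ∩ U) e := ContMDiffOn.mono he inter_subset_right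
  have he₀' : SmoothSec (2 * n) ((U₀ ∩ {p | e₀ p ≠ 0}) ∩ U) e₀ :=
    ContMDiffOn.mono he₀ (inter_subset_left.trans inter_subset_left)
  obtain ⟨h1, h2⟩ := hD.hasFDerivAt_coef hUo he₀' (fun p hp => hp.1.2) he' hQz hzo (hc z hz).2.2 hθ
  set r : Rn n × Rn n → ℂ := fun w => LagFib.coef (e₀ (Δ.Q w)) (e (Δ.Q w)) with hr
  have hrs : ContDiffAt ℝ ∞ r z :=
    (((hD.contMDiffOn_coef hUo he₀' (fun p hp => hp.1.2) he').contMDiffAt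
      (hUo.mem_nhds hzo)).comp z (hQc z)).contDiffAt
  have hfs : ContDiffAt ℝ ∞ (fun w => f (Δ.Q w)) z :=
    ((hf.contMDiffAt (hU.mem_nhds hzU)).comp z (hQc z)).contDiffAt
  have hFe : F =ᶠ[𝓝 z] fun w => f (Δ.Q w) * r w ^ N := by
    filter_upwards [hs, hW.mem_nhds hz,
      hQc.continuous.continuousAt.preimage_mem_nhds (hUo.mem_nhds hzo)] with w hw hwW hwU
    have h3 := (coefAt_iff (hc w hwW).2.1).1 hw
    rw [hsf _ hwU.2, ← coef_smul_self hwU.1.2 (e (Δ.Q w)), pow_smul, smul_smul] at h3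
    exact (smul_left_injective ℂ (pow_ne_zero' hwU.1.2) h3).symm
  refine ⟨(hfs.mul (hrs.pow N)).congr_of_eventuallyEq hFe, fun u => ?_⟩
  have hvz : v = e₀ (Δ.Q z) :=
    eq_of_heq (Bundle.TotalSpace.mk.inj (hv.symm.trans (hc z hz).2.1)).2
  have h4 : HasFDerivAt (fun w => f (Δ.Q w) * r w ^ N) _ z :=
    (hfs.differentiableAt (by simp)).hasFDerivAt.mul (h1.hasFDerivAt.pow N)
  have h5 : (N : ℂ) * r z ^ (N - 1) * r z = N * r z ^ N := by
    rcases Nat.eq_zero_or_pos N with hN | hN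
    · simp [hN]
    · rw [mul_assoc, ← pow_succ, Nat.sub_add_cancel hN]
  have h6 : nab N F z u = (mvfderiv (𝓡 (2 * n)) f (Δ.Q z) (dQ Δ.Q z u) + N * f (Δ.Q z) * θ u)
      * r z ^ N := by
    rw [nab, hFe.fderiv_eq, h4.fderiv, hFe.self_of_nhds]
    simp only [add_apply, smul_apply, smul_eq_mul, nsmul_eq_mul]
    have h7 := h2 u
    rw [fderiv_comp_coord hQz ((hf.contMDiffAt (hU.mem_nhds hzU)).mdifferentiableAt (by simp))]
    have h8 : fderiv ℝ r z u = (θ u - connForm id z u) * r z := h7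
    rw [h8]
    linear_combination (f (Δ.Q z) * (θ u - connForm id z u)) * h5
  rw [hA, h6, hθ, mul_smul _ _ (pow N v), ← pow_smul, hvz]
  have h9 : r z • e₀ (Δ.Q z) = e (Δ.Q z) := coef_smul_self (hne₀ z hz) _
  rw [h9]
  simp only [tprod_update_smul]
  rw [Finset.sum_const, Finset.card_univ, Fintype.card_fin, ← Nat.cast_smul_eq_nsmul ℂ, smul_smul,
    smul_smul, ← add_smul]
  congr 1
  ring

lemma exists_hasCovDeriv (hD : IsPrequantum ωM D)
    (hs : ∀ᶠ w in 𝓝 z, CoefAt Δ N s F w ∧ ContDiffAt ℝ ∞ F w) :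
    ∃ A, HasCovDeriv D N s (Δ.Q z) A := by
  obtain ⟨U₀, e₀, W, hU₀, he₀, hW, hz, hc⟩ := Δ.τ_conn z
  obtain ⟨r, hr, R, hb, hR⟩ := Δ.actionAngle.exists_localInverse_ball (inter_mem hs (hW.mem_nhds hz))
  refine ⟨_, Δ.Q '' Metric.ball z r, e₀, fun p => F (R p), hR.isOpen_image,
    ⟨z, Metric.mem_ball_self hr, rfl⟩, ContMDiffOn.mono he₀ ?_, ?_, ?_, ?_, fun v => rfl⟩
  · rintro p ⟨w, hw, rfl⟩
    exact (hc w (hb hw).2).1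
  · rintro p ⟨w, hw, rfl⟩
    exact snd_ne_zero_of_eq (Δ.τ_ne_zero w) (hc w (hb hw).2).2.1
  · rintro p ⟨w, hw, rfl⟩
    refine ContMDiffAt.contMDiffWithinAt ?_
    have h1 : ContDiffAt ℝ ∞ F (R (Δ.Q w)) := by
      rw [hR.left_inv w hw]
      exact (hb hw).1.2
    exact h1.contMDiffAt.comp (Δ.Q w) (hR.contMDiffAt_inv hw)
  · rintro p ⟨w, hw, rfl⟩
    dsimp only
    rw [hR.left_inv w hw]
    exact (coefAt_iff (hc w (hb hw).2).2.1).1 (hb hw).1.1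

variable {J : ∀ p : M, Tan (2 * n) p →L[ℝ] Tan (2 * n) p} {Z : Rn n → Matrix (Fin n) (Fin n) ℂ}

omit [IsManifold (𝓡 (2 * n)) ∞ M] [ContMDiffVectorBundle ∞ ℂ L (𝓡 (2 * n))] in
lemma IsActionAngle.dQ_surjective {q : Rn n → B} {Q : Rn n × Rn n → M}
    (hQ : IsActionAngle ωM π univ q Q) (z : Rn n × Rn n) (v : Tan (2 * n) (Q z)) :
    ∃ u, dQ Q z u = v :=
  ⟨_, (hQ.isInvertible_dQ (z := z) trivial).self_apply_inverse v⟩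

/-- Holomorphic sections in terms of their coefficient functions. -/
theorem isHolomorphicSection_iff (hD : IsPrequantum ωM D) (hq : Function.Surjective Δ.q)
    (hZ : IsSiegelMap J univ Δ.Q Z) (hs : ∀ z, CoefAt Δ N s F z) :
    IsHolomorphicSection J D N s ↔ ContDiff ℝ ∞ F ∧ ∀ z, IsHolAt N Z F z := by
  constructor
  · intro h
    have hz : ∀ z, ContDiffAt ℝ ∞ F z ∧ IsHolAt N Z F z := by
      intro z
      obtain ⟨A, hA, hJA⟩ := h (Δ.Q z)
      obtain ⟨v, hv, hne⟩ := Δ.exists_vec z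
      obtain ⟨h1, h2⟩ := hA.coef hD (Eventually.of_forall hs) hv
      refine ⟨h1, fun u => ?_⟩
      have h3 := hJA (dQ Δ.Q z u)
      rw [(hZ z.1 trivial).2 z u rfl, h2, h2, smul_smul] at h3
      exact smul_left_injective ℂ (pow_ne_zero' hne) h3
    exact ⟨contDiff_iff_contDiffAt.2 fun z => (hz z).1, fun z => (hz z).2⟩
  · rintro ⟨h, hol⟩ p
    obtain ⟨z, rfl⟩ := Δ.exists_Q hq p
    obtain ⟨A, hA⟩ := exists_hasCovDeriv (Δ := Δ) (N := N) (s := s) (F := F) (z := z) hD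
      (Eventually.of_forall fun w => ⟨hs w, h.contDiffAt⟩)
    refine ⟨A, hA, fun v => ?_⟩
    obtain ⟨e, he, hne⟩ := Δ.exists_vec z
    obtain ⟨-, h2⟩ := hA.coef hD (Eventually.of_forall hs) he
    obtain ⟨u, rfl⟩ := Δ.actionAngle.dQ_surjective z v
    rw [(hZ z.1 trivial).2 z u rfl, h2, h2, hol z u, smul_smul]

end CovDeriv

/-! ### Bohr–Sommerfeld points -/

section BohrSommerfeld

/-- The equation forces g to be a multiple of exp(2πi l·y), and comparing values at unit shifts
makes l integral. -/
lemma exists_int_of_periodic {n : ℕ} {g : Rn n → ℂ} {l y₀ : Rn n}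
    (hd : ∀ y, DifferentiableAt ℝ g y ∧ ∀ v, fderiv ℝ g y v
      = 2 * Real.pi * Complex.I * ((l ⬝ᵥ v : ℝ) : ℂ) * g y)
    (hp : IsPeriodic g) (h0 : g y₀ ≠ 0) : ∃ m : Fin n → ℤ, l = fun i => (m i : ℝ) := by
  let A : Rn n →L[ℝ] ℂ := LinearMap.toContinuousLinearMap
    { toFun := fun y => -(2 * Real.pi * Complex.I) * ((l ⬝ᵥ y : ℝ) : ℂ)
      map_add' := fun u v => by simp; ring
      map_smul' := fun c u => by simp; ring }
  have hA : ∀ y, A y = -(2 * Real.pi * Complex.I) * ((l ⬝ᵥ y : ℝ) : ℂ) := fun y => rfl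
  have hd' : ∀ y, HasFDerivAt (fun y => g y * Complex.exp (A y)) (0 : Rn n →L[ℝ] ℂ) y := by
    intro y
    have h3 : HasFDerivAt (fun y => g y * Complex.exp (A y)) _ y :=
      (hd y).1.hasFDerivAt.mul A.hasFDerivAt.cexp
    refine h3.congr_fderiv (ContinuousLinearMap.ext fun v => ?_)
    simp only [add_apply, smul_apply, smul_eq_mul, (hd y).2, hA, zero_apply]
    ring
  have hint : ∀ i, ∃ k : ℤ, l i = k := by
    intro i
    set e : Rn n := fun j => ((Pi.single i 1 : Fin n → ℤ) j : ℝ) with he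
    have h1 := is_const_of_fderiv_eq_zero (𝕜 := ℝ) (fun y => (hd' y).differentiableAt)
      (fun y => (hd' y).fderiv) (y₀ + e) y₀
    rw [show g (y₀ + e) = g y₀ from hp y₀ _] at h1
    have h2 := mul_left_cancel₀ h0 h1
    obtain ⟨k, hk⟩ := Complex.exp_eq_exp_iff_exists_int.1 h2
    have h3 : l ⬝ᵥ e = l i := by
      rw [dotProduct, Finset.sum_eq_single i (fun j _ hj => by simp [he, hj]) (by simp)]
      simp [he]
    rw [map_add, add_right_inj, hA, h3] at hk
    refine ⟨-k, ?_⟩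
    have h4 : ((l i : ℝ) : ℂ) = ((-k : ℤ) : ℂ) := by
      refine mul_left_cancel₀ Complex.two_pi_I_ne_zero ?_
      push_cast
      linear_combination -hk
    exact_mod_cast h4
  choose m hm using hint
  exact ⟨m, funext hm⟩

lemma latticePt_injective {n N : ℕ} (hN : 0 < N) :
    Function.Injective (latticePt (n := n) N) := by
  intro m m' h
  ext i
  have h1 := congrFun h i
  have hN' : (N : ℝ) ≠ 0 := by exact_mod_cast hN.ne'
  simp only [latticePt] at h1
  rw [div_left_inj' hN'] at h1
  exact_mod_cast h1

lemma hasFDerivAt_mchar_snd {n : ℕ} (m : Fin n → ℤ) (z : Rn n × Rn n) :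
    ContDiffAt ℝ ∞ (fun z : Rn n × Rn n => mchar m z.2) z ∧
    ∀ u, fderiv ℝ (fun z : Rn n × Rn n => mchar m z.2) z u = 2 * Real.pi * Complex.I
      * (((fun i => (m i : ℝ)) ⬝ᵥ u.2 : ℝ) : ℂ) * mchar m z.2 := by
  set A : Rn n × Rn n →L[ℝ] ℂ := ((cdotL n).flip (fun i => (m i : ℝ))).comp
    ((cvec n).comp (ContinuousLinearMap.snd ℝ (Rn n) (Rn n)))
  have h2 : HasFDerivAt (fun z : Rn n × Rn n => mchar m z.2) _ z :=
    (A.hasFDerivAt.const_mul (2 * Real.pi * Complex.I)).cexp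
  refine ⟨(contDiff_const.mul A.contDiff).cexp.contDiffAt, fun u => ?_⟩
  rw [h2.fderiv, ← cdot_cvec]
  simp only [smul_apply, smul_eq_mul, mchar]
  change Complex.exp (2 * Real.pi * Complex.I * cdot (fun i => (m i : ℝ)) (cvec n z.2))
    * (2 * Real.pi * Complex.I * cdot (fun i => (m i : ℝ)) (cvec n u.2)) = _
  ring

variable {n : ℕ} {M B : Type*} [TopologicalSpace M]
  [ChartedSpace (EuclideanSpace ℝ (Fin (2 * n))) M] [TopologicalSpace B]
  {L : M → Type*} [TopologicalSpace (Bundle.TotalSpace ℂ L)]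
  [∀ p, NormedAddCommGroup (L p)] [∀ p, InnerProductSpace ℂ (L p)]
  [FiberBundle ℂ L] [VectorBundle ℝ ℂ L]
  {ωM : ∀ p : M, Tan (2 * n) p →L[ℝ] Tan (2 * n) p →L[ℝ] ℝ} {π : M → B}
  {D : CovariantDerivative (𝓡 (2 * n)) ℂ L} {Δ : Development ωM π D} {N : ℕ}
  [IsManifold (𝓡 (2 * n)) ∞ M] [ContMDiffVectorBundle ∞ ℂ L (𝓡 (2 * n))]
  [ChartedSpace (EuclideanSpace ℝ (Fin n)) B]

/-- The section is exp(2πi m·y) τ^N. Its vertical covariant derivative has the factor 2πi (m - Nx),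
which vanishes at x = m/N. -/
lemma latticePt_mem_bohrSommerfeld (hD : IsPrequantum ωM D) (hN : 0 < N) (m : Fin n → ℤ) :
    Δ.q (latticePt N m) ∈ bohrSommerfeld π D N := by
  set x := latticePt N m with hx
  set F : Rn n × Rn n → ℂ := fun z => mchar m z.2 with hF
  -- Two preimages with the same base point x differ by an integral shift of y, so the function is
  -- consistent over this fibre.
  obtain ⟨s, hs⟩ := exists_section_on (Δ := Δ) (N := N) (F := F) (O := {z | z.1 = x}) (by
    rintro ⟨x₁, y⟩ h ⟨x₂, y'⟩ h' hQ
    obtain rfl : x₁ = x := h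
    obtain rfl : x₂ = x := h'
    obtain ⟨k, hk⟩ := Δ.actionAngle.exists_add_int hQ rfl
    have h1 := Δ.τ_periodic x y k
    change Δ.τ (x, y + fun i => (k i : ℝ)) = _ at h1
    rw [hk, h1, Δ.lineRatio_self, one_pow, mul_one]
    exact (isPeriodic_mchar m y k).symm)
  have hpi : ∀ z, π (Δ.Q z) = Δ.q z.1 := fun z => Δ.actionAngle.proj z.1 trivial z.2
  refine ⟨s, ⟨Δ.Q (x, 0), hpi _, ?_⟩, fun p hp => ?_⟩
  · obtain ⟨e, he, hne⟩ := Δ.exists_vec (x, 0)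
    rw [(coefAt_iff he).1 (hs (x, 0) rfl)]
    exact smul_ne_zero (Complex.exp_ne_zero _) (pow_ne_zero' hne)
  obtain ⟨y, rfl⟩ := Δ.actionAngle.surjective x trivial p hp
  obtain ⟨O, hO, hqO⟩ := exists_nhds_injOn Δ.covering x
  obtain ⟨r, hr, R, hb, hR⟩ := Δ.actionAngle.exists_localInverse_ball (z := (x, y))
    (continuousAt_fst.preimage_mem_nhds hO)
  -- The same function on a ball on which Q is injective extends the section to an open set, where
  -- it can be differentiated.
  obtain ⟨σ, hσ⟩ := exists_section_on (Δ := Δ) (N := N) (F := F) (O := Metric.ball (x, y) r) (by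
    intro z hz z' hz' hQ
    have h1 : z = z' := by rw [← hR.left_inv z hz, ← hR.left_inv z' hz', hQ]
    rw [h1, Δ.lineRatio_self, one_pow, mul_one])
  refine ⟨Δ.Q '' Metric.ball (x, y) r, σ, hR.isOpen_image, ⟨_, Metric.mem_ball_self hr, rfl⟩, ?_⟩
  rintro p ⟨w, hw, rfl⟩
  have hwx : π (Δ.Q w) = Δ.q x → w.1 = x := fun h =>
    hqO (hb hw) (mem_of_mem_nhds hO) ((hpi w).symm.trans h)
  refine ⟨fun h => (hσ w hw).eq (hs w (hwx h)), ?_⟩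
  have hev : ∀ᶠ w' in 𝓝 w, CoefAt Δ N σ F w' := by
    filter_upwards [hR.isOpen.mem_nhds hw] with w' hw' using hσ w' hw'
  obtain ⟨A, hA⟩ := exists_hasCovDeriv (Δ := Δ) (N := N) (s := σ) (F := F) (z := w) hD
    (by filter_upwards [hev] with w' hw' using ⟨hw', (hasFDerivAt_mchar_snd m w').1⟩)
  refine ⟨A, hA, fun h v _ => ?_⟩
  obtain ⟨e, he, hne⟩ := Δ.exists_vec w
  obtain ⟨u, rfl⟩ := Δ.actionAngle.dQ_surjective w v
  rw [(hA.coef hD hev he).2 u, nab, hF, (hasFDerivAt_mchar_snd m w).2, connForm, id, hwx h]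
  have h1 : (fun i => (m i : ℝ)) ⬝ᵥ u.2 = N * (x ⬝ᵥ u.2) := by
    rw [hx, ← smul_eq_mul, ← smul_dotProduct]
    congr 1
    ext i
    simp only [Pi.smul_apply, latticePt, smul_eq_mul]
    field_simp
  have h2 : 2 * Real.pi * Complex.I * (((fun i => (m i : ℝ)) ⬝ᵥ u.2 : ℝ) : ℂ) * mchar m w.2
      + N * (-(2 * Real.pi * Complex.I) * ((x ⬝ᵥ u.2 : ℝ) : ℂ)) * mchar m w.2 = 0 := by
    rw [h1]
    push_cast
    ring
  rw [h2, zero_smul]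

variable [IsManifold (𝓡 n) ∞ B]

/-- Flatness along the fibre says that the coefficient has logarithmic derivative 2πi N x·dy. As it
is periodic and nonzero somewhere, Nx is integral. -/
lemma exists_latticePt_of_mem_bohrSommerfeld (hD : IsPrequantum ωM D) (hN : 0 < N)
    (hπ : ContMDiff (𝓡 (2 * n)) (𝓡 n) ∞ π) {x : Rn n}
    (hx : Δ.q x ∈ bohrSommerfeld π D N) : ∃ m, latticePt N m = x := by
  obtain ⟨s, ⟨p₀, hp₀, hs₀⟩, hs⟩ := hx
  obtain ⟨F, hF⟩ := exists_coefAt Δ s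
  have hpi : ∀ z, π (Δ.Q z) = Δ.q z.1 := fun z => Δ.actionAngle.proj z.1 trivial z.2
  obtain ⟨y₀, rfl⟩ := Δ.actionAngle.surjective x trivial p₀ hp₀
  have h0 : F (x, y₀) ≠ 0 := by
    intro h
    obtain ⟨e, he, hne⟩ := Δ.exists_vec (x, y₀)
    rw [(coefAt_iff he).1 (hF _), h, zero_smul] at hs₀
    exact hs₀ rfl
  obtain ⟨m, hm⟩ := exists_int_of_periodic (g := fun y => F (x, y)) (l := (N : ℝ) • x) (y₀ := y₀)
    (fun y => by
      obtain ⟨U, σ, hU, hyU, hσ⟩ := hs (Δ.Q (x, y)) (hpi _)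
      obtain ⟨G, hG⟩ := exists_coefAt Δ σ
      obtain ⟨hσs, A, hA, hA0⟩ := hσ _ hyU
      obtain ⟨e, he, hne⟩ := Δ.exists_vec (x, y)
      obtain ⟨hGs, hGA⟩ := hA.coef hD (Eventually.of_forall hG) he
      have hev : (fun y => F (x, y)) =ᶠ[𝓝 y] fun y => G (x, y) := by
        have hc : Continuous fun y => Δ.Q (x, y) :=
          Δ.actionAngle.contMDiff.continuous.comp (by fun_prop)
        filter_upwards [hc.continuousAt.preimage_mem_nhds (hU.mem_nhds hyU)] with y' hy'
        obtain ⟨e', he', hne'⟩ := Δ.exists_vec (x, y')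
        have h1 := (hσ _ hy').1 (hpi _)
        rw [(coefAt_iff he').1 (hF _), (coefAt_iff he').1 (hG _)] at h1
        exact (smul_left_injective ℂ (pow_ne_zero' hne') h1).symm
      have hd : HasFDerivAt (fun y => G (x, y)) _ y :=
        (hGs.differentiableAt (by simp)).hasFDerivAt.comp y (hasFDerivAt_prodMk_right x y)
      refine ⟨hd.differentiableAt.congr_of_eventuallyEq hev, fun v => ?_⟩
      have hFG : F (x, y) = G (x, y) := hev.self_of_nhds
      rw [hev.fderiv_eq, hd.fderiv, hFG]
      have hvert : mfderiv (𝓡 (2 * n)) (𝓡 n) π (Δ.Q (x, y)) (dQ Δ.Q (x, y) (0, v)) = 0 := by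
        have hQd : MDifferentiableAt 𝓘(ℝ, Rn n × Rn n) (𝓡 (2 * n)) Δ.Q (x, y) :=
          Δ.actionAngle.contMDiff.mdifferentiable (by simp) _
        have hj : HasMFDerivAt 𝓘(ℝ, Rn n) 𝓘(ℝ, Rn n × Rn n) (fun y' : Rn n => (x, y')) y
            (ContinuousLinearMap.inr ℝ (Rn n) (Rn n)) :=
          (hasFDerivAt_prodMk_right x y).hasMFDerivAt
        have h1 := (((hπ.mdifferentiable (by simp) (Δ.Q (x, y))).hasMFDerivAt).comp y
          (HasMFDerivAt.comp y (g := Δ.Q) hQd.hasMFDerivAt hj)).mfderiv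
        have h2 : π ∘ Δ.Q ∘ (fun y' : Rn n => (x, y')) = fun _ => Δ.q x := funext fun y' => hpi _
        rw [h2, mfderiv_const] at h1
        exact (congrArg (fun T : Rn n →L[ℝ] EuclideanSpace ℝ (Fin n) => T v) h1).symm
      have h1 := hA0 (hpi _) _ hvert
      rw [hGA, smul_eq_zero, or_iff_left (pow_ne_zero' hne), nab, connForm] at h1
      simp only [ContinuousLinearMap.comp_apply, ContinuousLinearMap.inr_apply, id] at h1 ⊢
      rw [smul_dotProduct, smul_eq_mul]
      push_cast
      linear_combination h1)
    ((CoefAt.equivariant hF).isPeriodic x) h0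
  refine ⟨m, ?_⟩
  ext i
  have h1 := congrFun hm i
  simp only [Pi.smul_apply, smul_eq_mul] at h1
  rw [latticePt, ← h1]
  field_simp

theorem bijOn_bohrSommerfeld (hD : IsPrequantum ωM D) (hN : 0 < N)
    (hπ : ContMDiff (𝓡 (2 * n)) (𝓡 n) ∞ π) {F : Set (Rn n)} (hF : IsFundDomain Δ.q F) :
    BijOn (fun m => Δ.q (latticePt N m)) {m : Fin n → ℤ | latticePt N m ∈ F}
      (bohrSommerfeld π D N) := by
  refine ⟨fun m _ => latticePt_mem_bohrSommerfeld hD hN m, fun m hm m' hm' h => ?_, fun b hb => ?_⟩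
  · exact latticePt_injective hN ((hF _).unique ⟨hm, rfl⟩ ⟨hm', h.symm⟩)
  · obtain ⟨x, ⟨hx, rfl⟩, -⟩ := hF b
    obtain ⟨m, rfl⟩ := exists_latticePt_of_mem_bohrSommerfeld hD hN hπ hb
    exact ⟨m, hx, rfl⟩

end BohrSommerfeld

/-! ### The theta series and the expansion of holomorphic sections -/

/-- Outside a finite set of indices, each term is the difference of two partial sums that lie within
1 of the limit, hence less than 2. -/
lemma exists_bound_of_summableUniformlyOn {ι X : Type*} {f : ι → X → ℝ} {K : Set X}
    (hf : SummableUniformlyOn f K) (h0 : ∀ i, ∃ C, ∀ x ∈ K, f i x ≤ C) :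
    ∃ C, ∀ i, ∀ x ∈ K, f i x ≤ C := by
  classical
  obtain ⟨g, hg⟩ := hf.exists
  rw [hasSumUniformlyOn_iff_tendstoUniformlyOn, Metric.tendstoUniformlyOn_iff] at hg
  obtain ⟨T, hT⟩ := eventually_atTop.1 (hg 1 one_pos)
  choose C hC using h0
  refine ⟨2 + ∑ i ∈ T, |C i|, fun i x hx => ?_⟩
  have hs : 0 ≤ ∑ i ∈ T, |C i| := Finset.sum_nonneg fun i _ => abs_nonneg _
  by_cases hi : i ∈ T
  · have := Finset.single_le_sum (f := fun i => |C i|) (fun i _ => abs_nonneg _) hi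
    linarith [hC i x hx, le_abs_self (C i)]
  · have h1 := hT T le_rfl x hx
    have h2 := hT (insert i T) (Finset.subset_insert i T) x hx
    rw [Finset.sum_insert hi] at h2
    rw [Real.dist_eq, abs_lt] at h1 h2
    linarith [h1.1, h2.1, h1.2, h2.2]

/-! ### Orbits of lattice points and coefficients of theta series -/

section Index

variable {n N : ℕ} {B : Type*} [TopologicalSpace B] {q : Rn n → B}

/-- Γ acts freely on the lattice points and the fundamental domain meets every orbit once. That the
representative of a lattice point is again a lattice point follows from `hσ` for γ⁻¹. -/
lemma bijective_index (hq : IsCoveringMap q) (hN : 0 < N) {F : Set (Rn n)} (hF : IsFundDomain q F)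
    {σ : (Fin n → ℤ) → Deck q → Fin n → ℤ}
    (hσ : ∀ m γ, latticePt N (σ m γ) = γ.1 (latticePt N m)) :
    Function.Bijective fun i : {m : Fin n → ℤ // latticePt N m ∈ F} × Deck q => σ i.1.1 i.2 := by
  constructor
  · rintro ⟨⟨m, hm⟩, γ⟩ ⟨⟨m', hm'⟩, γ'⟩ h
    have h1 : γ.1 (latticePt N m) = γ'.1 (latticePt N m') := by
      rw [← hσ, ← hσ]
      exact congrArg _ h
    have h2 : q (latticePt N m) = q (latticePt N m') := by rw [← γ.2, h1, γ'.2]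
    obtain rfl := latticePt_injective hN ((hF _).unique ⟨hm, rfl⟩ ⟨hm', h2.symm⟩)
    rw [Deck.eq_of_apply_eq hq h1]
  · intro k
    obtain ⟨x, ⟨hx, hqx⟩, -⟩ := hF (q (latticePt N k))
    obtain ⟨γ, hγ⟩ := exists_deck hq hqx
    have h1 : latticePt N (σ k (deckInv γ)) = x := by rw [hσ, ← hγ, deckInv_apply]
    refine ⟨⟨⟨σ k (deckInv γ), by rw [h1]; exact hx⟩, γ⟩, latticePt_injective hN ?_⟩
    dsimp only
    rw [hσ, h1, hγ]

end Index

section ThetaSeries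

variable {n : ℕ} {M B : Type*} [TopologicalSpace M]
  [ChartedSpace (EuclideanSpace ℝ (Fin (2 * n))) M] [TopologicalSpace B]
  {L : M → Type*} [TopologicalSpace (Bundle.TotalSpace ℂ L)]
  [∀ p, NormedAddCommGroup (L p)] [∀ p, InnerProductSpace ℂ (L p)]
  [FiberBundle ℂ L] [VectorBundle ℝ ℂ L]
  {ωM : ∀ p : M, Tan (2 * n) p →L[ℝ] Tan (2 * n) p →L[ℝ] ℝ} {π : M → B}
  {D : CovariantDerivative (𝓡 (2 * n)) ℂ L} {Δ : Development ωM π D} {N : ℕ}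
  {Z : Rn n → Matrix (Fin n) (Fin n) ℂ} {ψ : Rn n → Fin n → ℂ} {φ : Rn n → ℂ}
  {σ : (Fin n → ℤ) → Deck Δ.q → Fin n → ℤ} {c : (Fin n → ℤ) → Deck Δ.q → ℂ}
  {F : Rn n × Rn n → ℂ}

/-- The theta series as series in the functions `eBase`: the `γ`-term of `ϑ_{m/N}` is
`c m γ` times `eBase` with index `σ m γ`. -/
structure IsThetaIndex (Δ : Development ωM π D) (N : ℕ) (Z : Rn n → Matrix (Fin n) (Fin n) ℂ)
    (ψ : Rn n → Fin n → ℂ) (φ : Rn n → ℂ) (σ : (Fin n → ℤ) → Deck Δ.q → Fin n → ℤ)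
    (c : (Fin n → ℤ) → Deck Δ.q → ℂ) : Prop where
  apply : ∀ m γ, latticePt N (σ m γ) = γ.1 (latticePt N m)
  ne_zero : ∀ m γ, c m γ ≠ 0
  term : ∀ m γ z, thetaTerm Δ N Z m γ z = c m γ * eBase N ψ φ (σ m γ) z

lemma IsThetaIndex.injective_left (hσ : IsThetaIndex Δ N Z ψ φ σ c) (hN : 0 < N) (γ : Deck Δ.q) :
    Function.Injective fun m => σ m γ := by
  intro m m' h
  refine latticePt_injective hN (γ.1.injective ?_)
  rw [← hσ.apply, ← hσ.apply]
  exact congrArg _ h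

lemma IsThetaIndex.injective (hσ : IsThetaIndex Δ N Z ψ φ σ c) (m : Fin n → ℤ) :
    Function.Injective (σ m) := by
  intro γ γ' h
  refine Deck.eq_of_apply_eq Δ.covering (x := latticePt N m) ?_
  rw [← hσ.apply, ← hσ.apply, h]

/-- The coefficients of a theta series. -/
def thetaCoef (σ : (Fin n → ℤ) → Deck Δ.q → Fin n → ℤ) (c : (Fin n → ℤ) → Deck Δ.q → ℂ)
    (m : Fin n → ℤ) : (Fin n → ℤ) → ℂ :=
  Function.extend (σ m) (c m) 0

lemma IsThetaIndex.thetaCoef_apply (hσ : IsThetaIndex Δ N Z ψ φ σ c) (m : Fin n → ℤ)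
    (γ : Deck Δ.q) : thetaCoef σ c m (σ m γ) = c m γ :=
  (hσ.injective m).extend_apply _ _ _

lemma IsThetaIndex.tsum_eq (hσ : IsThetaIndex Δ N Z ψ φ σ c) (m : Fin n → ℤ) (z : Rn n × Rn n) :
    ∑' γ, thetaTerm Δ N Z m γ z = ∑' k, thetaCoef σ c m k * eBase N ψ φ k z := by
  rw [← (hσ.injective m).tsum_eq]
  · exact tsum_congr fun γ => by rw [hσ.term, hσ.thetaCoef_apply]
  · intro k hk
    by_contra h
    refine hk ?_
    dsimp only
    rw [thetaCoef, Function.extend_apply' _ _ _ h, Pi.zero_apply, zero_mul]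

/-- Uniform convergence on a compact set bounds the terms uniformly there. Dividing by |exp(2πi Nφ)|
leaves the bound that tameness asks for. -/
lemma IsThetaIndex.tame (hσ : IsThetaIndex Δ N Z ψ φ σ c) (h : IsPotential Z ψ φ) {m : Fin n → ℤ}
    (hm : ThetaConverges Δ N Z m) : Tame ψ (thetaCoef σ c m) := by
  intro x
  set E : Rn n → ℂ := fun x => Complex.exp (2 * Real.pi * Complex.I * (N * φ x)) with hE
  have hEc : Continuous E := by
    have := h.smooth'.continuous
    fun_prop
  have hK : IsCompact (Metric.closedBall x 1 ×ˢ ({0} : Set (Rn n))) :=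
    (isCompact_closedBall x 1).prod isCompact_singleton
  have htc : ∀ γ, Continuous fun z => thetaTerm Δ N Z m γ z := fun γ => by
    simp only [hσ.term]
    exact continuous_const.mul (h.contDiff_eBase _).continuous
  obtain ⟨C, hC⟩ := exists_bound_of_summableUniformlyOn (hm _ hK) fun γ => by
    obtain ⟨C, hC⟩ := hK.exists_bound_of_continuousOn (htc γ).continuousOn
    exact ⟨C, hC⟩
  obtain ⟨A, hA⟩ := (isCompact_closedBall x 1).exists_bound_of_continuousOn
    (f := fun x => (E x)⁻¹) (hEc.inv₀ fun x => Complex.exp_ne_zero _).continuousOn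
  refine ⟨|C| * |A|, ?_⟩
  filter_upwards [Metric.closedBall_mem_nhds x one_pos] with ξ hξ k
  by_cases hk : k ∈ range (σ m)
  · obtain ⟨γ, rfl⟩ := hk
    rw [hσ.thetaCoef_apply]
    have h1 := (hC γ (ξ, 0) ⟨hξ, rfl⟩).trans (le_abs_self C)
    have h2 := (hA ξ hξ).trans (le_abs_self A)
    rw [hσ.term, norm_mul, norm_eBase] at h1
    have h3 : ‖E ξ‖ ≠ 0 := norm_ne_zero_iff.2 (Complex.exp_ne_zero _)
    have h4 := mul_le_mul h1 h2 (norm_nonneg _) (abs_nonneg C)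
    rw [norm_inv] at h4
    have h5 : ∀ a b : ℝ, a * (‖E ξ‖ * b) * ‖E ξ‖⁻¹ = a * b := fun a b => by field_simp
    rwa [h5] at h4
  · rw [thetaCoef, Function.extend_apply' _ _ _ hk, Pi.zero_apply, norm_zero, zero_mul]
    positivity

lemma IsThetaIndex.hasSum (hσ : IsThetaIndex Δ N Z ψ φ σ c) (h : IsPotential Z ψ φ)
    {m : Fin n → ℤ} (hm : ThetaConverges Δ N Z m) (z : Rn n × Rn n) :
    HasSum (fun γ => thetaTerm Δ N Z m γ z) (∑' γ, thetaTerm Δ N Z m γ z) := by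
  have h1 := ((hσ.tame h hm).summable (N := N) h z).of_norm.comp_injective (hσ.injective m)
  refine (h1.congr fun γ => ?_).hasSum
  rw [hσ.term, Function.comp_apply, hσ.thetaCoef_apply]

/-- Relations between the coefficients of an equivariant function. -/
lemma IsThetaIndex.exists_coef (hσ : IsThetaIndex Δ N Z ψ φ σ c) (h : IsPotential Z ψ φ)
    (hN : 0 < N) (hF : Equivariant Δ N F) {κ : (Fin n → ℤ) → ℂ}
    (hs : ∀ z, HasSum (fun k => κ k * eBase N ψ φ k z) (F z)) (m : Fin n → ℤ) :
    ∃ a, ∀ γ, κ (σ m γ) = a * c m γ := by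
  -- The constants with s_k = b_k e_k.
  set b : (Fin n → ℤ) → ℂ := fun k =>
    Complex.exp (2 * Real.pi * Complex.I * potH N ψ φ k (latticePt N k)) with hb
  have hb0 : ∀ k, b k ≠ 0 := fun k => Complex.exp_ne_zero _
  refine ⟨κ m * (b m)⁻¹, fun γ => ?_⟩
  -- Moving the expansion by γ gives a second expansion of the same F, with e_k replaced by a
  -- multiple of e with index Nγ(k/N). Fourier coefficients at that index compare the two.
  have h1 : ∀ z, HasSum (fun k => κ k * (b k)⁻¹ * c k γ * eBase N ψ φ (σ k γ) z) (F z) := by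
    intro z
    set z' := deckLift Δ.Q (deckInv γ) z
    have hz : Δ.Q z' = Δ.Q z := Δ.actionAngle.apply_deckLift _ z
    rw [hF z z' hz.symm]
    refine ((hs z').mul_right (lineRatio (Δ.τ z) (Δ.τ z') ^ N)).congr_fun fun k => ?_
    rw [mul_assoc (κ k * (b k)⁻¹), ← hσ.term, thetaTerm_eq Δ hz rfl, h.sBase_eq,
      ← mul_assoc, ← mul_assoc, mul_assoc (κ k), inv_mul_cancel₀ (hb0 k), mul_one]
  have key : ∀ (τ : (Fin n → ℤ) → Fin n → ℤ) (a : (Fin n → ℤ) → ℂ), Function.Injective τ →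
      (∀ z, HasSum (fun k => a k * eBase N ψ φ (τ k) z) (F z)) → ∀ k,
      fcoef (fun y => F (0, y)) (τ k) = a k * eBase N ψ φ (τ k) (0, 0) := by
    intro τ a hτ ha k
    refine fcoef_eq (a := fun k => a k * eBase N ψ φ (τ k) (0, 0)) (ha (0, 0)).summable.norm
      (fun y => ?_) hτ k
    convert ha (0, y) using 1
    ext k
    rw [eBase_eq_mchar ψ φ (τ k) 0 y, mul_assoc]
  have h2 := key (fun k => σ k γ) (fun k => κ k * (b k)⁻¹ * c k γ) (hσ.injective_left hN γ) h1 m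
  have h3 := key id κ Function.injective_id hs (σ m γ)
  exact mul_right_cancel₀ (eBase_ne_zero ψ φ _ _) (h3.symm.trans h2)

/-- An equivariant tame series is a locally uniformly convergent combination of theta series. -/
lemma IsThetaIndex.exists_tendstoUniformlyOn (hσ : IsThetaIndex Δ N Z ψ φ σ c)
    (h : IsPotential Z ψ φ) (hN : 0 < N) {X : Set (Rn n)} (hX : IsFundDomain Δ.q X)
    (hc : ∀ m : Fin n → ℤ, latticePt N m ∈ X → ThetaConverges Δ N Z m)
    (hF : Equivariant Δ N F) {κ : (Fin n → ℤ) → ℂ} (hκ : Tame ψ κ)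
    (hs : ∀ z, HasSum (fun k => κ k * eBase N ψ φ k z) (F z)) :
    ∃ a : {m : Fin n → ℤ // latticePt N m ∈ X} → ℂ, ∀ z₀, ∃ W ∈ 𝓝 z₀,
      TendstoUniformlyOn (fun (T : Finset _) z => ∑ m ∈ T, a m * ∑' γ, thetaTerm Δ N Z m.1 γ z) F
        atTop W := by
  choose a ha using fun m : {m : Fin n → ℤ // latticePt N m ∈ X} =>
    hσ.exists_coef h hN hF hs m.1
  refine ⟨a, fun z₀ => ?_⟩
  obtain ⟨u, hu, hb⟩ := hκ.exists_bound (N := N) h z₀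
  refine ⟨_, hb, ?_⟩
  -- The series over ℤⁿ is regrouped into orbits. The inner sum over Γ is a multiple of one theta
  -- series, and the bounds u, summed over orbits, control the outer sum uniformly.
  let e := Equiv.ofBijective _ (bijective_index Δ.covering hN hX hσ.apply)
  have he : ∀ m γ, e (m, γ) = σ m.1 γ := fun m γ => rfl
  have hue : Summable fun i => u (e i) := hu.comp_injective e.injective
  have hus : ∀ m : {m : Fin n → ℤ // latticePt N m ∈ X}, Summable fun γ => u (σ m.1 γ) :=
    fun m => hue.comp_injective (Prod.mk_right_injective m)
  have hw : HasSum (fun m : {m : Fin n → ℤ // latticePt N m ∈ X} => ∑' γ, u (σ m.1 γ)) _ :=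
    hue.hasSum.prod_fiberwise fun m => (hus m).hasSum
  have hterm : ∀ m γ z, a m * thetaTerm Δ N Z m.1 γ z = κ (σ m.1 γ) * eBase N ψ φ (σ m.1 γ) z := by
    intro m γ z
    rw [ha, hσ.term, mul_assoc]
  have hsum : ∀ z, HasSum (fun m => a m * ∑' γ, thetaTerm Δ N Z m.1 γ z) (F z) := by
    intro z
    refine ((e.hasSum_iff (f := fun k => κ k * eBase N ψ φ k z)).2 (hs z)).prod_fiberwise
      fun m => ?_
    exact ((hσ.hasSum h (hc m.1 m.2) z).mul_left (a m)).congr_fun fun γ => (hterm m γ z).symm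
  have hle : ∀ (m : {m : Fin n → ℤ // latticePt N m ∈ X}) z,
      (∀ k, ‖κ k * eBase N ψ φ k z‖ ≤ u k) →
      ‖a m * ∑' γ, thetaTerm Δ N Z m.1 γ z‖ ≤ ∑' γ, u (σ m.1 γ) := by
    intro m z hz
    rw [← tsum_mul_left]
    refine tsum_of_norm_bounded (hus m).hasSum fun γ => ?_
    rw [hterm]
    exact hz _
  refine (tendstoUniformlyOn_tsum hw.summable fun m z hz => hle m z hz).congr_right fun z _ => ?_
  exact (hsum z).tsum_eq

lemma IsThetaIndex.fcoef_theta (hσ : IsThetaIndex Δ N Z ψ φ σ c) (h : IsPotential Z ψ φ)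
    {m : Fin n → ℤ} (hm : ThetaConverges Δ N Z m) (x : Rn n) :
    (∀ γ, fcoef (fun y => ∑' γ, thetaTerm Δ N Z m γ (x, y)) (σ m γ)
      = c m γ * eBase N ψ φ (σ m γ) (x, 0)) ∧
    ∀ k, k ∉ range (σ m) → fcoef (fun y => ∑' γ, thetaTerm Δ N Z m γ (x, y)) k = 0 := by
  have : Countable (Deck Δ.q) := (hσ.injective m).countable
  have h1 : ∀ y, HasSum (fun γ => c m γ * eBase N ψ φ (σ m γ) (x, 0) * mchar (σ m γ) y)
      (∑' γ, thetaTerm Δ N Z m γ (x, y)) := by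
    intro y
    convert hσ.hasSum h hm (x, y) using 1
    ext γ
    rw [hσ.term, eBase_eq_mchar ψ φ (σ m γ) x y, mul_assoc]
  have h2 : Summable fun γ => ‖c m γ * eBase N ψ φ (σ m γ) (x, 0)‖ := by
    have h3 := (hσ.hasSum h hm (x, 0)).summable.norm
    exact h3.congr fun γ => by rw [hσ.term]
  exact ⟨fun γ => fcoef_eq h2 h1 (hσ.injective m) γ, fun k hk => fcoef_eq_zero h2 h1 hk⟩

lemma IsThetaIndex.disjoint_range (hσ : IsThetaIndex Δ N Z ψ φ σ c) (hN : 0 < N) {X : Set (Rn n)}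
    (hX : IsFundDomain Δ.q X) {m m' : {m : Fin n → ℤ // latticePt N m ∈ X}} (hm : m ≠ m')
    (γ : Deck Δ.q) : σ m.1 γ ∉ range (σ m'.1) := by
  rintro ⟨γ', h⟩
  have := (bijective_index Δ.covering hN hX hσ.apply).1 (a₁ := (m', γ')) (a₂ := (m, γ)) h
  exact hm (congrArg Prod.fst this).symm

end ThetaSeries

/-! ### Expansions on M and on ℝⁿ × ℝⁿ -/

section Expansion

variable {n : ℕ} {M B : Type*} [TopologicalSpace M]
  [ChartedSpace (EuclideanSpace ℝ (Fin (2 * n))) M] [TopologicalSpace B]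
  {L : M → Type*} [TopologicalSpace (Bundle.TotalSpace ℂ L)]
  [∀ p, NormedAddCommGroup (L p)] [∀ p, InnerProductSpace ℂ (L p)]
  [FiberBundle ℂ L] [VectorBundle ℝ ℂ L]
  {ωM : ∀ p : M, Tan (2 * n) p →L[ℝ] Tan (2 * n) p →L[ℝ] ℝ} {π : M → B}
  {D : CovariantDerivative (𝓡 (2 * n)) ℂ L} {Δ : Development ωM π D} {N : ℕ}
  [IsManifold (𝓡 (2 * n)) ∞ M] [ContMDiffVectorBundle ∞ ℂ L (𝓡 (2 * n))]
  {s : ∀ p, Pow L N p} {F : Rn n × Rn n → ℂ}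
  {ι : Type*} {c : ι → ℂ} {ϑ : ι → ∀ p, Pow L N p} {Θ : ι → Rn n × Rn n → ℂ}

omit [TopologicalSpace B] in
lemma IsActionAngle.isOpenMap {q : Rn n → B} {Q : Rn n × Rn n → M}
    (hQ : IsActionAngle ωM π univ q Q) : IsOpenMap Q := by
  refine isOpenMap_iff_nhds_le.2 fun z s hs => ?_
  obtain ⟨r, hr, R, hb, hR⟩ := hQ.exists_localInverse_ball (z := z) hs
  exact mem_of_superset (hR.isOpen_image.mem_nhds ⟨z, Metric.mem_ball_self hr, rfl⟩)
    (image_subset_iff.2 hb)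

/-- Since ‖τ‖ is constant, the Hermitian square of the remainder is a constant times the squared
modulus of its coefficient. Convergence on M thus amounts to convergence of coefficient functions.
-/
lemma norm_hermPow_sub (hD : IsPrequantum ωM D) (hs : ∀ z, CoefAt Δ N s F z)
    (hϑ : ∀ i z, CoefAt Δ N (ϑ i) (Θ i) z) (T : Finset ι) (z : Rn n × Rn n) :
    ‖hermPow N (s (Δ.Q z) - ∑ i ∈ T, c i • ϑ i (Δ.Q z)) (s (Δ.Q z) - ∑ i ∈ T, c i • ϑ i (Δ.Q z))‖
      = ‖F z - ∑ i ∈ T, c i * Θ i z‖ ^ 2 * (‖(Δ.τ 0).snd‖ ^ 2) ^ N := by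
  have h := (hs z).sub (CoefAt.sum (T := T) (c := c) fun i _ => hϑ i z)
  have h1 := h.hermPow h
  rw [h1, norm_mul, norm_mul, RCLike.norm_conj, Complex.norm_real, Real.norm_of_nonneg
    (by positivity), Δ.isFrame.norm_eq hD Δ.actionAngle z 0, ← sq]

lemma hasExpansion_of_tendsto (hD : IsPrequantum ωM D) (hq : Function.Surjective Δ.q)
    (hs : ∀ z, CoefAt Δ N s F z) (hϑ : ∀ i z, CoefAt Δ N (ϑ i) (Θ i) z)
    (H : ∀ z₀, ∃ W ∈ 𝓝 z₀,
      TendstoUniformlyOn (fun (T : Finset ι) z => ∑ i ∈ T, c i * Θ i z) F atTop W) :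
    HasExpansion ϑ c s := by
  classical
  intro K hK ε hε
  refine hK.induction_on (p := fun K => ∃ T₀ : Finset ι, ∀ T : Finset ι, T₀ ⊆ T → ∀ p ∈ K,
    ‖hermPow N (s p - ∑ i ∈ T, c i • ϑ i p) (s p - ∑ i ∈ T, c i • ϑ i p)‖ < ε)
    ⟨∅, fun _ _ _ h => h.elim⟩ ?_ ?_ ?_
  · rintro K K' hKK ⟨T₀, h⟩
    exact ⟨T₀, fun T hT p hp => h T hT p (hKK hp)⟩
  · rintro K K' ⟨T₀, h⟩ ⟨T₁, h'⟩
    refine ⟨T₀ ∪ T₁, fun T hT p hp => hp.elim (h T (Finset.union_subset_left hT) p)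
      (h' T (Finset.union_subset_right hT) p)⟩
  · intro p _
    obtain ⟨z₀, rfl⟩ := Δ.exists_Q hq p
    obtain ⟨W, hW, hu⟩ := H z₀
    set A := (‖(Δ.τ 0).snd‖ ^ 2) ^ N with hA
    have hA0 : 0 ≤ A := by positivity
    -- The square root appears because ε bounds a squared norm.
    obtain ⟨T₀, hT₀⟩ := eventually_atTop.1
      (Metric.tendstoUniformlyOn_iff.1 hu (Real.sqrt (ε / (A + 1))) (by positivity))
    refine ⟨Δ.Q '' W, mem_nhdsWithin_of_mem_nhds (Δ.actionAngle.isOpenMap.image_mem_nhds hW),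
      T₀, fun T hT p hp => ?_⟩
    obtain ⟨z, hz, rfl⟩ := hp
    have h1 := hT₀ T hT z hz
    rw [dist_eq_norm, Real.lt_sqrt (norm_nonneg _), lt_div_iff₀ (by positivity)] at h1
    rw [norm_hermPow_sub hD hs hϑ, ← hA]
    refine lt_of_le_of_lt ?_ h1
    gcongr
    linarith

lemma HasExpansion.tendsto (hD : IsPrequantum ωM D)
    (hs : ∀ z, CoefAt Δ N s F z) (hϑ : ∀ i z, CoefAt Δ N (ϑ i) (Θ i) z)
    (hE : HasExpansion ϑ c s) {K : Set (Rn n × Rn n)} (hK : IsCompact K) :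
    TendstoUniformlyOn (fun (T : Finset ι) z => ∑ i ∈ T, c i * Θ i z) F atTop K := by
  rw [Metric.tendstoUniformlyOn_iff]
  intro ε hε
  have hτ := norm_pos_iff.2 (Δ.τ_ne_zero 0)
  obtain ⟨T₀, hT₀⟩ := hE (Δ.Q '' K) (hK.image Δ.actionAngle.contMDiff.continuous)
    (ε ^ 2 * (‖(Δ.τ 0).snd‖ ^ 2) ^ N) (by positivity)
  refine eventually_atTop.2 ⟨T₀, fun T hT z hz => ?_⟩
  have h1 := hT₀ T hT _ ⟨z, hz, rfl⟩
  rw [norm_hermPow_sub hD hs hϑ, mul_lt_mul_iff_left₀ (by positivity)] at h1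
  rw [dist_eq_norm]
  exact lt_of_pow_lt_pow_left₀ 2 hε.le h1

lemma fcoef_sub_sum {f : Rn n → ℂ} {g : ι → Rn n → ℂ} (hf : Continuous f)
    (hg : ∀ i, Continuous (g i)) (T : Finset ι) (k : Fin n → ℤ) :
    fcoef (fun y => f y - ∑ i ∈ T, c i * g i y) k = fcoef f k - ∑ i ∈ T, c i * fcoef (g i) k := by
  have h1 : ∀ {f : Rn n → ℂ}, Continuous f →
      IntegrableOn (fun y => mchar (-k) y * f y) (box 0) := fun hf =>
    integrableOn_box ((continuous_mchar _).mul hf) 0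
  have h2 : ∀ y, mchar (-k) y * (f y - ∑ i ∈ T, c i * g i y)
      = mchar (-k) y * f y - ∑ i ∈ T, c i * (mchar (-k) y * g i y) := by
    intro y
    rw [mul_sub, Finset.mul_sum]
    congr 1
    exact Finset.sum_congr rfl fun i _ => by ring
  simp only [fcoef, h2]
  rw [integral_sub (h1 hf) (integrable_finsetSum _ fun i _ => (h1 (hg i)).const_mul _),
    integral_finsetSum _ fun i _ => (h1 (hg i)).const_mul _]
  simp only [integral_const_mul]

/-- The coefficients of an expansion are determined by a Fourier coefficient. -/
lemma coef_eq_of_tendsto (hF : Continuous F) (hΘ : ∀ i, Continuous (Θ i)) (x : Rn n)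
    (H : TendstoUniformlyOn (fun (T : Finset ι) z => ∑ i ∈ T, c i * Θ i z) F atTop
      ({x} ×ˢ Icc (0 : Rn n) 1)) {i : ι} {k : Fin n → ℤ}
    (hk : ∀ j, j ≠ i → fcoef (fun y => Θ j (x, y)) k = 0) :
    fcoef (fun y => F (x, y)) k = c i * fcoef (fun y => Θ i (x, y)) k := by
  classical
  refine eq_of_sub_eq_zero (norm_le_zero_iff.1 (le_of_forall_pos_le_add fun ε hε => ?_))
  obtain ⟨T₀, hT₀⟩ := eventually_atTop.1 (Metric.tendstoUniformlyOn_iff.1 H ε hε)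
  -- Inserting i ensures that its term is present; by `hk` all other terms contribute nothing to the
  -- k-th coefficient.
  have h1 := norm_fcoef_le (f := fun y => F (x, y) - ∑ j ∈ insert i T₀, c j * Θ j (x, y)) (C := ε)
    (fun y hy => by
      have := hT₀ (insert i T₀) (Finset.subset_insert i T₀) (x, y) ⟨rfl, hy⟩
      rw [dist_eq_norm] at this
      exact this.le) k
  rw [fcoef_sub_sum (f := fun y => F (x, y)) (g := fun j y => Θ j (x, y)) (hF.comp (by fun_prop))
    (fun j => (hΘ j).comp (by fun_prop)),
    Finset.sum_eq_single i (fun j _ hj => by rw [hk j hj, mul_zero])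
      (fun h => absurd (Finset.mem_insert_self i T₀) h)] at h1
  rwa [zero_add]

lemma HasExpansion.eq_sum [Fintype ι] (hq : Function.Surjective Δ.q)
    (hD : IsPrequantum ωM D) (hs : ∀ z, CoefAt Δ N s F z) (hϑ : ∀ i z, CoefAt Δ N (ϑ i) (Θ i) z)
    (hE : HasExpansion ϑ c s) : s = ∑ i, c i • ϑ i := by
  funext p
  obtain ⟨z, rfl⟩ := Δ.exists_Q hq p
  have h1 := (hE.tendsto hD hs hϑ (isCompact_singleton (x := z))).tendsto_at (mem_singleton z)
  have h2 : F z = ∑ i, c i * Θ i z :=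
    tendsto_nhds_unique h1 (hasSum_fintype fun i => c i * Θ i z)
  have h3 := CoefAt.sum (T := Finset.univ) (c := c) fun i _ => hϑ i z
  obtain ⟨e, he, hne⟩ := Δ.exists_vec z
  rw [coefAt_iff he] at h3
  rw [(coefAt_iff he).1 (hs z), h2, Finset.sum_apply]
  exact h3.symm

lemma IsHolAt.sum {Z : Rn n → Matrix (Fin n) (Fin n) ℂ} {z : Rn n × Rn n}
    (hΘ : ∀ i, Differentiable ℝ (Θ i)) (h : ∀ i, IsHolAt N Z (Θ i) z) (T : Finset ι) :
    IsHolAt N Z (fun z => ∑ i ∈ T, c i * Θ i z) z := by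
  have h1 : ∀ u, nab N (fun z => ∑ i ∈ T, c i * Θ i z) z u = ∑ i ∈ T, c i * nab N (Θ i) z u := by
    intro u
    have hd : HasFDerivAt (fun z => ∑ i ∈ T, c i * Θ i z) (∑ i ∈ T, c i • fderiv ℝ (Θ i) z) z :=
      HasFDerivAt.fun_sum fun i _ => ((hΘ i) z).hasFDerivAt.const_mul (c i)
    rw [nab, hd.fderiv, Finset.mul_sum, sum_apply]
    simp only [nab, smul_apply, smul_eq_mul, mul_add, Finset.sum_add_distrib]
    congr 1
    exact Finset.sum_congr rfl fun i _ => by ring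
  intro u
  rw [h1, h1, Finset.mul_sum]
  exact Finset.sum_congr rfl fun i _ => by rw [h i u]; ring

/-- The images of the balls of integral radius are open, increasing and cover M. -/
lemma exists_bounded_preimage [CompactSpace M] (hq : Function.Surjective Δ.q) :
    ∃ R : ℝ, ∀ p, ∃ z, ‖z‖ ≤ R ∧ Δ.Q z = p := by
  obtain ⟨k, hk⟩ := isCompact_univ.elim_directed_cover
    (fun k : ℕ => Δ.Q '' Metric.ball 0 k)
    (fun k => Δ.actionAngle.isOpenMap _ Metric.isOpen_ball)
    (fun p _ => by
      obtain ⟨z, rfl⟩ := Δ.exists_Q hq p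
      obtain ⟨k, hk⟩ := exists_nat_gt ‖z‖
      exact mem_iUnion.2 ⟨k, z, by simpa using hk, rfl⟩)
    (directed_of_isDirected_le fun i j hij =>
      image_mono (Metric.ball_subset_ball (by exact_mod_cast hij)))
  refine ⟨k, fun p => ?_⟩
  obtain ⟨z, hz, hp⟩ := hk (mem_univ p)
  exact ⟨z, by simpa using (Metric.mem_ball.1 hz).le, hp⟩

end Expansion

lemma finite_latticePt {n N : ℕ} (hN : 0 < N) (R : ℝ) :
    {k : Fin n → ℤ | ‖latticePt N k‖ ≤ R}.Finite := by
  refine (Set.finite_Icc (fun _ => -⌈N * R⌉) (fun _ => ⌈N * R⌉)).subset fun k hk => ?_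
  have hN' : (0 : ℝ) < N := by exact_mod_cast hN
  have h1 : ∀ i, |(k i : ℝ)| ≤ ⌈N * R⌉ := fun i => by
    have h2 := (norm_le_pi_norm (latticePt N k) i).trans hk
    rw [latticePt, Real.norm_eq_abs, abs_div, abs_of_pos hN', div_le_iff₀ hN'] at h2
    exact (h2.trans (mul_comm _ _).le).trans (Int.le_ceil _)
  constructor <;> intro i
  · have := (abs_le.1 (h1 i)).1
    exact_mod_cast this
  · have := (abs_le.1 (h1 i)).2
    exact_mod_cast this

/-! ### Theta sections as a basis -/

section ThetaBasis

variable {n : ℕ} {M B : Type*} [TopologicalSpace M]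
  [ChartedSpace (EuclideanSpace ℝ (Fin (2 * n))) M] [TopologicalSpace B]
  {L : M → Type*} [TopologicalSpace (Bundle.TotalSpace ℂ L)]
  [∀ p, NormedAddCommGroup (L p)] [∀ p, InnerProductSpace ℂ (L p)]
  [FiberBundle ℂ L] [VectorBundle ℝ ℂ L]
  {ωM : ∀ p : M, Tan (2 * n) p →L[ℝ] Tan (2 * n) p →L[ℝ] ℝ} {π : M → B}
  {D : CovariantDerivative (𝓡 (2 * n)) ℂ L} {Δ : Development ωM π D} {N : ℕ}
  [IsManifold (𝓡 (2 * n)) ∞ M] [ContMDiffVectorBundle ∞ ℂ L (𝓡 (2 * n))]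
  {J : ∀ p : M, Tan (2 * n) p →L[ℝ] Tan (2 * n) p}
  {Z : Rn n → Matrix (Fin n) (Fin n) ℂ} {ψ : Rn n → Fin n → ℂ} {φ : Rn n → ℂ}
  {X : Set (Rn n)} {ϑ : {m : Fin n → ℤ // latticePt N m ∈ X} → ∀ p, Pow L N p}

lemma IsFundDomain.surjective {q : Rn n → B} (hX : IsFundDomain q X) : Function.Surjective q :=
  fun b => by
    obtain ⟨x, hx, -⟩ := hX b
    exact ⟨x, hx.2⟩

lemma exists_isThetaIndex (hD : IsPrequantum ωM D) (hN : 0 < N) (hZ : IsSiegelMap J univ Δ.Q Z)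
    (h : IsPotential Z ψ φ) : ∃ σ c, IsThetaIndex Δ N Z ψ φ σ c := by
  choose σ hσ c hc ht using exists_thetaTerm_eq Δ hD hN hZ h
  exact ⟨σ, c, hσ, hc, ht⟩

lemma exists_isThetaSection (Δ : Development ωM π D) (N : ℕ) (Z : Rn n → Matrix (Fin n) (Fin n) ℂ)
    (m : Fin n → ℤ) : ∃ s, IsThetaSection Δ N Z m s := by
  obtain ⟨s, hs⟩ := exists_section_on (Δ := Δ) (N := N) (O := univ)
    fun z _ z' _ => equivariant_theta Z m z z'
  exact ⟨s, fun z => hs z trivial⟩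

lemma IsThetaSection.isHolomorphicSection (hD : IsPrequantum ωM D) (hN : 0 < N)
    (hq : Function.Surjective Δ.q) (hZ : IsSiegelMap J univ Δ.Q Z) (h : IsPotential Z ψ φ)
    {m : Fin n → ℤ} {s : ∀ p, Pow L N p} (hs : IsThetaSection Δ N Z m s)
    (hm : ThetaConverges Δ N Z m) : IsHolomorphicSection J D N s := by
  obtain ⟨σ, c, hσ⟩ := exists_isThetaIndex (N := N) hD hN hZ h
  rw [isHolomorphicSection_iff hD hq hZ hs, funext fun z => hσ.tsum_eq m z]
  exact (hσ.tame h hm).contDiff_tsum h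

/-- Every holomorphic section has a unique expansion in theta sections. -/
theorem existsUnique_expansion (hD : IsPrequantum ωM D) (hN : 0 < N)
    (hX : IsFundDomain Δ.q X) (hZ : IsSiegelMap J univ Δ.Q Z) (h : IsPotential Z ψ φ)
    (hϑ : ∀ m, IsThetaSection Δ N Z m.1 (ϑ m))
    (hc : ∀ m : Fin n → ℤ, latticePt N m ∈ X → ThetaConverges Δ N Z m)
    {s : ∀ p, Pow L N p} (hs : IsHolomorphicSection J D N s) : ∃! c, HasExpansion ϑ c s := by
  obtain ⟨σ, c, hσ⟩ := exists_isThetaIndex (N := N) hD hN hZ h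
  obtain ⟨F, hF⟩ := exists_coefAt Δ s
  have heq := CoefAt.equivariant hF
  obtain ⟨hFs, hFh⟩ := (isHolomorphicSection_iff hD hX.surjective hZ hF).1 hs
  obtain ⟨κ, hκ, hsum⟩ := h.exists_expansion hFs heq.isPeriodic hFh
  obtain ⟨a, ha⟩ := hσ.exists_tendstoUniformlyOn h hN hX hc heq hκ hsum
  refine ⟨a, hasExpansion_of_tendsto hD hX.surjective hF hϑ ha, fun b hb => funext fun m => ?_⟩
  have hcont : ∀ m : {m : Fin n → ℤ // latticePt N m ∈ X},
      Continuous fun z => ∑' γ, thetaTerm Δ N Z m.1 γ z := fun m => by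
    rw [funext fun z => hσ.tsum_eq m.1 z]
    exact ((hσ.tame h (hc m.1 m.2)).contDiff_tsum h).1.continuous
  -- The identity selects one index in the Fourier support of the m-th theta function. The supports
  -- of the others avoid it, so the coefficient of s there determines b m.
  let γ : Deck Δ.q := ⟨Homeomorph.refl _, fun _ => rfl⟩
  have key : ∀ b, HasExpansion ϑ b s → fcoef (fun y => F (0, y)) (σ m.1 γ)
      = b m * (c m.1 γ * eBase N ψ φ (σ m.1 γ) (0, 0)) := by
    intro b hb
    rw [← (hσ.fcoef_theta h (hc m.1 m.2) 0).1 γ]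
    exact coef_eq_of_tendsto hFs.continuous hcont 0
      (hb.tendsto hD hF hϑ (isCompact_singleton.prod isCompact_Icc))
      fun j hj => (hσ.fcoef_theta h (hc j.1 j.2) 0).2 _ (hσ.disjoint_range hN hX hj.symm γ)
  exact mul_right_cancel₀ (mul_ne_zero (hσ.ne_zero _ _) (eBase_ne_zero ψ φ _ _))
    ((key b hb).symm.trans
      (key a (hasExpansion_of_tendsto hD hX.surjective hF hϑ ha)))

/-- Each orbit of lattice points has a member in one fixed ball, which contains only finitely many
lattice points, and different m have disjoint orbits. -/
lemma finite_bohrSommerfeld_index [CompactSpace M] (hN : 0 < N) (hX : IsFundDomain Δ.q X)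
    {σ : (Fin n → ℤ) → Deck Δ.q → Fin n → ℤ}
    (hσ : ∀ m γ, latticePt N (σ m γ) = γ.1 (latticePt N m)) :
    Finite {m : Fin n → ℤ // latticePt N m ∈ X} := by
  obtain ⟨R, hR⟩ := exists_bounded_preimage (Δ := Δ) hX.surjective
  have h1 : ∀ m : {m : Fin n → ℤ // latticePt N m ∈ X}, ∃ γ : Deck Δ.q,
      ‖latticePt N (σ m.1 γ)‖ ≤ R := by
    intro m
    obtain ⟨z, hz, hzm⟩ := hR (Δ.Q (latticePt N m.1, 0))
    have h2 := congrArg π hzm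
    rw [Δ.actionAngle.proj _ trivial, ← Prod.mk.eta (p := z), Δ.actionAngle.proj _ trivial] at h2
    obtain ⟨γ, hγ⟩ := exists_deck Δ.covering h2.symm
    exact ⟨γ, by rw [hσ, hγ]; exact (norm_fst_le z).trans hz⟩
  choose γ hγ using h1
  have := (finite_latticePt (n := n) hN R).to_subtype
  refine Finite.of_injective (β := {k : Fin n → ℤ | ‖latticePt N k‖ ≤ R})
    (fun m => ⟨σ m.1 (γ m), hγ m⟩) fun m m' hm => ?_
  have h2 := (bijective_index Δ.covering hN hX hσ).1 (a₁ := (m, γ m)) (a₂ := (m', γ m'))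
    (congrArg Subtype.val hm)
  exact congrArg Prod.fst h2

lemma isHolomorphicSection_sum (hD : IsPrequantum ωM D) (hq : Function.Surjective Δ.q)
    (hZ : IsSiegelMap J univ Δ.Q Z) {ι : Type*} {ϑ : ι → ∀ p, Pow L N p}
    (hϑ : ∀ i, IsHolomorphicSection J D N (ϑ i)) (T : Finset ι) (c : ι → ℂ) :
    IsHolomorphicSection J D N (∑ i ∈ T, c i • ϑ i) := by
  choose Θ hΘ using fun i => exists_coefAt Δ (ϑ i)
  have h1 := fun i => (isHolomorphicSection_iff hD hq hZ (hΘ i)).1 (hϑ i)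
  have h2 : ∀ z, CoefAt Δ N (∑ i ∈ T, c i • ϑ i) (fun z => ∑ i ∈ T, c i * Θ i z) z := fun z => by
    have h3 := CoefAt.sum (T := T) (c := c) fun i _ => hΘ i z
    convert h3 using 1
    funext p
    simp
  rw [isHolomorphicSection_iff hD hq hZ h2]
  exact ⟨ContDiff.sum fun i _ => contDiff_const.mul (h1 i).1, fun z =>
    IsHolAt.sum (fun i => (h1 i).1.differentiable (by simp)) (fun i => (h1 i).2 z) T⟩

lemma HasExpansion.sum {ι : Type*} {ϑ : ι → ∀ p, Pow L N p} {c : ι → ℂ} {T : Finset ι}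
    (h : ∀ i ∉ T, c i = 0) : HasExpansion ϑ c (∑ i ∈ T, c i • ϑ i) := by
  intro K _ ε hε
  refine ⟨T, fun T' hT p _ => ?_⟩
  have : (∑ i ∈ T, c i • ϑ i) p - ∑ i ∈ T', c i • ϑ i p = 0 := by
    rw [Finset.sum_apply, sub_eq_zero]
    exact Finset.sum_subset hT fun i _ hi => by rw [h i hi, zero_smul]; rfl
  rw [this, hermPow, map_zero, map_zero, mul_zero, norm_zero]
  exact hε

/-- A linear relation and the trivial one are two expansions of the zero section. -/
lemma linearIndependent_theta (hD : IsPrequantum ωM D) (hN : 0 < N)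
    (hX : IsFundDomain Δ.q X) (hZ : IsSiegelMap J univ Δ.Q Z) (h : IsPotential Z ψ φ)
    (hϑ : ∀ m, IsThetaSection Δ N Z m.1 (ϑ m))
    (hc : ∀ m : Fin n → ℤ, latticePt N m ∈ X → ThetaConverges Δ N Z m) :
    LinearIndependent ℂ ϑ := by
  rw [linearIndependent_iff]
  intro l hl
  have h1 : HasExpansion ϑ l 0 := by
    rw [← hl, Finsupp.linearCombination_apply, Finsupp.sum]
    exact HasExpansion.sum fun i hi => Finsupp.notMem_support_iff.1 hi
  have h2 : HasExpansion ϑ 0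
      (∑ i ∈ ∅, (0 : {m : Fin n → ℤ // latticePt N m ∈ X} → ℂ) i • ϑ i) :=
    HasExpansion.sum (T := ∅) fun i _ => rfl
  have h3 := isHolomorphicSection_sum (T := ∅) hD hX.surjective hZ
    (fun m => (hϑ m).isHolomorphicSection hD hN hX.surjective hZ h (hc m.1 m.2)) 0
  rw [Finset.sum_empty] at h2 h3
  exact DFunLike.coe_injective
    ((existsUnique_expansion hD hN hX hZ h hϑ hc h3).unique h1 h2)

lemma mem_span_theta_iff [CompactSpace M] (hD : IsPrequantum ωM D) (hN : 0 < N)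
    (hX : IsFundDomain Δ.q X) (hZ : IsSiegelMap J univ Δ.Q Z) (h : IsPotential Z ψ φ)
    (hϑ : ∀ m, IsThetaSection Δ N Z m.1 (ϑ m))
    (hc : ∀ m : Fin n → ℤ, latticePt N m ∈ X → ThetaConverges Δ N Z m)
    [Finite {m : Fin n → ℤ // latticePt N m ∈ X}] (s : ∀ p, Pow L N p) :
    s ∈ Submodule.span ℂ (range ϑ) ↔ IsHolomorphicSection J D N s := by
  have := Fintype.ofFinite {m : Fin n → ℤ // latticePt N m ∈ X}
  rw [Submodule.mem_span_range_iff_exists_fun]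
  constructor
  · rintro ⟨c, rfl⟩
    exact isHolomorphicSection_sum hD hX.surjective hZ
      (fun m => (hϑ m).isHolomorphicSection hD hN hX.surjective hZ h (hc m.1 m.2)) _ c
  · intro hs
    obtain ⟨c, hE, -⟩ := existsUnique_expansion hD hN hX hZ h hϑ hc hs
    obtain ⟨F, hF⟩ := exists_coefAt Δ s
    exact ⟨c, (hE.eq_sum hX.surjective hD hF hϑ).symm⟩

end ThetaBasis

/-! ### The Liouville measure in action-angle coordinates -/

section Measure

open scoped ENNReal

/-- If the measures `μ i` are bounded by `ν` on `S`, so is their supremum. -/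
lemma restrict_iSup_le {ι X : Type*} [MeasurableSpace X] {μ : ι → Measure X} {ν : Measure X}
    {S : Set X} (hS : MeasurableSet S) (h : ∀ i, (μ i).restrict S ≤ ν) :
    (⨆ i, μ i).restrict S ≤ ν := by
  -- Adding an infinite multiple of counting measure off S makes a bound for each μ i itself, so it
  -- bounds the supremum; the addition vanishes on subsets of S.
  have h1 : ⨆ i, μ i ≤ ν + ((⊤ : ℝ≥0∞) • Measure.count).restrict Sᶜ := by
    refine iSup_le fun i => ?_
    rw [← Measure.restrict_add_restrict_compl (μ := μ i) hS]
    refine add_le_add (h i) (Measure.restrict_mono' (Eventually.of_forall fun _ => id) ?_)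
    refine Measure.le_iff.2 fun A hA => ?_
    rcases A.eq_empty_or_nonempty with rfl | hne
    · simp
    · rw [Measure.smul_apply, smul_eq_mul, ENNReal.top_mul (Measure.count_ne_zero hne)]
      exact le_top
  refine Measure.le_iff.2 fun A hA => ?_
  rw [Measure.restrict_apply hA]
  refine (h1 (A ∩ S)).trans ?_
  rw [Measure.add_apply, Measure.restrict_apply (hA.inter hS)]
  have : A ∩ S ∩ Sᶜ = ∅ := by
    rw [inter_assoc, inter_compl_self, inter_empty]
  rw [this, measure_empty, add_zero]
  exact measure_mono inter_subset_left

lemma det_bilin_comp {d : ℕ} (b : EuclideanSpace ℝ (Fin d) →L[ℝ] EuclideanSpace ℝ (Fin d) →L[ℝ] ℝ)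
    (A : EuclideanSpace ℝ (Fin d) →L[ℝ] EuclideanSpace ℝ (Fin d)) :
    (Matrix.of fun i j => b (A (EuclideanSpace.single i 1)) (A (EuclideanSpace.single j 1))).det
      = A.det ^ 2 * (Matrix.of fun i j => b (EuclideanSpace.single i 1)
        (EuclideanSpace.single j 1)).det := by
  let v := (EuclideanSpace.basisFun (Fin d) ℝ).toBasis
  have hv : ∀ i, v i = EuclideanSpace.single i (1 : ℝ) := fun i => by simp [v]
  let β : LinearMap.BilinForm ℝ (EuclideanSpace ℝ (Fin d)) :=
    LinearMap.mk₂ ℝ (fun u w => b u w) (by simp) (by simp) (by simp) (by simp)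
  have h1 := LinearMap.BilinForm.toMatrix_comp v v β (A : _ →ₗ[ℝ] _) (A : _ →ₗ[ℝ] _)
  have h2 := congrArg Matrix.det h1
  rw [Matrix.det_mul, Matrix.det_mul, Matrix.det_transpose, LinearMap.det_toMatrix] at h2
  have h3 : LinearMap.BilinForm.toMatrix v (β.comp (A : _ →ₗ[ℝ] _) (A : _ →ₗ[ℝ] _))
      = Matrix.of fun i j => b (A (EuclideanSpace.single i 1)) (A (EuclideanSpace.single j 1)) := by
    ext i j
    rw [LinearMap.BilinForm.toMatrix_apply, hv, hv]
    rfl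
  have h4 : LinearMap.BilinForm.toMatrix v β
      = Matrix.of fun i j => b (EuclideanSpace.single i 1) (EuclideanSpace.single j 1) := by
    ext i j
    rw [LinearMap.BilinForm.toMatrix_apply, hv, hv]
    rfl
  rw [h3, h4] at h2
  rw [h2]
  change A.det * _ * A.det = _
  ring

variable {n : ℕ} {M : Type*} [TopologicalSpace M]
  [ChartedSpace (EuclideanSpace ℝ (Fin (2 * n))) M] [MeasurableSpace M]
  {ωM : ∀ p : M, Tan (2 * n) p →L[ℝ] Tan (2 * n) p →L[ℝ] ℝ}
  {Q : Rn n × Rn n → M} {W : Set (Rn n × Rn n)} {R : M → Rn n × Rn n}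

/-- The part of the Liouville measure in the chart at `p`. -/
def chartMeasure {d : ℕ} {M : Type*} [TopologicalSpace M]
    [ChartedSpace (EuclideanSpace ℝ (Fin d)) M] [MeasurableSpace M]
    (ωM : ∀ p : M, Tan d p →L[ℝ] Tan d p →L[ℝ] ℝ) (p : M) : Measure M :=
  let c := chartAt (EuclideanSpace ℝ (Fin d)) p
  let e : ∀ u : EuclideanSpace ℝ (Fin d), Fin d → Tan d (c.symm u) := fun u i =>
    mfderiv (𝓡 d) (𝓡 d) c.symm u (EuclideanSpace.single i (1 : ℝ))
  Measure.map c.symm ((volume.restrict c.target).withDensity fun u =>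
    ENNReal.ofReal (Real.sqrt |(Matrix.of fun i j => ωM (c.symm u) (e u i) (e u j)).det|))

/-- A linear identification of `ℝⁿ × ℝⁿ` with `ℝ²ⁿ`. -/
def euclid (n : ℕ) : (Rn n × Rn n) ≃L[ℝ] EuclideanSpace ℝ (Fin (2 * n)) :=
  ContinuousLinearEquiv.ofFinrankEq (by simp; ring)

/-- The density of the Liouville measure in coordinates in which the form has constant
coefficients `β`. -/
def euclidDensity (β : Rn n × Rn n → Rn n × Rn n → ℝ) : ℝ≥0∞ :=
  ENNReal.ofReal (Real.sqrt |(Matrix.of fun i j : Fin (2 * n) =>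
    β ((euclid n).symm (EuclideanSpace.single i 1))
      ((euclid n).symm (EuclideanSpace.single j 1))).det|)

/-- Uniqueness of Haar measure gives the constant. Its value is irrelevant to the vanishing of
integrals. -/
lemma exists_volume_image_euclid (n : ℕ) : ∃ c : NNReal, ∀ S : Set (Rn n × Rn n),
    volume (euclid n '' S) = c * volume S := by
  have : Measure.IsAddHaarMeasure
      (Measure.map (euclid n).symm (volume : Measure (EuclideanSpace ℝ (Fin (2 * n))))) :=
    (euclid n).symm.isAddHaarMeasure_map volume
  have : Measure.IsAddHaarMeasure (volume : Measure (Rn n × Rn n)) :=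
    Measure.prod.instIsAddHaarMeasure _ _
  refine ⟨Measure.addHaarScalarFactor (Measure.map (euclid n).symm volume) volume, fun S => ?_⟩
  have h1 := Measure.isAddLeftInvariant_eq_smul
    (Measure.map (euclid n).symm (volume : Measure (EuclideanSpace ℝ (Fin (2 * n)))))
    (volume : Measure (Rn n × Rn n))
  have h2 := congrArg (fun μ : Measure (Rn n × Rn n) => μ S) h1
  have h3 : Measure.map (euclid n).symm (volume : Measure (EuclideanSpace ℝ (Fin (2 * n)))) S
      = volume ((euclid n).symm ⁻¹' S) :=
    (euclid n).symm.toHomeomorph.toMeasurableEquiv.map_apply S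
  refine Eq.trans ?_ (h3.symm.trans (h2.trans ?_))
  · rw [(euclid n).image_eq_preimage_symm]
  · rw [Measure.smul_apply]
    rfl

end Measure

/-! ### Change of variables from charts to action-angle coordinates -/

section LiouvilleMeasure

open scoped ENNReal

variable {n : ℕ} {M : Type*} [TopologicalSpace M]
  [ChartedSpace (EuclideanSpace ℝ (Fin (2 * n))) M] [MeasurableSpace M] [BorelSpace M]
  [IsManifold (𝓡 (2 * n)) ∞ M]
  {ωM : ∀ p : M, Tan (2 * n) p →L[ℝ] Tan (2 * n) p →L[ℝ] ℝ}
  {Q : Rn n × Rn n → M} {W : Set (Rn n × Rn n)} {R : M → Rn n × Rn n}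
  {β : Rn n × Rn n → Rn n × Rn n → ℝ}

/-- The density of the Liouville measure of a form with constant coefficients `β`. -/
def liouvilleConst (n : ℕ) (β : Rn n × Rn n → Rn n × Rn n → ℝ) : ℝ≥0∞ :=
  euclidDensity β * (exists_volume_image_euclid n).choose

lemma liouvilleConst_ne_top (β : Rn n × Rn n → Rn n × Rn n → ℝ) : liouvilleConst n β ≠ ⊤ :=
  ENNReal.mul_ne_top ENNReal.ofReal_ne_top ENNReal.coe_ne_top

omit [BorelSpace M] [IsManifold (𝓡 (2 * n)) ∞ M] [MeasurableSpace M] in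
/-- The density in a chart and the density in constant coefficients. -/
lemma density_eq {c : OpenPartialHomeomorph M (EuclideanSpace ℝ (Fin (2 * n)))}
    {f : EuclideanSpace ℝ (Fin (2 * n)) → EuclideanSpace ℝ (Fin (2 * n))}
    {w : EuclideanSpace ℝ (Fin (2 * n))}
    (hc : MDifferentiableAt (𝓡 (2 * n)) (𝓡 (2 * n)) c.symm (f w))
    (hf : DifferentiableAt ℝ f w)
    (hQ : MDifferentiableAt 𝓘(ℝ, Rn n × Rn n) (𝓡 (2 * n)) Q ((euclid n).symm w))
    (hfQ : c.symm ∘ f =ᶠ[𝓝 w] Q ∘ (euclid n).symm)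
    (hβ : ∀ u v, ωM (Q ((euclid n).symm w)) (dQ Q ((euclid n).symm w) u)
      (dQ Q ((euclid n).symm w) v) = β u v) :
    ENNReal.ofReal |(fderiv ℝ f w).det| * ENNReal.ofReal (Real.sqrt |(Matrix.of fun i j =>
      ωM (c.symm (f w))
        (mfderiv (𝓡 (2 * n)) (𝓡 (2 * n)) c.symm (f w) (EuclideanSpace.single i (1 : ℝ)))
        (mfderiv (𝓡 (2 * n)) (𝓡 (2 * n)) c.symm (f w) (EuclideanSpace.single j (1 : ℝ)))).det|)
      = euclidDensity β := by
  let T : EuclideanSpace ℝ (Fin (2 * n)) →L[ℝ] EuclideanSpace ℝ (Fin (2 * n)) :=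
    mfderiv (𝓡 (2 * n)) (𝓡 (2 * n)) c.symm (f w)
  let b : EuclideanSpace ℝ (Fin (2 * n)) →L[ℝ] EuclideanSpace ℝ (Fin (2 * n)) →L[ℝ] ℝ :=
    ((ωM (c.symm (f w)) : EuclideanSpace ℝ (Fin (2 * n)) →L[ℝ]
      EuclideanSpace ℝ (Fin (2 * n)) →L[ℝ] ℝ)).bilinearComp T T
  have h1 := det_bilin_comp b (fderiv ℝ f w)
  have hchain : ∀ u : EuclideanSpace ℝ (Fin (2 * n)),
      T (fderiv ℝ f w u) = dQ Q ((euclid n).symm w) ((euclid n).symm u) := by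
    intro u
    have h2 : HasMFDerivAt (𝓡 (2 * n)) (𝓡 (2 * n)) (c.symm ∘ f) w
        ((mfderiv (𝓡 (2 * n)) (𝓡 (2 * n)) c.symm (f w)).comp (fderiv ℝ f w)) :=
      HasMFDerivAt.comp w hc.hasMFDerivAt hf.hasFDerivAt.hasMFDerivAt
    have h3 : HasMFDerivAt (𝓡 (2 * n)) (𝓡 (2 * n)) (Q ∘ (euclid n).symm) w
        ((mfderiv 𝓘(ℝ, Rn n × Rn n) (𝓡 (2 * n)) Q ((euclid n).symm w)).comp
          ((euclid n).symm : EuclideanSpace ℝ (Fin (2 * n)) →L[ℝ] Rn n × Rn n)) :=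
      HasMFDerivAt.comp w hQ.hasMFDerivAt
        ((euclid n).symm : EuclideanSpace ℝ (Fin (2 * n)) →L[ℝ] Rn n × Rn n).hasFDerivAt.hasMFDerivAt
    have h4 := h2.mfderiv.symm.trans (hfQ.mfderiv_eq.trans h3.mfderiv)
    exact congrArg (fun T : EuclideanSpace ℝ (Fin (2 * n)) →L[ℝ] EuclideanSpace ℝ (Fin (2 * n)) =>
      T u) h4
  have hbase : ∀ {p p' : M} (_ : p = p') (u v : EuclideanSpace ℝ (Fin (2 * n))),
      (ωM p : EuclideanSpace ℝ (Fin (2 * n)) →L[ℝ] EuclideanSpace ℝ (Fin (2 * n)) →L[ℝ] ℝ) u v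
        = (ωM p' : EuclideanSpace ℝ (Fin (2 * n)) →L[ℝ]
          EuclideanSpace ℝ (Fin (2 * n)) →L[ℝ] ℝ) u v := by
    rintro p _ rfl u v
    rfl
  have hb : ∀ u v, b (fderiv ℝ f w u) (fderiv ℝ f w v)
      = β ((euclid n).symm u) ((euclid n).symm v) := by
    intro u v
    rw [← hβ]
    refine Eq.trans ?_ (hbase hfQ.self_of_nhds _ _)
    change (ωM (c.symm (f w)) : EuclideanSpace ℝ (Fin (2 * n)) →L[ℝ]
      EuclideanSpace ℝ (Fin (2 * n)) →L[ℝ] ℝ) (T (fderiv ℝ f w u)) (T (fderiv ℝ f w v)) = _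
    rw [hchain, hchain]
    rfl
  simp only [hb] at h1
  rw [euclidDensity, h1, abs_mul, abs_pow, Real.sqrt_mul (by positivity),
    Real.sqrt_sq (abs_nonneg _), ENNReal.ofReal_mul (abs_nonneg _)]
  rfl

/-- The Liouville measure in a chart by change of variables. -/
lemma chartMeasure_apply (hR : IsLocalInverse Q W R)
    (hβ : ∀ z ∈ W, ∀ u v, ωM (Q z) (dQ Q z u) (dQ Q z v) = β u v) (p : M) {A : Set M}
    (hA : MeasurableSet A) (hAW : A ⊆ Q '' W) :
    chartMeasure ωM p A = liouvilleConst n β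
      * volume (W ∩ Q ⁻¹' (A ∩ (chartAt (EuclideanSpace ℝ (Fin (2 * n))) p).source)) := by
  set c := chartAt (EuclideanSpace ℝ (Fin (2 * n))) p with hc
  set S := W ∩ Q ⁻¹' (A ∩ c.source) with hS
  have hSm : MeasurableSet S := by
    have h1 : Measurable (W.domRestrict Q) :=
      (continuousOn_iff_continuous_domRestrict.1 hR.smooth.continuousOn).measurable
    have h2 := hR.isOpen.measurableSet.subtype_image (h1 (hA.inter c.open_source.measurableSet))
    convert h2 using 1
    ext z
    exact ⟨fun h => ⟨⟨z, h.1⟩, h.2, rfl⟩, by rintro ⟨⟨w, hw⟩, h, rfl⟩; exact ⟨hw, h⟩⟩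
  -- This is Q read in the chart. Its Jacobian times the chart density is the constant
  -- `euclidDensity β`, so the change of variables leaves a multiple of Lebesgue measure.
  set f : EuclideanSpace ℝ (Fin (2 * n)) → EuclideanSpace ℝ (Fin (2 * n)) :=
    fun w => c (Q ((euclid n).symm w)) with hf
  have hsm : MeasurableSet (euclid n '' S) :=
    (euclid n).toHomeomorph.toMeasurableEquiv.measurableSet_image.2 hSm
  have hdiff : ∀ z ∈ S, DifferentiableAt ℝ f (euclid n z) := by
    intro z hz
    have h1 : MDifferentiableAt (𝓡 (2 * n)) (𝓡 (2 * n)) c (Q z) :=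
      ((contMDiffOn_chart (I := 𝓡 (2 * n)) (n := ∞)).contMDiffAt
        (c.open_source.mem_nhds hz.2.2)).mdifferentiableAt (by simp)
    have h2 : HasMFDerivAt (𝓡 (2 * n)) 𝓘(ℝ, Rn n × Rn n) (euclid n).symm (euclid n z)
        ((euclid n).symm : EuclideanSpace ℝ (Fin (2 * n)) →L[ℝ] Rn n × Rn n) :=
      ((euclid n).symm : EuclideanSpace ℝ (Fin (2 * n)) →L[ℝ] Rn n × Rn n).hasFDerivAt.hasMFDerivAt
    have h3 : MDifferentiableAt 𝓘(ℝ, Rn n × Rn n) (𝓡 (2 * n)) Q ((euclid n).symm (euclid n z)) := by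
      rw [ContinuousLinearEquiv.symm_apply_apply]
      exact hR.mdifferentiableAt hz.1
    have h4 : MDifferentiableAt (𝓡 (2 * n)) (𝓡 (2 * n)) c (Q ((euclid n).symm (euclid n z))) := by
      rw [ContinuousLinearEquiv.symm_apply_apply]
      exact h1
    have h5 : MDifferentiableAt (𝓡 (2 * n)) (𝓡 (2 * n)) f (euclid n z) :=
      MDifferentiableAt.comp (euclid n z) (g := c) h4
        (MDifferentiableAt.comp (euclid n z) (g := Q) h3 h2.mdifferentiableAt)
    exact mdifferentiableAt_iff_differentiableAt.1 h5
  have hinj : InjOn f (euclid n '' S) := by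
    rintro _ ⟨z, hz, rfl⟩ _ ⟨z', hz', rfl⟩ h
    simp only [hf, ContinuousLinearEquiv.symm_apply_apply] at h
    rw [← hR.left_inv z hz.1, ← hR.left_inv z' hz'.1, c.injOn hz.2.2 hz'.2.2 h]
  have himage : f '' (euclid n '' S) = c.symm ⁻¹' A ∩ c.target := by
    ext u
    constructor
    · rintro ⟨_, ⟨z, hz, rfl⟩, rfl⟩
      simp only [hf, ContinuousLinearEquiv.symm_apply_apply]
      exact ⟨by rw [mem_preimage, c.left_inv hz.2.2]; exact hz.2.1, c.map_source hz.2.2⟩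
    · rintro ⟨h1, h2⟩
      obtain ⟨z, hz, hzu⟩ := hAW h1
      refine ⟨_, ⟨z, ⟨hz, ?_⟩, rfl⟩, ?_⟩
      · rw [mem_preimage, hzu]
        exact ⟨h1, c.map_target h2⟩
      · simp only [hf, ContinuousLinearEquiv.symm_apply_apply]
        rw [hzu, c.right_inv h2]
  have hmeas : AEMeasurable c.symm (volume.restrict c.target) :=
    c.continuousOn_symm.aemeasurable c.open_target.measurableSet
  rw [chartMeasure, ← hc, Measure.map_apply_of_aemeasurable
    (hmeas.mono_ac (withDensity_absolutelyContinuous _ _)) hA, withDensity_apply',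
    Measure.restrict_restrict' c.open_target.measurableSet, ← himage,
    lintegral_image_eq_lintegral_abs_det_fderiv_mul volume hsm
      (f' := fun w => fderiv ℝ f w) (fun w hw => by
        obtain ⟨z, hz, rfl⟩ := hw
        exact (hdiff z hz).hasFDerivAt.hasFDerivWithinAt) hinj,
    setLIntegral_congr_fun (g := fun _ => euclidDensity β) hsm ?_, setLIntegral_const,
    (exists_volume_image_euclid n).choose_spec S, liouvilleConst, mul_assoc]
  rintro _ ⟨z, hz, rfl⟩
  have hz' := (euclid n).symm_apply_apply z
  refine density_eq (Q := Q) (c := c) (f := f) ?_ (hdiff z hz) ?_ ?_ ?_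
  · refine ((contMDiffOn_chart_symm (I := 𝓡 (2 * n)) (n := ∞)).contMDiffAt
      (c.open_target.mem_nhds ?_)).mdifferentiableAt (by simp)
    simp only [hf, hz']
    exact c.map_source hz.2.2
  · rw [hz']
    exact hR.mdifferentiableAt hz.1
  · have h1 : ContinuousAt (fun w => Q ((euclid n).symm w)) (euclid n z) := by
      have h2 := (hR.contMDiffAt hz.1).continuousAt
      rw [← hz'] at h2
      exact h2.comp (euclid n).symm.continuous.continuousAt
    have h3 : Q ((euclid n).symm (euclid n z)) ∈ c.source := by rw [hz']; exact hz.2.2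
    filter_upwards [h1.preimage_mem_nhds (c.open_source.mem_nhds h3)] with w hw
    exact c.left_inv hw
  · rw [hz']
    exact hβ z hz.1

end LiouvilleMeasure

/-! ### Integration over the fibres -/

section Integration

open scoped ENNReal

variable {n : ℕ} {M B : Type*} [TopologicalSpace M]
  [ChartedSpace (EuclideanSpace ℝ (Fin (2 * n))) M] [MeasurableSpace M] [BorelSpace M]
  [IsManifold (𝓡 (2 * n)) ∞ M] [TopologicalSpace B]
  {ωM ηM : ∀ p : M, Tan (2 * n) p →L[ℝ] Tan (2 * n) p →L[ℝ] ℝ} {π : M → B} {q : Rn n → B}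
  {Q : Rn n × Rn n → M} {W : Set (Rn n × Rn n)} {R : M → Rn n × Rn n}
  {β : Rn n × Rn n → Rn n × Rn n → ℝ}

/-- Every chart gives the same density on its own source, so the supremum is attained by a chart
whose source contains Q '' W. -/
lemma liouville_apply (hR : IsLocalInverse Q W R)
    (hβ : ∀ z ∈ W, ∀ u v, ηM (Q z) (dQ Q z u) (dQ Q z v) = β u v) {p : M}
    (hp : Q '' W ⊆ (chartAt (EuclideanSpace ℝ (Fin (2 * n))) p).source) {A : Set M}
    (hA : MeasurableSet A) (hAW : A ⊆ Q '' W) :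
    liouville ηM A = liouvilleConst n β * volume (W ∩ Q ⁻¹' A) := by
  have h0 : ∀ A : Set M, MeasurableSet A → A ⊆ Q '' W →
      chartMeasure ηM p A = liouvilleConst n β * volume (W ∩ Q ⁻¹' A) := by
    intro A hA hAW
    rw [chartMeasure_apply hR hβ p hA hAW, inter_eq_left.2 (hAW.trans hp)]
  have h1 : liouville ηM = ⨆ p, chartMeasure ηM p := rfl
  rw [← h0 A hA hAW]
  refine le_antisymm ?_ ?_
  · have h2 : (⨆ p, chartMeasure ηM p).restrict (Q '' W) ≤ chartMeasure ηM p := by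
      refine restrict_iSup_le hR.isOpen_image.measurableSet fun i => Measure.le_iff.2 fun A' hA' => ?_
      have h3 := hA'.inter hR.isOpen_image.measurableSet
      rw [Measure.restrict_apply hA', chartMeasure_apply hR hβ i h3 inter_subset_right]
      refine le_trans ?_ (measure_mono (inter_subset_left (t := Q '' W)))
      rw [h0 _ h3 inter_subset_right]
      exact mul_le_mul' le_rfl
        (measure_mono (inter_subset_inter_right _ (preimage_mono inter_subset_left)))
    have h3 := h2 A
    rw [Measure.restrict_apply hA, inter_eq_left.2 hAW] at h3
    rw [h1]
    exact h3
  · rw [h1]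
    exact le_iSup (chartMeasure ηM) p A

omit [IsManifold (𝓡 (2 * n)) ∞ M] [MeasurableSpace M] [BorelSpace M] [TopologicalSpace B] in
lemma IsActionAngle.injOn_box (hQ : IsActionAngle ωM π univ q Q) {V : Set (Rn n)}
    (hV : InjOn q V) (a : Rn n) : InjOn Q (V ×ˢ box a) := by
  rintro ⟨x, y⟩ ⟨hx, hy⟩ ⟨x', y'⟩ ⟨hx', hy'⟩ h
  have h1 := congrArg π h
  rw [hQ.proj x trivial, hQ.proj x' trivial] at h1
  obtain rfl := hV hx hx' h1
  obtain ⟨k, hk⟩ := (hQ.periodic x trivial y y').1 h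
  refine Prod.ext rfl (funext fun i => ?_)
  dsimp only
  have h2 := hy i
  have h3 := hy' i
  dsimp only at h2 h3
  rw [hk i] at h3 ⊢
  have h4 : (k i : ℝ) < 1 := by linarith [h2.1, h3.2]
  have h5 : (-1 : ℝ) < k i := by linarith [h2.2, h3.1]
  have h6 : k i = 0 := by
    have h7 : k i < 1 := by exact_mod_cast h4
    have h8 : -1 < k i := by exact_mod_cast h5
    omega
  rw [h6, Int.cast_zero, add_zero]

/-- For fixed x the condition on y is periodic, so its volume in a unit cube does not depend on the
cube; Fubini integrates this over x. -/
lemma volume_box_inter_preimage (hQ : IsActionAngle ωM π univ q Q) {V : Set (Rn n)}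
    (hV : MeasurableSet V) {A : Set M} (hA : MeasurableSet A) (a b : Rn n) :
    volume ((V ×ˢ box a) ∩ Q ⁻¹' A) = volume ((V ×ˢ box b) ∩ Q ⁻¹' A) := by
  have hQm : Measurable Q := hQ.contMDiff.continuous.measurable
  have h0 : ∀ (x : Rn n) (a : Rn n), volume.real (box a ∩ {y | Q (x, y) ∈ A})
      = volume.real (box (0 : Rn n) ∩ {y | Q (x, y) ∈ A}) := by
    intro x a
    set S := {y | Q (x, y) ∈ A}
    have hS : MeasurableSet S := (hQm.comp measurable_prodMk_left) hA
    have h1 := setIntegral_box (f := S.indicator fun _ => (1 : ℂ)) (fun y k => by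
      have h2 : (y + fun i => (k i : ℝ)) ∈ S ↔ y ∈ S := by
        change Q (x, y + fun i => (k i : ℝ)) ∈ A ↔ Q (x, y) ∈ A
        rw [hQ.add_int]
      by_cases h : y ∈ S
      · rw [indicator_of_mem h, indicator_of_mem (h2.2 h)]
      · rw [indicator_of_notMem h, indicator_of_notMem fun h' => h (h2.1 h')]) a 0
    rw [integral_indicator_const _ hS, integral_indicator_const _ hS, measureReal_restrict_apply hS,
      measureReal_restrict_apply hS] at h1
    rw [inter_comm (box a), inter_comm (box 0)]
    simpa using h1
  have key : ∀ a : Rn n, volume ((V ×ˢ box a) ∩ Q ⁻¹' A)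
      = ∫⁻ x in V, volume (box (0 : Rn n) ∩ {y | Q (x, y) ∈ A}) := by
    intro a
    have hm : MeasurableSet ((V ×ˢ box a) ∩ Q ⁻¹' A) :=
      (hV.prod (measurableSet_box a)).inter (hQm hA)
    change (volume.prod volume) _ = _
    rw [Measure.prod_apply hm, ← lintegral_indicator hV]
    refine lintegral_congr fun x => ?_
    by_cases hx : x ∈ V
    · rw [indicator_of_mem hx]
      have h1 : Prod.mk x ⁻¹' ((V ×ˢ box a) ∩ Q ⁻¹' A) = box a ∩ {y | Q (x, y) ∈ A} := by
        ext y
        simp [hx]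
      have hfin : ∀ a : Rn n, volume (box a ∩ {y | Q (x, y) ∈ A}) ≠ ⊤ := fun a =>
        ((measure_mono inter_subset_left).trans_lt
          (by rw [volume_box]; exact ENNReal.one_lt_top)).ne
      rw [h1]
      exact (ENNReal.toReal_eq_toReal_iff' (hfin a) (hfin 0)).1 (h0 x a)
    · rw [indicator_of_notMem hx]
      have h1 : Prod.mk x ⁻¹' ((V ×ˢ box a) ∩ Q ⁻¹' A) = ∅ := by
        ext y
        simp [hx]
      rw [h1, measure_empty]
  rw [key a, key b]

lemma exists_ball_liouville (hQ : IsActionAngle ωM π univ q Q)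
    (hβ : ∀ z u v, ηM (Q z) (dQ Q z u) (dQ Q z v) = β u v) {z : Rn n × Rn n}
    {O : Set (Rn n × Rn n)} (hO : O ∈ 𝓝 z) : ∃ r > 0, Metric.ball z r ⊆ O ∧
      ∀ A, MeasurableSet A → A ⊆ Q '' Metric.ball z r →
        liouville ηM A = liouvilleConst n β * volume (Metric.ball z r ∩ Q ⁻¹' A) := by
  set c := chartAt (EuclideanSpace ℝ (Fin (2 * n))) (Q z)
  have h1 : Q ⁻¹' c.source ∈ 𝓝 z := hQ.contMDiff.continuous.continuousAt.preimage_mem_nhds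
    (c.open_source.mem_nhds (mem_chart_source _ _))
  obtain ⟨r, hr, R, hb, hR⟩ := hQ.exists_localInverse_ball (inter_mem hO h1)
  refine ⟨r, hr, fun w hw => (hb hw).1, fun A hA hAW => ?_⟩
  exact liouville_apply hR (fun w _ => hβ w) (image_subset_iff.2 fun w hw => (hb hw).2) hA hAW

lemma isLocallyFiniteMeasure_liouville (hQ : IsActionAngle ωM π univ q Q)
    (hq : Function.Surjective q)
    (hβ : ∀ z u v, ηM (Q z) (dQ Q z u) (dQ Q z v) = β u v) :
    IsLocallyFiniteMeasure (liouville ηM) := by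
  refine ⟨fun p => ?_⟩
  obtain ⟨x, hx⟩ := hq (π p)
  obtain ⟨y, rfl⟩ := hQ.surjective x trivial p hx.symm
  obtain ⟨r, hr, -, h⟩ := exists_ball_liouville hQ hβ (z := (x, y)) univ_mem
  have ho : IsOpen (Q '' Metric.ball (x, y) r) := hQ.isOpenMap _ Metric.isOpen_ball
  refine ⟨_, ho.mem_nhds ⟨_, Metric.mem_ball_self hr, rfl⟩, ?_⟩
  rw [h _ ho.measurableSet subset_rfl]
  refine ENNReal.mul_lt_top (liouvilleConst_ne_top β).lt_top
    ((measure_mono inter_subset_left).trans_lt ?_)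
  exact Metric.isBounded_ball.measure_lt_top

/-- The Liouville measure over a small open set of the base. -/
lemma liouville_restrict [SecondCountableTopology M] (hQ : IsActionAngle ωM π univ q Q)
    (hβ : ∀ z u v, ηM (Q z) (dQ Q z u) (dQ Q z v) = β u v) {V : Set (Rn n)} (hVo : IsOpen V)
    (hV : InjOn q V) : (liouville ηM).restrict (π ⁻¹' (q '' V))
      = (liouvilleConst n β • Measure.map Q (volume.restrict (V ×ˢ box 0))).restrict
        (π ⁻¹' (q '' V)) := by
  have hQm : Measurable Q := hQ.contMDiff.continuous.measurable
  have h1 : ∀ p ∈ π ⁻¹' (q '' V), ∃ s ∈ 𝓝 p, (liouville ηM).restrict s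
      = (liouvilleConst n β • Measure.map Q (volume.restrict (V ×ˢ box 0))).restrict s := by
    rintro p ⟨x, hx, hp⟩
    obtain ⟨y, rfl⟩ := hQ.surjective x trivial p hp.symm
    -- The cube is centred at y, so the point lies in its interior and a small ball fits. The cube
    -- is afterwards exchanged for the one with corner 0.
    set a : Rn n := fun i => y i - 1 / 2 with ha
    have hO : V ×ˢ (univ.pi fun i => Ioo (a i) (a i + 1)) ∈ 𝓝 (x, y) := by
      refine prod_mem_nhds (hVo.mem_nhds hx)
        ((isOpen_set_pi finite_univ fun i _ => isOpen_Ioo).mem_nhds fun i _ => ?_)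
      constructor <;> simp only [ha] <;> linarith
    obtain ⟨r, hr, hb, h⟩ := exists_ball_liouville hQ hβ hO
    have ho : IsOpen (Q '' Metric.ball (x, y) r) := hQ.isOpenMap _ Metric.isOpen_ball
    refine ⟨_, ho.mem_nhds ⟨_, Metric.mem_ball_self hr, rfl⟩, Measure.ext fun A hA => ?_⟩
    have hA' := hA.inter ho.measurableSet
    rw [Measure.restrict_apply hA, Measure.restrict_apply hA, h _ hA' inter_subset_right,
      Measure.smul_apply, Measure.map_apply hQm hA', Measure.restrict_apply (hQm hA'), smul_eq_mul,
      inter_comm _ (V ×ˢ box 0), volume_box_inter_preimage hQ hVo.measurableSet hA' 0 a]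
    congr 2
    have hbox : Metric.ball (x, y) r ⊆ V ×ˢ box a := fun w hw =>
      ⟨(hb hw).1, fun i => Ioo_subset_Ioc_self ((hb hw).2 i trivial)⟩
    ext w
    constructor
    · rintro ⟨h2, h3⟩
      exact ⟨hbox h2, h3⟩
    · rintro ⟨h2, h3⟩
      obtain ⟨w', hw', hww⟩ := h3.2
      rw [← hQ.injOn_box hV a (hbox hw') h2 hww]
      exact ⟨hw', by rw [mem_preimage, hww]; exact h3⟩
  choose! f hf hfe using h1
  obtain ⟨t, ht, htc, hc⟩ := TopologicalSpace.countable_cover_nhdsWithin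
    (f := f) (s := π ⁻¹' (q '' V)) fun p hp => mem_nhdsWithin_of_mem_nhds (hf p hp)
  exact Measure.restrict_congr_mono hc
    ((Measure.restrict_biUnion_congr htc).2 fun p hp => hfe p (ht hp))

lemma setIntegral_eq_zero_of_fibre [SecondCountableTopology M] [MeasurableSpace B] [BorelSpace B]
    (hQ : IsActionAngle ωM π univ q Q) (hπ : Continuous π)
    (hβ : ∀ z u v, ηM (Q z) (dQ Q z u) (dQ Q z v) = β u v) {V : Set (Rn n)} (hVo : IsOpen V)
    (hV : InjOn q V) {S : Set B} (hS : MeasurableSet S) (hSV : S ⊆ q '' V) {g : M → ℂ}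
    (hg : Continuous g) (h0 : ∀ x, ∫ y in box (0 : Rn n), g (Q (x, y)) = 0) :
    ∫ p in π ⁻¹' S, g p ∂liouville ηM = 0 := by
  have hQc : Continuous Q := hQ.contMDiff.continuous
  have hQm : Measurable Q := hQc.measurable
  have hSm : MeasurableSet (π ⁻¹' S) := hπ.measurable hS
  rw [Measure.restrict_congr_mono (preimage_mono hSV) (liouville_restrict hQ hβ hVo hV),
    Measure.restrict_smul, integral_smul_measure,
    setIntegral_map hSm hg.aestronglyMeasurable hQm.aemeasurable,
    Measure.restrict_restrict (hQm hSm)]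
  have h1 : Q ⁻¹' (π ⁻¹' S) ∩ V ×ˢ box 0 = (V ∩ q ⁻¹' S) ×ˢ box 0 := by
    ext ⟨x, y⟩
    simp only [mem_inter_iff, mem_preimage, mem_prod, hQ.proj x trivial]
    tauto
  rw [h1]
  -- Without integrability the integral is 0 by convention, which is also the claimed value.
  by_cases hi : IntegrableOn (fun z => g (Q z)) ((V ∩ q ⁻¹' S) ×ˢ box 0) (volume.prod volume)
  · change _ • ∫ z in (V ∩ q ⁻¹' S) ×ˢ box 0, g (Q z) ∂(volume.prod volume) = 0
    rw [setIntegral_prod _ hi]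
    simp only [h0, integral_zero, smul_zero]
  · change _ • ∫ z in (V ∩ q ⁻¹' S) ×ˢ box 0, g (Q z) ∂(volume.prod volume) = 0
    rw [integral_undef hi, smul_zero]

/-- A function whose integrals over the fibres vanish has vanishing integral. -/
theorem integral_eq_zero_of_fibre [SecondCountableTopology M] [SecondCountableTopology B]
    (hQ : IsActionAngle ωM π univ q Q) (hq : IsCoveringMap q) (hqs : Function.Surjective q)
    (hπ : Continuous π) (hβ : ∀ z u v, ηM (Q z) (dQ Q z u) (dQ Q z v) = β u v) {g : M → ℂ}
    (hg : Continuous g) (hgi : Integrable g (liouville ηM))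
    (h0 : ∀ x, ∫ y in box (0 : Rn n), g (Q (x, y)) = 0) : ∫ p, g p ∂liouville ηM = 0 := by
  borelize B
  have h1 : ∀ b : B, ∃ V : Set (Rn n), IsOpen V ∧ InjOn q V ∧ b ∈ q '' V := by
    intro b
    obtain ⟨x, rfl⟩ := hqs b
    obtain ⟨O, hO, hqO⟩ := exists_nhds_injOn hq x
    exact ⟨interior O, isOpen_interior, hqO.mono interior_subset,
      x, mem_interior_iff_mem_nhds.2 hO, rfl⟩
  choose V hVo hV hbV using h1
  have hqo : ∀ b, IsOpen (q '' V b) := fun b => hq.isLocalHomeomorph.isOpenMap _ (hVo b)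
  obtain ⟨s, hs, hsu⟩ := TopologicalSpace.countable_cover_nhds
    fun b => (hqo b).mem_nhds (hbV b)
  have hne : s.Nonempty := by
    have h2 : q 0 ∈ ⋃ b ∈ s, q '' V b := by rw [hsu]; trivial
    obtain ⟨b, hb, -⟩ := mem_iUnion₂.1 h2
    exact ⟨b, hb⟩
  obtain ⟨f, rfl⟩ := hs.exists_eq_range hne
  -- Base sets over which q has an injective branch are made disjoint, so the integral over M is the
  -- sum of integrals over their preimages.
  set S : ℕ → Set B := disjointed fun i => q '' V (f i) with hS
  have hSm : ∀ i, MeasurableSet (S i) :=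
    MeasurableSet.disjointed fun i => (hqo (f i)).measurableSet
  have hSu : ⋃ i, π ⁻¹' S i = univ := by
    rw [← preimage_iUnion, hS, iUnion_disjointed, ← preimage_univ (f := π), ← hsu, biUnion_range]
  have hd : Pairwise (Function.onFun Disjoint fun i => π ⁻¹' S i) := fun i j hij =>
    (disjoint_disjointed _ hij).preimage π
  rw [← setIntegral_univ, ← hSu, integral_iUnion (fun i => hπ.measurable (hSm i)) hd
    hgi.integrableOn]
  refine (tsum_congr fun i => ?_).trans tsum_zero
  exact setIntegral_eq_zero_of_fibre hQ hπ hβ (hVo (f i)) (hV (f i)) (hSm i)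
    (disjointed_subset _ i) hg h0

end Integration

/-! ### Orthogonality of the theta sections -/

section Orthogonality

variable {n : ℕ} {M B : Type*} [TopologicalSpace M]
  [ChartedSpace (EuclideanSpace ℝ (Fin (2 * n))) M] [TopologicalSpace B]
  {L : M → Type*} [TopologicalSpace (Bundle.TotalSpace ℂ L)]
  [∀ p, NormedAddCommGroup (L p)] [∀ p, InnerProductSpace ℂ (L p)]
  [FiberBundle ℂ L] [VectorBundle ℝ ℂ L]
  {ωM : ∀ p : M, Tan (2 * n) p →L[ℝ] Tan (2 * n) p →L[ℝ] ℝ} {π : M → B}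
  {D : CovariantDerivative (𝓡 (2 * n)) ℂ L} {Δ : Development ωM π D} {N : ℕ}
  [IsManifold (𝓡 (2 * n)) ∞ M] [ContMDiffVectorBundle ∞ ℂ L (𝓡 (2 * n))]
  {s t : ∀ p, Pow L N p} {F G : Rn n × Rn n → ℂ}

lemma hermPow_eq (hD : IsPrequantum ωM D) (hs : ∀ z, CoefAt Δ N s F z)
    (ht : ∀ z, CoefAt Δ N t G z) (z : Rn n × Rn n) : hermPow N (s (Δ.Q z)) (t (Δ.Q z))
      = (starRingEnd ℂ) (F z) * G z * ((‖(Δ.τ 0).snd‖ ^ 2) ^ N : ℝ) := by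
  rw [(hs z).hermPow (ht z), Δ.isFrame.norm_eq hD Δ.actionAngle z 0]

/-- Q is an open quotient map, so continuity is tested on ℝⁿ × ℝⁿ. -/
lemma continuous_hermPow (hD : IsPrequantum ωM D) (hq : Function.Surjective Δ.q)
    (hs : ∀ z, CoefAt Δ N s F z) (ht : ∀ z, CoefAt Δ N t G z) (hF : Continuous F)
    (hG : Continuous G) : Continuous fun p => hermPow N (s p) (t p) := by
  have h1 : IsOpenQuotientMap Δ.Q :=
    ⟨Δ.exists_Q hq, Δ.actionAngle.contMDiff.continuous, Δ.actionAngle.isOpenMap⟩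
  rw [h1.isQuotientMap.continuous_iff, Function.comp_def]
  simp only [hermPow_eq hD hs ht]
  fun_prop

/-- Two periodic functions whose Fourier coefficients have disjoint supports are orthogonal. -/
lemma integral_conj_mul_eq_zero {ι : Type*} [Countable ι] {b : ι → ℂ} {σ : ι → Fin n → ℤ}
    {f g : Rn n → ℂ} (hf : Continuous f) (hb : Summable fun i => ‖b i‖)
    (hg : ∀ y, HasSum (fun i => b i * mchar (σ i) y) (g y)) (h0 : ∀ i, fcoef f (σ i) = 0) :
    ∫ y in box (0 : Rn n), (starRingEnd ℂ) (f y) * g y = 0 := by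
  obtain ⟨C, hC⟩ := (isCompact_Icc (a := (0 : Rn n)) (b := 1)).exists_bound_of_continuousOn
    hf.continuousOn
  have hint : ∀ i, IntegrableOn (fun y => (starRingEnd ℂ) (f y) * (b i * mchar (σ i) y))
      (box (0 : Rn n)) := fun i =>
    integrableOn_box ((Complex.continuous_conj.comp hf).mul
      (continuous_const.mul (continuous_mchar _))) 0
  have h1 := hasSum_integral_of_summable_integral_norm (μ := volume.restrict (box (0 : Rn n)))
    hint (by
      refine (hb.mul_left C).of_nonneg_of_le (fun i => integral_nonneg fun _ => norm_nonneg _)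
        fun i => ?_
      have h2 := norm_setIntegral_le_of_norm_le_const (μ := volume) (s := box (0 : Rn n))
        (f := fun y => ‖(starRingEnd ℂ) (f y) * (b i * mchar (σ i) y)‖) (C := C * ‖b i‖)
        (by rw [volume_box]; exact ENNReal.one_lt_top) (fun y hy => by
          rw [norm_norm, norm_mul, norm_mul, norm_mchar, mul_one, RCLike.norm_conj]
          have h3 := box_subset_Icc 0 hy
          rw [zero_add] at h3
          exact mul_le_mul_of_nonneg_right (hC y h3) (norm_nonneg _))
      rw [measureReal_def, volume_box, ENNReal.toReal_one, mul_one] at h2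
      exact (le_abs_self _).trans h2)
  have h2 : ∀ i, ∫ y in box (0 : Rn n), (starRingEnd ℂ) (f y) * (b i * mchar (σ i) y) = 0 := by
    intro i
    have h3 : ∀ y, (starRingEnd ℂ) (f y) * (b i * mchar (σ i) y)
        = b i * (starRingEnd ℂ) (mchar (-σ i) y * f y) := fun y => by
      rw [map_mul, conj_mchar, neg_neg]
      ring
    simp only [h3]
    rw [integral_const_mul, integral_conj]
    change b i * (starRingEnd ℂ) (fcoef f (σ i)) = 0
    rw [h0, map_zero, mul_zero]
  simp only [h2] at h1
  have h3 := h1.unique hasSum_zero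
  rw [← h3]
  refine integral_congr_ae (Eventually.of_forall fun y => ?_)
  exact (((hg y).mul_left ((starRingEnd ℂ) (f y))).tsum_eq).symm

variable {J : ∀ p : M, Tan (2 * n) p →L[ℝ] Tan (2 * n) p}
  {Z : Rn n → Matrix (Fin n) (Fin n) ℂ} {ψ : Rn n → Fin n → ℂ} {φ : Rn n → ℂ}
  {X : Set (Rn n)} {ϑ : {m : Fin n → ℤ // latticePt N m ∈ X} → ∀ p, Pow L N p}
  [SecondCountableTopology M] [MeasurableSpace M] [BorelSpace M] [SecondCountableTopology B]

/-- The theta sections are pairwise orthogonal. -/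
theorem integral_hermPow_theta [CompactSpace M] (hD : IsPrequantum ωM D) (hN : 0 < N)
    (hπ : Continuous π) (hX : IsFundDomain Δ.q X) (hZ : IsSiegelMap J univ Δ.Q Z)
    (h : IsPotential Z ψ φ) (hϑ : ∀ m, IsThetaSection Δ N Z m.1 (ϑ m))
    (hc : ∀ m : Fin n → ℤ, latticePt N m ∈ X → ThetaConverges Δ N Z m)
    {m m' : {m : Fin n → ℤ // latticePt N m ∈ X}} (hm : m ≠ m') :
    Integrable (fun p => hermPow N (ϑ m p) (ϑ m' p)) (liouville fun p => (N : ℝ) • ωM p) ∧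
      ∫ p, hermPow N (ϑ m p) (ϑ m' p) ∂(liouville fun p => (N : ℝ) • ωM p) = 0 := by
  obtain ⟨σ, c, hσ⟩ := exists_isThetaIndex (N := N) hD hN hZ h
  have hcont : ∀ m : {m : Fin n → ℤ // latticePt N m ∈ X},
      Continuous fun z => ∑' γ, thetaTerm Δ N Z m.1 γ z := fun m => by
    rw [funext fun z => hσ.tsum_eq m.1 z]
    exact ((hσ.tame h (hc m.1 m.2)).contDiff_tsum h).1.continuous
  have hβ : ∀ z u v, (fun p => (N : ℝ) • ωM p) (Δ.Q z) (dQ Δ.Q z u) (dQ Δ.Q z v)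
      = (N : ℝ) * (u.1 ⬝ᵥ v.2 - u.2 ⬝ᵥ v.1) := fun z u v => by
    rw [← Δ.actionAngle.symplectic z.1 trivial z.2 u v]
    rfl
  have hherm := continuous_hermPow hD hX.surjective (hϑ m) (hϑ m') (hcont m) (hcont m')
  have : IsLocallyFiniteMeasure (liouville fun p => (N : ℝ) • ωM p) :=
    isLocallyFiniteMeasure_liouville Δ.actionAngle hX.surjective hβ
  have hi : Integrable (fun p => hermPow N (ϑ m p) (ϑ m' p))
      (liouville fun p => (N : ℝ) • ωM p) :=
    hherm.integrable_of_hasCompactSupport (HasCompactSupport.of_compactSpace _)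
  refine ⟨hi, integral_eq_zero_of_fibre Δ.actionAngle Δ.covering hX.surjective hπ hβ hherm hi
    fun x => ?_⟩
  simp only [hermPow_eq hD (hϑ m) (hϑ m')]
  rw [integral_mul_const]
  have : Countable (Deck Δ.q) := (hσ.injective m'.1).countable
  rw [integral_conj_mul_eq_zero (σ := σ m'.1)
    (f := fun y => ∑' γ, thetaTerm Δ N Z m.1 γ (x, y))
    (g := fun y => ∑' γ, thetaTerm Δ N Z m'.1 γ (x, y))
    (b := fun γ => c m'.1 γ * eBase N ψ φ (σ m'.1 γ) (x, 0)) ((hcont m).comp (by fun_prop)) ?_ ?_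
    fun γ => (hσ.fcoef_theta h (hc m.1 m.2) x).2 _ (hσ.disjoint_range hN hX hm.symm γ), zero_mul]
  · exact (hσ.hasSum h (hc m'.1 m'.2) (x, 0)).summable.norm.congr fun γ => by rw [hσ.term]
  · intro y
    refine (hσ.hasSum h (hc m'.1 m'.2) (x, y)).congr_fun fun γ => ?_
    rw [hσ.term, eBase_eq_mchar ψ φ (σ m'.1 γ) x y, mul_assoc]

end Orthogonality

end LagFib

end

/-! ### The main theorem -/

open LagFib in
theorem mainTheorem4 (n N : ℕ) (hN : 0 < N)
    {M : Type*} [TopologicalSpace M] [T2Space M] [SecondCountableTopology M]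
    [ChartedSpace (EuclideanSpace ℝ (Fin (2 * n))) M] [IsManifold (𝓡 (2 * n)) ∞ M]
    [MeasurableSpace M] [BorelSpace M]
    {B : Type*} [TopologicalSpace B] [T2Space B] [SecondCountableTopology B] [ConnectedSpace B]
    [ChartedSpace (EuclideanSpace ℝ (Fin n)) B] [IsManifold (𝓡 n) ∞ B]
    {S : Type*} [TopologicalSpace S] [T2Space S] [CompactSpace S] [PathConnectedSpace S]
    [ChartedSpace (EuclideanSpace ℝ (Fin n)) S] [IsManifold (𝓡 n) ∞ S]
    (ωM : ∀ p : M, Tan (2 * n) p →L[ℝ] Tan (2 * n) p →L[ℝ] ℝ) (hωM : IsSymplectic ωM)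
    (π : M → B) (hπ : IsLagrangianFibration S ωM π) (hB : IsCompleteBase ωM π)
    {L : M → Type*} [TopologicalSpace (Bundle.TotalSpace ℂ L)]
    [∀ p, NormedAddCommGroup (L p)] [∀ p, InnerProductSpace ℂ (L p)]
    [FiberBundle ℂ L] [VectorBundle ℝ ℂ L] [ContMDiffVectorBundle ∞ ℂ L (𝓡 (2 * n))]
    (D : CovariantDerivative (𝓡 (2 * n)) ℂ L) (hD : IsPrequantum ωM D)
    (J : ∀ p : M, Tan (2 * n) p →L[ℝ] Tan (2 * n) p) (hJ : IsCompatible ωM J)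
    (hJinv : IsFibreInvariant ωM π J) (hJint : IsIntegrable J) :
    Nonempty (Development ωM π D) ∧
    ∀ Δ : Development ωM π D, ∃ Z : Rn n → Matrix (Fin n) (Fin n) ℂ,
      IsSiegelMap J univ Δ.Q Z ∧
      ∀ F : Set (Rn n), IsFundDomain Δ.q F →
        (∀ m : Fin n → ℤ, latticePt N m ∈ F → ThetaConverges Δ N Z m) →
        BijOn (fun m => Δ.q (latticePt N m)) {m : Fin n → ℤ | latticePt N m ∈ F}
          (bohrSommerfeld π D N) ∧
        ∃ ϑ : {m : Fin n → ℤ // latticePt N m ∈ F} → ∀ p, Pow L N p,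
          (∀ m, IsThetaSection Δ N Z m.1 (ϑ m)) ∧
          (∀ m, IsHolomorphicSection J D N (ϑ m)) ∧
          (∀ s : ∀ p, Pow L N p, IsHolomorphicSection J D N s →
            ∃! c : {m : Fin n → ℤ // latticePt N m ∈ F} → ℂ, HasExpansion ϑ c s) ∧
          (CompactSpace M →
            Finite {m : Fin n → ℤ // latticePt N m ∈ F} ∧
            LinearIndependent ℂ ϑ ∧
            (∀ s : ∀ p, Pow L N p,
              s ∈ Submodule.span ℂ (range ϑ) ↔ IsHolomorphicSection J D N s) ∧
            ∀ m m', m ≠ m' →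
              Integrable (fun p => hermPow N (ϑ m p) (ϑ m' p))
                (liouville fun p => (N : ℝ) • ωM p) ∧
              ∫ p, hermPow N (ϑ m p) (ϑ m' p) ∂(liouville fun p => (N : ℝ) • ωM p) = 0) := by
  obtain ⟨q, hq, hloc⟩ := hB
  obtain ⟨Q, hQ⟩ := exists_global_actionAngle hq hJ hJinv hJint hloc
  refine ⟨exists_development hD hq hQ, fun Δ => ?_⟩
  -- The coordinates of an arbitrary development are global action-angle coordinates, so invariance
  -- along the fibres applies to them directly and gives Z.
  obtain ⟨Z, hZ⟩ := hJinv univ Δ.q Δ.Q isOpen_univ Δ.actionAngle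
  obtain ⟨ψ, φ, h⟩ := hZ.exists_potential Δ.actionAngle hJ hJint
  refine ⟨Z, hZ, fun F hF hc => ⟨bijOn_bohrSommerfeld hD hN hπ.smooth hF, ?_⟩⟩
  choose ϑ hϑ using fun m : {m : Fin n → ℤ // latticePt N m ∈ F} =>
    exists_isThetaSection Δ N Z m.1
  refine ⟨ϑ, hϑ, fun m => (hϑ m).isHolomorphicSection hD hN hF.surjective hZ h (hc m.1 m.2),
    fun s hs => existsUnique_expansion hD hN hF hZ h hϑ hc hs, fun hM => ?_⟩
  obtain ⟨σ, c, hσ⟩ := exists_isThetaIndex (N := N) hD hN hZ h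
  have hfin := finite_bohrSommerfeld_index hN hF hσ.apply
  exact ⟨hfin, linearIndependent_theta hD hN hF hZ h hϑ hc,
    mem_span_theta_iff hD hN hF hZ h hϑ hc, fun m m' hm =>
      integral_hermPow_theta hD hN hπ.smooth.continuous hF hZ h hϑ hc hm⟩
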